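/- **Linear $\lambda$-calculus.** Types are $A ::= p \mid A\otimes B \mid A\multimap B$ with type variables $p$. Terms are $x$, $\mathtt{fn}\,x\Rightarrow t$, $t\,s$, $(s,t)$ and $\mathtt{let}\ (x,y)=s\ \mathtt{in}\ t$. Judgements $\Gamma\vdash t:A$, where $\Gamma$ is a list of declarations of distinct variables, are derived by the rules: $x:A\vdash x:A$; exchange; from $x:A,\Gamma\vdash t:B$ infer $\Gamma\vdash \mathtt{fn}\,x\Rightarrow t:A\multimap B$; from $\Gamma\vdash t:A\multimap B$ and $\Delta\vdash s:A$ infer $\Gamma,\Delta\vdash t\,s:B$; from $\Gamma\vdash s:A$ and $\Delta\vdash t:B$ infer $\Gamma,\Delta\vdash(s,t):A\otimes B$; from $\Gamma\vdash s:A\otimes B$ and $x:A,y:B,\Delta\vdash t:C$ infer $\Gamma,\Delta\vdash\mathtt{let}\ (x,y)=s\ \mathtt{in}\ t:C$. In every sequent each variable that occurs, occurs exactly twice (declared or bound once, used once). One-step reduction $\to_{\beta\eta}$ is the closure under one-hole contexts $C[\,]$ of $(\mathtt{fn}\,x\Rightarrow t)s\Rightarrow t[s/x]$, $\ \mathtt{let}\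 (x,y)=(u,v)\ \mathtt{in}\ w\Rightarrow w[u/x,v/y]$, $\ \mathtt{fn}\,x\Rightarrow(t\,x)\Rightarrow t$, $\ \mathtt{let}\ (x,y)=t\ \mathtt{in}\ (x,y)\Rightarrow t$. The commutative conversion is $C[\mathtt{let}\ (x,y)=t\ \mathtt{in}\ u]\leftrightarrow_c \mathtt{let}\ (x,y)=t\ \mathtt{in}\ C[u]$, where $x,y$ are not free in $C[\,]$ and $C[\,]$ captures no free variable of $t$; $=_c$ is the congruent equivalence relation generated by it, and $t\to_{\beta\eta c}u$ means $t=_c t'\to_{\beta\eta}u'=_c u$ for some $t',u'$. The typed equality $\Gamma\vdash t=_{\beta\eta c}t':A$ is the least relation between terms of type $A$ in $\Gamma$ that is reflexive, symmetric, transitive, contains $\leftrightarrow_c$ and $\to_{\beta\eta c}$ (with typed left-hand side), and is closed under the term-forming typing rules. **IMLL proof nets.** A net consists of occurrences of signed formulas $A^+,A^-$ joined by links: ID-links (conclusions $A^+,A^-$), cuts (premises $A^+,A^-$), and $\otimes^+,\otimes^-,\multimap^+,\multimap^-$-links; it has an ordered list $\Gamma$ of negative conclusions and one positive conclusion $A$.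 The proof nets are generated from ID-links by exchange of negative conclusions, by adding a $\otimes^-$- or a $\multimap^+$-link to one net, and by joining two nets by a $\otimes^+$-link, a $\multimap^-$-link or a cut. They are reduced by the multiplicative rules (cut between dual $\otimes$- or $\multimap$-links; cut against an ID-link) and the $\eta$-rules (an ID-link of a compound formula is replaced by ID-links of its two components and the two corresponding links). Two nets are *isomorphic* if a bijection of their formula occurrences preserves formulas, links and (ordered) conclusions, and *equal*, $\Theta_1=\Theta_2$, if their normal forms are isomorphic. A derivation of $\Gamma\vdash t:A$ is translated into a proof net $\llbracket t\rrbracket$ with conclusions $\Gamma^-,A^+$: a variable is an ID-link, exchange exchanges negative conclusions, abstraction adds a $\multimap^+$-link, pairing a $\otimes^+$-link, an application $t\,s$ is a cut of $\llbracket t\rrbracket$ with a $\multimap^-$-link that joins $\llbracket s\rrbracket$ and an ID-link, and $\mathtt{let}\ (x,y)=s\ \mathtt{in}\ t$ is a cut of $\llbracket s\rrbracket$ with a $\otimes^-$-link that joins the conclusions $x,y$ of $\llbracket t\rrbracket$. **Proposition.** For all contexts $\Gamma$ and types $A$: 1. Every proof net with conclusions $\Gamma^-,A^+$ has a normal form that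 is a proof net, and its normal form is unique up to isomorphism. 2. If $\Gamma\vdash t:A$ and $t\to_{\beta\eta c}t'$, then $\Gamma\vdash t':A$ and $\llbracket t\rrbracket=\llbracket t'\rrbracket$. 3. (Faithfulness) If $\Gamma\vdash t:A$ and $\Gamma\vdash t':A$, then $\llbracket t\rrbracket=\llbracket t'\rrbracket$ if and only if $\Gamma\vdash t=_{\beta\eta c}t':A$ (for all derivations of the two judgements; in particular $\llbracket t\rrbracket$ does not depend on the derivation, up to equality). 4. (Fullness) For every proof net $\Theta$ with conclusions $\Gamma^-,A^+$ there is a term $t$ with $\Gamma\vdash t:A$ and $\llbracket t\rrbracket=\Theta$. Hence $\llbracket-\rrbracket$ induces a bijection between the $=_{\beta\eta c}$-classes of terms of type $A$ in $\Gamma$ and the isomorphism classes of normal IMLL proof nets with conclusions $\Gamma^-,A^+$. -/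

import Mathlib

namespace LinLam

/-! ### Types, terms, typing -/

/-- Types of the linear lambda-calculus; the same grammar gives the plain IMLL formulas. -/
inductive Ty : Type
  | var (p : ℕ) : Ty
  | tensor (A B : Ty) : Ty
  | limp (A B : Ty) : Ty

/-- Terms: variables, `fn x=>t`, `t s`, `(s,t)` and `let val (x,y)=s in t end`. -/
inductive Term : Type
  | var (x : ℕ) : Term
  | lam (x : ℕ) (t : Term) : Term
  | app (t s : Term) : Term
  | pair (s t : Term) : Term
  | letp (x y : ℕ) (s t : Term) : Term

/-- All occurrences of variables in a term, binding ones included. -/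
def Term.occ : Term → List ℕ
  | .var x => [x]
  | .lam x t => x :: t.occ
  | .app t s => t.occ ++ s.occ
  | .pair s t => s.occ ++ t.occ
  | .letp x y s t => x :: y :: (s.occ ++ t.occ)

/-- The bound variables of a term. -/
def Term.bv : Term → Finset ℕ
  | .var _ => ∅
  | .lam x t => {x} ∪ t.bv
  | .app t s => t.bv ∪ s.bv
  | .pair s t => s.bv ∪ t.bv
  | .letp x y s t => {x, y} ∪ s.bv ∪ t.bv

/-- The free variables: the variables of the term that are not bound variables. -/
def Term.fv (t : Term) : Finset ℕ := t.occ.toFinset \ t.bv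

/-- Simultaneous substitution. No renaming takes place: in the terms considered here all
binders have names of their own, so nothing can be captured. -/
def Term.subst : Term → (ℕ → Term) → Term
  | .var x, σ => σ x
  | .lam x t, σ => .lam x (t.subst (Function.update σ x (.var x)))
  | .app t s, σ => .app (t.subst σ) (s.subst σ)
  | .pair s t, σ => .pair (s.subst σ) (t.subst σ)
  | .letp x y s t, σ =>
      .letp x y (s.subst σ)
        (t.subst (Function.update (Function.update σ x (.var x)) y (.var y)))

/-- `t[s/x]` -/
def Term.subst1 (t : Term) (x : ℕ) (s : Term) : Term :=
  t.subst (Function.update Term.var x s)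

/-- `t[u/x, v/y]` -/
def Term.subst2 (t : Term) (x : ℕ) (u : Term) (y : ℕ) (v : Term) : Term :=
  t.subst (Function.update (Function.update Term.var x u) y v)

/-- Typing contexts: lists of declarations `x : A`. -/
abbrev Ctx : Type := List (ℕ × Ty)

/-- The variables declared in a context. -/
def Ctx.names (Γ : Ctx) : List ℕ := Γ.map Prod.fst

/-- The types declared in a context. -/
def Ctx.types (Γ : Ctx) : List Ty := Γ.map Prod.snd

/-- The linearity convention for a sequent `Γ ⊢ t : A`: each variable that occurs in it occurs
exactly twice (declared or bound once, and used once). -/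
def TwoOcc (Γ : Ctx) (t : Term) : Prop :=
  ∀ x ∈ Ctx.names Γ ++ t.occ, (Ctx.names Γ ++ t.occ).count x = 2

/-- Derivations of `Γ ⊢ t : A`. The linearity convention is imposed on the conclusions of the
rules with two premises; the other rules preserve it. -/
inductive Deriv : Ctx → Term → Ty → Type
  | var (x : ℕ) (A : Ty) : Deriv [(x, A)] (.var x) A
  | exch (Γ Δ : Ctx) (x y : ℕ) (A B C : Ty) (t : Term) :
      Deriv (Γ ++ (x, A) :: (y, B) :: Δ) t C → Deriv (Γ ++ (y, B) :: (x, A) :: Δ) t C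
  | lam (Γ : Ctx) (x : ℕ) (A B : Ty) (t : Term) :
      Deriv ((x, A) :: Γ) t B → Deriv Γ (.lam x t) (.limp A B)
  | app (Γ Δ : Ctx) (A B : Ty) (t s : Term) (lin : TwoOcc (Γ ++ Δ) (.app t s)) :
      Deriv Γ t (.limp A B) → Deriv Δ s A → Deriv (Γ ++ Δ) (.app t s) B
  | pair (Γ Δ : Ctx) (A B : Ty) (s t : Term) (lin : TwoOcc (Γ ++ Δ) (.pair s t)) :
      Deriv Γ s A → Deriv Δ t B → Deriv (Γ ++ Δ) (.pair s t) (.tensor A B)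
  | letp (Γ Δ : Ctx) (x y : ℕ) (A B C : Ty) (s t : Term)
      (lin : TwoOcc (Γ ++ Δ) (.letp x y s t)) :
      Deriv Γ s (.tensor A B) → Deriv ((x, A) :: (y, B) :: Δ) t C →
        Deriv (Γ ++ Δ) (.letp x y s t) C

/-! ### Reduction -/

/-- One-hole contexts `C[]`. -/
inductive TermCtx : Type
  | hole : TermCtx
  | appL (C : TermCtx) (t : Term) : TermCtx
  | appR (t : Term) (C : TermCtx) : TermCtx
  | pairL (C : TermCtx) (t : Term) : TermCtx
  | pairR (t : Term) (C : TermCtx) : TermCtx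
  | lam (x : ℕ) (C : TermCtx) : TermCtx
  | letL (x y : ℕ) (C : TermCtx) (t : Term) : TermCtx
  | letR (x y : ℕ) (t : Term) (C : TermCtx) : TermCtx

/-- `C[u]`: literal replacement of the hole; variables may be captured. -/
def TermCtx.plug : TermCtx → Term → Term
  | .hole, u => u
  | .appL C t, u => .app (C.plug u) t
  | .appR t C, u => .app t (C.plug u)
  | .pairL C t, u => .pair (C.plug u) t
  | .pairR t C, u => .pair t (C.plug u)
  | .lam x C, u => .lam x (C.plug u)
  | .letL x y C t, u => .letp x y (C.plug u) t
  | .letR x y t C, u => .letp x y t (C.plug u)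

/-- The variables captured by a context. -/
def TermCtx.cv : TermCtx → Finset ℕ
  | .hole => ∅
  | .appL C _ => C.cv
  | .appR _ C => C.cv
  | .pairL C _ => C.cv
  | .pairR _ C => C.cv
  | .lam x C => {x} ∪ C.cv
  | .letL _ _ C _ => C.cv
  | .letR x y _ C => {x, y} ∪ C.cv

/-- All occurrences of variables in a context, binding ones included. -/
def TermCtx.occ : TermCtx → List ℕ
  | .hole => []
  | .appL C t => C.occ ++ t.occ
  | .appR t C => t.occ ++ C.occ
  | .pairL C t => C.occ ++ t.occ
  | .pairR t C => t.occ ++ C.occ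
  | .lam x C => x :: C.occ
  | .letL x y C t => x :: y :: (C.occ ++ t.occ)
  | .letR x y t C => x :: y :: (t.occ ++ C.occ)

/-- The bound variables of a context. -/
def TermCtx.bv : TermCtx → Finset ℕ
  | .hole => ∅
  | .appL C t => C.bv ∪ t.bv
  | .appR t C => t.bv ∪ C.bv
  | .pairL C t => C.bv ∪ t.bv
  | .pairR t C => t.bv ∪ C.bv
  | .lam x C => {x} ∪ C.bv
  | .letL x y C t => {x, y} ∪ C.bv ∪ t.bv
  | .letR x y t C => {x, y} ∪ t.bv ∪ C.bv

/-- The free variables of a context. -/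
def TermCtx.fv (C : TermCtx) : Finset ℕ := C.occ.toFinset \ C.bv

/-- The closure of a relation under contexts. -/
def CtxClosure (R : Term → Term → Prop) (t t' : Term) : Prop :=
  ∃ (C : TermCtx) (r r' : Term), R r r' ∧ t = C.plug r ∧ t' = C.plug r'

/-- The rules beta1, beta2, eta1, eta2. -/
inductive BetaEtaRule : Term → Term → Prop
  | beta1 (x : ℕ) (t s : Term) : BetaEtaRule (.app (.lam x t) s) (t.subst1 x s)
  | beta2 (x y : ℕ) (u v w : Term) :
      BetaEtaRule (.letp x y (.pair u v) w) (w.subst2 x u y v)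
  | eta1 (x : ℕ) (t : Term) : BetaEtaRule (.lam x (.app t (.var x))) t
  | eta2 (x y : ℕ) (t : Term) :
      BetaEtaRule (.letp x y t (.pair (.var x) (.var y))) t

/-- One-step beta-eta-reduction. -/
def BetaEta : Term → Term → Prop := CtxClosure BetaEtaRule

/-- The commutative conversion, read from left to right. -/
inductive CommRule : Term → Term → Prop
  | mk (C : TermCtx) (x y : ℕ) (t u : Term)
      (hxy : Disjoint C.fv {x, y}) (ht : Disjoint C.cv t.fv) :
      CommRule (C.plug (.letp x y t u)) (.letp x y t (C.plug u))

/-- The commutative conversion relation, in both directions. -/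
def CommConv (t t' : Term) : Prop := CommRule t t' ∨ CommRule t' t

/-- `t =c t'`: the congruent equivalence relation generated by commutative conversion. -/
def CommEq : Term → Term → Prop := Relation.EqvGen (CtxClosure CommConv)

/-- Reduction modulo commutative conversion. -/
def BetaEtaC (t u : Term) : Prop :=
  ∃ t' u', CommEq t t' ∧ BetaEta t' u' ∧ CommEq u' u

/-- Equality judgements `Γ ⊢ t = t' : A`. As for typing, the linearity convention is imposed
on both sides of the conclusions of the rules with two premises. -/
inductive EqJ : Ctx → Term → Term → Ty → Prop
  | refl {Γ : Ctx} {t : Term} {A : Ty} : Deriv Γ t A → EqJ Γ t t A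
  | symm {Γ : Ctx} {t s : Term} {A : Ty} : EqJ Γ t s A → EqJ Γ s t A
  | trans {Γ : Ctx} {t s u : Term} {A : Ty} : EqJ Γ t s A → EqJ Γ s u A → EqJ Γ t u A
  | comm {Γ : Ctx} {t t' : Term} {A : Ty} : Deriv Γ t A → CommConv t t' → EqJ Γ t t' A
  | red {Γ : Ctx} {t t' : Term} {A : Ty} : Deriv Γ t A → BetaEtaC t t' → EqJ Γ t t' A
  | lam {Γ : Ctx} {x : ℕ} {t t' : Term} {A B : Ty} :
      EqJ ((x, A) :: Γ) t t' B → EqJ Γ (.lam x t) (.lam x t') (.limp A B)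
  | app {Γ Δ : Ctx} {t t' s s' : Term} {A B : Ty} :
      TwoOcc (Γ ++ Δ) (.app t s) → TwoOcc (Γ ++ Δ) (.app t' s') →
      EqJ Γ t t' (.limp A B) → EqJ Δ s s' A → EqJ (Γ ++ Δ) (.app t s) (.app t' s') B
  | pair {Γ Δ : Ctx} {s s' t t' : Term} {A B : Ty} :
      TwoOcc (Γ ++ Δ) (.pair s t) → TwoOcc (Γ ++ Δ) (.pair s' t') →
      EqJ Γ s s' A → EqJ Δ t t' B → EqJ (Γ ++ Δ) (.pair s t) (.pair s' t') (.tensor A B)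
  | letp {Γ Δ : Ctx} {x y : ℕ} {s s' t t' : Term} {A B C : Ty} :
      TwoOcc (Γ ++ Δ) (.letp x y s t) → TwoOcc (Γ ++ Δ) (.letp x y s' t') →
      EqJ Γ s s' (.tensor A B) → EqJ ((x, A) :: (y, B) :: Δ) t t' C →
      EqJ (Γ ++ Δ) (.letp x y s t) (.letp x y s' t') C

/-! ### Proof nets -/

/-- Signed IMLL formulas. -/
inductive SFormula : Type
  | pos (A : Ty) : SFormula
  | neg (A : Ty) : SFormula

/-- Links between occurrences of signed formulas:
* `ax p n`: conclusions `p : A⁺`, `n : A⁻` (an ID-link, `A` arbitrary);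
* `cut p n`: premises `p : A⁺`, `n : A⁻`;
* `tensorPos a b c`: premises `a : A⁺`, `b : B⁺`, conclusion `c : (A ⊗ B)⁺`;
* `tensorNeg a b c`: premises `a : A⁻`, `b : B⁻`, conclusion `c : (A ⊗ B)⁻`;
* `limpPos a b c`: premises `a : A⁻`, `b : B⁺`, conclusion `c : (A ⊸ B)⁺`;
* `limpNeg a b c`: premises `a : A⁺`, `b : B⁻`, conclusion `c : (A ⊸ B)⁻`. -/
inductive Link (V : Type) : Type
  | ax (p n : V) : Link V
  | cut (p n : V) : Link V
  | tensorPos (a b c : V) : Link V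
  | tensorNeg (a b c : V) : Link V
  | limpPos (a b c : V) : Link V
  | limpNeg (a b c : V) : Link V

/-- Renaming of occurrences. -/
def Link.map {V W : Type} (f : V → W) : Link V → Link W
  | .ax p n => .ax (f p) (f n)
  | .cut p n => .cut (f p) (f n)
  | .tensorPos a b c => .tensorPos (f a) (f b) (f c)
  | .tensorNeg a b c => .tensorNeg (f a) (f b) (f c)
  | .limpPos a b c => .limpPos (f a) (f b) (f c)
  | .limpNeg a b c => .limpNeg (f a) (f b) (f c)

/-- Proof structures: signed formula occurrences, links between them, the list of the negative
conclusions and the positive conclusion. Which of them are proof nets is said below. -/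
structure PStruct : Type 1 where
  /-- the signed formula occurrences -/
  Occ : Type
  /-- the signed formula of an occurrence -/
  form : Occ → SFormula
  /-- the links -/
  links : Set (Link Occ)
  /-- the negative conclusions, in order -/
  hyps : List Occ
  /-- the positive conclusion -/
  concl : Occ

namespace PStruct

/-- A bijection of the formula occurrences that preserves the signed formulas, the links and
the conclusions. -/
def Iso (Θ Ξ : PStruct) : Prop :=
  ∃ e : Θ.Occ ≃ Ξ.Occ,
    (∀ v, Ξ.form (e v) = Θ.form v) ∧
    Link.map e '' Θ.links = Ξ.links ∧
    Θ.hyps.map e = Ξ.hyps ∧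
    e Θ.concl = Ξ.concl

/-- A single ID-link. -/
abbrev idLink (A : Ty) : PStruct where
  Occ := Bool
  form v := if v then .pos A else .neg A
  links := {.ax true false}
  hyps := [false]
  concl := true

/-- Exchange of the members with indices `n` and `n + 1` of a list. -/
def swapAt {α : Type} : ℕ → List α → List α
  | 0, a :: b :: l => b :: a :: l
  | n + 1, a :: l => a :: swapAt n l
  | _, l => l

/-- Exchange of two neighbouring negative conclusions. -/
abbrev exch (n : ℕ) (Θ : PStruct) : PStruct :=
  { Θ with hyps := swapAt n Θ.hyps }

/-- A `⊗⁺`-link below the positive conclusions of two structures. -/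
abbrev tensorPos (A B : Ty) (Θ Ξ : PStruct) : PStruct where
  Occ := Option (Θ.Occ ⊕ Ξ.Occ)
  form
    | some (.inl v) => Θ.form v
    | some (.inr v) => Ξ.form v
    | none => .pos (.tensor A B)
  links := Link.map (fun v => some (.inl v)) '' Θ.links ∪
    Link.map (fun v => some (.inr v)) '' Ξ.links ∪
    {.tensorPos (some (.inl Θ.concl)) (some (.inr Ξ.concl)) none}
  hyps := Θ.hyps.map (fun v => some (.inl v)) ++ Ξ.hyps.map (fun v => some (.inr v))
  concl := none

/-- A `⊗⁻`-link below the first two negative conclusions. -/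
abbrev tensorNeg (A B : Ty) (Θ : PStruct) : PStruct where
  Occ := Option Θ.Occ
  form
    | some v => Θ.form v
    | none => .neg (.tensor A B)
  links := Link.map some '' Θ.links ∪
    {l | ∃ a b r, Θ.hyps = a :: b :: r ∧ l = .tensorNeg (some a) (some b) none}
  hyps := none :: (Θ.hyps.drop 2).map some
  concl := some Θ.concl

/-- A `⊸⁺`-link below the first negative conclusion and the positive conclusion. -/
abbrev limpPos (A B : Ty) (Θ : PStruct) : PStruct where
  Occ := Option Θ.Occ
  form
    | some v => Θ.form v
    | none => .pos (.limp A B)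
  links := Link.map some '' Θ.links ∪
    {l | ∃ a r, Θ.hyps = a :: r ∧ l = .limpPos (some a) (some Θ.concl) none}
  hyps := (Θ.hyps.drop 1).map some
  concl := none

/-- A `⊸⁻`-link below the positive conclusion of `Θ` and the first negative conclusion
of `Ξ`. -/
abbrev limpNeg (A B : Ty) (Θ Ξ : PStruct) : PStruct where
  Occ := Option (Θ.Occ ⊕ Ξ.Occ)
  form
    | some (.inl v) => Θ.form v
    | some (.inr v) => Ξ.form v
    | none => .neg (.limp A B)
  links := Link.map (fun v => some (.inl v)) '' Θ.links ∪
    Link.map (fun v => some (.inr v)) '' Ξ.links ∪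
    {l | ∃ b r, Ξ.hyps = b :: r ∧
      l = .limpNeg (some (.inl Θ.concl)) (some (.inr b)) none}
  hyps := none :: (Θ.hyps.map (fun v => some (.inl v)) ++
    (Ξ.hyps.drop 1).map (fun v => some (.inr v)))
  concl := some (.inr Ξ.concl)

/-- A cut between the positive conclusion of `Θ` and the first negative conclusion of `Ξ`. -/
abbrev cut (Θ Ξ : PStruct) : PStruct where
  Occ := Θ.Occ ⊕ Ξ.Occ
  form
    | .inl v => Θ.form v
    | .inr v => Ξ.form v
  links := Link.map Sum.inl '' Θ.links ∪ Link.map Sum.inr '' Ξ.links ∪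
    {l | ∃ a r, Ξ.hyps = a :: r ∧ l = .cut (.inl Θ.concl) (.inr a)}
  hyps := Θ.hyps.map Sum.inl ++ (Ξ.hyps.drop 1).map Sum.inr
  concl := .inr Ξ.concl

end PStruct

/-- `IsProofNet Γ A Θ`: the structure `Θ` is an IMLL proof net with the negative
conclusions `Γ` and the positive conclusion `A`. -/
inductive IsProofNet : List Ty → Ty → PStruct → Prop
  | idLink (A : Ty) : IsProofNet [A] A (.idLink A)
  | exch (Γ Δ : List Ty) (A B C : Ty) (Θ : PStruct) :
      IsProofNet (Γ ++ A :: B :: Δ) C Θ →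
        IsProofNet (Γ ++ B :: A :: Δ) C (Θ.exch Γ.length)
  | tensorPos (Γ Δ : List Ty) (A B : Ty) (Θ Ξ : PStruct) :
      IsProofNet Γ A Θ → IsProofNet Δ B Ξ →
        IsProofNet (Γ ++ Δ) (.tensor A B) (.tensorPos A B Θ Ξ)
  | tensorNeg (Γ : List Ty) (A B C : Ty) (Θ : PStruct) :
      IsProofNet (A :: B :: Γ) C Θ → IsProofNet (.tensor A B :: Γ) C (.tensorNeg A B Θ)
  | limpPos (Γ : List Ty) (A B : Ty) (Θ : PStruct) :
      IsProofNet (A :: Γ) B Θ → IsProofNet Γ (.limp A B) (.limpPos A B Θ)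
  | limpNeg (Γ Δ : List Ty) (A B C : Ty) (Θ Ξ : PStruct) :
      IsProofNet Γ A Θ → IsProofNet (B :: Δ) C Ξ →
        IsProofNet (.limp A B :: (Γ ++ Δ)) C (.limpNeg A B Θ Ξ)
  | cut (Γ Δ : List Ty) (A C : Ty) (Θ Ξ : PStruct) :
      IsProofNet Γ A Θ → IsProofNet (A :: Δ) C Ξ → IsProofNet (Γ ++ Δ) C (.cut Θ Ξ)
  | iso (Γ : List Ty) (A : Ty) (Θ Ξ : PStruct) :
      Θ.Iso Ξ → IsProofNet Γ A Θ → IsProofNet Γ A Ξ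

/-- IMLL proof nets with conclusions `Γ⁻, A⁺`. -/
def ProofNet (Γ : List Ty) (A : Ty) : Type 1 := {Θ : PStruct // IsProofNet Γ A Θ}

/-! ### Reduction of proof nets -/

namespace PStruct

/-- `Θ'` arises from `Θ` by deleting the occurrences in `gone` and taking `L` as links. -/
def Remains (Θ Θ' : PStruct) (gone : Set Θ.Occ) (L : Set (Link Θ.Occ)) : Prop :=
  ∃ ι : Θ'.Occ ↪ Θ.Occ,
    Set.range ι = goneᶜ ∧
    (∀ v, Θ'.form v = Θ.form (ι v)) ∧
    Link.map ι '' Θ'.links = L ∧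
    Θ'.hyps.map ι = Θ.hyps ∧
    ι Θ'.concl = Θ.concl

/-- `Θ'` arises from `Θ` by replacing the links in `old` by the links in `new`, with four
additional occurrences `a : A⁺`, `a' : A⁻`, `b : B⁺`, `b' : B⁻`, which are numbered 0 to 3. -/
abbrev expand (Θ : PStruct) (A B : Ty) (old : Set (Link Θ.Occ))
    (new : Set (Link (Θ.Occ ⊕ Fin 4))) : PStruct where
  Occ := Θ.Occ ⊕ Fin 4
  form
    | .inl v => Θ.form v
    | .inr i => ![.pos A, .neg A, .pos B, .neg B] i
  links := Link.map Sum.inl '' (Θ.links \ old) ∪ new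
  hyps := Θ.hyps.map Sum.inl
  concl := .inl Θ.concl

open Classical in
/-- The map that sends `a` to `b` and fixes everything else. -/
noncomputable def redirect {V : Type} (a b : V) : V → V := Function.update id a b

/-- One-step reduction. The first four rules are the multiplicative ones, i.e. the elimination
of a cut between dual links and of a cut against an ID-link; the last two are the eta rules,
which replace an ID-link of a compound formula by ID-links of its components. -/
inductive Step (Θ : PStruct) : PStruct → Prop
  | tensor (Θ' : PStruct) (a b c a' b' c' : Θ.Occ)
      (h1 : Link.tensorPos a b c ∈ Θ.links) (h2 : Link.tensorNeg a' b' c' ∈ Θ.links)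
      (h3 : Link.cut c c' ∈ Θ.links)
      (h : Θ.Remains Θ' {c, c'}
        ((Θ.links \ {.tensorPos a b c, .tensorNeg a' b' c', .cut c c'}) ∪
          {.cut a a', .cut b b'})) :
      Step Θ Θ'
  | limp (Θ' : PStruct) (a b c a' b' c' : Θ.Occ)
      (h1 : Link.limpPos a b c ∈ Θ.links) (h2 : Link.limpNeg a' b' c' ∈ Θ.links)
      (h3 : Link.cut c c' ∈ Θ.links)
      (h : Θ.Remains Θ' {c, c'}
        ((Θ.links \ {.limpPos a b c, .limpNeg a' b' c', .cut c c'}) ∪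
          {.cut a' a, .cut b b'})) :
      Step Θ Θ'
  | axPos (Θ' : PStruct) (p n n' : Θ.Occ) (hn : n' ≠ n)
      (h1 : Link.ax p n ∈ Θ.links) (h2 : Link.cut p n' ∈ Θ.links)
      (h : Θ.Remains Θ' {p, n'}
        (Link.map (redirect n' n) '' (Θ.links \ {.ax p n, .cut p n'}))) :
      Step Θ Θ'
  | axNeg (Θ' : PStruct) (p n p' : Θ.Occ) (hp : p' ≠ p)
      (h1 : Link.ax p n ∈ Θ.links) (h2 : Link.cut p' n ∈ Θ.links)
      (h : Θ.Remains Θ' {n, p'}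
        (Link.map (redirect p' p) '' (Θ.links \ {.ax p n, .cut p' n}))) :
      Step Θ Θ'
  | etaTensor (A B : Ty) (p n : Θ.Occ) (h1 : Link.ax p n ∈ Θ.links)
      (hp : Θ.form p = .pos (.tensor A B)) (hn : Θ.form n = .neg (.tensor A B)) :
      Step Θ (Θ.expand A B {.ax p n}
        {.ax (.inr 0) (.inr 1), .ax (.inr 2) (.inr 3),
          .tensorPos (.inr 0) (.inr 2) (.inl p), .tensorNeg (.inr 1) (.inr 3) (.inl n)})
  | etaLimp (A B : Ty) (p n : Θ.Occ) (h1 : Link.ax p n ∈ Θ.links)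
      (hp : Θ.form p = .pos (.limp A B)) (hn : Θ.form n = .neg (.limp A B)) :
      Step Θ (Θ.expand A B {.ax p n}
        {.ax (.inr 0) (.inr 1), .ax (.inr 2) (.inr 3),
          .limpPos (.inr 1) (.inr 2) (.inl p), .limpNeg (.inr 0) (.inr 3) (.inl n)})

/-- No reduction rule applies. -/
def Normal (Θ : PStruct) : Prop := ∀ Θ', ¬ Θ.Step Θ'

/-- `N` is a normal form of `Θ`. -/
def NormalFormOf (N Θ : PStruct) : Prop := Relation.ReflTransGen Step Θ N ∧ N.Normal

end PStruct

/-- Equality of proof nets: their normal forms are isomorphic. -/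
def ProofNet.Equal {Γ : List Ty} {A : Ty} (Θ Ξ : ProofNet Γ A) : Prop :=
  ∃ N M : PStruct, N.NormalFormOf Θ.1 ∧ M.NormalFormOf Ξ.1 ∧ N.Iso M

/-! ### The translation -/

/-- The structure into which a derivation is translated. A variable becomes an ID-link, an
abstraction a `⊸⁺`-link, a pair a `⊗⁺`-link, an application a cut of the function against
a `⊸⁻`-link that joins the argument and an ID-link, and a `let` a cut of the pair against
a `⊗⁻`-link that joins the two bound variables. -/
def Deriv.toStruct : {Γ : Ctx} → {t : Term} → {A : Ty} → Deriv Γ t A → PStruct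
  | _, _, _, .var _ A => .idLink A
  | _, _, _, .exch Γ _ _ _ _ _ _ _ d => d.toStruct.exch Γ.length
  | _, _, _, .lam _ _ A B _ d => .limpPos A B d.toStruct
  | _, _, _, .app _ _ A B _ _ _ d e => .cut d.toStruct (.limpNeg A B e.toStruct (.idLink B))
  | _, _, _, .pair _ _ A B _ _ _ d e => .tensorPos A B d.toStruct e.toStruct
  | _, _, _, .letp _ _ _ _ A B _ _ _ _ d e => .cut d.toStruct (.tensorNeg A B e.toStruct)

theorem Deriv.toStruct_isProofNet {Γ : Ctx} {t : Term} {A : Ty} (d : Deriv Γ t A) :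
    IsProofNet (Ctx.types Γ) A d.toStruct := by
  induction d with
  | var x A => exact .idLink A
  | exch Γ Δ x y A B C t d ih =>
      have := IsProofNet.exch (Ctx.types Γ) (Ctx.types Δ) A B C d.toStruct
        (by simpa [Ctx.types] using ih)
      simpa [Ctx.types, Deriv.toStruct] using this
  | lam Γ x A B t d ih => exact .limpPos _ A B _ ih
  | app Γ Δ A B t s lin d e ihd ihe =>
      have := IsProofNet.cut _ _ _ _ _ _ ihd (.limpNeg _ [] A B B _ _ ihe (.idLink B))
      simpa [Ctx.types, Deriv.toStruct] using this
  | pair Γ Δ A B s t lin d e ihd ihe =>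
      have := IsProofNet.tensorPos _ _ A B _ _ ihd ihe
      simpa [Ctx.types, Deriv.toStruct] using this
  | letp Γ Δ x y A B C s t lin d e ihd ihe =>
      have := IsProofNet.cut _ _ _ _ _ _ ihd (.tensorNeg (Ctx.types Δ) A B C _ ihe)
      simpa [Ctx.types, Deriv.toStruct] using this

/-- The translation of (a derivation of) `Γ ⊢ t : A` into IMLL proof nets. -/
def Deriv.net {Γ : Ctx} {t : Term} {A : Ty} (d : Deriv Γ t A) : ProofNet (Ctx.types Γ) A :=
  ⟨d.toStruct, d.toStruct_isProofNet⟩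

end LinLam

namespace LinLam

/-! ### Linear terms -/

/-! Terms and nets are compared through their typings. A structure has consistent labellings: types
placed at its occurrences that fit every link and have the shape of the given formulas, that is,
agree with them once all atoms are identified. `Typ` records the labels that these labellings give
to the conclusions. A term has its typings `J`. The relation `Rep` says that a term and a structure
have the same set of typings, among types of the given shapes. The translation of a derivation is
represented by its term (`Deriv.rep`). Conversely every net is represented by some term, obtained by
reading its links as term formers and a cut as a beta-redex (`IsProofNet.exists_rep`).

Both sides are invariant. Equal terms have the same typings (`EqJ.sound`): besides subject reduction
there is subject expansion, because a linear step neither erases nor copies a subterm; only eta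
forces the restriction to fixed shapes. Every reduction step of structures preserves `Typ`
(`Good.step`).

Passing to typings loses nothing, for two reasons.

For nets: every typed term is represented by a cut-free net with atomic ID-links (`J.norm`). Such a
net has a generic labelling, in which different ID-links have different labels and each atom occurs
at most twice in the conclusions. A normal structure with the same typings has a labelling with the
same labels at the conclusions. The formulas of the conclusions determine the trees of links above
them, and the generic labels determine how the ID-links connect the leaves, so the structure is
isomorphic to the net (`Rep.iso_normalForm`). This gives existence and uniqueness of normal forms,
and shows that they are proof nets without a correctness criterion for the structures reached on the
way. One point remains: an ID-link cut against itself is irreducible. It is excluded by the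
invariant `Uniq`, since the label of such a loop could be changed freely.

For terms: by coherence (`EqE.of_balanced`), two terms of one sequent are equal if each atom occurs
at most twice in that sequent. Terms with the same typings both inhabit the generic sequent, hence
are equal there, and substitution for the atoms gives equality in the original sequent (`Rep.eqE`).
This is faithfulness. Fullness holds because a net and the translation of a term that represents it
have isomorphic normal forms.

Coherence is proved by induction on the weight of the sequent. Tensor hypotheses and compound
conclusions are decomposed reversibly. For an atomic conclusion one term may be assumed to have a
head variable f : D ⊸ E with an argument s. A parity count and balance give a set of atoms such that
the sequent of s has only atoms outside it and the rest of the term only atoms inside it. Then f can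
be brought to the front of the other term too (`J.exists_split`), and the colours of the types force
the same division of the context. That monochrome hypotheses cannot contribute to a conclusion of
the other colour follows from a three-valued model in which every hypothesis counts (`J.val`). -/

/-- The free variables of a term, by recursion. -/
def Term.FV : Term → Finset ℕ
  | .var x => {x}
  | .lam x t => t.FV.erase x
  | .app t s => t.FV ∪ s.FV
  | .pair s t => s.FV ∪ t.FV
  | .letp x y s t => s.FV ∪ (t.FV \ {x, y})

/-- Linearity: every binder has a name of its own and binds exactly one occurrence, and no
variable is used twice. -/
def Term.Lin : Term → Prop
  | .var _ => True
  | .lam x t => t.Lin ∧ x ∈ t.FV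
  | .app t s => t.Lin ∧ s.Lin ∧ ∀ z ∈ t.occ, z ∉ s.occ
  | .pair s t => s.Lin ∧ t.Lin ∧ ∀ z ∈ s.occ, z ∉ t.occ
  | .letp x y s t => s.Lin ∧ t.Lin ∧ x ∈ t.FV ∧ y ∈ t.FV ∧ x ≠ y ∧ ∀ z ∈ s.occ, z ∉ t.occ

/-- Typing in the style of Church: `ρ` assigns a type to every variable, bound or free. -/
def HasTy (ρ : ℕ → Ty) : Term → Ty → Prop
  | .var x, A => A = ρ x
  | .lam x t, A => ∃ B, A = .limp (ρ x) B ∧ HasTy ρ t B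
  | .app t s, A => ∃ B, HasTy ρ t (.limp B A) ∧ HasTy ρ s B
  | .pair s t, A => ∃ B C, A = .tensor B C ∧ HasTy ρ s B ∧ HasTy ρ t C
  | .letp x y s t, A => HasTy ρ s (.tensor (ρ x) (ρ y)) ∧ HasTy ρ t A

/-- The number of term constructors in a term. -/
def Term.size : Term → ℕ
  | .var _ => 1
  | .lam _ t => t.size + 1
  | .app t s => t.size + s.size + 1
  | .pair s t => s.size + t.size + 1
  | .letp _ _ s t => s.size + t.size + 1

theorem Term.size_pos (t : Term) : 0 < t.size := by cases t <;> simp [Term.size]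

theorem Term.mem_occ (t : Term) (z : ℕ) : z ∈ t.occ ↔ z ∈ t.FV ∨ z ∈ t.bv := by
  induction t <;> simp [Term.occ, Term.FV, Term.bv] <;> grind

theorem Term.FV_occ {t : Term} {z : ℕ} (h : z ∈ t.FV) : z ∈ t.occ := (t.mem_occ z).2 (.inl h)

theorem Term.Lin.not_bv {t : Term} (h : t.Lin) {z : ℕ} (hz : z ∈ t.FV) : z ∉ t.bv := by
  induction t with
  | var => simp [Term.bv]
  | lam x t ih => simp only [Term.Lin, Term.FV, Term.bv] at *; grind
  | app t s ih1 ih2 =>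
      have := t.mem_occ z; have := s.mem_occ z
      simp only [Term.Lin, Term.FV, Term.bv] at *; grind
  | pair t s ih1 ih2 =>
      have := t.mem_occ z; have := s.mem_occ z
      simp only [Term.Lin, Term.FV, Term.bv] at *; grind
  | letp x y t s ih1 ih2 =>
      have := t.mem_occ z; have := s.mem_occ z
      have := s.mem_occ x; have := s.mem_occ y
      have := t.mem_occ x; have := t.mem_occ y
      simp only [Term.Lin, Term.FV, Term.bv] at *; grind

theorem Term.Lin.fv_eq {t : Term} (h : t.Lin) : t.fv = t.FV := by
  ext z
  have := t.mem_occ z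
  have := h.not_bv (z := z)
  simp only [Term.fv, Finset.mem_sdiff, List.mem_toFinset]
  grind

/-- The assignment also covers bound variables, so the type can be computed by recursion on the
term. That the types of bound variables are themselves forced, once the type of the term is given,
is the deeper `HasTy.rigid`. -/
theorem HasTy.unique {ρ ρ' : ℕ → Ty} {t : Term} {A A' : Ty} (h : HasTy ρ t A)
    (h' : HasTy ρ' t A') (hρ : ∀ z ∈ t.occ, ρ z = ρ' z) : A = A' := by
  induction t generalizing A A' with
  | var x => simp only [HasTy, Term.occ] at *; grind
  | lam x t ih =>
      simp only [HasTy, Term.occ] at *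
      obtain ⟨B, rfl, hB⟩ := h
      obtain ⟨B', rfl, hB'⟩ := h'
      rw [ih hB hB' (by grind), hρ x (by simp)]
  | app t s ih1 ih2 =>
      simp only [HasTy, Term.occ] at *
      obtain ⟨B, hB, -⟩ := h
      obtain ⟨B', hB', -⟩ := h'
      have := ih1 hB hB' (by grind)
      grind
  | pair t s ih1 ih2 =>
      simp only [HasTy, Term.occ] at *
      obtain ⟨B, C, rfl, hB, hC⟩ := h
      obtain ⟨B', C', rfl, hB', hC'⟩ := h'
      rw [ih1 hB hB' (by grind), ih2 hC hC' (by grind)]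
  | letp x y s t ih1 ih2 =>
      simp only [HasTy, Term.occ] at *
      exact ih2 h.2 h'.2 (by grind)

theorem HasTy.congr {ρ ρ' : ℕ → Ty} {t : Term} {A : Ty} (h : HasTy ρ t A)
    (hρ : ∀ z ∈ t.occ, ρ z = ρ' z) : HasTy ρ' t A := by
  induction t generalizing A with
  | var x => simp only [HasTy, Term.occ] at *; grind
  | lam x t ih =>
      simp only [HasTy, Term.occ] at *
      obtain ⟨B, rfl, hB⟩ := h
      exact ⟨B, by rw [hρ x (by simp)], ih hB (by grind)⟩
  | app t s ih1 ih2 =>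
      simp only [HasTy, Term.occ] at *
      obtain ⟨B, hB, hC⟩ := h
      exact ⟨B, ih1 hB (by grind), ih2 hC (by grind)⟩
  | pair t s ih1 ih2 =>
      simp only [HasTy, Term.occ] at *
      obtain ⟨B, C, rfl, hB, hC⟩ := h
      exact ⟨B, C, rfl, ih1 hB (by grind), ih2 hC (by grind)⟩
  | letp x y s t ih1 ih2 =>
      simp only [HasTy, Term.occ] at *
      rw [← hρ x (by simp), ← hρ y (by simp)]
      exact ⟨ih1 h.1 (by grind), ih2 h.2 (by grind)⟩

/-! ### Contexts -/

/-- The free variables of a context. -/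
def TermCtx.FV : TermCtx → Finset ℕ
  | .hole => ∅
  | .appL C t => C.FV ∪ t.FV
  | .appR t C => t.FV ∪ C.FV
  | .pairL C t => C.FV ∪ t.FV
  | .pairR t C => t.FV ∪ C.FV
  | .lam x C => C.FV.erase x
  | .letL x y C t => C.FV ∪ (t.FV \ {x, y})
  | .letR x y t C => t.FV ∪ (C.FV \ {x, y})

/-- Linearity of a context whose hole is to be filled with a term with free variables `F`. -/
def TermCtx.Lin (F : Finset ℕ) : TermCtx → Prop
  | .hole => True
  | .appL C t => C.Lin F ∧ t.Lin ∧ ∀ z, z ∈ C.occ ∨ z ∈ F → z ∉ t.occ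
  | .appR t C => t.Lin ∧ C.Lin F ∧ ∀ z, z ∈ C.occ ∨ z ∈ F → z ∉ t.occ
  | .pairL C t => C.Lin F ∧ t.Lin ∧ ∀ z, z ∈ C.occ ∨ z ∈ F → z ∉ t.occ
  | .pairR t C => t.Lin ∧ C.Lin F ∧ ∀ z, z ∈ C.occ ∨ z ∈ F → z ∉ t.occ
  | .lam x C => C.Lin F ∧ x ∈ C.FV ∪ (F \ C.cv)
  | .letL x y C t => C.Lin F ∧ t.Lin ∧ x ∈ t.FV ∧ y ∈ t.FV ∧ x ≠ y ∧
      ∀ z, z ∈ C.occ ∨ z ∈ F → z ∉ t.occ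
  | .letR x y t C => t.Lin ∧ C.Lin F ∧ x ∈ C.FV ∪ (F \ C.cv) ∧ y ∈ C.FV ∪ (F \ C.cv) ∧ x ≠ y ∧
      ∀ z, z ∈ C.occ ∨ z ∈ F → z ∉ t.occ

theorem TermCtx.mem_plug_occ (C : TermCtx) (u : Term) (z : ℕ) :
    z ∈ (C.plug u).occ ↔ z ∈ C.occ ∨ z ∈ u.occ := by
  induction C <;> simp [TermCtx.plug, TermCtx.occ, Term.occ, *] <;> grind

theorem TermCtx.mem_plug_bv (C : TermCtx) (u : Term) (z : ℕ) :
    z ∈ (C.plug u).bv ↔ z ∈ C.bv ∨ z ∈ u.bv := by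
  induction C <;> simp [TermCtx.plug, TermCtx.bv, Term.bv, *] <;> grind

theorem TermCtx.mem_plug_FV (C : TermCtx) (u : Term) (z : ℕ) :
    z ∈ (C.plug u).FV ↔ z ∈ C.FV ∨ z ∈ u.FV ∧ z ∉ C.cv := by
  induction C <;> simp [TermCtx.plug, TermCtx.FV, Term.FV, TermCtx.cv, *] <;> grind

theorem TermCtx.mem_occ (C : TermCtx) (z : ℕ) : z ∈ C.occ ↔ z ∈ C.FV ∨ z ∈ C.bv := by
  induction C <;> simp [TermCtx.occ, TermCtx.FV, TermCtx.bv, Term.mem_occ, *] <;> grind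

theorem TermCtx.cv_sub_bv (C : TermCtx) (z : ℕ) (h : z ∈ C.cv) : z ∈ C.bv := by
  induction C <;> simp [TermCtx.cv, TermCtx.bv] at * <;> grind

theorem TermCtx.cv_sub_occ (C : TermCtx) (z : ℕ) (h : z ∈ C.cv) : z ∈ C.occ :=
  (C.mem_occ z).2 (.inr (C.cv_sub_bv z h))

theorem TermCtx.size_plug (C : TermCtx) (u v : Term) :
    (C.plug u).size + v.size = (C.plug v).size + u.size := by
  induction C <;> simp [TermCtx.plug, Term.size] <;> omega

/-- Linearity of C[u] depends on u only through its own linearity, its free variables and the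
freshness of its binders. A subterm may therefore be replaced by another with the same free
variables and no new binders. -/
theorem TermCtx.plug_lin (C : TermCtx) (u : Term) :
    (C.plug u).Lin ↔ u.Lin ∧ C.Lin u.FV ∧ ∀ z ∈ u.bv, z ∉ C.occ := by
  induction C with
  | hole => simp [TermCtx.plug, TermCtx.Lin, TermCtx.occ]
  | lam x C ih =>
      have := C.mem_plug_FV u x
      have := fun h : u.Lin => h.not_bv (z := x)
      have := C.mem_occ x
      simp only [TermCtx.plug, TermCtx.Lin, TermCtx.occ, Term.Lin] at *
      grind
  | appL C t ih =>
      have := C.mem_plug_occ u; have := u.mem_occ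
      simp only [TermCtx.plug, TermCtx.Lin, TermCtx.occ, Term.Lin] at *
      grind
  | appR t C ih =>
      have := C.mem_plug_occ u; have := u.mem_occ
      simp only [TermCtx.plug, TermCtx.Lin, TermCtx.occ, Term.Lin] at *
      grind
  | pairL C t ih =>
      have := C.mem_plug_occ u; have := u.mem_occ
      simp only [TermCtx.plug, TermCtx.Lin, TermCtx.occ, Term.Lin] at *
      grind
  | pairR t C ih =>
      have := C.mem_plug_occ u; have := u.mem_occ
      simp only [TermCtx.plug, TermCtx.Lin, TermCtx.occ, Term.Lin] at *
      grind
  | letL x y C t ih =>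
      have := C.mem_plug_occ u; have := u.mem_occ
      have := t.mem_occ x; have := t.mem_occ y
      simp only [TermCtx.plug, TermCtx.Lin, TermCtx.occ, Term.Lin] at *
      grind
  | letR x y t C ih =>
      have := C.mem_plug_occ u; have := u.mem_occ
      have := C.mem_plug_FV u x
      have := C.mem_plug_FV u y
      have := fun h : u.Lin => h.not_bv (z := x)
      have := fun h : u.Lin => h.not_bv (z := y)
      have := C.mem_occ x
      have := C.mem_occ y
      simp only [TermCtx.plug, TermCtx.Lin, TermCtx.occ, Term.Lin] at *
      grind

/-- Only the captured variables in F and the overlap of F with the occurrences in C matter. -/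
theorem TermCtx.Lin.congr {F F' : Finset ℕ} {C : TermCtx} (h : C.Lin F)
    (h1 : ∀ z ∈ C.cv, z ∈ F → z ∈ F') (h2 : ∀ z ∈ F', z ∈ C.occ → z ∈ F) : C.Lin F' := by
  induction C <;> simp [TermCtx.Lin, TermCtx.cv, TermCtx.occ] at * <;> grind

/-- A free variable of the plugged term has its single use there, so any occurrence of it in C must
come from the binder that captures it. -/
theorem TermCtx.Lin.captured {F : Finset ℕ} {C : TermCtx} (h : C.Lin F) {z : ℕ} (hF : z ∈ F)
    (hz : z ∈ C.occ) : z ∈ C.cv := by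
  induction C with
  | hole => simp [TermCtx.occ] at hz
  | letL x y C t ih =>
      have := t.mem_occ x; have := t.mem_occ y
      simp [TermCtx.Lin, TermCtx.cv, TermCtx.occ] at *; grind
  | _ => simp [TermCtx.Lin, TermCtx.cv, TermCtx.occ] at * <;> grind

theorem HasTy.of_plug {ρ : ℕ → Ty} {C : TermCtx} {u : Term} {A : Ty} (h : HasTy ρ (C.plug u) A) :
    ∃ B, HasTy ρ u B := by
  induction C generalizing A <;> simp only [TermCtx.plug, HasTy] at h <;> grind

theorem HasTy.plug {ρ : ℕ → Ty} {C : TermCtx} {u v : Term} {A : Ty} (h : HasTy ρ (C.plug u) A)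
    (huv : ∀ B, HasTy ρ u B → HasTy ρ v B) : HasTy ρ (C.plug v) A := by
  induction C generalizing A <;> simp only [TermCtx.plug, HasTy] at * <;> grind

/-! ### Substitution -/

theorem Term.subst_congr {t : Term} {σ τ : ℕ → Term} (h : ∀ z ∈ t.FV, σ z = τ z) :
    t.subst σ = t.subst τ := by
  induction t generalizing σ τ with
  | var x => simpa [Term.FV, Term.subst] using h
  | lam x t ih =>
      simp only [Term.subst, Term.FV, Term.lam.injEq, true_and] at *
      refine ih fun z hz => ?_
      by_cases hx : z = x <;> simp [hx, Function.update] <;> grind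
  | app t s ih1 ih2 => simp only [Term.subst, Term.FV] at *; grind
  | pair t s ih1 ih2 => simp only [Term.subst, Term.FV] at *; grind
  | letp x y s t ih1 ih2 =>
      simp only [Term.subst, Term.FV, Term.letp.injEq, true_and] at *
      refine ⟨ih1 (by grind), ih2 fun z hz => ?_⟩
      simp only [Function.update]
      grind

theorem Term.subst_var (t : Term) : t.subst Term.var = t := by
  induction t with
  | var x => rfl
  | lam x t ih => simp [Term.subst, Function.update_eq_self, ih]
  | app t s ih1 ih2 => simp [Term.subst, ih1, ih2]
  | pair t s ih1 ih2 => simp [Term.subst, ih1, ih2]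
  | letp x y s t ih1 ih2 => simp [Term.subst, Function.update_eq_self, ih1, ih2]

theorem Term.subst1_of_notMem {t : Term} {x : ℕ} (h : x ∉ t.FV) (s : Term) :
    t.subst1 x s = t := by
  conv_rhs => rw [← t.subst_var]
  refine Term.subst_congr fun z hz => ?_
  rw [Function.update_of_ne]
  grind

theorem Term.subst1_var_self (x : ℕ) (s : Term) : (Term.var x).subst1 x s = s := by
  simp [Term.subst1, Term.subst]

theorem Term.subst1_var_ne {x y : ℕ} (h : y ≠ x) (s : Term) :
    (Term.var y).subst1 x s = .var y := by
  simp [Term.subst1, Term.subst, h]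

theorem Term.subst1_lam {x y : ℕ} (h : y ≠ x) (t s : Term) :
    (Term.lam y t).subst1 x s = .lam y (t.subst1 x s) := by
  simp only [Term.subst1, Term.subst, Term.lam.injEq, true_and]
  congr 1
  funext z
  simp only [Function.update]
  grind

theorem Term.subst1_app (t u : Term) (x : ℕ) (s : Term) :
    (Term.app t u).subst1 x s = .app (t.subst1 x s) (u.subst1 x s) := rfl

theorem Term.subst1_pair (t u : Term) (x : ℕ) (s : Term) :
    (Term.pair t u).subst1 x s = .pair (t.subst1 x s) (u.subst1 x s) := rfl

theorem Term.subst1_letp {x y z : ℕ} (h : y ≠ x) (h' : z ≠ x) (u t s : Term) :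
    (Term.letp y z u t).subst1 x s = .letp y z (u.subst1 x s) (t.subst1 x s) := by
  simp only [Term.subst1, Term.subst, Term.letp.injEq, true_and]
  congr 1
  funext w
  simp only [Function.update]
  grind

/-- Simultaneous substitution becomes iterated substitution as y is not free in u. This reduces the
rule beta2 to two instances of beta1. -/
theorem Term.subst2_eq {t u : Term} {x y : ℕ} (v : Term) (hxy : x ≠ y) (hx : x ∉ t.bv)
    (hy : y ∉ t.bv) (hu : y ∉ u.FV) :
    t.subst2 x u y v = (t.subst1 x u).subst1 y v := by
  induction t with
  | var z =>
      by_cases hz : z = x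
      · subst hz
        rw [Term.subst1_var_self, Term.subst1_of_notMem hu]
        simp [Term.subst2, Term.subst, hxy]
      · rw [Term.subst1_var_ne hz]
        simp [Term.subst2, Term.subst1, Term.subst, Function.update, hz]
  | lam z t ih =>
      simp only [Term.bv] at *
      rw [Term.subst1_lam (by grind), Term.subst1_lam (by grind), ← ih (by grind) (by grind)]
      simp only [Term.subst2, Term.subst, Term.lam.injEq, true_and]
      congr 1
      funext w
      simp only [Function.update]
      grind
  | app t s ih1 ih2 =>
      simp only [Term.bv] at *
      rw [Term.subst1_app, Term.subst1_app, ← ih1 (by grind) (by grind),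
        ← ih2 (by grind) (by grind)]
      rfl
  | pair t s ih1 ih2 =>
      simp only [Term.bv] at *
      rw [Term.subst1_pair, Term.subst1_pair, ← ih1 (by grind) (by grind),
        ← ih2 (by grind) (by grind)]
      rfl
  | letp z z' s t ih1 ih2 =>
      simp only [Term.bv] at *
      rw [Term.subst1_letp (by grind) (by grind), Term.subst1_letp (by grind) (by grind),
        ← ih1 (by grind) (by grind), ← ih2 (by grind) (by grind)]
      simp only [Term.subst2, Term.subst, Term.letp.injEq, true_and]
      congr 1
      funext w
      simp only [Function.update]
      grind

theorem TermCtx.plug_subst1 {C : TermCtx} {x : ℕ} (h : x ∉ C.occ) (u s : Term) :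
    (C.plug u).subst1 x s = C.plug (u.subst1 x s) := by
  induction C with
  | hole => rfl
  | lam y C ih =>
      simp only [TermCtx.occ, TermCtx.plug] at *
      rw [Term.subst1_lam (by grind), ih (by grind)]
  | letL y z C t ih =>
      have := t.mem_occ x
      simp only [TermCtx.occ, TermCtx.plug] at *
      rw [Term.subst1_letp (by grind) (by grind), ih (by grind),
        Term.subst1_of_notMem (t := t) (by grind)]
  | letR y z t C ih =>
      have := t.mem_occ x
      simp only [TermCtx.occ, TermCtx.plug] at *
      rw [Term.subst1_letp (by grind) (by grind), ih (by grind),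
        Term.subst1_of_notMem (t := t) (by grind)]
  | appL C t ih =>
      have := t.mem_occ x
      simp only [TermCtx.occ, TermCtx.plug] at *
      rw [Term.subst1_app, ih (by grind), Term.subst1_of_notMem (t := t) (by grind)]
  | appR t C ih =>
      have := t.mem_occ x
      simp only [TermCtx.occ, TermCtx.plug] at *
      rw [Term.subst1_app, ih (by grind), Term.subst1_of_notMem (t := t) (by grind)]
  | pairL C t ih =>
      have := t.mem_occ x
      simp only [TermCtx.occ, TermCtx.plug] at *
      rw [Term.subst1_pair, ih (by grind), Term.subst1_of_notMem (t := t) (by grind)]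
  | pairR t C ih =>
      have := t.mem_occ x
      simp only [TermCtx.occ, TermCtx.plug] at *
      rw [Term.subst1_pair, ih (by grind), Term.subst1_of_notMem (t := t) (by grind)]

/-- A linear term has a one-hole context around each of its free variables. -/
theorem Term.Lin.exists_plug {t : Term} (h : t.Lin) {x : ℕ} (hx : x ∈ t.FV) :
    ∃ C : TermCtx, t = C.plug (.var x) ∧ x ∉ C.occ := by
  induction t with
  | var y =>
      simp only [Term.FV, Finset.mem_singleton] at hx
      exact ⟨.hole, by simp [TermCtx.plug, hx], by simp [TermCtx.occ]⟩
  | lam y t ih =>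
      simp only [Term.FV, Finset.mem_erase, Term.Lin] at *
      obtain ⟨C, rfl, hC⟩ := ih h.1 hx.2
      exact ⟨.lam y C, rfl, by simp [TermCtx.occ, hC, hx.1]⟩
  | app t s ih1 ih2 =>
      have := t.mem_occ x; have := s.mem_occ x
      simp only [Term.FV, Finset.mem_union, Term.Lin] at *
      rcases hx with hx | hx
      · obtain ⟨C, rfl, hC⟩ := ih1 h.1 hx
        exact ⟨.appL C s, rfl, by simp [TermCtx.occ, hC]; grind⟩
      · obtain ⟨C, rfl, hC⟩ := ih2 h.2.1 hx
        exact ⟨.appR t C, rfl, by simp [TermCtx.occ, hC]; grind⟩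
  | pair t s ih1 ih2 =>
      have := t.mem_occ x; have := s.mem_occ x
      simp only [Term.FV, Finset.mem_union, Term.Lin] at *
      rcases hx with hx | hx
      · obtain ⟨C, rfl, hC⟩ := ih1 h.1 hx
        exact ⟨.pairL C s, rfl, by simp [TermCtx.occ, hC]; grind⟩
      · obtain ⟨C, rfl, hC⟩ := ih2 h.2.1 hx
        exact ⟨.pairR t C, rfl, by simp [TermCtx.occ, hC]; grind⟩
  | letp y z s t ih1 ih2 =>
      have := t.mem_occ x; have := s.mem_occ x
      have := t.mem_occ y; have := t.mem_occ z
      simp only [Term.FV, Finset.mem_union, Finset.mem_sdiff, Finset.mem_insert,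
        Finset.mem_singleton, Term.Lin] at *
      rcases hx with hx | hx
      · obtain ⟨C, rfl, hC⟩ := ih1 h.1 hx
        exact ⟨.letL y z C t, rfl, by simp [TermCtx.occ, hC]; grind⟩
      · obtain ⟨C, rfl, hC⟩ := ih2 h.2.1 hx.1
        exact ⟨.letR y z s C, rfl, by simp [TermCtx.occ, hC]; grind⟩

theorem TermCtx.plug_var_subst1 {C : TermCtx} {x : ℕ} (h : x ∉ C.occ) (s : Term) :
    (C.plug (.var x)).subst1 x s = C.plug s := by
  rw [TermCtx.plug_subst1 h, Term.subst1_var_self]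

/-- Filling the hole of a context with another term instead of a variable. -/
theorem TermCtx.plug_lin_of_var {C : TermCtx} {x : ℕ} {s : Term} (h : (C.plug (.var x)).Lin)
    (hx : x ∉ C.occ) (hs : s.Lin) (hsC : ∀ z ∈ s.occ, z ∉ C.occ) : (C.plug s).Lin := by
  have hm := s.mem_occ
  rw [TermCtx.plug_lin] at *
  refine ⟨hs, h.2.1.congr ?_ ?_, by grind⟩
  · intro z hz hzx
    have := C.cv_sub_occ z hz
    simp only [Term.FV] at hzx
    grind
  · grind

/-! ### Types up to the choice of atoms -/

/-- Substitution of types for type variables. -/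
def Ty.bind (f : ℕ → Ty) : Ty → Ty
  | .var p => f p
  | .tensor A B => .tensor (A.bind f) (B.bind f)
  | .limp A B => .limp (A.bind f) (B.bind f)

/-- The shape of a type: all type variables are identified. -/
def Ty.sh (A : Ty) : Ty := A.bind fun _ => .var 0

@[simp] theorem Ty.sh_var (p : ℕ) : (Ty.var p).sh = .var 0 := rfl
@[simp] theorem Ty.sh_tensor (A B : Ty) : (Ty.tensor A B).sh = .tensor A.sh B.sh := rfl
@[simp] theorem Ty.sh_limp (A B : Ty) : (Ty.limp A B).sh = .limp A.sh B.sh := rfl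

theorem HasTy.bind {ρ : ℕ → Ty} {t : Term} {A : Ty} (h : HasTy ρ t A) (f : ℕ → Ty) :
    HasTy (fun x => (ρ x).bind f) t (A.bind f) := by
  induction t generalizing A with
  | var x => simp only [HasTy] at *; grind
  | lam x t ih =>
      obtain ⟨B, rfl, hB⟩ := h
      exact ⟨B.bind f, rfl, ih hB⟩
  | app t s ih1 ih2 =>
      obtain ⟨B, hB, hC⟩ := h
      exact ⟨B.bind f, ih1 hB, ih2 hC⟩
  | pair t s ih1 ih2 =>
      obtain ⟨B, C, rfl, hB, hC⟩ := h
      exact ⟨B.bind f, C.bind f, rfl, ih1 hB, ih2 hC⟩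
  | letp x y s t ih1 ih2 => exact ⟨ih1 h.1, ih2 h.2⟩

/-! ### Preservation under the rules of reduction -/

/-- What reduction and commutative conversion preserve. -/
structure Preserves (r r' : Term) : Prop where
  lin : r'.Lin
  FV : r'.FV = r.FV
  bv : ∀ z ∈ r'.bv, z ∈ r.bv
  ty : ∀ ρ A, HasTy ρ r A → HasTy ρ r' A
  -- The types of variables that the step removes are forced by those of the variables that remain.
  rigid : ∀ ρ₁ ρ₂ A₁ A₂, HasTy ρ₁ r A₁ → HasTy ρ₂ r A₂ → (∀ z ∈ r'.occ, ρ₁ z = ρ₂ z) →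
    ∀ z ∈ r.occ, ρ₁ z = ρ₂ z

/-- A typing of `r'` whose type has the right shape comes from a typing of `r`. -/
structure Expands (r r' : Term) : Prop extends Preserves r r' where
  -- The new assignment changes only removed binders, so that it remains compatible with a typing of
  -- the surrounding context.
  exp : ∀ ρ₀ A₀ ρ A, HasTy ρ₀ r A₀ → HasTy ρ r' A → A.sh = A₀.sh →
    ∃ ρ', (∀ z, ρ' z ≠ ρ z → z ∈ r.bv ∧ z ∉ r'.occ) ∧ HasTy ρ' r A

theorem Preserves.plug {C : TermCtx} {r r' : Term} (h : Preserves r r') (hl : (C.plug r).Lin) :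
    Preserves (C.plug r) (C.plug r') := by
  have hl' := (C.plug_lin r).1 hl
  have hbv := h.bv
  refine ⟨(C.plug_lin r').2 ⟨h.lin, by rw [h.FV]; exact hl'.2.1, by grind⟩, ?_, ?_, ?_, ?_⟩
  · ext z
    simp only [C.mem_plug_FV, h.FV]
  · simp only [C.mem_plug_bv]
    grind
  · exact fun ρ A hA => hA.plug (h.ty ρ)
  · intro ρ₁ ρ₂ A₁ A₂ h1 h2 h3
    obtain ⟨B₁, hB₁⟩ := h1.of_plug
    obtain ⟨B₂, hB₂⟩ := h2.of_plug
    have := h.rigid ρ₁ ρ₂ B₁ B₂ hB₁ hB₂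
    simp only [C.mem_plug_occ] at *
    grind

/-- By linearity x occurs exactly once, so t = C[x] and the reduct is C[s]: the argument is moved
and neither erased nor copied. Hence the size drops, and a typing of the reduct can be pulled back
to the redex. -/
theorem Expands.beta1 {x : ℕ} {t s : Term} (h : (Term.app (.lam x t) s).Lin) :
    Expands (.app (.lam x t) s) (t.subst1 x s) ∧
      (t.subst1 x s).size + 1 = t.size + s.size := by
  have h0 := h
  simp only [Term.Lin, Term.occ] at h
  obtain ⟨⟨ht, hx⟩, hs, hd⟩ := h
  obtain ⟨C, rfl, hC⟩ := ht.exists_plug hx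
  rw [TermCtx.plug_var_subst1 hC]
  have ho := C.mem_plug_occ (.var x)
  have hso := s.mem_occ
  have hCo := C.mem_occ
  have hcv := C.cv_sub_occ
  have hfv := C.mem_plug_FV
  refine ⟨⟨⟨?_, ?_, ?_, ?_, ?_⟩, ?_⟩, ?_⟩
  rotate_left 4
  swap
  rotate_right 4
  · refine TermCtx.plug_lin_of_var ht hC hs ?_
    grind
  · ext z
    simp only [Term.FV, Finset.mem_union, Finset.mem_erase, hfv, Finset.mem_singleton] at *
    grind
  · intro z
    simp only [Term.bv, C.mem_plug_bv, Finset.mem_union]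
    grind
  · rintro ρ A ⟨B, ⟨B', h1, h2⟩, h3⟩
    cases h1
    exact h2.plug fun B' hB' => by rw [hB']; exact h3
  · intro ρ₀ A₀ ρ A _ h1 _
    obtain ⟨B, hB⟩ := h1.of_plug
    have hxs : x ∉ s.occ := fun hxs => hd x (by simp) hxs
    -- The only variable lost in the contraction is x; it receives the type that s has inside C[s].
    refine ⟨Function.update ρ x B, ?_, B, ⟨A, by simp, ?_⟩, ?_⟩
    · intro z hz
      have : z = x := by by_contra hne; simp [hne] at hz
      subst this
      simp [Term.bv, C.mem_plug_occ, hC, hxs]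
    · have h1' := h1.congr (ρ' := Function.update ρ x B) (by
        intro z hz
        rw [C.mem_plug_occ] at hz
        rw [Function.update_of_ne]
        grind)
      refine h1'.plug fun B' hB' => ?_
      simp only [HasTy, Function.update_self]
      exact hB'.unique hB fun z hz => by rw [Function.update_of_ne]; grind
    · exact hB.congr fun z hz => by rw [Function.update_of_ne]; grind
  · rintro ρ₁ ρ₂ A₁ A₂ ⟨B₁, ⟨B, h1, -⟩, h2⟩ ⟨B₂, ⟨B', h3, -⟩, h4⟩ h5
    cases h1
    cases h3
    have := h2.unique h4 fun z hz => h5 z ((C.mem_plug_occ s z).2 (.inr hz))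
    intro z hz
    simp only [C.mem_plug_occ] at h5
    simp only [Term.occ, List.cons_append, List.mem_cons, List.mem_append, C.mem_plug_occ,
      List.not_mem_nil, or_false] at hz
    grind
  · have := C.size_plug s (.var x)
    simp only [Term.size] at *
    omega

theorem Expands.beta2 {x y : ℕ} {u v w : Term} (h : (Term.letp x y (.pair u v) w).Lin) :
    Expands (.letp x y (.pair u v) w) (w.subst2 x u y v) ∧
      (w.subst2 x u y v).size < (Term.letp x y (.pair u v) w).size := by
  simp only [Term.Lin, Term.occ] at h
  obtain ⟨⟨hu, hv, huv⟩, hw, hx, hy, hxy, hd⟩ := h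
  have huo := u.mem_occ
  have hvo := v.mem_occ
  have hwo := w.mem_occ
  have hxw := hw.not_bv hx
  have hyw := hw.not_bv hy
  rw [Term.subst2_eq v hxy hxw hyw (by grind)]
  -- two beta steps for functions have the same effect
  have l1 : (Term.app (.lam x w) u).Lin := by
    simp only [Term.Lin, Term.occ]; grind
  obtain ⟨p1, s1⟩ := Expands.beta1 l1
  have hy1 : y ∈ (w.subst1 x u).FV := by
    rw [p1.FV]; simp only [Term.FV]; grind
  have ho1 := (w.subst1 x u).mem_occ
  have p1FV := p1.FV
  have p1bv := p1.bv
  simp only [Term.FV, Term.bv] at p1FV p1bv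
  have l2 : (Term.app (.lam y (w.subst1 x u)) v).Lin := by
    refine ⟨⟨p1.lin, hy1⟩, hv, ?_⟩
    intro z
    simp only [Term.occ, List.mem_cons, ho1, p1FV]
    grind
  obtain ⟨p2, s2⟩ := Expands.beta1 l2
  refine ⟨⟨⟨p2.lin, ?_, ?_, ?_, ?_⟩, ?_⟩, ?_⟩
  rotate_left 3
  swap
  rotate_right 3
  · rw [p2.FV]
    ext z
    simp only [Term.FV, p1FV]
    grind
  · intro z hz
    have := p2.bv z hz
    simp only [Term.bv] at *
    grind
  · rintro ρ A ⟨⟨B, C, h1, h2, h3⟩, h4⟩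
    cases h1
    exact p2.ty ρ A ⟨_, ⟨A, rfl, p1.ty ρ A ⟨_, ⟨A, rfl, h4⟩, h2⟩⟩, h3⟩
  · intro ρ₀ A₀ ρ A h0 h1 h2
    have h0' : HasTy ρ₀ (.app (.lam y (w.subst1 x u)) v) A₀ := by
      obtain ⟨⟨B, C, e, h2, h3⟩, h4⟩ := h0
      cases e
      exact ⟨_, ⟨A₀, rfl, p1.ty ρ₀ A₀ ⟨_, ⟨A₀, rfl, h4⟩, h2⟩⟩, h3⟩
    obtain ⟨ρ', hρ, C, ⟨B, e, h3⟩, h4⟩ := p2.exp ρ₀ A₀ ρ A h0' h1 h2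
    cases e
    have h0'' : HasTy ρ₀ (.app (.lam x w) u) A₀ := by
      obtain ⟨⟨B, C, e, h2, h3⟩, h4⟩ := h0
      cases e
      exact ⟨_, ⟨A₀, rfl, h4⟩, h2⟩
    obtain ⟨ρ'', hρ', C, ⟨B, e, h5⟩, h6⟩ := p1.exp ρ₀ A₀ ρ' A h0'' h3 h2
    cases e
    have ho2 := ((w.subst1 x u).subst1 y v).mem_occ
    have p2FV := p2.FV
    have p2bv := p2.bv
    simp only [Term.FV, Term.bv] at p2FV p2bv hρ hρ'
    refine ⟨ρ'', ?_, ⟨_, _, rfl, h6, ?_⟩, h5⟩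
    · intro z hz
      simp only [Term.bv, ho2, p2FV, p1FV]
      by_cases hz' : ρ'' z = ρ' z
      · have := hρ z (by rwa [← hz'])
        simp only [ho2, p2FV, p1FV] at this
        grind
      · have := hρ' z hz'
        simp only [ho1, p1FV] at this
        grind
    · have hv' : ∀ z ∈ v.occ, ρ' z = ρ'' z := by
        intro z hz
        by_contra hne
        have := (hρ' z (fun e => hne e.symm)).1
        grind
      have hyy : ρ' y = ρ'' y := by
        by_contra hne
        have := (hρ' y (fun e => hne e.symm))
        have := ho1 y
        grind
      rw [← hyy]
      exact h4.congr hv'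
  · rintro ρ₁ ρ₂ A₁ A₂ ⟨⟨B, C, e, h2, h3⟩, h4⟩ ⟨⟨B', C', e', h2', h3'⟩, h4'⟩ h5
    cases e
    cases e'
    have e1 : HasTy ρ₁ (.app (.lam x w) u) A₁ := ⟨_, ⟨A₁, rfl, h4⟩, h2⟩
    have e2 : HasTy ρ₂ (.app (.lam x w) u) A₂ := ⟨_, ⟨A₂, rfl, h4'⟩, h2'⟩
    have r2 := p2.rigid ρ₁ ρ₂ A₁ A₂ ⟨_, ⟨A₁, rfl, p1.ty _ _ e1⟩, h3⟩
      ⟨_, ⟨A₂, rfl, p1.ty _ _ e2⟩, h3'⟩ h5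
    have r1 := p1.rigid ρ₁ ρ₂ A₁ A₂ e1 e2 fun z hz => r2 z (by simp [Term.occ, hz])
    simp only [Term.occ] at *
    grind
  · simp only [Term.size] at *
    omega

/-- This is where the shape is needed. The term t could also be typed by a non-functional type, but
the expanded term could not; a type with the shape of a function type is one. -/
theorem Expands.eta1 {x : ℕ} {t : Term} (h : (Term.lam x (.app t (.var x))).Lin) :
    Expands (.lam x (.app t (.var x))) t := by
  simp only [Term.Lin, Term.occ] at h
  obtain ⟨⟨ht, -, hd⟩, -⟩ := h
  have hx : x ∉ t.occ := fun hx => hd x hx (by simp)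
  have hto := t.mem_occ
  refine ⟨⟨ht, ?_, ?_, ?_, ?_⟩, ?_⟩
  rotate_left 3
  swap
  rotate_right 3
  · ext z; simp only [Term.FV]; grind
  · simp only [Term.bv]; grind
  · rintro ρ A ⟨B, rfl, C, h1, h2⟩
    cases h2
    exact h1
  · rintro ρ₀ A₀ ρ A ⟨B, rfl, h0⟩ h1 h2
    cases A with
    | limp X Y =>
        refine ⟨Function.update ρ x X, ?_, Y, by simp, X, ?_, by simp [HasTy]⟩
        · intro z hz
          have : z = x := by by_contra hne; simp [hne] at hz
          subst this
          simp [Term.bv, hx]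
        · exact h1.congr fun z hz => by rw [Function.update_of_ne]; grind
    | _ => simp at h2
  · rintro ρ₁ ρ₂ A₁ A₂ ⟨B, rfl, C, h1, h2⟩ ⟨B', rfl, C', h3, h4⟩ h5
    have := h1.unique h3 h5
    simp only [HasTy, Term.occ] at *
    grind

theorem Expands.eta2 {x y : ℕ} {t : Term} (h : (Term.letp x y t (.pair (.var x) (.var y))).Lin) :
    Expands (.letp x y t (.pair (.var x) (.var y))) t := by
  simp only [Term.Lin, Term.occ] at h
  obtain ⟨ht, -, -, -, hxy, hd⟩ := h
  have hx : x ∉ t.occ := fun hx => hd x hx (by simp)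
  have hy : y ∉ t.occ := fun hx => hd y hx (by simp)
  have hto := t.mem_occ
  refine ⟨⟨ht, ?_, ?_, ?_, ?_⟩, ?_⟩
  rotate_left 3
  swap
  rotate_right 3
  · ext z; simp only [Term.FV]; grind
  · simp only [Term.bv]; grind
  · rintro ρ A ⟨h0, B, C, rfl, h1, h2⟩
    cases h1
    cases h2
    exact h0
  · rintro ρ₀ A₀ ρ A ⟨h0, B, C, rfl, h3, h4⟩ h1 h2
    cases A with
    | tensor X Y =>
        refine ⟨Function.update (Function.update ρ x X) y Y, ?_, ?_, X, Y, rfl, ?_, ?_⟩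
        · intro z hz
          have : z = x ∨ z = y := by by_contra hne; simp [Function.update] at hz; grind
          rcases this with rfl | rfl <;> simp [Term.bv, hx, hy]
        · simp only [Function.update_self, Function.update_of_ne hxy]
          exact h1.congr fun z hz => by rw [Function.update_of_ne, Function.update_of_ne] <;> grind
        · simp [HasTy, hxy]
        · simp [HasTy]
    | _ => simp at h2
  · rintro ρ₁ ρ₂ A₁ A₂ ⟨h1, -⟩ ⟨h3, -⟩ h5
    have := h1.unique h3 h5
    simp only [Term.occ] at *
    grind

theorem BetaEtaRule.expands {r r' : Term} (h : BetaEtaRule r r') (hl : r.Lin) :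
    Expands r r' := by
  cases h with
  | beta1 x t s => exact (Expands.beta1 hl).1
  | beta2 x y u v w => exact (Expands.beta2 hl).1
  | eta1 x t => exact Expands.eta1 hl
  | eta2 x y t => exact Expands.eta2 hl

theorem BetaEtaRule.size_lt {r r' : Term} (h : BetaEtaRule r r') (hl : r.Lin) :
    r'.size < r.size := by
  cases h with
  | beta1 x t s =>
      have := (Expands.beta1 hl).2
      simp only [Term.size]
      omega
  | beta2 x y u v w => exact (Expands.beta2 hl).2
  | eta1 x t => simp only [Term.size]; omega
  | eta2 x y t => simp only [Term.size]; omega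

/-- With one global assignment the typing conditions do not see scopes, so moving a `let` through a
context changes none of them. -/
theorem HasTy.letp_plug {ρ : ℕ → Ty} {C : TermCtx} {x y : ℕ} {t u : Term} {A : Ty} :
    HasTy ρ (C.plug (.letp x y t u)) A ↔ HasTy ρ (.letp x y t (C.plug u)) A := by
  constructor
  · intro h
    obtain ⟨B, hB⟩ := h.of_plug
    exact ⟨hB.1, h.plug fun _ h' => h'.2⟩
  · intro h
    exact h.2.plug fun _ h' => ⟨h.1, h'⟩

/-- From left to right, linearity already keeps x and y out of C. From right to left the side
condition does: x and y are free in C[u], hence not bound in C, so an occurrence in C would be a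
free one. The condition on t prevents capture. -/
theorem CommRule.lin {t t' : Term} (h : CommRule t t') :
    (t.Lin ↔ t'.Lin) ∧ (t.Lin → t.FV = t'.FV) ∧ (∀ z, z ∈ t.bv ↔ z ∈ t'.bv) ∧
      t'.size = t.size := by
  obtain ⟨C, x, y, t, u, hxy, ht⟩ := h
  have hcvo := C.cv_sub_occ
  have hto := t.mem_occ
  have huo := u.mem_occ
  have hCo := C.mem_occ
  have hpo := C.mem_plug_occ u
  have hpFV := C.mem_plug_FV u
  have key : (C.plug (.letp x y t u)).Lin →
      (Term.letp x y t (C.plug u)).Lin ∧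
        (C.plug (.letp x y t u)).FV = (Term.letp x y t (C.plug u)).FV := by
    intro h
    rw [TermCtx.plug_lin] at h
    obtain ⟨⟨h1, h2, h3, h4, h5, h6⟩, h7, h8⟩ := h
    rw [h1.fv_eq] at ht
    rw [Finset.disjoint_left] at ht
    have hcap := fun z => h7.captured (z := z)
    have hxC : x ∉ C.occ := h8 x (by simp [Term.bv])
    have hyC : y ∉ C.occ := h8 y (by simp [Term.bv])
    simp only [Term.FV, Term.bv] at *
    refine ⟨⟨h1, (C.plug_lin u).2 ⟨h2, h7.congr ?_ ?_, ?_⟩, ?_, ?_, h5, ?_⟩, ?_⟩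
    · grind
    · grind
    · grind
    · rw [hpFV]; grind
    · rw [hpFV]; grind
    · intro z hz; rw [hpo]; grind
    · ext z
      simp only [TermCtx.mem_plug_FV, Term.FV, Finset.mem_union, Finset.mem_sdiff, hpFV]
      grind
  refine ⟨⟨fun h => (key h).1, ?_⟩, fun h => (key h).2, ?_, ?_⟩
  · intro h
    obtain ⟨h1, h2, h3, h4, h5, h6⟩ := h
    have hxb := h2.not_bv h3
    have hyb := h2.not_bv h4
    have hCfv : ∀ z, z ∈ C.fv ↔ z ∈ C.occ ∧ z ∉ C.bv := by simp [TermCtx.fv]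
    rw [C.mem_plug_bv] at hxb hyb
    rw [Finset.disjoint_right] at hxy
    have hx' := hxy (a := x) (by simp)
    have hy' := hxy (a := y) (by simp)
    rw [hCfv] at hx' hy'
    rw [hpFV] at h3 h4
    rw [TermCtx.plug_lin] at h2
    obtain ⟨h2, h7, h8⟩ := h2
    refine (C.plug_lin _).2 ⟨⟨h1, h2, ?_, ?_, h5, ?_⟩, h7.congr ?_ ?_, ?_⟩
    · grind
    · grind
    · intro z hz hz'; exact h6 z hz ((hpo z).2 (.inr hz'))
    · simp only [Term.FV]; grind
    · simp only [Term.FV]; grind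
    · simp only [Term.bv]; grind
  · intro z
    simp only [TermCtx.mem_plug_bv, Term.bv, Finset.mem_union, C.mem_plug_bv u]
    grind
  · have := C.size_plug u (.letp x y t u)
    simp only [Term.size] at *
    omega

theorem CommRule.hasTy {t t' : Term} (h : CommRule t t') (ρ : ℕ → Ty) (A : Ty) :
    HasTy ρ t A ↔ HasTy ρ t' A := by
  obtain ⟨C, x, y, t, u, -, -⟩ := h
  exact HasTy.letp_plug

theorem CommRule.mem_occ {t t' : Term} (h : CommRule t t') (z : ℕ) : z ∈ t.occ ↔ z ∈ t'.occ := by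
  obtain ⟨C, x, y, t, u, -, -⟩ := h
  simp only [TermCtx.mem_plug_occ, Term.occ, List.mem_cons, List.mem_append]
  grind

theorem CommRule.preserves {r r' : Term} (h : CommRule r r') (hl : r.Lin) : Preserves r r' :=
  ⟨h.lin.1.1 hl, (h.lin.2.1 hl).symm, fun z hz => (h.lin.2.2.1 z).2 hz,
    fun ρ A => (h.hasTy ρ A).1, fun _ _ _ _ _ _ h3 z hz => h3 z ((h.mem_occ z).1 hz)⟩

theorem CommRule.preserves' {r r' : Term} (h : CommRule r r') (hl : r'.Lin) : Preserves r' r :=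
  ⟨h.lin.1.2 hl, h.lin.2.1 (h.lin.1.2 hl), fun z hz => (h.lin.2.2.1 z).1 hz,
    fun ρ A => (h.hasTy ρ A).2, fun _ _ _ _ _ _ h3 z hz => h3 z ((h.mem_occ z).2 hz)⟩

theorem CommConv.preserves {r r' : Term} (h : CommConv r r') (hl : r.Lin) : Preserves r r' :=
  h.elim (fun h => h.preserves hl) fun h => h.preserves' hl

/-! ### Typing judgements without contexts -/

/-- `t` is linear and has type `A` if its free variables have the types given by `ρ`. -/
def J (ρ : ℕ → Ty) (t : Term) (A : Ty) : Prop :=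
  t.Lin ∧ ∃ ρ', (∀ z ∈ t.FV, ρ' z = ρ z) ∧ HasTy ρ' t A

theorem J.congr {ρ ρ' : ℕ → Ty} {t : Term} {A : Ty} (h : J ρ t A)
    (hρ : ∀ z ∈ t.FV, ρ z = ρ' z) : J ρ' t A := by
  obtain ⟨hl, ρ₁, h1, h2⟩ := h
  exact ⟨hl, ρ₁, fun z hz => (h1 z hz).trans (hρ z hz), h2⟩

theorem J.preserves {ρ : ℕ → Ty} {t t' : Term} {A : Ty} (h : J ρ t A) (hp : Preserves t t') :
    J ρ t' A := by
  obtain ⟨hl, ρ₁, h1, h2⟩ := h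
  exact ⟨hp.lin, ρ₁, by rwa [hp.FV], hp.ty _ _ h2⟩

theorem J.var (ρ : ℕ → Ty) (x : ℕ) : J ρ (.var x) (ρ x) :=
  ⟨trivial, ρ, fun _ _ => rfl, rfl⟩

theorem J.var_inv {ρ : ℕ → Ty} {x : ℕ} {A : Ty} (h : J ρ (.var x) A) : A = ρ x := by
  obtain ⟨-, ρ', h1, h2⟩ := h
  rw [← h1 x (by simp [Term.FV])]
  exact h2

theorem J.lam {ρ : ℕ → Ty} {x : ℕ} {t : Term} {B C : Ty} (h : J (Function.update ρ x B) t C)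
    (hx : x ∈ t.FV) : J ρ (.lam x t) (.limp B C) := by
  obtain ⟨hl, ρ', h1, h2⟩ := h
  refine ⟨⟨hl, hx⟩, ρ', ?_, C, ?_, h2⟩
  · intro z hz
    simp only [Term.FV, Finset.mem_erase] at hz
    rw [h1 z hz.2, Function.update_of_ne hz.1]
  · rw [h1 x hx, Function.update_self]

theorem J.lam_inv {ρ : ℕ → Ty} {x : ℕ} {t : Term} {A : Ty} (h : J ρ (.lam x t) A) :
    ∃ B C, A = .limp B C ∧ J (Function.update ρ x B) t C ∧ x ∈ t.FV := by
  obtain ⟨hl, ρ', h1, C, rfl, h2⟩ := h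
  refine ⟨_, _, rfl, ⟨hl.1, ρ', ?_, h2⟩, hl.2⟩
  intro z hz
  by_cases hx : z = x
  · subst hx; simp
  · rw [Function.update_of_ne hx, h1 z (by simp [Term.FV, hx, hz])]

/-- As the two terms share no variable, not even a bound one, their assignments can be glued. This
makes the Church-style typing of compound terms compositional. -/
theorem exists_common_env {ρ ρ₁ ρ₂ : ℕ → Ty} {t s : Term} (hd : ∀ z ∈ t.occ, z ∉ s.occ)
    (h1 : ∀ z ∈ t.FV, ρ₁ z = ρ z) (h2 : ∀ z ∈ s.FV, ρ₂ z = ρ z) :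
    ∃ ρ' : ℕ → Ty, (∀ z ∈ t.FV ∪ s.FV, ρ' z = ρ z) ∧ (∀ z ∈ t.occ, ρ₁ z = ρ' z) ∧
      ∀ z ∈ s.occ, ρ₂ z = ρ' z := by
  classical
  refine ⟨fun z => if z ∈ t.occ then ρ₁ z else ρ₂ z, ?_, ?_, ?_⟩
  · have := t.mem_occ; have := s.mem_occ
    intro z hz
    grind
  · grind
  · grind

theorem J.app {ρ : ℕ → Ty} {t s : Term} {A B : Ty} (h1 : J ρ t (.limp B A)) (h2 : J ρ s B)
    (hd : ∀ z ∈ t.occ, z ∉ s.occ) : J ρ (.app t s) A := by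
  obtain ⟨hl1, ρ₁, e1, t1⟩ := h1
  obtain ⟨hl2, ρ₂, e2, t2⟩ := h2
  obtain ⟨ρ', h, h', h''⟩ := exists_common_env hd e1 e2
  exact ⟨⟨hl1, hl2, hd⟩, ρ', h, B, t1.congr h', t2.congr h''⟩

theorem J.app_inv {ρ : ℕ → Ty} {t s : Term} {A : Ty} (h : J ρ (.app t s) A) :
    ∃ B, J ρ t (.limp B A) ∧ J ρ s B ∧ ∀ z ∈ t.occ, z ∉ s.occ := by
  obtain ⟨hl, ρ', h, B, h1, h2⟩ := h
  simp only [Term.FV, Finset.mem_union] at h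
  exact ⟨B, ⟨hl.1, ρ', fun z hz => h z (.inl hz), h1⟩,
    ⟨hl.2.1, ρ', fun z hz => h z (.inr hz), h2⟩, hl.2.2⟩

theorem J.pair {ρ : ℕ → Ty} {s t : Term} {A B : Ty} (h1 : J ρ s A) (h2 : J ρ t B)
    (hd : ∀ z ∈ s.occ, z ∉ t.occ) : J ρ (.pair s t) (.tensor A B) := by
  obtain ⟨hl1, ρ₁, e1, t1⟩ := h1
  obtain ⟨hl2, ρ₂, e2, t2⟩ := h2
  obtain ⟨ρ', h, h', h''⟩ := exists_common_env hd e1 e2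
  exact ⟨⟨hl1, hl2, hd⟩, ρ', h, A, B, rfl, t1.congr h', t2.congr h''⟩

theorem J.pair_inv {ρ : ℕ → Ty} {s t : Term} {A : Ty} (h : J ρ (.pair s t) A) :
    ∃ B C, A = .tensor B C ∧ J ρ s B ∧ J ρ t C ∧ ∀ z ∈ s.occ, z ∉ t.occ := by
  obtain ⟨hl, ρ', h, B, C, rfl, h1, h2⟩ := h
  simp only [Term.FV, Finset.mem_union] at h
  exact ⟨B, C, rfl, ⟨hl.1, ρ', fun z hz => h z (.inl hz), h1⟩,
    ⟨hl.2.1, ρ', fun z hz => h z (.inr hz), h2⟩, hl.2.2⟩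

theorem J.letp {ρ : ℕ → Ty} {x y : ℕ} {s t : Term} {A B C : Ty} (h1 : J ρ s (.tensor A B))
    (h2 : J (Function.update (Function.update ρ x A) y B) t C) (hx : x ∈ t.FV) (hy : y ∈ t.FV)
    (hxy : x ≠ y) (hd : ∀ z ∈ s.occ, z ∉ t.occ) : J ρ (.letp x y s t) C := by
  obtain ⟨hl1, ρ₁, e1, t1⟩ := h1
  obtain ⟨hl2, ρ₂, e2, t2⟩ := h2
  have hxs : x ∉ s.FV := fun h => hd x (Term.FV_occ h) (Term.FV_occ hx)
  have hys : y ∉ s.FV := fun h => hd y (Term.FV_occ h) (Term.FV_occ hy)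
  obtain ⟨ρ', h, h', h''⟩ := exists_common_env (ρ := Function.update (Function.update ρ x A) y B)
    hd (ρ₁ := ρ₁) (fun z hz => by
      rw [e1 z hz, Function.update_of_ne, Function.update_of_ne] <;> grind) e2
  refine ⟨⟨hl1, hl2, hx, hy, hxy, hd⟩, ρ', ?_, ?_, t2.congr h''⟩
  · intro z hz
    simp only [Term.FV, Finset.mem_union, Finset.mem_sdiff] at hz
    rw [h z (by grind), Function.update_of_ne, Function.update_of_ne] <;> grind
  · rw [h x (by simp [hx]), h y (by simp [hy])]
    simpa [Function.update_of_ne hxy] using t1.congr h'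

theorem J.letp_inv {ρ : ℕ → Ty} {x y : ℕ} {s t : Term} {C : Ty} (h : J ρ (.letp x y s t) C) :
    ∃ A B, J ρ s (.tensor A B) ∧ J (Function.update (Function.update ρ x A) y B) t C ∧
      x ∈ t.FV ∧ y ∈ t.FV ∧ x ≠ y ∧ ∀ z ∈ s.occ, z ∉ t.occ := by
  obtain ⟨⟨hl1, hl2, hx, hy, hxy, hd⟩, ρ', h, h1, h2⟩ := h
  simp only [Term.FV, Finset.mem_union, Finset.mem_sdiff] at h
  refine ⟨ρ' x, ρ' y, ⟨hl1, ρ', fun z hz => h z (.inl hz), h1⟩, ⟨hl2, ρ', ?_, h2⟩, hx, hy, hxy, hd⟩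
  intro z hz
  simp only [Function.update]
  grind

theorem J.bind {ρ : ℕ → Ty} {t : Term} {A : Ty} (h : J ρ t A) (f : ℕ → Ty) :
    J (fun x => (ρ x).bind f) t (A.bind f) := by
  obtain ⟨hl, ρ', h1, h2⟩ := h
  exact ⟨hl, _, fun z hz => by simp only [h1 z hz], h2.bind f⟩

/-! ### The head of a term -/

/-- The possible forms of a typable term. -/
theorem HasTy.head {ρ : ℕ → Ty} {t : Term} {A : Ty} (h : HasTy ρ t A) :
    (∃ x, t = .var x) ∨ (∃ x u, t = .lam x u) ∨ (∃ u v, t = .pair u v) ∨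
    ∃ E : TermCtx, E.cv = ∅ ∧ ((∃ r r', t = E.plug r ∧ BetaEtaRule r r') ∨
      (∃ f s, t = E.plug (.app (.var f) s)) ∨
      ∃ x y f w, t = E.plug (.letp x y (.var f) w)) := by
  induction t generalizing A with
  | var x => exact .inl ⟨x, rfl⟩
  | lam x t => exact .inr (.inl ⟨x, t, rfl⟩)
  | pair u v => exact .inr (.inr (.inl ⟨u, v, rfl⟩))
  -- The context E descends only into function positions and into the terms taken apart by a `let`,
  -- and therefore binds nothing at the hole. Typing excludes the application of a pair and the
  -- decomposition of an abstraction.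
  | app t s ih =>
      obtain ⟨B, h1, h2⟩ := h
      refine .inr (.inr (.inr ?_))
      rcases ih h1 with ⟨x, rfl⟩ | ⟨x, u, rfl⟩ | ⟨u, v, rfl⟩ | ⟨E, hE, h⟩
      · exact ⟨.hole, rfl, .inr (.inl ⟨x, s, rfl⟩)⟩
      · exact ⟨.hole, rfl, .inl ⟨_, _, rfl, .beta1 x u s⟩⟩
      · obtain ⟨_, _, h, -⟩ := h1
        cases h
      · refine ⟨.appL E s, hE, ?_⟩
        rcases h with ⟨r, r', rfl, h⟩ | ⟨f, s', rfl⟩ | ⟨x, y, f, w, rfl⟩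
        · exact .inl ⟨r, r', rfl, h⟩
        · exact .inr (.inl ⟨f, s', rfl⟩)
        · exact .inr (.inr ⟨x, y, f, w, rfl⟩)
  | letp x y s t ih =>
      obtain ⟨h1, h2⟩ := h
      refine .inr (.inr (.inr ?_))
      rcases ih h1 with ⟨x', rfl⟩ | ⟨x', u, rfl⟩ | ⟨u, v, rfl⟩ | ⟨E, hE, h⟩
      · exact ⟨.hole, rfl, .inr (.inr ⟨x, y, x', t, rfl⟩)⟩
      · obtain ⟨_, h, -⟩ := h1
        cases h
      · exact ⟨.hole, rfl, .inl ⟨_, _, rfl, .beta2 x y u v t⟩⟩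
      · refine ⟨.letL x y E t, hE, ?_⟩
        rcases h with ⟨r, r', rfl, h⟩ | ⟨f, s', rfl⟩ | ⟨x', y', f, w, rfl⟩
        · exact .inl ⟨r, r', rfl, h⟩
        · exact .inr (.inl ⟨f, s', rfl⟩)
        · exact .inr (.inr ⟨x', y', f, w, rfl⟩)

theorem exists_fresh (S : Finset ℕ) : ∃ z, z ∉ S := Infinite.exists_notMem_finset S

theorem TermCtx.Lin.plug_var {E : TermCtx} {F : Finset ℕ} {z : ℕ} (h : E.Lin F) (hE : E.cv = ∅) (hz : z ∉ E.occ) :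
    (E.plug (.var z)).Lin := by
  refine (E.plug_lin _).2 ⟨trivial, h.congr ?_ ?_, by simp [Term.bv]⟩
  · simp [hE]
  · simp [Term.FV, hz]

/-- Induction along the reduction to normal form. -/
theorem J.induction {P : (ℕ → Ty) → Term → Ty → Prop}
    (var : ∀ ρ x, P ρ (.var x) (ρ x))
    (lam : ∀ ρ x t B C, J (Function.update ρ x B) t C → x ∈ t.FV →
      P (Function.update ρ x B) t C → P ρ (.lam x t) (.limp B C))
    (pair : ∀ ρ s t B C, J ρ s B → J ρ t C → (∀ z ∈ s.occ, z ∉ t.occ) →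
      P ρ s B → P ρ t C → P ρ (.pair s t) (.tensor B C))
    (beta : ∀ ρ (E : TermCtx) r r' A, J ρ (E.plug r) A → BetaEtaRule r r' →
      P ρ (E.plug r') A → P ρ (E.plug r) A)
    -- The head application f s is cut off: its argument and the remaining term, with a fresh
    -- variable z for the result, are treated separately.
    (headApp : ∀ ρ (E : TermCtx) f s z D B A, J ρ (E.plug (.app (.var f) s)) A → E.cv = ∅ →
      ρ f = .limp D B → z ∉ (E.plug (.app (.var f) s)).occ → J ρ s D →
      J (Function.update ρ z B) (E.plug (.var z)) A → P ρ s D →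
      P (Function.update ρ z B) (E.plug (.var z)) A → P ρ (E.plug (.app (.var f) s)) A)
    (headLet : ∀ ρ (E : TermCtx) x y f w B C A, J ρ (E.plug (.letp x y (.var f) w)) A → E.cv = ∅ →
      ρ f = .tensor B C →
      J (Function.update (Function.update ρ x B) y C) (E.plug w) A →
      P (Function.update (Function.update ρ x B) y C) (E.plug w) A →
      P ρ (E.plug (.letp x y (.var f) w)) A)
    {ρ : ℕ → Ty} {t : Term} {A : Ty} (h : J ρ t A) : P ρ t A := by
  -- The size is a sufficient measure because, by linearity, contractions shrink terms; cutting off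
  -- a head application and opening a head `let` do so as well.
  induction hn : t.size using Nat.strong_induction_on generalizing ρ t A with
  | _ n ih =>
  subst hn
  obtain ⟨hl, ρ', hρ, ht⟩ := id h
  rcases ht.head with ⟨x, rfl⟩ | ⟨x, u, rfl⟩ | ⟨u, v, rfl⟩ |
    ⟨E, hE, ⟨r, r', rfl, hr⟩ | ⟨f, s, rfl⟩ | ⟨x, y, f, w, rfl⟩⟩
  · rw [h.var_inv]
    exact var ρ x
  · obtain ⟨B, C, rfl, h1, h2⟩ := h.lam_inv
    exact lam ρ x u B C h1 h2 (ih _ (by simp only [Term.size]; omega) h1 rfl)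
  · obtain ⟨B, C, rfl, h1, h2, h3⟩ := h.pair_inv
    exact pair ρ u v B C h1 h2 h3 (ih _ (by simp only [Term.size]; omega) h1 rfl)
      (ih _ (by simp only [Term.size]; omega) h2 rfl)
  · have hp := (hr.expands ((E.plug_lin r).1 hl).1).toPreserves.plug hl
    refine beta ρ E r r' A h hr (ih _ ?_ (h.preserves hp) rfl)
    have := hr.size_lt ((E.plug_lin r).1 hl).1
    have := E.size_plug r r'
    omega
  · obtain ⟨hl1, hl2, hl3⟩ := (E.plug_lin _).1 hl
    obtain ⟨B, D, hB, hs⟩ := ht.of_plug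
    have hoc := E.mem_plug_occ (.app (.var f) s)
    have hfv := E.mem_plug_FV
    have hEo := E.mem_occ
    have hf : ρ' f = ρ f := hρ f (by simp [hfv, Term.FV, hE])
    obtain ⟨z, hz⟩ := exists_fresh (E.plug (.app (.var f) s)).occ.toFinset
    rw [List.mem_toFinset] at hz
    have hzE : z ∉ E.occ := fun h => hz ((hoc z).2 (.inl h))
    have h1 : J ρ s D := ⟨hl1.2.1, ρ', fun x hx => hρ x (by simp [hfv, Term.FV, hE, hx]), hs⟩
    have h2 : J (Function.update ρ z B) (E.plug (.var z)) A := by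
      refine ⟨hl2.plug_var hE hzE, Function.update ρ' z B, ?_, ?_⟩
      · intro x hx
        by_cases hxz : x = z
        · subst hxz; simp
        · simp only [Function.update_of_ne hxz]
          refine hρ x ?_
          rw [hfv] at hx ⊢
          simp only [Term.FV, Finset.mem_singleton, hxz, false_and, or_false] at hx
          exact .inl hx
      · have ht' := ht.congr (ρ' := Function.update ρ' z B) fun x hx => by
          rw [Function.update_of_ne]; grind
        refine ht'.plug ?_
        rintro B' ⟨D', h3, -⟩
        simp only [HasTy, Function.update_self] at h3 ⊢
        rw [Function.update_of_ne (by rintro rfl; exact hz ((hoc f).2 (.inr (by simp [Term.occ]))))]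
          at h3
        simp only [HasTy] at hB
        rw [← hB] at h3
        cases h3
        rfl
    refine headApp ρ E f s z D B A h hE (by rw [← hf]; exact hB.symm) hz h1 h2
      (ih _ ?_ h1 rfl) (ih _ ?_ h2 rfl)
    · have := E.size_plug (.app (.var f) s) s
      have := E.size_plug (.app (.var f) s) (.var 0)
      have := (E.plug (.var 0)).size_pos
      simp only [Term.size] at *
      omega
    · have := E.size_plug (.app (.var f) s) (.var z)
      have := s.size_pos
      simp only [Term.size] at *
      omega
  · obtain ⟨hl1, hl2, hl3⟩ := (E.plug_lin _).1 hl
    obtain ⟨B, hB, hw⟩ := ht.of_plug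
    have hfv := E.mem_plug_FV
    have hEo := E.mem_occ
    have hf : ρ' f = ρ f := hρ f (by simp [hfv, Term.FV, hE])
    have hxE := hl3 x (by simp [Term.bv])
    have hyE := hl3 y (by simp [Term.bv])
    have hxy := hl1.2.2.2.2.1
    have h2 : J (Function.update (Function.update ρ x (ρ' x)) y (ρ' y)) (E.plug w) A := by
      refine ⟨(E.plug_lin w).2 ⟨hl1.2.1, hl2.congr (by simp [hE]) ?_, ?_⟩, ρ', ?_, ?_⟩
      · intro z hz hzo
        simp only [Term.FV]
        grind
      · intro z hz
        exact hl3 z (by simp [Term.bv, hz])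
      · intro z hz
        have := hρ z
        simp only [hfv, Term.FV, hE] at this hz
        simp only [Function.update]
        grind
      · exact ht.plug fun B' h' => h'.2
    refine headLet ρ E x y f w _ _ A h hE (by rw [← hf]; exact hB.symm) h2 (ih _ ?_ h2 rfl)
    have := E.size_plug (.letp x y (.var f) w) w
    simp only [Term.size] at *
    omega

/-! ### Rigidity of typings, and expansion at fixed shapes -/

/-- The types of the free variables and of the term determine the types of the bound variables. -/
theorem HasTy.rigid {ρ₁ ρ₂ : ℕ → Ty} {t : Term} {A : Ty} (hl : t.Lin) (h1 : HasTy ρ₁ t A)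
    (h2 : HasTy ρ₂ t A) (h : ∀ z ∈ t.FV, ρ₁ z = ρ₂ z) : ∀ z ∈ t.occ, ρ₁ z = ρ₂ z := by
  have hJ : J ρ₁ t A := ⟨hl, ρ₁, fun _ _ => rfl, h1⟩
  -- The induction follows the normalisation of t, while the claim concerns arbitrary pairs of
  -- typings. In the beta case they are carried along by subject reduction, and the field `rigid`
  -- recovers the types that were lost.
  suffices ∀ ρ₁ ρ₂ A, HasTy ρ₁ t A → HasTy ρ₂ t A → (∀ z ∈ t.FV, ρ₁ z = ρ₂ z) →
    ∀ z ∈ t.occ, ρ₁ z = ρ₂ z from this _ _ _ h1 h2 h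
  refine J.induction (P := fun _ t _ => ∀ ρ₁ ρ₂ A, HasTy ρ₁ t A → HasTy ρ₂ t A →
    (∀ z ∈ t.FV, ρ₁ z = ρ₂ z) → ∀ z ∈ t.occ, ρ₁ z = ρ₂ z) ?_ ?_ ?_ ?_ ?_ ?_ hJ
  · intro ρ x ρ₁ ρ₂ A h1 h2 h
    simpa [Term.FV, Term.occ] using h
  · rintro ρ x t B C hJ hx ih ρ₁ ρ₂ A ⟨B', rfl, h1⟩ ⟨B'', e, h2⟩ h
    injection e with e1 e2
    subst e2
    have := ih ρ₁ ρ₂ B' h1 h2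
    simp only [Term.FV, Term.occ] at *
    grind
  · rintro ρ s t B C - - - ih1 ih2 ρ₁ ρ₂ A ⟨B', C', rfl, h1, h2⟩ ⟨B'', C'', e, h3, h4⟩ h
    injection e with e1 e2
    subst e1 e2
    have := ih1 ρ₁ ρ₂ _ h1 h3
    have := ih2 ρ₁ ρ₂ _ h2 h4
    simp only [Term.FV, Term.occ] at *
    grind
  · intro ρ E r r' A hJ hr ih ρ₁ ρ₂ A h1 h2 h
    have hp := (hr.expands ((E.plug_lin r).1 hJ.1).1).toPreserves.plug hJ.1
    exact hp.rigid ρ₁ ρ₂ A A h1 h2 (ih ρ₁ ρ₂ A (hp.ty _ _ h1) (hp.ty _ _ h2) (by rwa [hp.FV]))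
  · intro ρ E f s z D B A hJ hE hf hz _ _ ih1 ih2 ρ₁ ρ₂ A h1 h2 h
    have hoc := E.mem_plug_occ
    have hfv := E.mem_plug_FV
    obtain ⟨B₁, D₁, hB₁, hD₁⟩ := h1.of_plug
    obtain ⟨B₂, D₂, hB₂, hD₂⟩ := h2.of_plug
    simp only [HasTy] at hB₁ hB₂
    -- The head variable is free, so its type is the same in both typings, and with it the types of
    -- the argument and of the result z.
    have hf := h f (by simp [hfv, Term.FV, hE])
    rw [← hB₁, ← hB₂] at hf
    injection hf with e1 e2
    subst e1 e2
    have hs := ih1 ρ₁ ρ₂ D₁ hD₁ hD₂ fun x hx => h x (by simp [hfv, Term.FV, hE, hx])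
    have key : ∀ ρ', HasTy ρ' (E.plug (.app (.var f) s)) A → Ty.limp D₁ B₁ = ρ' f →
        HasTy (Function.update ρ' z B₁) (E.plug (.var z)) A := by
      intro ρ' ht hB
      have ht' := ht.congr (ρ' := Function.update ρ' z B₁) fun x hx => by
        rw [Function.update_of_ne]; grind
      refine ht'.plug ?_
      rintro B' ⟨D', h3, -⟩
      simp only [HasTy, Function.update_self] at h3 ⊢
      rw [Function.update_of_ne (by rintro rfl; exact hz ((hoc _ f).2 (.inr (by simp [Term.occ]))))]
        at h3
      rw [← hB] at h3
      cases h3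
      rfl
    have h3 := ih2 _ _ A (key ρ₁ h1 hB₁) (key ρ₂ h2 hB₂) (by
      intro x hx
      by_cases hxz : x = z
      · subst hxz; simp
      · simp only [Function.update_of_ne hxz]
        refine h x ?_
        rw [hfv] at hx ⊢
        simp only [Term.FV, Finset.mem_singleton, hxz, false_and, or_false] at hx
        exact .inl hx)
    intro x hx
    have h4 := h3 x
    have h5 := h f
    have hxz : x ≠ z := fun e => hz (e ▸ hx)
    simp only [Function.update_of_ne hxz, hoc, hfv, Term.FV, hE, Term.occ] at *
    grind
  · intro ρ E x y f w B C A hJ hE hf _ ih ρ₁ ρ₂ A h1 h2 h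
    have hoc := E.mem_plug_occ
    have hfv := E.mem_plug_FV
    obtain ⟨B₁, hB₁, -⟩ := h1.of_plug
    obtain ⟨B₂, hB₂, -⟩ := h2.of_plug
    simp only [HasTy] at hB₁ hB₂
    have hf := h f (by simp [hfv, Term.FV, hE])
    rw [← hB₁, ← hB₂] at hf
    injection hf with e1 e2
    have h3 := ih ρ₁ ρ₂ A (h1.plug fun _ h => h.2) (h2.plug fun _ h => h.2) (by
      simp only [hfv, Term.FV, hE] at *
      grind)
    have h5 := h f
    simp only [hoc, hfv, Term.FV, hE, Term.occ] at *
    grind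

/-- The hidden type in an application is forced by the types of the free variables and of the
result: glue the assignments on each side and use rigidity of the application. This will determine
the label of a cut. -/
theorem J.app_rigid {ρ : ℕ → Ty} {t s : Term} {A B B' : Ty} (hd : ∀ z ∈ t.occ, z ∉ s.occ)
    (h1 : J ρ t (.limp B A)) (h2 : J ρ s B) (h1' : J ρ t (.limp B' A)) (h2' : J ρ s B') :
    B = B' := by
  obtain ⟨hl1, ρ₁, e1, t1⟩ := h1
  obtain ⟨hl2, ρ₂, e2, t2⟩ := h2
  obtain ⟨-, ρ₁', e1', t1'⟩ := h1'
  obtain ⟨-, ρ₂', e2', t2'⟩ := h2'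
  obtain ⟨σ, h, h', h''⟩ := exists_common_env hd e1 e2
  obtain ⟨σ', g, g', g''⟩ := exists_common_env hd e1' e2'
  have hs := t2.congr h''
  have hs' := t2'.congr g''
  refine hs.unique hs' fun z hz => ?_
  exact HasTy.rigid (t := .app t s) ⟨hl1, hl2, hd⟩ ⟨B, t1.congr h', hs⟩
    ⟨B', t1'.congr g', hs'⟩ (fun z hz => (h z hz).trans (g z hz).symm) z (by simp [Term.occ, hz])

theorem J.letp_rigid {ρ : ℕ → Ty} {x y : ℕ} {s t : Term} {A B A' B' C : Ty}
    (hx : x ∈ t.FV) (hy : y ∈ t.FV) (hxy : x ≠ y) (hd : ∀ z ∈ s.occ, z ∉ t.occ)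
    (h1 : J ρ s (.tensor A B)) (h2 : J (Function.update (Function.update ρ x A) y B) t C)
    (h1' : J ρ s (.tensor A' B')) (h2' : J (Function.update (Function.update ρ x A') y B') t C) :
    A = A' ∧ B = B' := by
  have hE : ∀ A B, J ρ s (.tensor A B) → J (Function.update (Function.update ρ x A) y B) t C →
      ∃ σ, HasTy σ (.letp x y s t) C ∧ (∀ z ∈ (Term.letp x y s t).FV, σ z = ρ z) ∧
        σ x = A ∧ σ y = B := by
    intro A B h1 h2
    have h := J.letp h1 h2 hx hy hxy hd
    obtain ⟨hl1, ρ₁, e1, t1⟩ := h1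
    obtain ⟨hl2, ρ₂, e2, t2⟩ := h2
    have hxs : x ∉ s.FV := fun h => hd x (Term.FV_occ h) (Term.FV_occ hx)
    have hys : y ∉ s.FV := fun h => hd y (Term.FV_occ h) (Term.FV_occ hy)
    obtain ⟨σ, h, h', h''⟩ := exists_common_env
      (ρ := Function.update (Function.update ρ x A) y B) hd (ρ₁ := ρ₁) (fun z hz => by
        rw [e1 z hz, Function.update_of_ne, Function.update_of_ne] <;> grind) e2
    have hσx : σ x = A := by rw [h x (by simp [hx]), Function.update_of_ne hxy]; simp
    have hσy : σ y = B := by rw [h y (by simp [hy])]; simp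
    refine ⟨σ, ⟨by rw [hσx, hσy]; exact t1.congr h', t2.congr h''⟩, ?_, hσx, hσy⟩
    intro z hz
    simp only [Term.FV, Finset.mem_union, Finset.mem_sdiff] at hz
    rw [h z (by grind), Function.update_of_ne, Function.update_of_ne] <;> grind
  obtain ⟨σ, t1, e1, rfl, rfl⟩ := hE A B h1 h2
  obtain ⟨σ', t2, e2, rfl, rfl⟩ := hE A' B' h1' h2'
  have := HasTy.rigid (t := .letp x y s t) ⟨h1.1, h2.1, hx, hy, hxy, hd⟩ t1 t2
    fun z hz => (e1 z hz).trans (e2 z hz).symm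
  exact ⟨this x (by simp [Term.occ]), this y (by simp [Term.occ])⟩

theorem J.sh {ρ ρ₀ : ℕ → Ty} {t : Term} {A : Ty} (h : J ρ t A)
    (hρ : ∀ z ∈ t.FV, (ρ z).sh = (ρ₀ z).sh) : J (fun z => (ρ₀ z).sh) t A.sh :=
  (h.bind _).congr hρ

/-- Identifying all atoms turns both typings into typings of the same sequent, where `J.app_rigid`
applies. -/
theorem J.app_shape {ρ ρ₀ : ℕ → Ty} {t s : Term} {A A₀ B B₀ : Ty} (hd : ∀ z ∈ t.occ, z ∉ s.occ)
    (h1 : J ρ₀ t (.limp B₀ A₀)) (h2 : J ρ₀ s B₀) (h1' : J ρ t (.limp B A)) (h2' : J ρ s B)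
    (hA : A.sh = A₀.sh) (hρ : ∀ z ∈ t.FV ∪ s.FV, (ρ z).sh = (ρ₀ z).sh) : B.sh = B₀.sh := by
  have e1 := h1'.sh (ρ₀ := ρ₀) fun z hz => hρ z (by simp [hz])
  have e2 := h2'.sh (ρ₀ := ρ₀) fun z hz => hρ z (by simp [hz])
  rw [Ty.sh_limp, hA] at e1
  exact J.app_rigid hd e1 e2 (h1.bind _) (h2.bind _)

theorem J.letp_shape {ρ ρ₀ : ℕ → Ty} {x y : ℕ} {s t : Term} {A₀ B₀ C₀ A B C : Ty}
    (hx : x ∈ t.FV) (hy : y ∈ t.FV) (hxy : x ≠ y) (hd : ∀ z ∈ s.occ, z ∉ t.occ)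
    (h1 : J ρ₀ s (.tensor A₀ B₀)) (h2 : J (Function.update (Function.update ρ₀ x A₀) y B₀) t C₀)
    (h1' : J ρ s (.tensor A B)) (h2' : J (Function.update (Function.update ρ x A) y B) t C)
    (hC : C.sh = C₀.sh) (hρ : ∀ z ∈ (Term.letp x y s t).FV, (ρ z).sh = (ρ₀ z).sh) :
    A.sh = A₀.sh ∧ B.sh = B₀.sh := by
  simp only [Term.FV, Finset.mem_union, Finset.mem_sdiff] at hρ
  have e1 := h1'.sh (ρ₀ := ρ₀) fun z hz => hρ z (by simp [hz])
  have e2 := h2'.sh (ρ₀ := Function.update (Function.update ρ₀ x A) y B) fun z hz => by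
    simp only [Function.update]
    grind
  have e3 := h2.bind (fun _ => .var 0)
  have r1 : (fun z => (Function.update (Function.update ρ₀ x A) y B z).sh) =
      Function.update (Function.update (fun z => (ρ₀ z).sh) x A.sh) y B.sh := by
    funext z; simp only [Function.update]; grind
  have r2 : (fun z => (Function.update (Function.update ρ₀ x A₀) y B₀ z).bind fun _ => .var 0) =
      Function.update (Function.update (fun z => (ρ₀ z).sh) x A₀.sh) y B₀.sh := by
    funext z; simp only [Function.update]; grind [Ty.sh]
  rw [r1, hC] at e2
  rw [r2] at e3
  exact J.letp_rigid hx hy hxy hd e1 e2 (h1.bind _) e3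

/-- The expansion of the redex requires the right shape at the hole. After identification of all
atoms, the two typings of C[r'] belong to one sequent, and rigidity makes them agree on the
variables of r', hence on its type. -/
theorem Expands.plug {C : TermCtx} {r r' : Term} (h : Expands r r') {ρ ρ₀ : ℕ → Ty} {A A₀ : Ty}
    (h0 : J ρ₀ (C.plug r) A₀) (h1 : J ρ (C.plug r') A) (hA : A.sh = A₀.sh)
    (hρ : ∀ z ∈ (C.plug r).FV, (ρ z).sh = (ρ₀ z).sh) : J ρ (C.plug r) A := by
  have hl' := (C.plug_lin r).1 h0.1
  have hp := h.toPreserves.plug h0.1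
  obtain ⟨hl, ρ₁, e1, t1⟩ := h1
  obtain ⟨-, ρ₂, e2, t2⟩ := id h0
  obtain ⟨B, hB⟩ := t1.of_plug
  obtain ⟨B₀, hB₀⟩ := t2.of_plug
  have hsh : B.sh = B₀.sh := by
    have t1' := t1.bind fun _ => .var 0
    have t2' := (hp.ty _ _ t2).bind fun _ => .var 0
    change HasTy _ _ A.sh at t1'
    rw [hA] at t1'
    refine (hB.bind _).unique ((h.ty _ _ hB₀).bind _) fun z hz => ?_
    refine HasTy.rigid hp.lin t1' t2' ?_ z ((C.mem_plug_occ _ z).2 (.inr hz))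
    intro z hz
    have hz' := hz
    rw [hp.FV] at hz'
    simp only [e1 z hz, e2 z hz']
    exact hρ z hz'
  obtain ⟨σ, hσ, t3⟩ := h.exp ρ₂ B₀ ρ₁ B hB₀ hB hsh
  have hoff : ∀ z, σ z ≠ ρ₁ z → z ∈ (C.plug r).bv ∧ z ∉ (C.plug r').occ := by
    intro z hz
    have := hσ z hz
    have := hl'.2.2 z this.1
    rw [C.mem_plug_bv, C.mem_plug_occ]
    grind
  refine ⟨h0.1, σ, ?_, ?_⟩
  · intro z hz
    rw [← e1 z (by rwa [hp.FV])]
    by_contra hne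
    exact h0.1.not_bv hz (hoff z hne).1
  · refine (t1.congr (ρ' := σ) (by grind)).plug fun B' hB' => ?_
    rwa [hB'.unique hB (fun z hz => by have := hσ z; grind)]

theorem CommConv.symm {t t' : Term} (h : CommConv t t') : CommConv t' t := Or.symm h

theorem CtxClosure.comm_preserves {t t' : Term} (h : CtxClosure CommConv t t') (hl : t.Lin) :
    Preserves t t' := by
  obtain ⟨C, r, r', hr, rfl, rfl⟩ := h
  exact (hr.preserves ((C.plug_lin r).1 hl).1).plug hl

theorem CtxClosure.comm_symm {t t' : Term} (h : CtxClosure CommConv t t') :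
    CtxClosure CommConv t' t := by
  obtain ⟨C, r, r', hr, rfl, rfl⟩ := h
  exact ⟨C, r', r, hr.symm, rfl, rfl⟩

theorem BetaEta.preserves {t t' : Term} (h : BetaEta t t') (hl : t.Lin) : Preserves t t' := by
  obtain ⟨C, r, r', hr, rfl, rfl⟩ := h
  exact (hr.expands ((C.plug_lin r).1 hl).1).toPreserves.plug hl

theorem CommEq.J_iff {t t' : Term} (h : CommEq t t') :
    (t.Lin ↔ t'.Lin) ∧ (t.Lin → t.FV = t'.FV) ∧ ∀ ρ A, J ρ t A ↔ J ρ t' A := by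
  induction h with
  | rel t t' h =>
      refine ⟨⟨fun hl => (h.comm_preserves hl).lin, fun hl => (h.comm_symm.comm_preserves hl).lin⟩,
        fun hl => (h.comm_preserves hl).FV.symm, fun ρ A => ⟨fun hJ => ?_, fun hJ => ?_⟩⟩
      · exact hJ.preserves (h.comm_preserves hJ.1)
      · exact hJ.preserves (h.comm_symm.comm_preserves hJ.1)
  | refl t => simp
  | symm t t' _ ih =>
      exact ⟨ih.1.symm, fun hl => (ih.2.1 (ih.1.2 hl)).symm, fun ρ A => (ih.2.2 ρ A).symm⟩
  | trans t t' t'' _ _ ih1 ih2 =>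
      exact ⟨ih1.1.trans ih2.1, fun hl => (ih1.2.1 hl).trans (ih2.2.1 (ih1.1.1 hl)),
        fun ρ A => (ih1.2.2 ρ A).trans (ih2.2.2 ρ A)⟩

/-- Subject reduction. -/
theorem BetaEtaC.J {ρ : ℕ → Ty} {t t' : Term} {A : Ty} (h : BetaEtaC t t') (hJ : J ρ t A) :
    J ρ t' A ∧ t'.FV = t.FV := by
  obtain ⟨u, u', h1, h2, h3⟩ := h
  have e1 := (h1.J_iff.2.2 ρ A).1 hJ
  have hp := h2.preserves e1.1
  have e2 := e1.preserves hp
  exact ⟨(h3.J_iff.2.2 ρ A).1 e2,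
    by rw [← h3.J_iff.2.1 e2.1, hp.FV, h1.J_iff.2.1 hJ.1]⟩

/-- Subject expansion. It needs one reference typing of the redex side and applies to all typings of
the reduct with the same shapes. -/
theorem BetaEtaC.J_exp {ρ ρ₀ : ℕ → Ty} {t t' : Term} {A A₀ : Ty} (h : BetaEtaC t t')
    (h0 : LinLam.J ρ₀ t A₀) (h1 : LinLam.J ρ t' A) (hA : A.sh = A₀.sh)
    (hρ : ∀ z ∈ t.FV, (ρ z).sh = (ρ₀ z).sh) : LinLam.J ρ t A := by
  obtain ⟨u, u', c1, ⟨C, r, r', hr, rfl, rfl⟩, c2⟩ := h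
  rw [c1.J_iff.2.1 h0.1] at hρ
  have e0 := (c1.J_iff.2.2 ρ₀ A₀).1 h0
  exact (c1.J_iff.2.2 ρ A).2 ((hr.expands ((C.plug_lin r).1 e0.1).1).plug e0
    ((c2.J_iff.2.2 ρ A).2 h1) hA hρ)

/-! ### Derivations -/

/-- `Γ` declares exactly the variables in `F`, with the types given by `ρ`. -/
def Fits (Γ : Ctx) (ρ : ℕ → Ty) (F : Finset ℕ) : Prop :=
  (Ctx.names Γ).Nodup ∧ (∀ x, x ∈ Ctx.names Γ ↔ x ∈ F) ∧ ∀ p ∈ Γ, p.2 = ρ p.1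

theorem Fits.exists (ρ : ℕ → Ty) (F : Finset ℕ) : ∃ Γ, Fits Γ ρ F := by
  refine ⟨F.toList.map fun x => (x, ρ x), ?_, ?_, ?_⟩
  · simpa [Ctx.names, Function.comp_def] using F.nodup_toList
  · simp [Ctx.names, Function.comp_def]
  · simp

theorem Fits.mem {Γ : Ctx} {ρ : ℕ → Ty} {F : Finset ℕ} (h : Fits Γ ρ F) (p : ℕ × Ty) :
    p ∈ Γ ↔ p.1 ∈ F ∧ p.2 = ρ p.1 := by
  constructor
  · intro hp
    exact ⟨(h.2.1 _).1 (List.mem_map_of_mem hp), h.2.2 p hp⟩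
  · rintro ⟨h1, h2⟩
    obtain ⟨q, hq, e⟩ := List.mem_map.1 ((h.2.1 _).2 h1)
    have := h.2.2 q hq
    have : q = p := Prod.ext e (by rw [this, h2, e])
    exact this ▸ hq

theorem Fits.perm {Γ Γ' : Ctx} {ρ : ℕ → Ty} {F : Finset ℕ} (h : Fits Γ ρ F) (h' : Fits Γ' ρ F) :
    Γ.Perm Γ' := by
  rw [List.perm_ext_iff_of_nodup (List.Nodup.of_map _ h.1) (List.Nodup.of_map _ h'.1)]
  intro p
  rw [h.mem, h'.mem]

theorem Fits.of_perm {Γ Γ' : Ctx} {ρ : ℕ → Ty} {F : Finset ℕ} (h : Fits Γ ρ F)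
    (hp : Γ.Perm Γ') : Fits Γ' ρ F := by
  refine ⟨(hp.map _).nodup_iff.1 h.1, fun x => ?_, fun p hp' => h.2.2 p (hp.mem_iff.2 hp')⟩
  rw [← h.2.1]
  exact (hp.map _).mem_iff.symm

theorem Fits.congr {Γ : Ctx} {ρ ρ' : ℕ → Ty} {F F' : Finset ℕ} (h : Fits Γ ρ F)
    (hF : F = F') (hρ : ∀ z ∈ F, ρ z = ρ' z) : Fits Γ ρ' F' := by
  subst hF
  exact ⟨h.1, h.2.1, fun p hp => (h.2.2 p hp).trans (hρ _ ((h.mem p).1 hp).1)⟩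

theorem Fits.append {Γ Δ : Ctx} {ρ : ℕ → Ty} {F G : Finset ℕ} (h : Fits Γ ρ F) (h' : Fits Δ ρ G)
    (hd : ∀ z ∈ F, z ∉ G) : Fits (Γ ++ Δ) ρ (F ∪ G) := by
  refine ⟨?_, fun x => ?_, ?_⟩
  · simp only [Ctx.names, List.map_append]
    refine List.Nodup.append h.1 h'.1 ?_
    intro x hx hx'
    exact hd x ((h.2.1 x).1 hx) ((h'.2.1 x).1 hx')
  · have := h.2.1 x; have := h'.2.1 x
    simp only [Ctx.names, List.map_append, List.mem_append, Finset.mem_union] at *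
    grind
  · intro p hp
    rcases List.mem_append.1 hp with hp | hp
    · exact h.2.2 p hp
    · exact h'.2.2 p hp

theorem Fits.cons {Γ : Ctx} {ρ : ℕ → Ty} {F : Finset ℕ} {x : ℕ} (h : Fits Γ ρ (F.erase x)) (B : Ty)
    (hx : x ∈ F) : Fits ((x, B) :: Γ) (Function.update ρ x B) F := by
  have hxΓ : x ∉ Ctx.names Γ := by rw [h.2.1]; simp
  refine ⟨List.nodup_cons.2 ⟨hxΓ, h.1⟩, fun z => ?_, ?_⟩
  · have := h.2.1 z
    simp only [Ctx.names, List.map_cons, List.mem_cons] at *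
    grind
  · intro p hp
    rcases List.mem_cons.1 hp with rfl | hp'
    · simp
    · rw [h.2.2 p hp', Function.update_of_ne]
      rintro rfl
      exact hxΓ (List.mem_map_of_mem hp')

theorem Fits.of_cons {Γ : Ctx} {ρ : ℕ → Ty} {F : Finset ℕ} {x : ℕ} {B : Ty}
    (h : Fits ((x, B) :: Γ) ρ F) : ρ x = B ∧ x ∈ F ∧ Fits Γ ρ (F.erase x) := by
  have h1 := List.nodup_cons.1 h.1
  refine ⟨(h.2.2 (x, B) (by simp)).symm, (h.2.1 x).1 (by simp [Ctx.names]), h1.2, fun z => ?_,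
    fun p hp => h.2.2 p (by simp [hp])⟩
  have := h.2.1 z
  have := h1.1
  simp only [Ctx.names, List.map_cons, List.mem_cons] at *
  grind

/-- Every permutation is a sequence of exchanges of neighbours; the prefix in the proof carries the
members already passed. -/
theorem perm_induction {α : Type*} {P : List α → Prop}
    (h : ∀ Γ Δ a b, P (Γ ++ a :: b :: Δ) → P (Γ ++ b :: a :: Δ)) {l l' : List α}
    (p : l.Perm l') (hl : P l) : P l' := by
  suffices ∀ pre, P (pre ++ l) → P (pre ++ l') from this [] hl
  clear hl
  induction p with
  | nil => exact fun _ h => h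
  | cons x _ ih =>
      intro pre hp
      simpa using ih (pre ++ [x]) (by simpa using hp)
  | swap x y l => exact fun pre hp => h pre l y x hp
  | trans _ _ ih1 ih2 => exact fun pre hp => ih2 pre (ih1 pre hp)

theorem Deriv.perm {Γ Γ' : Ctx} {t : Term} {A : Ty} (h : Nonempty (Deriv Γ t A))
    (hp : Γ.Perm Γ') : Nonempty (Deriv Γ' t A) := by
  refine perm_induction (P := fun Γ => Nonempty (Deriv Γ t A)) ?_ hp h
  rintro Γ Δ ⟨x, A⟩ ⟨y, B⟩ ⟨d⟩
  exact ⟨.exch _ _ _ _ _ _ _ _ d⟩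

/-- A bound variable is counted at its binder and at its only use; a free variable is counted once
and obtains its second occurrence from the context. -/
theorem Term.Lin.count_occ {t : Term} (h : t.Lin) (z : ℕ) :
    t.occ.count z = (if z ∈ t.FV then 1 else 0) + (if z ∈ t.bv then 2 else 0) := by
  induction t with
  | var x => simp only [Term.occ, Term.FV, Term.bv, List.count_singleton]; grind
  | lam x t ih =>
      have hx := h.2
      have := h.1.not_bv hx
      simp only [Term.occ, Term.FV, Term.bv, List.count_cons, ih h.1]; grind
  | app t s ih1 ih2 =>
      have := t.mem_occ z; have := s.mem_occ z
      have := h.2.2 z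
      simp only [Term.occ, Term.FV, Term.bv, List.count_append, ih1 h.1, ih2 h.2.1]; grind
  | pair t s ih1 ih2 =>
      have := t.mem_occ z; have := s.mem_occ z
      have := h.2.2 z
      simp only [Term.occ, Term.FV, Term.bv, List.count_append, ih1 h.1, ih2 h.2.1]; grind
  | letp x y s t ih1 ih2 =>
      have := t.mem_occ; have := s.mem_occ
      obtain ⟨h1, h2, h3, h4, h5, h6⟩ := h
      have := h2.not_bv h3
      have := h2.not_bv h4
      simp only [Term.occ, Term.FV, Term.bv, List.count_append, List.count_cons, ih1 h1, ih2 h2]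
      grind

theorem Fits.twoOcc {Γ : Ctx} {ρ : ℕ → Ty} {t : Term} (h : Fits Γ ρ t.FV) (hl : t.Lin) :
    TwoOcc Γ t := by
  intro x hx
  rw [List.count_append, hl.count_occ, List.Nodup.count h.1]
  rw [List.mem_append, t.mem_occ, h.2.1] at hx
  have := h.2.1 x
  have := hl.not_bv (z := x)
  grind

/-- Each rule with two premises is applied to contexts that list the free variables in an arbitrary
order; exchange then produces the prescribed context. -/
theorem Deriv.exists_of_J {t : Term} {Γ : Ctx} {ρ : ℕ → Ty} {A : Ty} (h : J ρ t A)
    (hΓ : Fits Γ ρ t.FV) : Nonempty (Deriv Γ t A) := by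
  induction t generalizing Γ ρ A with
  | var x =>
      have hp : List.Perm [(x, A)] Γ := Fits.perm (ρ := ρ) (F := {x}) ⟨by simp [Ctx.names],
        by simp [Ctx.names], by simp [h.var_inv]⟩ hΓ
      exact Deriv.perm ⟨.var x A⟩ hp
  | lam x t ih =>
      obtain ⟨B, C, rfl, h1, hx⟩ := h.lam_inv
      obtain ⟨d⟩ := ih h1 (hΓ.cons B hx)
      exact ⟨.lam _ _ _ _ _ d⟩
  | app t s ih1 ih2 =>
      obtain ⟨B, h1, h2, hd⟩ := h.app_inv
      obtain ⟨Γ₁, f1⟩ := Fits.exists ρ t.FV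
      obtain ⟨Γ₂, f2⟩ := Fits.exists ρ s.FV
      obtain ⟨d1⟩ := ih1 h1 f1
      obtain ⟨d2⟩ := ih2 h2 f2
      have f3 := f1.append f2 fun z hz hz' => hd z (Term.FV_occ hz) (Term.FV_occ hz')
      exact Deriv.perm ⟨.app _ _ _ _ _ _ (f3.twoOcc (t := .app t s) h.1) d1 d2⟩ (f3.perm hΓ)
  | pair t s ih1 ih2 =>
      obtain ⟨B, C, rfl, h1, h2, hd⟩ := h.pair_inv
      obtain ⟨Γ₁, f1⟩ := Fits.exists ρ t.FV
      obtain ⟨Γ₂, f2⟩ := Fits.exists ρ s.FV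
      obtain ⟨d1⟩ := ih1 h1 f1
      obtain ⟨d2⟩ := ih2 h2 f2
      have f3 := f1.append f2 fun z hz hz' => hd z (Term.FV_occ hz) (Term.FV_occ hz')
      exact Deriv.perm ⟨.pair _ _ _ _ _ _ (f3.twoOcc (t := .pair t s) h.1) d1 d2⟩ (f3.perm hΓ)
  | letp x y s t ih1 ih2 =>
      obtain ⟨B, C, h1, h2, hx, hy, hxy, hd⟩ := h.letp_inv
      obtain ⟨Γ₁, f1⟩ := Fits.exists ρ s.FV
      obtain ⟨Γ₂, f2⟩ := Fits.exists ρ (t.FV \ {x, y})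
      obtain ⟨d1⟩ := ih1 h1 f1
      have f2' : Fits ((x, B) :: (y, C) :: Γ₂) (Function.update (Function.update ρ x B) y C)
          t.FV := by
        have e : t.FV \ {x, y} = (t.FV.erase x).erase y := by grind
        have := ((e ▸ f2).cons C (by grind)).cons B hx
        exact this.congr rfl fun z _ => by simp only [Function.update]; grind
      obtain ⟨d2⟩ := ih2 h2 f2'
      have f3 := f1.append f2 fun z hz hz' => hd z (Term.FV_occ hz)
        (Term.FV_occ (Finset.mem_sdiff.1 hz').1)
      exact Deriv.perm ⟨.letp _ _ _ _ _ _ _ _ _ (f3.twoOcc (t := .letp x y s t) h.1) d1 d2⟩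
        (f3.perm hΓ)

theorem Deriv.twoOcc {Γ : Ctx} {t : Term} {A : Ty} (d : Deriv Γ t A) : TwoOcc Γ t := by
  induction d with
  | var x A => intro z hz; simp_all [Ctx.names, Term.occ]
  | exch Γ Δ x y A B C t d ih =>
      have hp : (Ctx.names (Γ ++ (x, A) :: (y, B) :: Δ)).Perm
          (Ctx.names (Γ ++ (y, B) :: (x, A) :: Δ)) :=
        List.Perm.map _ (List.Perm.append_left _ (List.Perm.swap _ _ _))
      intro z hz
      rw [← (hp.append_right _).count_eq]
      exact ih z ((hp.append_right _).mem_iff.2 hz)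
  | lam Γ x A B t d ih =>
      have hp : (Ctx.names ((x, A) :: Γ) ++ t.occ).Perm
          (Ctx.names Γ ++ (Term.lam x t).occ) := List.perm_middle.symm
      intro z hz
      rw [← hp.count_eq]
      exact ih z (hp.mem_iff.2 hz)
  | app Γ Δ A B t s lin => exact lin
  | pair Γ Δ A B t s lin => exact lin
  | letp Γ Δ x y A B C s t lin => exact lin

theorem Deriv.fits {Γ : Ctx} {t : Term} {A : Ty} (d : Deriv Γ t A) :
    ∃ ρ, Fits Γ ρ t.FV ∧ J ρ t A := by
  induction d with
  | var x A =>
      exact ⟨fun _ => A, ⟨by simp [Ctx.names], by simp [Ctx.names, Term.FV], by simp⟩, J.var _ x⟩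
  | exch Γ Δ x y A B C t d ih =>
      obtain ⟨ρ, h1, h2⟩ := ih
      exact ⟨ρ, h1.of_perm (List.Perm.append_left _ (List.Perm.swap _ _ _)), h2⟩
  | lam Γ x A B t d ih =>
      obtain ⟨ρ, h1, h2⟩ := ih
      obtain ⟨rfl, h4, h3⟩ := h1.of_cons
      refine ⟨ρ, h3, J.lam (by rwa [Function.update_eq_self]) h4⟩
  | app Γ Δ A B t s lin d e ih1 ih2 =>
      obtain ⟨ρ₁, f1, j1⟩ := ih1
      obtain ⟨ρ₂, f2, j2⟩ := ih2
      -- A common variable would be counted twice in each premise, hence at least four times in the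
      -- conclusion.
      have hd : ∀ z ∈ t.occ, z ∉ s.occ := by
        intro z hz hz'
        have h1 := d.twoOcc z (List.mem_append_right _ hz)
        have h2 := e.twoOcc z (List.mem_append_right _ hz')
        have h3 := lin z (by simp [Term.occ, hz])
        simp only [Ctx.names, List.map_append, Term.occ, List.count_append] at h1 h2 h3
        omega
      obtain ⟨σ, h, h', h''⟩ := exists_common_env (ρ := fun z => if z ∈ t.FV then ρ₁ z else ρ₂ z)
        hd (ρ₁ := ρ₁) (ρ₂ := ρ₂) (by grind) (by
          have := t.mem_occ; have := s.mem_occ; grind)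
      have hto := t.mem_occ; have hso := s.mem_occ
      exact ⟨σ, (f1.congr rfl (by grind)).append (f2.congr rfl (by grind)) (by grind),
        (j1.congr (by grind)).app (j2.congr (by grind)) hd⟩
  | pair Γ Δ A B t s lin d e ih1 ih2 =>
      obtain ⟨ρ₁, f1, j1⟩ := ih1
      obtain ⟨ρ₂, f2, j2⟩ := ih2
      have hd : ∀ z ∈ t.occ, z ∉ s.occ := by
        intro z hz hz'
        have h1 := d.twoOcc z (List.mem_append_right _ hz)
        have h2 := e.twoOcc z (List.mem_append_right _ hz')
        have h3 := lin z (by simp [Term.occ, hz])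
        simp only [Ctx.names, List.map_append, Term.occ, List.count_append] at h1 h2 h3
        omega
      obtain ⟨σ, h, h', h''⟩ := exists_common_env (ρ := fun z => if z ∈ t.FV then ρ₁ z else ρ₂ z)
        hd (ρ₁ := ρ₁) (ρ₂ := ρ₂) (by grind) (by
          have := t.mem_occ; have := s.mem_occ; grind)
      have hto := t.mem_occ; have hso := s.mem_occ
      exact ⟨σ, (f1.congr rfl (by grind)).append (f2.congr rfl (by grind)) (by grind),
        (j1.congr (by grind)).pair (j2.congr (by grind)) hd⟩
  | letp Γ Δ x y A B C s t lin d e ih1 ih2 =>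
      obtain ⟨ρ₁, f1, j1⟩ := ih1
      obtain ⟨ρ₂, f2, j2⟩ := ih2
      have hd : ∀ z ∈ s.occ, z ∉ t.occ := by
        intro z hz hz'
        have h1 := d.twoOcc z (List.mem_append_right _ hz)
        have h2 := e.twoOcc z (List.mem_append_right _ hz')
        have h3 := lin z (by simp [Term.occ, hz])
        simp only [Ctx.names, List.map_append, List.map_cons, Term.occ, List.count_append,
          List.count_cons] at h1 h2 h3
        omega
      have hto := t.mem_occ; have hso := s.mem_occ
      obtain ⟨σ, h, h', h''⟩ := exists_common_env (ρ := fun z => if z ∈ s.FV then ρ₁ z else ρ₂ z)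
        hd (ρ₁ := ρ₁) (ρ₂ := ρ₂) (by grind) (by grind)
      have f2' := f2.congr (ρ' := σ) rfl (by grind)
      obtain ⟨rfl, hx, f3⟩ := f2'.of_cons
      obtain ⟨rfl, hy, f4⟩ := f3.of_cons
      have j2' := j2.congr (ρ' := σ) (by grind)
      refine ⟨σ, ((f1.congr rfl (by grind)).append f4 (by grind)).congr ?_ (by simp), ?_⟩
      · simp only [Term.FV]; grind
      · exact (j1.congr (by grind)).letp (by simpa [Function.update_eq_self] using j2') hx
          (by grind) (by grind) hd

/-- This removes the order of contexts from the argument: typing can be studied through `J`, where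
no rule of exchange is needed. -/
theorem deriv_iff {Γ : Ctx} {t : Term} {A : Ty} :
    Nonempty (Deriv Γ t A) ↔ ∃ ρ, Fits Γ ρ t.FV ∧ J ρ t A :=
  ⟨fun ⟨d⟩ => d.fits, fun ⟨_, h1, h2⟩ => Deriv.exists_of_J h2 h1⟩

theorem Fits.env_eq {Γ : Ctx} {ρ ρ' : ℕ → Ty} {F F' : Finset ℕ} (h : Fits Γ ρ F)
    (h' : Fits Γ ρ' F') : F = F' ∧ ∀ z ∈ F, ρ z = ρ' z := by
  have e : F = F' := by ext z; rw [← h.2.1, h'.2.1]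
  refine ⟨e, fun z hz => ?_⟩
  obtain ⟨p, hp, rfl⟩ := List.mem_map.1 ((h.2.1 z).2 hz)
  rw [← h.2.2 p hp, h'.2.2 p hp]

theorem Deriv.J_of_fits {Γ : Ctx} {ρ : ℕ → Ty} {F : Finset ℕ} {t : Term} {A : Ty}
    (h : Nonempty (Deriv Γ t A)) (hΓ : Fits Γ ρ F) : t.FV = F ∧ J ρ t A := by
  obtain ⟨ρ', h1, h2⟩ := deriv_iff.1 h
  obtain ⟨e, he⟩ := h1.env_eq hΓ
  exact ⟨e, h2.congr he⟩

/-! ### Equality judgements -/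

theorem Deriv.disjoint_env {Γ Δ : Ctx} {t s : Term} {A B : Ty} (h : Nonempty (Deriv Γ t A))
    (h' : Nonempty (Deriv Δ s B)) (hd : ∀ z ∈ t.occ, z ∉ s.occ) :
    ∃ ρ, Fits Γ ρ t.FV ∧ Fits Δ ρ s.FV ∧ J ρ t A ∧ J ρ s B ∧ Fits (Γ ++ Δ) ρ (t.FV ∪ s.FV) := by
  obtain ⟨ρ₁, f1, j1⟩ := deriv_iff.1 h
  obtain ⟨ρ₂, f2, j2⟩ := deriv_iff.1 h'
  have hto := t.mem_occ; have hso := s.mem_occ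
  obtain ⟨σ, h, h', h''⟩ := exists_common_env (ρ := fun z => if z ∈ t.FV then ρ₁ z else ρ₂ z)
    hd (ρ₁ := ρ₁) (ρ₂ := ρ₂) (by grind) (by grind)
  have g1 : Fits Γ σ t.FV := f1.congr rfl (by grind)
  have g2 : Fits Δ σ s.FV := f2.congr rfl (by grind)
  exact ⟨σ, g1, g2, j1.congr (by grind), j2.congr (by grind), g1.append g2 (by grind)⟩

theorem Deriv.lin {Γ : Ctx} {t : Term} {A : Ty} (h : Nonempty (Deriv Γ t A)) : t.Lin := by
  obtain ⟨ρ, -, h⟩ := deriv_iff.1 h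
  exact h.1

theorem EqJ.typed {Γ : Ctx} {t t' : Term} {A : Ty} (h : EqJ Γ t t' A) :
    Nonempty (Deriv Γ t A) ∧ Nonempty (Deriv Γ t' A) := by
  induction h with
  | refl d => exact ⟨⟨d⟩, ⟨d⟩⟩
  | symm _ ih => exact ih.symm
  | trans _ _ ih1 ih2 => exact ⟨ih1.1, ih2.2⟩
  | comm d h =>
      obtain ⟨ρ, f, j⟩ := d.fits
      have hp := h.preserves j.1
      exact ⟨⟨d⟩, deriv_iff.2 ⟨ρ, by rwa [hp.FV], j.preserves hp⟩⟩
  | red d h =>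
      obtain ⟨ρ, f, j⟩ := d.fits
      obtain ⟨h1, h2⟩ := h.J j
      exact ⟨⟨d⟩, deriv_iff.2 ⟨ρ, by rwa [h2], h1⟩⟩
  | lam _ ih =>
      obtain ⟨⟨d⟩, ⟨d'⟩⟩ := ih
      exact ⟨⟨.lam _ _ _ _ _ d⟩, ⟨.lam _ _ _ _ _ d'⟩⟩
  | app h1 h2 _ _ ih1 ih2 =>
      obtain ⟨⟨d⟩, ⟨d'⟩⟩ := ih1
      obtain ⟨⟨e⟩, ⟨e'⟩⟩ := ih2
      exact ⟨⟨.app _ _ _ _ _ _ h1 d e⟩, ⟨.app _ _ _ _ _ _ h2 d' e'⟩⟩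
  | pair h1 h2 _ _ ih1 ih2 =>
      obtain ⟨⟨d⟩, ⟨d'⟩⟩ := ih1
      obtain ⟨⟨e⟩, ⟨e'⟩⟩ := ih2
      exact ⟨⟨.pair _ _ _ _ _ _ h1 d e⟩, ⟨.pair _ _ _ _ _ _ h2 d' e'⟩⟩
  | letp h1 h2 _ _ ih1 ih2 =>
      obtain ⟨⟨d⟩, ⟨d'⟩⟩ := ih1
      obtain ⟨⟨e⟩, ⟨e'⟩⟩ := ih2
      exact ⟨⟨.letp _ _ _ _ _ _ _ _ _ h1 d e⟩, ⟨.letp _ _ _ _ _ _ _ _ _ h2 d' e'⟩⟩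

theorem EqJ.FV_eq {Γ : Ctx} {t t' : Term} {A : Ty} (h : EqJ Γ t t' A) : t.FV = t'.FV := by
  obtain ⟨h1, h2⟩ := h.typed
  obtain ⟨ρ, f, -⟩ := deriv_iff.1 h2
  exact (Deriv.J_of_fits h1 f).1

theorem Fits.sh {Γ : Ctx} {ρ ρ₀ : ℕ → Ty} {F : Finset ℕ} (h : Fits Γ ρ₀ F)
    (hs : ∀ p ∈ Γ, (ρ p.1).sh = p.2.sh) : ∀ z ∈ F, (ρ z).sh = (ρ₀ z).sh := by
  intro z hz
  have := (h.mem (z, ρ₀ z)).2 ⟨hz, rfl⟩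
  exact hs _ this

/-- Equal terms have the same typings. -/
theorem EqJ.sound {Γ : Ctx} {t t' : Term} {A₀ : Ty} (h : EqJ Γ t t' A₀) {ρ : ℕ → Ty} {A : Ty}
    (hA : A.sh = A₀.sh) (hρ : ∀ p ∈ Γ, (ρ p.1).sh = p.2.sh) : J ρ t A ↔ J ρ t' A := by
  induction h generalizing ρ A with
  | refl d => exact Iff.rfl
  | symm _ ih => exact (ih hA hρ).symm
  | trans _ _ ih1 ih2 => exact (ih1 hA hρ).trans (ih2 hA hρ)
  | comm d h =>
      have hl := Deriv.lin ⟨d⟩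
      have hl' := (h.preserves hl).lin
      exact ⟨fun j => j.preserves (h.preserves hl), fun j => j.preserves (h.symm.preserves hl')⟩
  | red d h =>
      obtain ⟨ρ₀, f, j⟩ := d.fits
      -- The given derivation supplies the reference typing that fixes the shapes for subject
      -- expansion.
      exact ⟨fun j' => (h.J j').1, fun j' => h.J_exp j j' hA (f.sh hρ)⟩
  | @lam Γ x t t' B C h ih =>
      obtain ⟨⟨d⟩, ⟨d'⟩⟩ := h.typed
      obtain ⟨ρ₀, f, -⟩ := d.fits
      obtain ⟨ρ₁, f', -⟩ := d'.fits
      have hx := f.of_cons.2.1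
      have hx' := f'.of_cons.2.1
      have hxΓ := (List.nodup_cons.1 f.1).1
      have key : ∀ X Y, (Ty.limp X Y).sh = (Ty.limp B C).sh →
          (J (Function.update ρ x X) t Y ↔ J (Function.update ρ x X) t' Y) := by
        intro X Y hXY
        simp only [Ty.sh_limp, Ty.limp.injEq] at hXY
        refine ih hXY.2 fun p hp => ?_
        rcases List.mem_cons.1 hp with rfl | hp'
        · simp [hXY.1]
        · rw [Function.update_of_ne]
          · exact hρ p hp'
          · rintro rfl
            exact hxΓ (List.mem_map.2 ⟨p, hp', rfl⟩)
      constructor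
      · intro j
        obtain ⟨X, Y, rfl, j', -⟩ := j.lam_inv
        exact ((key X Y hA).1 j').lam hx'
      · intro j
        obtain ⟨X, Y, rfl, j', -⟩ := j.lam_inv
        exact ((key X Y hA).2 j').lam hx
  | @app Γ Δ t t' s s' B C l1 l2 h1 h2 ih1 ih2 =>
      have hl := Deriv.lin (EqJ.app l1 l2 h1 h2).typed.1
      have hl' := Deriv.lin (EqJ.app l1 l2 h1 h2).typed.2
      obtain ⟨ρ₀, f1, f2, j1, j2, f3⟩ := Deriv.disjoint_env h1.typed.1 h2.typed.1 hl.2.2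
      obtain ⟨ρ₀', f1', f2', j1', j2', f3'⟩ := Deriv.disjoint_env h1.typed.2 h2.typed.2 hl'.2.2
      have hρ1 : ∀ p ∈ Γ, (ρ p.1).sh = p.2.sh := fun p hp => hρ p (by simp [hp])
      have hρ2 : ∀ p ∈ Δ, (ρ p.1).sh = p.2.sh := fun p hp => hρ p (by simp [hp])
      constructor
      · intro j
        obtain ⟨B', k1, k2, -⟩ := j.app_inv
        -- The induction hypotheses need the shape of the argument type, which the sequent does not
        -- mention; rigidity supplies it.
        have hB := J.app_shape hl.2.2 j1 j2 k1 k2 hA (f3.sh hρ)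
        exact ((ih1 (by simp [hB, hA]) hρ1).1 k1).app ((ih2 hB hρ2).1 k2) hl'.2.2
      · intro j
        obtain ⟨B', k1, k2, -⟩ := j.app_inv
        have hB := J.app_shape hl'.2.2 j1' j2' k1 k2 hA (f3'.sh hρ)
        exact ((ih1 (by simp [hB, hA]) hρ1).2 k1).app ((ih2 hB hρ2).2 k2) hl.2.2
  | @pair Γ Δ t t' s s' B C l1 l2 h1 h2 ih1 ih2 =>
      have hl := Deriv.lin (EqJ.pair l1 l2 h1 h2).typed.1
      have hl' := Deriv.lin (EqJ.pair l1 l2 h1 h2).typed.2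
      have hρ1 : ∀ p ∈ Γ, (ρ p.1).sh = p.2.sh := fun p hp => hρ p (by simp [hp])
      have hρ2 : ∀ p ∈ Δ, (ρ p.1).sh = p.2.sh := fun p hp => hρ p (by simp [hp])
      constructor
      · intro j
        obtain ⟨B', C', rfl, k1, k2, -⟩ := j.pair_inv
        simp only [Ty.sh_tensor, Ty.tensor.injEq] at hA
        exact ((ih1 hA.1 hρ1).1 k1).pair ((ih2 hA.2 hρ2).1 k2) hl'.2.2
      · intro j
        obtain ⟨B', C', rfl, k1, k2, -⟩ := j.pair_inv
        simp only [Ty.sh_tensor, Ty.tensor.injEq] at hA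
        exact ((ih1 hA.1 hρ1).2 k1).pair ((ih2 hA.2 hρ2).2 k2) hl.2.2
  | @letp Γ Δ x y s s' t t' B C D l1 l2 h1 h2 ih1 ih2 =>
      have key : ∀ s s' t t', (Term.letp x y s t).Lin → (Term.letp x y s' t').Lin →
          Nonempty (Deriv Γ s (.tensor B C)) → Nonempty (Deriv ((x, B) :: (y, C) :: Δ) t D) →
          Nonempty (Deriv (Γ ++ Δ) (.letp x y s t) D) →
          (∀ X Y, X.sh = B.sh → Y.sh = C.sh → J ρ s (.tensor X Y) → J ρ s' (.tensor X Y)) →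
          (∀ X Y, X.sh = B.sh → Y.sh = C.sh →
            J (Function.update (Function.update ρ x X) y Y) t A →
            J (Function.update (Function.update ρ x X) y Y) t' A) →
          J ρ (.letp x y s t) A → J ρ (.letp x y s' t') A := by
        intro s s' t t' hl hl' d1 d2 d3 H1 H2 j
        obtain ⟨X, Y, k1, k2, hx, hy, hxy, hd⟩ := j.letp_inv
        obtain ⟨ρ₀, f, j1, j2, f3⟩ := Deriv.disjoint_env d1 d2 hd
        obtain ⟨rfl, -, f4⟩ := j1.of_cons
        obtain ⟨rfl, -, f5⟩ := f4.of_cons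
        obtain ⟨ρ₁, f6, j6⟩ := deriv_iff.1 d3
        have e := f6.env_eq ((f.append f5 (by
          have := s.mem_occ; have := t.mem_occ; grind)))
        -- Likewise the types of the two bound variables are hidden, and their shapes are forced.
        obtain ⟨eX, eY⟩ := J.letp_shape hx hy hxy hd j2 (by simpa using f3.1) k1 k2 hA (by
          intro z hz
          rw [f6.sh hρ z hz, e.2 z hz])
        exact (H1 X Y eX eY k1).letp (H2 X Y eX eY k2) hl'.2.2.1 hl'.2.2.2.1 hxy hl'.2.2.2.2.2
      have hT := (EqJ.letp l1 l2 h1 h2).typed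
      have hl := Deriv.lin hT.1
      have hl' := Deriv.lin hT.2
      have hρ1 : ∀ p ∈ Γ, (ρ p.1).sh = p.2.sh := fun p hp => hρ p (by simp [hp])
      have hnd : ∀ p ∈ Δ, p.1 ≠ x ∧ p.1 ≠ y := by
        obtain ⟨ρ₀, f, -⟩ := deriv_iff.1 h2.typed.1
        have h1 := List.nodup_cons.1 f.1
        have h2 := List.nodup_cons.1 h1.2
        intro p hp
        refine ⟨?_, ?_⟩
        · rintro rfl
          exact h1.1 (List.mem_map.2 ⟨p, List.mem_cons_of_mem _ hp, rfl⟩)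
        · rintro rfl
          exact h2.1 (List.mem_map.2 ⟨p, hp, rfl⟩)
      have hρ2 : ∀ X Y, X.sh = B.sh → Y.sh = C.sh → ∀ p ∈ (x, B) :: (y, C) :: Δ,
          (Function.update (Function.update ρ x X) y Y p.1).sh = p.2.sh := by
        intro X Y hX hY p hp
        rcases List.mem_cons.1 hp with rfl | hp
        · simp [Function.update_of_ne hl.2.2.2.2.1, hX]
        · rcases List.mem_cons.1 hp with rfl | hp
          · simp [hY]
          · rw [Function.update_of_ne (hnd p hp).2, Function.update_of_ne (hnd p hp).1]
            exact hρ p (by simp [hp])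
      constructor
      · exact key s s' t t' hl hl' h1.typed.1 h2.typed.1 hT.1
          (fun X Y hX hY => (ih1 (by simp [hX, hY]) hρ1).1)
          (fun X Y hX hY => (ih2 hA (hρ2 X Y hX hY)).1)
      · exact key s' s t' t hl' hl h1.typed.2 h2.typed.2 hT.2
          (fun X Y hX hY => (ih1 (by simp [hX, hY]) hρ1).2)
          (fun X Y hX hY => (ih2 hA (hρ2 X Y hX hY)).2)


/-! ### Equality judgements and exchange -/

theorem EqJ.step {Γ : Ctx} {t t' : Term} {A : Ty} (d : Nonempty (Deriv Γ t A))
    (h : BetaEta t t') : EqJ Γ t t' A :=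
  .red d.some ⟨t, t', .refl t, h, .refl t'⟩

theorem EqJ.rule {Γ : Ctx} {t t' : Term} {A : Ty} (C : TermCtx) (d : Nonempty (Deriv Γ (C.plug t) A))
    (h : BetaEtaRule t t') : EqJ Γ (C.plug t) (C.plug t') A :=
  .step d ⟨C, t, t', h, rfl, rfl⟩

theorem EqJ.app_of_disjoint {Γ Δ : Ctx} {t t' s s' : Term} {A B : Ty}
    (h1 : EqJ Γ t t' (.limp A B)) (h2 : EqJ Δ s s' A) (hd : ∀ z ∈ t.occ, z ∉ s.occ)
    (hd' : ∀ z ∈ t'.occ, z ∉ s'.occ) : EqJ (Γ ++ Δ) (.app t s) (.app t' s') B := by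
  obtain ⟨ρ, -, -, -, -, f⟩ := Deriv.disjoint_env h1.typed.1 h2.typed.1 hd
  obtain ⟨ρ', -, -, -, -, f'⟩ := Deriv.disjoint_env h1.typed.2 h2.typed.2 hd'
  exact .app (f.twoOcc (t := .app t s) ⟨Deriv.lin h1.typed.1, Deriv.lin h2.typed.1, hd⟩)
    (f'.twoOcc (t := .app t' s') ⟨Deriv.lin h1.typed.2, Deriv.lin h2.typed.2, hd'⟩) h1 h2

theorem EqJ.pair_of_disjoint {Γ Δ : Ctx} {t t' s s' : Term} {A B : Ty}
    (h1 : EqJ Γ t t' A) (h2 : EqJ Δ s s' B) (hd : ∀ z ∈ t.occ, z ∉ s.occ)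
    (hd' : ∀ z ∈ t'.occ, z ∉ s'.occ) : EqJ (Γ ++ Δ) (.pair t s) (.pair t' s') (.tensor A B) := by
  obtain ⟨ρ, -, -, -, -, f⟩ := Deriv.disjoint_env h1.typed.1 h2.typed.1 hd
  obtain ⟨ρ', -, -, -, -, f'⟩ := Deriv.disjoint_env h1.typed.2 h2.typed.2 hd'
  exact .pair (f.twoOcc (t := .pair t s) ⟨Deriv.lin h1.typed.1, Deriv.lin h2.typed.1, hd⟩)
    (f'.twoOcc (t := .pair t' s') ⟨Deriv.lin h1.typed.2, Deriv.lin h2.typed.2, hd'⟩) h1 h2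

theorem Term.Lin.subst1_occ {t : Term} (h : t.Lin) {x : ℕ} (hx : x ∈ t.FV) (s : Term) (z : ℕ) :
    z ∈ (t.subst1 x s).occ ↔ z ∈ t.occ ∧ z ≠ x ∨ z ∈ s.occ := by
  obtain ⟨C, rfl, hC⟩ := h.exists_plug hx
  rw [TermCtx.plug_var_subst1 hC]
  simp only [C.mem_plug_occ, Term.occ, List.mem_singleton]
  grind

theorem Term.Lin.subst1_subst1 {t : Term} (h : t.Lin) {x y : ℕ} (hx : x ∈ t.FV) (hy : y ∉ t.occ) :
    (t.subst1 x (.var y)).subst1 y (.var x) = t := by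
  obtain ⟨C, rfl, hC⟩ := h.exists_plug hx
  rw [TermCtx.plug_var_subst1 hC, TermCtx.plug_var_subst1]
  exact fun h => hy ((C.mem_plug_occ _ _).2 (.inl h))

theorem exists_fresh_two (L : List ℕ) : ∃ x y, x ≠ y ∧ x ∉ L ∧ y ∉ L := by
  obtain ⟨x, hx⟩ := exists_fresh L.toFinset
  obtain ⟨y, hy⟩ := exists_fresh (insert x L.toFinset)
  simp at hx hy
  exact ⟨x, y, fun e => hy.1 e.symm, hx, hy.2⟩

/-- Adding a fresh argument in front of the context. -/
theorem EqJ.app_fresh {Γ : Ctx} {f f' : Term} {A B : Ty} (h : EqJ Γ f f' (.limp A B)) {y : ℕ}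
    (hy : y ∉ f.occ) (hy' : y ∉ f'.occ) :
    EqJ ((y, A) :: Γ) (.app f (.var y)) (.app f' (.var y)) B := by
  obtain ⟨g, g', hgg, hg, hg'⟩ := exists_fresh_two (y :: (f.occ ++ f'.occ))
  simp only [List.mem_cons, List.mem_append, not_or] at hg hg'
  -- Equality has no exchange rule, and an application lists the context of the function first.
  -- Applying `fn g => g y` to f therefore puts y in front; a beta step then gives f y.
  have hu : Nonempty (Deriv [(y, A)] (.lam g (.app (.var g) (.var y))) (.limp (.limp A B) B)) :=
    ⟨.lam _ _ _ _ _ (.app [(g, _)] [(y, A)] _ _ _ _ (by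
      intro z hz
      simp only [Ctx.names, Term.occ] at *
      simp at hz
      have := hg.1
      have hz' : z = g ∨ z = y := by grind
      rcases hz' with rfl | rfl <;> simp [List.count_cons] <;> grind) (.var _ _) (.var _ _))⟩
  have h1 := EqJ.app_of_disjoint (.refl hu.some) h (by
    intro z hz; simp [Term.occ] at hz; grind) (by intro z hz; simp [Term.occ] at hz; grind)
  have e : ∀ k, (Term.app (.var g) (.var y)).subst1 g k = .app k (.var y) := by
    intro k
    rw [Term.subst1_app, Term.subst1_var_self, Term.subst1_var_ne (by grind)]
  have b1 := EqJ.rule .hole h1.typed.1 (.beta1 g (.app (.var g) (.var y)) f)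
  have b2 := EqJ.rule .hole h1.typed.2 (.beta1 g (.app (.var g) (.var y)) f')
  rw [e] at b1 b2
  exact b1.symm.trans (h1.trans b2)

/-- Abstract x, apply both sides to y, and contract. -/
theorem EqJ.rename {Γ : Ctx} {t t' : Term} {A B : Ty} {x y : ℕ} (h : EqJ ((x, A) :: Γ) t t' B)
    (hxy : x ≠ y) (hy : y ∉ t.occ) (hy' : y ∉ t'.occ) :
    EqJ ((y, A) :: Γ) (t.subst1 x (.var y)) (t'.subst1 x (.var y)) B := by
  have h1 := h.lam.app_fresh (y := y) (by simp [Term.occ, hy, hxy.symm])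
    (by simp [Term.occ, hy', hxy.symm])
  exact (EqJ.rule .hole h1.typed.1 (.beta1 x t (.var y))).symm.trans
    (h1.trans (EqJ.rule .hole h1.typed.2 (.beta1 x t' (.var y))))

/-- Abstracting x leaves an equality over the tail alone, which may be permuted. Applying it to a
fresh variable and contracting restores the first declaration, and renaming restores the name x. -/
theorem EqJ.cons_perm {Γ Γ' : Ctx} {t t' : Term} {A B : Ty} {x : ℕ}
    (h : EqJ ((x, A) :: Γ) t t' B)
    (ih : EqJ Γ (.lam x t) (.lam x t') (.limp A B) → EqJ Γ' (.lam x t) (.lam x t') (.limp A B)) :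
    EqJ ((x, A) :: Γ') t t' B := by
  obtain ⟨y, -, -, hy, -⟩ := exists_fresh_two (x :: (t.occ ++ t'.occ))
  simp only [List.mem_cons, List.mem_append, not_or] at hy
  obtain ⟨h1, h2⟩ := h.typed
  obtain ⟨ρ, f, j⟩ := deriv_iff.1 h1
  obtain ⟨ρ', f', j'⟩ := deriv_iff.1 h2
  have hx := f.of_cons.2.1
  have hx' := f'.of_cons.2.1
  have k := (ih h.lam).app_fresh (y := y) (by simp [Term.occ]; grind) (by simp [Term.occ]; grind)
  have k' := (EqJ.rule .hole k.typed.1 (.beta1 x t (.var y))).symm.trans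
    (k.trans (EqJ.rule .hole k.typed.2 (.beta1 x t' (.var y))))
  have k'' := EqJ.rename k' (y := x) hy.1 (by
    simp only [TermCtx.plug, j.1.subst1_occ hx, Term.occ]; simp; grind) (by
    simp only [TermCtx.plug, j'.1.subst1_occ hx', Term.occ]; simp; grind)
  simp only [TermCtx.plug] at k''
  rwa [j.1.subst1_subst1 hx hy.2.1, j'.1.subst1_subst1 hx' hy.2.2] at k''

/-- Both leading variables are abstracted and then supplied by `fn g => g y' x'`. The order of y'
and x' is free there, because a derivation, unlike an equality judgement, has exchange. -/
theorem EqJ.swap_rename {Γ Δ : Ctx} {t t' : Term} {A B C : Ty} {x y x' y' : ℕ}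
    (h : EqJ ((x, A) :: (y, B) :: Γ) t t' C) (hΔ : [(y', B), (x', A)].Perm Δ)
    (hx : x' ∉ x :: y :: (t.occ ++ t'.occ)) (hy : y' ∉ x :: y :: (t.occ ++ t'.occ))
    (hxy : x' ≠ y') :
    EqJ (Δ ++ Γ) ((t.subst1 y (.var y')).subst1 x (.var x'))
      ((t'.subst1 y (.var y')).subst1 x (.var x')) C := by
  obtain ⟨g, -, -, hg, -⟩ := exists_fresh_two (x :: y :: x' :: y' :: (t.occ ++ t'.occ))
  simp only [List.mem_cons, List.mem_append, not_or] at hg hx hy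
  have hxy' : x ≠ y := by
    obtain ⟨ρ, f, -⟩ := deriv_iff.1 h.typed.1
    rintro rfl
    have := (List.nodup_cons.1 f.1).1
    simp at this
  have lin1 : TwoOcc ([(g, Ty.limp B (.limp A C))] ++ [(y', B)]) (.app (.var g) (.var y')) := by
    intro z hz
    simp only [Ctx.names, Term.occ] at *
    simp at hz
    have hz' : z = g ∨ z = y' := by grind
    rcases hz' with rfl | rfl <;> simp [List.count_cons] <;> grind
  have lin2 : TwoOcc (([(g, Ty.limp B (.limp A C))] ++ [(y', B)]) ++ [(x', A)])
      (.app (.app (.var g) (.var y')) (.var x')) := by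
    intro z hz
    simp only [Ctx.names, Term.occ] at *
    simp at hz
    have hz' : z = g ∨ z = y' ∨ z = x' := by grind
    rcases hz' with rfl | rfl | rfl <;> simp [List.count_cons] <;> grind
  have hu : Nonempty (Deriv Δ (.lam g (.app (.app (.var g) (.var y')) (.var x')))
      (.limp (.limp B (.limp A C)) C)) :=
    Deriv.perm ⟨.lam _ _ _ _ _ (.app _ _ _ _ _ _ lin2
      (.app _ _ _ _ _ _ lin1 (.var _ _) (.var _ _)) (.var _ _))⟩ hΔ
  have h1 := EqJ.app_of_disjoint (.refl hu.some) h.lam.lam (by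
    intro z hz; simp [Term.occ] at hz ⊢; grind) (by intro z hz; simp [Term.occ] at hz ⊢; grind)
  have key : ∀ k, Nonempty (Deriv (Δ ++ Γ) (.app (.lam g (.app (.app (.var g) (.var y'))
      (.var x'))) (.lam y (.lam x k))) C) → EqJ (Δ ++ Γ) (.app (.lam g (.app (.app (.var g) (.var y'))
      (.var x'))) (.lam y (.lam x k))) ((k.subst1 y (.var y')).subst1 x (.var x')) C := by
    intro k hk
    have b1 := EqJ.rule .hole hk (.beta1 _ _ _)
    have e : (Term.app (.app (.var g) (.var y')) (.var x')).subst1 g (.lam y (.lam x k)) =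
        .app (.app (.lam y (.lam x k)) (.var y')) (.var x') := by
      rw [Term.subst1_app, Term.subst1_app, Term.subst1_var_self, Term.subst1_var_ne (by grind),
        Term.subst1_var_ne (by grind)]
    rw [e] at b1
    have b2 := EqJ.rule (.appL .hole (.var x')) b1.typed.2 (.beta1 _ _ _)
    rw [Term.subst1_lam hxy'] at b2
    have b3 := EqJ.rule .hole b2.typed.2 (.beta1 _ _ _)
    exact b1.trans (b2.trans b3)
  exact (key _ h1.typed.1).symm.trans (h1.trans (key _ h1.typed.2))

theorem EqJ.swap {Γ : Ctx} {t t' : Term} {A B C : Ty} {x y : ℕ}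
    (h : EqJ ((x, A) :: (y, B) :: Γ) t t' C) : EqJ ((y, B) :: (x, A) :: Γ) t t' C := by
  obtain ⟨x', y', hxy', hx, hy⟩ := exists_fresh_two (x :: y :: (t.occ ++ t'.occ))
  -- New names are needed for this trick, so it is used twice: the first time exchanges the
  -- declarations under fresh names, the second time brings the old names back.
  have h1 := h.swap_rename (.refl _) hx hy hxy'
  obtain ⟨ρ, f, j⟩ := deriv_iff.1 h.typed.1
  obtain ⟨ρ', f', j'⟩ := deriv_iff.1 h.typed.2
  obtain ⟨-, m1, f1⟩ := f.of_cons
  obtain ⟨-, m2, f2⟩ := f1.of_cons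
  obtain ⟨-, m1', f1'⟩ := f'.of_cons
  obtain ⟨-, m2', f2'⟩ := f1'.of_cons
  simp only [List.mem_cons, List.mem_append, not_or, Finset.mem_erase] at hx hy m2 m2'
  have key : ∀ k : Term, k.Lin → x ∈ k.FV → y ∈ k.FV → x' ∉ k.occ → y' ∉ k.occ →
      (∀ z, z ∈ ((k.subst1 y (.var y')).subst1 x (.var x')).occ →
        z ∈ k.occ ∧ z ≠ x ∧ z ≠ y ∨ z = x' ∨ z = y') ∧
      (((k.subst1 y (.var y')).subst1 x (.var x')).subst1 x' (.var x)).subst1 y' (.var y) = k := by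
    intro k hk hxk hyk hx'k hy'k
    obtain ⟨D, rfl, hD⟩ := hk.exists_plug hyk
    have hDo := D.mem_plug_occ
    have hl : (D.plug (.var y')).Lin := TermCtx.plug_lin_of_var hk hD trivial (by
      intro z hz; simp [Term.occ] at hz; grind)
    have hxD : x ∈ (D.plug (.var y')).FV := by
      have := D.mem_plug_FV
      simp only [this, Term.FV, Finset.mem_singleton] at hxk ⊢
      grind
    rw [TermCtx.plug_var_subst1 hD, hl.subst1_subst1 hxD (by
      simp only [hDo, Term.occ, List.mem_singleton] at hx'k ⊢; grind),
      TermCtx.plug_var_subst1 (by grind)]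
    refine ⟨fun z hz => ?_, rfl⟩
    rw [hl.subst1_occ hxD] at hz
    simp only [hDo, Term.occ, List.mem_singleton] at hz ⊢
    grind
  obtain ⟨k1, k2⟩ := key t j.1 m1 m2.2 hx.2.2.1 hy.2.2.1
  obtain ⟨k3, k4⟩ := key t' j'.1 m1' m2'.2 hx.2.2.2 hy.2.2.2
  have h2 := h1.swap_rename (x' := y) (y' := x) (.swap _ _ _)
    (by have := k1 y; have := k3 y; simp only [List.mem_cons, List.mem_append]; grind)
    (by have := k1 x; have := k3 x; simp only [List.mem_cons, List.mem_append]; grind) (by grind)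
  rwa [k2, k4] at h2

/-- Equality judgements are closed under exchange. -/
theorem EqJ.perm {Γ Γ' : Ctx} {t t' : Term} {A : Ty} (h : EqJ Γ t t' A) (hp : Γ.Perm Γ') :
    EqJ Γ' t t' A := by
  induction hp generalizing t t' A with
  | nil => exact h
  | cons x _ ih => exact h.cons_perm ih
  | swap x y l => exact h.swap
  | trans _ _ ih1 ih2 => exact ih2 (ih1 h)

/-! ### Equality without contexts -/

/-- Equality of terms of type `A` whose free variables have the types given by `ρ`. -/
def EqE (ρ : ℕ → Ty) (t t' : Term) (A : Ty) : Prop := ∃ Γ, Fits Γ ρ t.FV ∧ EqJ Γ t t' A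

theorem EqE.toEqJ {ρ : ℕ → Ty} {t t' : Term} {A : Ty} {Γ : Ctx} (h : EqE ρ t t' A)
    (hΓ : Fits Γ ρ t.FV) : EqJ Γ t t' A := by
  obtain ⟨Δ, f, e⟩ := h
  exact e.perm (f.perm hΓ)

theorem EqE.left {ρ : ℕ → Ty} {t t' : Term} {A : Ty} (h : EqE ρ t t' A) : J ρ t A := by
  obtain ⟨Γ, f, e⟩ := h
  exact (Deriv.J_of_fits e.typed.1 f).2

theorem EqE.right {ρ : ℕ → Ty} {t t' : Term} {A : Ty} (h : EqE ρ t t' A) : J ρ t' A := by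
  obtain ⟨Γ, f, e⟩ := h
  exact (Deriv.J_of_fits e.typed.2 f).2

theorem EqE.FV_eq {ρ : ℕ → Ty} {t t' : Term} {A : Ty} (h : EqE ρ t t' A) : t.FV = t'.FV := by
  obtain ⟨Γ, f, e⟩ := h
  exact e.FV_eq

theorem EqE.of_J {ρ : ℕ → Ty} {t t' : Term} {A : Ty} (h : J ρ t A)
    (H : ∀ Γ, Nonempty (Deriv Γ t A) → EqJ Γ t t' A) : EqE ρ t t' A := by
  obtain ⟨Γ, f⟩ := Fits.exists ρ t.FV
  exact ⟨Γ, f, H Γ (Deriv.exists_of_J h f)⟩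

theorem EqE.refl {ρ : ℕ → Ty} {t : Term} {A : Ty} (h : J ρ t A) : EqE ρ t t A :=
  .of_J h fun _ d => .refl d.some

theorem EqE.symm {ρ : ℕ → Ty} {t t' : Term} {A : Ty} (h : EqE ρ t t' A) : EqE ρ t' t A := by
  have e := h.FV_eq
  obtain ⟨Γ, f, h⟩ := h
  exact ⟨Γ, e ▸ f, h.symm⟩

theorem EqE.trans {ρ : ℕ → Ty} {t t' t'' : Term} {A : Ty} (h : EqE ρ t t' A)
    (h' : EqE ρ t' t'' A) : EqE ρ t t'' A := by
  have e := h.FV_eq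
  obtain ⟨Γ, f, h⟩ := h
  exact ⟨Γ, f, h.trans (h'.toEqJ (e ▸ f))⟩

theorem EqE.congr_env {ρ ρ' : ℕ → Ty} {t t' : Term} {A : Ty} (h : EqE ρ t t' A)
    (hρ : ∀ z ∈ t.FV, ρ z = ρ' z) : EqE ρ' t t' A := by
  obtain ⟨Γ, f, h⟩ := h
  exact ⟨Γ, f.congr rfl hρ, h⟩

theorem EqE.rule {ρ : ℕ → Ty} {t t' : Term} {A : Ty} (C : TermCtx) (h : J ρ (C.plug t) A)
    (hr : BetaEtaRule t t') : EqE ρ (C.plug t) (C.plug t') A :=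
  .of_J h fun _ d => .rule C d hr

theorem EqE.lam {ρ : ℕ → Ty} {x : ℕ} {t t' : Term} {B C : Ty}
    (h : EqE (Function.update ρ x B) t t' C) (hx : x ∈ t.FV) :
    EqE ρ (.lam x t) (.lam x t') (.limp B C) := by
  obtain ⟨Γ, f⟩ := Fits.exists ρ (t.FV.erase x)
  exact ⟨Γ, f, .lam (h.toEqJ (f.cons B hx))⟩

theorem EqE.app {ρ : ℕ → Ty} {t t' s s' : Term} {A B : Ty} (h1 : EqE ρ t t' (.limp A B))
    (h2 : EqE ρ s s' A) (hd : ∀ z ∈ t.occ, z ∉ s.occ) (hd' : ∀ z ∈ t'.occ, z ∉ s'.occ) :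
    EqE ρ (.app t s) (.app t' s') B := by
  obtain ⟨Γ, f, h1⟩ := h1
  obtain ⟨Δ, g, h2⟩ := h2
  exact ⟨Γ ++ Δ, f.append g fun z hz hz' => hd z (Term.FV_occ hz) (Term.FV_occ hz'),
    h1.app_of_disjoint h2 hd hd'⟩

theorem EqE.pair {ρ : ℕ → Ty} {t t' s s' : Term} {A B : Ty} (h1 : EqE ρ t t' A)
    (h2 : EqE ρ s s' B) (hd : ∀ z ∈ t.occ, z ∉ s.occ) (hd' : ∀ z ∈ t'.occ, z ∉ s'.occ) :
    EqE ρ (.pair t s) (.pair t' s') (.tensor A B) := by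
  obtain ⟨Γ, f, h1⟩ := h1
  obtain ⟨Δ, g, h2⟩ := h2
  exact ⟨Γ ++ Δ, f.append g fun z hz hz' => hd z (Term.FV_occ hz) (Term.FV_occ hz'),
    h1.pair_of_disjoint h2 hd hd'⟩

theorem EqE.letp {ρ : ℕ → Ty} {x y : ℕ} {s s' t t' : Term} {A B C : Ty}
    (h1 : EqE ρ s s' (.tensor A B))
    (h2 : EqE (Function.update (Function.update ρ x A) y B) t t' C) (hx : x ∈ t.FV)
    (hy : y ∈ t.FV) (hxy : x ≠ y) (hd : ∀ z ∈ s.occ, z ∉ t.occ)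
    (hd' : ∀ z ∈ s'.occ, z ∉ t'.occ) : EqE ρ (.letp x y s t) (.letp x y s' t') C := by
  have hFV := h2.FV_eq
  have hJ := h1.left.letp h2.left hx hy hxy hd
  have hJ' := h1.right.letp h2.right (hFV ▸ hx) (hFV ▸ hy) hxy hd'
  have hFV' : (Term.letp x y s' t').FV = (Term.letp x y s t).FV := by
    simp only [Term.FV, h1.FV_eq, h2.FV_eq]
  obtain ⟨Γ, f, h1⟩ := h1
  obtain ⟨Δ, g⟩ := Fits.exists ρ (t.FV \ {x, y})
  have e : t.FV \ {x, y} = (t.FV.erase x).erase y := by grind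
  have g' : Fits ((x, A) :: (y, B) :: Δ) (Function.update (Function.update ρ x A) y B) t.FV :=
    (((e ▸ g).cons B (by grind)).cons A hx).congr rfl fun z _ => by
      simp only [Function.update]; grind
  have f3 : Fits (Γ ++ Δ) ρ (Term.letp x y s t).FV := f.append g fun z hz hz' =>
    hd z (Term.FV_occ hz) (Term.FV_occ (Finset.mem_sdiff.1 hz').1)
  exact ⟨Γ ++ Δ, f3, .letp (f3.twoOcc hJ.1) ((hFV' ▸ f3 : Fits _ _ _).twoOcc hJ'.1) h1
    (h2.toEqJ g')⟩

theorem EqE.comm {ρ : ℕ → Ty} {C : TermCtx} {x y : ℕ} {t u : Term} {A : Ty}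
    (h : J ρ (C.plug (.letp x y t u)) A) (hC : ∀ z ∈ C.cv, z ∉ t.FV) :
    EqE ρ (C.plug (.letp x y t u)) (.letp x y t (C.plug u)) A := by
  refine .of_J h fun Γ d => .comm d.some (.inl (.mk C x y t u ?_ ?_))
  · obtain ⟨hl, -⟩ := h
    have := ((C.plug_lin _).1 hl).2.2
    rw [Finset.disjoint_right]
    intro z hz
    have := this z (by simp [Term.bv] at hz ⊢; grind)
    simp [TermCtx.fv, this]
  · rw [(((C.plug_lin _).1 h.1).1).1.fv_eq, Finset.disjoint_left]
    exact hC

theorem EqE.comm' {ρ : ℕ → Ty} {C : TermCtx} {x y : ℕ} {t u : Term} {A : Ty}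
    (h : J ρ (.letp x y t (C.plug u)) A) (hC : ∀ z ∈ C.cv, z ∉ t.FV) (hx : x ∉ C.occ)
    (hy : y ∉ C.occ) : EqE ρ (.letp x y t (C.plug u)) (C.plug (.letp x y t u)) A := by
  refine .of_J h fun Γ d => .comm d.some (.inr (.mk C x y t u ?_ ?_))
  · rw [Finset.disjoint_right]
    intro z hz
    simp only [Finset.mem_insert, Finset.mem_singleton] at hz
    simp only [TermCtx.fv, Finset.mem_sdiff, List.mem_toFinset]
    rcases hz with rfl | rfl <;> simp [*]
  · rw [h.1.1.fv_eq, Finset.disjoint_left]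
    exact hC

/-- A beta-redex can be moved out of a context that does not capture variables of its argument. -/
theorem EqE.cut {ρ : ℕ → Ty} {C : TermCtx} {y : ℕ} {w r : Term} {A : Ty}
    (h : J ρ (C.plug (.app (.lam y w) r)) A) (hC : ∀ z ∈ C.cv, z ∉ r.FV) :
    EqE ρ (C.plug (.app (.lam y w) r)) (.app (.lam y (C.plug w)) r) A := by
  obtain ⟨hl, ρ', e, ht⟩ := id h
  obtain ⟨⟨⟨hw, hy⟩, hr, hd⟩, hCl, hb⟩ := (C.plug_lin _).1 hl
  have hyC : y ∉ C.occ := hb y (by simp [Term.bv])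
  have hcap := fun z => hCl.captured (z := z)
  have hcv := C.cv_sub_occ
  have hpo := C.mem_plug_occ
  have hpf := C.mem_plug_FV
  have hwo := w.mem_occ
  have hro := r.mem_occ
  have hJ : J ρ (.app (.lam y (C.plug w)) r) A := by
    refine ⟨⟨⟨(C.plug_lin w).2 ⟨hw, hCl.congr ?_ ?_, ?_⟩, ?_⟩, hr, ?_⟩, ρ', ?_, ?_⟩
    · intro z hz
      have := hC z hz
      have := hcv z hz
      simp only [Term.FV]; grind
    · intro z hz hz'
      simp only [Term.FV]; grind
    · intro z hz
      exact hb z (by simp [Term.bv, hz])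
    · rw [hpf]; grind
    · intro z hz
      simp only [Term.FV, Term.bv, Term.occ, List.mem_cons, hpo] at *
      grind
    · intro z hz
      refine e z ?_
      have := hpf w z
      have hpf' := hpf (.app (.lam y w) r) z
      simp only [Term.FV] at hz hpf'
      rw [hpf']
      grind
    · obtain ⟨B, D, ⟨B', e1, h1⟩, h2⟩ := ht.of_plug
      cases e1
      refine ⟨_, ⟨A, rfl, ht.plug ?_⟩, h2⟩
      rintro B'' ⟨D', ⟨B', e1, h1⟩, -⟩
      cases e1
      exact h1
  -- Both sides contract to C[w[r/y]], as y does not occur in C.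
  have b1 := EqE.rule C h (.beta1 y w r)
  have b2 := EqE.rule .hole hJ (.beta1 y (C.plug w) r)
  rw [TermCtx.plug_subst1 hyC] at b2
  exact b1.trans b2.symm

/-- Filling the hole of a context: expansion into a beta-redex. -/
theorem EqE.of_plug {ρ : ℕ → Ty} {E : TermCtx} {z : ℕ} {r : Term} {A B : Ty}
    (hE : J (Function.update ρ z B) (E.plug (.var z)) A) (hr : J ρ r B) (hz : z ∉ E.occ)
    (hd : ∀ x ∈ (E.plug (.var z)).occ, x ∉ r.occ) (hcv : z ∉ E.cv) :
    EqE ρ (.app (.lam z (E.plug (.var z))) r) (E.plug r) A := by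
  have hJ : J ρ (.app (.lam z (E.plug (.var z))) r) A := by
    refine (hE.lam ?_).app hr ?_
    · rw [E.mem_plug_FV]; simp [Term.FV, hcv]
    · intro x hx
      refine hd x ?_
      rcases List.mem_cons.1 hx with rfl | hx
      · rw [E.mem_plug_occ]; simp [Term.occ]
      · exact hx
  have := EqE.rule .hole hJ (.beta1 _ _ _)
  rwa [TermCtx.plug_var_subst1 hz] at this

theorem Term.Lin.subst1_var_bv {t : Term} (h : t.Lin) {x : ℕ} (hx : x ∈ t.FV) (y : ℕ) :
    (t.subst1 x (.var y)).bv = t.bv := by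
  obtain ⟨C, rfl, hC⟩ := h.exists_plug hx
  rw [TermCtx.plug_var_subst1 hC]
  ext z
  simp [C.mem_plug_bv, Term.bv]

/-- Renaming of a bound variable. -/
theorem J.alpha {ρ : ℕ → Ty} {x y : ℕ} {t : Term} {A : Ty} (h : J ρ (.lam x t) A)
    (hy : y ∉ (Term.lam x t).occ) : EqE ρ (.lam x t) (.lam y (t.subst1 x (.var y))) A := by
  obtain ⟨B, C, rfl, h1, hx⟩ := h.lam_inv
  have hto := t.mem_occ
  simp only [Term.occ, List.mem_cons, not_or] at hy
  -- Terms are not identified up to renaming, but renaming is derivable: the term `fn y => (fn x =>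
  -- t) y` eta-reduces to one side and beta-reduces to the other.
  have j1 : J ρ (.lam y (.app (.lam x t) (.var y))) (.limp B C) := by
    refine J.lam (J.app (B := B) (h.congr ?_) ?_ ?_) ?_
    · intro z hz
      rw [Function.update_of_ne]
      simp only [Term.FV] at hz
      grind
    · simpa using J.var (Function.update ρ y B) y
    · intro z hz
      simp only [Term.occ, List.mem_cons, List.not_mem_nil, or_false] at hz ⊢
      grind
    · simp [Term.FV]
  exact (EqE.rule .hole j1 (.eta1 _ _)).symm.trans (EqE.rule (.lam y .hole) j1 (.beta1 _ _ _))

/-- Every term is equal to one whose bound variables avoid a given finite set. -/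
theorem EqE.fresh {ρ : ℕ → Ty} {t : Term} {A : Ty} (h : J ρ t A) (S : Finset ℕ) :
    ∃ t', EqE ρ t t' A ∧ ∀ z ∈ t'.bv, z ∉ S := by
  induction t generalizing ρ A S with
  | var x => exact ⟨_, .refl h, by simp [Term.bv]⟩
  | app t s ih1 ih2 =>
      obtain ⟨B, h1, h2, hd⟩ := h.app_inv
      obtain ⟨t₁, e1, hb1⟩ := ih1 h1 (S ∪ s.occ.toFinset)
      obtain ⟨s₁, e2, hb2⟩ := ih2 h2 (S ∪ t₁.occ.toFinset)
      have := t.mem_occ; have := s.mem_occ; have := t₁.mem_occ; have := s₁.mem_occ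
      have := e1.FV_eq; have := e2.FV_eq
      simp only [Finset.mem_union, List.mem_toFinset, not_or] at hb1 hb2
      refine ⟨_, e1.app e2 hd (by grind), ?_⟩
      simp only [Term.bv]
      grind
  | pair t s ih1 ih2 =>
      obtain ⟨B, C, rfl, h1, h2, hd⟩ := h.pair_inv
      obtain ⟨t₁, e1, hb1⟩ := ih1 h1 (S ∪ s.occ.toFinset)
      obtain ⟨s₁, e2, hb2⟩ := ih2 h2 (S ∪ t₁.occ.toFinset)
      have := t.mem_occ; have := s.mem_occ; have := t₁.mem_occ; have := s₁.mem_occ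
      have := e1.FV_eq; have := e2.FV_eq
      simp only [Finset.mem_union, List.mem_toFinset, not_or] at hb1 hb2
      refine ⟨_, e1.pair e2 hd (by grind), ?_⟩
      simp only [Term.bv]
      grind
  | lam x t ih =>
      obtain ⟨B, C, rfl, h1, hx⟩ := h.lam_inv
      obtain ⟨t₁, e1, hb1⟩ := ih h1 S
      have hx1 : x ∈ t₁.FV := e1.FV_eq ▸ hx
      obtain ⟨y, hy⟩ := exists_fresh (S ∪ (Term.lam x t₁).occ.toFinset)
      simp only [Finset.mem_union, List.mem_toFinset, not_or] at hy
      refine ⟨.lam y (t₁.subst1 x (.var y)), (e1.lam hx).trans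
        ((e1.right.lam hx1).alpha hy.2), ?_⟩
      rw [Term.bv, e1.right.1.subst1_var_bv hx1]
      grind
  | letp x y s t ih1 ih2 =>
      obtain ⟨B, C, h1, h2, hx, hy, hxy, hd⟩ := h.letp_inv
      obtain ⟨t₁, e2, hb2⟩ := ih2 h2 (S ∪ s.occ.toFinset)
      obtain ⟨s₁, e1, hb1⟩ := ih1 h1 (S ∪ insert x (insert y t₁.occ.toFinset))
      have := t.mem_occ; have hso := s.mem_occ; have hto := t₁.mem_occ; have hs1 := s₁.mem_occ
      have hs := e1.FV_eq; have ht := e2.FV_eq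
      simp only [Finset.mem_union, Finset.mem_insert, List.mem_toFinset, not_or] at hb1 hb2
      have hx1 : x ∈ t₁.FV := ht ▸ hx
      have hy1 : y ∈ t₁.FV := ht ▸ hy
      obtain ⟨x', y', hxy', hx', hy'⟩ := exists_fresh_two
        (S.toList ++ x :: y :: (t₁.occ ++ s₁.occ))
      simp only [List.mem_append, Finset.mem_toList, List.mem_cons, not_or] at hx' hy'
      have hd1 : ∀ z ∈ s₁.occ, z ∉ t₁.occ := by grind
      have l1 := e1.letp e2 hx hy hxy hd hd1
      have j0 := l1.right
      -- For a `let`, eta2 expands s₁ to `let (x',y') = s₁ in (x',y')`; commutative conversion moves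
      -- this binder outside, and beta2 renames x, y to x', y'.
      have j1 : J ρ ((TermCtx.letL x y .hole t₁).plug (.letp x' y' s₁ (.pair (.var x') (.var y')))) A := by
        refine J.letp (A := B) (B := C) (J.letp (A := B) (B := C) e1.right (J.pair ?_ ?_ ?_) ?_ ?_ hxy' ?_) e2.right
          hx1 hy1 hxy ?_
        · simpa [Function.update_of_ne hxy'] using
            J.var (Function.update (Function.update ρ x' B) y' C) x'
        · simpa using J.var (Function.update (Function.update ρ x' B) y' C) y'
        · simpa [Term.occ] using hxy'
        · simp [Term.FV]
        · simp [Term.FV]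
        · simp [Term.occ]; grind
        · intro z hz
          change z ∈ (Term.letp x' y' s₁ (.pair (.var x') (.var y'))).occ at hz
          simp only [Term.occ, List.mem_cons, List.mem_append, List.not_mem_nil, or_false] at hz
          grind
      have l2 := EqE.rule _ j1 (.eta2 _ _ _)
      have l3 := EqE.comm j1 (by simp [TermCtx.cv])
      have l4 := EqE.rule (.letR x' y' s₁ .hole) l3.right (.beta2 _ _ _ _ _)
      refine ⟨_, l1.trans (l2.symm.trans (l3.trans l4)), ?_⟩
      have n1 := e2.right.1.not_bv hx1
      have n2 := e2.right.1.not_bv hy1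
      rw [Term.subst2_eq _ hxy n1 n2 (by simp [Term.FV]; grind)]
      have hl : (t₁.subst1 x (.var x')).Lin ∧ y ∈ (t₁.subst1 x (.var x')).FV := by
        obtain ⟨D, rfl, hD⟩ := e2.right.1.exists_plug hx1
        rw [TermCtx.plug_var_subst1 hD]
        refine ⟨TermCtx.plug_lin_of_var e2.right.1 hD trivial ?_, ?_⟩
        · have := D.mem_plug_occ (.var x)
          simp only [Term.occ, List.mem_singleton]
          grind
        · rw [D.mem_plug_FV] at hy1 ⊢
          simp only [Term.FV, Finset.mem_singleton] at hy1
          grind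
      simp only [TermCtx.plug, Term.bv]
      rw [hl.1.subst1_var_bv hl.2, e2.right.1.subst1_var_bv hx1]
      grind

/-! ### Substitution of types -/

theorem Deriv.bind {Γ : Ctx} {t : Term} {A : Ty} (d : Nonempty (Deriv Γ t A)) (f : ℕ → Ty) :
    Nonempty (Deriv (Γ.map fun p => (p.1, p.2.bind f)) t (A.bind f)) := by
  obtain ⟨ρ, h, j⟩ := deriv_iff.1 d
  refine Deriv.exists_of_J (j.bind f) ⟨?_, fun x => ?_, ?_⟩
  · simpa [Ctx.names, Function.comp_def] using h.1
  · rw [← h.2.1]; simp [Ctx.names, Function.comp_def]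
  · simp only [List.mem_map]
    rintro _ ⟨p, hp, rfl⟩
    simp [h.2.2 p hp]

theorem EqJ.bind {Γ : Ctx} {t t' : Term} {A : Ty} (h : EqJ Γ t t' A) (f : ℕ → Ty) :
    EqJ (Γ.map fun p => (p.1, p.2.bind f)) t t' (A.bind f) := by
  have two : ∀ {Γ : Ctx} {t : Term}, TwoOcc Γ t → TwoOcc (Γ.map fun p => (p.1, p.2.bind f)) t := by
    intro Γ t h
    have : Ctx.names (Γ.map fun p => (p.1, p.2.bind f)) = Ctx.names Γ := by
      simp [Ctx.names, Function.comp_def]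
    simpa only [TwoOcc, this] using h
  induction h with
  | refl d => exact .refl (Deriv.bind ⟨d⟩ f).some
  | symm _ ih => exact ih.symm
  | trans _ _ ih1 ih2 => exact ih1.trans ih2
  | comm d h => exact .comm (Deriv.bind ⟨d⟩ f).some h
  | red d h => exact .red (Deriv.bind ⟨d⟩ f).some h
  | lam _ ih => exact .lam ih
  | app l1 l2 _ _ ih1 ih2 =>
      rw [List.map_append]
      exact .app (by simpa using two l1) (by simpa using two l2) ih1 ih2
  | pair l1 l2 _ _ ih1 ih2 =>
      rw [List.map_append]
      exact .pair (by simpa using two l1) (by simpa using two l2) ih1 ih2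
  | letp l1 l2 _ _ ih1 ih2 =>
      rw [List.map_append]
      exact .letp (by simpa using two l1) (by simpa using two l2) ih1 ih2

theorem EqE.bind {ρ : ℕ → Ty} {t t' : Term} {A : Ty} (h : EqE ρ t t' A) (f : ℕ → Ty) :
    EqE (fun x => (ρ x).bind f) t t' (A.bind f) := by
  obtain ⟨Γ, g, h⟩ := h
  refine ⟨_, ⟨?_, fun x => ?_, ?_⟩, h.bind f⟩
  · simpa [Ctx.names, Function.comp_def] using g.1
  · rw [← g.2.1]; simp [Ctx.names, Function.comp_def]
  · simp only [List.mem_map]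
    rintro _ ⟨p, hp, rfl⟩
    simp [g.2.2 p hp]

/-! ### A three-valued semantics -/

/-- Multiplication of the three element Sugihara monoid. -/
def sugTensor (a b : SignType) : SignType :=
  if a = -1 ∨ b = -1 then -1 else if a = 1 ∨ b = 1 then 1 else 0

/-- The residual of `sugTensor`. -/
def sugLimp (a b : SignType) : SignType := if a ≤ b then max (-a) b else min (-a) b

/-- The value of a type. -/
def Ty.val (v : ℕ → SignType) : Ty → SignType
  | .var p => v p
  | .tensor A B => sugTensor (A.val v) (B.val v)
  | .limp A B => sugLimp (A.val v) (B.val v)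

theorem sugTensor_nonneg : ∀ {a b : SignType}, 0 ≤ sugTensor a b ↔ 0 ≤ a ∧ 0 ≤ b := by decide

theorem sugTensor_eq_one : ∀ {a b : SignType}, 0 ≤ a → 0 ≤ b →
    (sugTensor a b = 1 ↔ a = 1 ∨ b = 1) := by decide

theorem sugLimp_elim : ∀ {a b : SignType}, 0 ≤ sugLimp a b → 0 ≤ a →
    0 ≤ b ∧ (sugLimp a b = 1 ∨ a = 1 → b = 1) := by decide

theorem sugLimp_intro : ∀ {a b : SignType}, (0 ≤ a → 0 ≤ b) → (a = 1 → b = 1) →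
    0 ≤ sugLimp a b := by decide

theorem sugLimp_intro_one : ∀ {a b : SignType}, (0 ≤ a → b = 1) → sugLimp a b = 1 := by decide

/-- Soundness of the three-valued model, in a form that records relevance. In the monoid 0 is the
unit, -1 is absorbing, and among nonnegative elements 1 is absorbing. Since every variable is really
used, a single hypothesis of value 1 forces the conclusion to have value 1. -/
theorem J.val {ρ : ℕ → Ty} {t : Term} {A : Ty} (h : J ρ t A) (v : ℕ → SignType)
    (h0 : ∀ z ∈ t.FV, 0 ≤ (ρ z).val v) :
    0 ≤ A.val v ∧ ((∃ z ∈ t.FV, (ρ z).val v = 1) → A.val v = 1) := by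
  induction t generalizing ρ A with
  | var x =>
      obtain rfl := h.var_inv
      exact ⟨h0 x (by simp [Term.FV]), by simp [Term.FV]⟩
  | app t s ih1 ih2 =>
      obtain ⟨B, h1, h2, -⟩ := h.app_inv
      simp only [Term.FV, Finset.mem_union] at h0 ⊢
      have i1 := ih1 h1 fun z hz => h0 z (.inl hz)
      have i2 := ih2 h2 fun z hz => h0 z (.inr hz)
      obtain ⟨e1, e2⟩ := sugLimp_elim i1.1 i2.1
      refine ⟨e1, ?_⟩
      rintro ⟨z, hz | hz, e⟩
      · exact e2 (.inl (i1.2 ⟨z, hz, e⟩))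
      · exact e2 (.inr (i2.2 ⟨z, hz, e⟩))
  | pair s t ih1 ih2 =>
      obtain ⟨B, C, rfl, h1, h2, -⟩ := h.pair_inv
      simp only [Term.FV, Finset.mem_union] at h0 ⊢
      have i1 := ih1 h1 fun z hz => h0 z (.inl hz)
      have i2 := ih2 h2 fun z hz => h0 z (.inr hz)
      refine ⟨sugTensor_nonneg.2 ⟨i1.1, i2.1⟩, ?_⟩
      rintro ⟨z, hz | hz, e⟩
      · exact (sugTensor_eq_one i1.1 i2.1).2 (.inl (i1.2 ⟨z, hz, e⟩))
      · exact (sugTensor_eq_one i1.1 i2.1).2 (.inr (i2.2 ⟨z, hz, e⟩))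
  | lam x t ih =>
      obtain ⟨B, C, rfl, h1, hx⟩ := h.lam_inv
      simp only [Term.FV, Finset.mem_erase] at h0 ⊢
      have i : 0 ≤ B.val v → _ := fun hB => ih h1 fun z hz => by
        by_cases e : z = x
        · subst e; simpa using hB
        · simpa [e] using h0 z ⟨e, hz⟩
      refine ⟨sugLimp_intro (fun hB => (i hB).1) fun hB =>
        (i (hB ▸ by decide)).2 ⟨x, hx, by simpa using hB⟩, ?_⟩
      rintro ⟨z, ⟨hzx, hz⟩, e⟩
      exact sugLimp_intro_one fun hB => (i hB).2 ⟨z, hz, by simpa [hzx] using e⟩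
  | letp x y s t ih1 ih2 =>
      obtain ⟨B, C, h1, h2, hx, hy, hxy, -⟩ := h.letp_inv
      simp only [Term.FV, Finset.mem_union, Finset.mem_sdiff, Finset.mem_insert,
        Finset.mem_singleton] at h0 ⊢
      have i1 := ih1 h1 fun z hz => h0 z (.inl hz)
      have hBC := sugTensor_nonneg.1 i1.1
      have i2 := ih2 h2 fun z hz => by
        by_cases e : z = y
        · subst e; simpa using hBC.2
        · by_cases e' : z = x
          · subst e'; simpa [e] using hBC.1
          · simpa [e, e'] using h0 z (.inr ⟨hz, by simp [e, e']⟩)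
      refine ⟨i2.1, ?_⟩
      rintro ⟨z, hz | ⟨hz, hz'⟩, e⟩
      · rcases (sugTensor_eq_one hBC.1 hBC.2).1 (i1.2 ⟨z, hz, e⟩) with e | e
        · exact i2.2 ⟨x, hx, by simpa [hxy] using e⟩
        · exact i2.2 ⟨y, hy, by simpa using e⟩
      · rw [not_or] at hz'
        exact i2.2 ⟨z, hz, by simpa [hz'.1, hz'.2] using e⟩

/-- All type variables of a type belong to `V`. -/
def Ty.In (V : Set ℕ) : Ty → Prop
  | .var p => p ∈ V
  | .tensor A B => A.In V ∧ B.In V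
  | .limp A B => A.In V ∧ B.In V

/-- All type variables of a type have the same colour. -/
def Ty.Mono (V : Set ℕ) (A : Ty) : Prop := A.In V ∨ A.In Vᶜ

open Classical in
/-- The valuation that maps the elements of `V` to 1 and all others to 0. -/
noncomputable def colour (V : Set ℕ) (p : ℕ) : SignType := if p ∈ V then 1 else 0

theorem Ty.In.val_one {V : Set ℕ} {A : Ty} (h : A.In V) : A.val (colour V) = 1 := by
  induction A with
  | var p => simpa [Ty.val, colour, Ty.In] using h
  | tensor A B i1 i2 => rw [Ty.val, i1 h.1, i2 h.2]; rfl
  | limp A B i1 i2 => rw [Ty.val, i1 h.1, i2 h.2]; decide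

theorem Ty.In.val_zero {V : Set ℕ} {A : Ty} (h : A.In Vᶜ) : A.val (colour V) = 0 := by
  induction A with
  | var p => simpa [Ty.val, colour, Ty.In] using h
  | tensor A B i1 i2 => rw [Ty.val, i1 h.1, i2 h.2]; decide
  | limp A B i1 i2 => rw [Ty.val, i1 h.1, i2 h.2]; decide

theorem Ty.Mono.nonneg {V : Set ℕ} {A : Ty} (h : A.Mono V) : 0 ≤ A.val (colour V) := by
  rcases h with h | h
  · rw [h.val_one]; decide
  · rw [h.val_zero]

theorem Ty.Mono.compl {V : Set ℕ} {A : Ty} (h : A.Mono V) : A.Mono Vᶜ := by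
  rw [Ty.Mono, compl_compl]; exact h.symm

theorem Ty.In.not_compl {V : Set ℕ} {A : Ty} (h : A.In V) : ¬ A.In Vᶜ := fun h' => by
  have := h.val_one.symm.trans h'.val_zero
  exact absurd this (by decide)

/-- If the types of the free variables are monochrome, they have the colour of the type of
the term. -/
theorem J.conn {V : Set ℕ} {ρ : ℕ → Ty} {t : Term} {A : Ty} (h : J ρ t A)
    (hm : ∀ z ∈ t.FV, (ρ z).Mono V) (hA : A.In V) : ∀ z ∈ t.FV, (ρ z).In V := by
  intro z hz
  refine (hm z hz).resolve_right fun hc => ?_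
  -- With the complement of V coloured 1, a hypothesis of the wrong colour has value 1 and would
  -- force the value 1 on A, which has value 0.
  have h1 := (h.val (colour Vᶜ) fun z hz => (hm z hz).compl.nonneg).2 ⟨z, hz, hc.val_one⟩
  have h2 : A.val (colour Vᶜ) = 0 := Ty.In.val_zero (by rwa [compl_compl])
  exact absurd (h1.symm.trans h2) (by decide)

/-! ### Splitting at a variable -/

/-- A term in which the result of the application of `f` to an argument is cut with a variable. -/
def splitTerm (y : ℕ) (w : Term) (f : ℕ) (s : Term) : Term := .app (.lam y w) (.app (.var f) s)

theorem J.split_inv {ρ : ℕ → Ty} {y f : ℕ} {w s : Term} {A D E : Ty}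
    (h : J ρ (splitTerm y w f s) A) (hf : ρ f = .limp D E) :
    J (Function.update ρ y E) w A ∧ y ∈ w.FV ∧ J ρ s D ∧ f ∉ s.occ ∧ f ≠ y ∧ f ∉ w.occ ∧
      (∀ z ∈ w.occ, z ∉ s.occ) ∧ y ∉ s.occ ∧ y ∉ w.bv := by
  obtain ⟨B, h1, h2, hd⟩ := h.app_inv
  obtain ⟨D', h3, h4, hd'⟩ := h2.app_inv
  have e := h3.var_inv
  rw [hf] at e
  cases e
  obtain ⟨_, _, e, h5, hy⟩ := h1.lam_inv
  cases e
  have := h5.1.not_bv hy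
  simp only [Term.occ, List.mem_cons, List.mem_append, List.not_mem_nil, or_false] at hd hd'
  refine ⟨h5, hy, h4, ?_⟩
  grind

theorem J.split {ρ : ℕ → Ty} {y f : ℕ} {w s : Term} {A D E : Ty} (hf : ρ f = .limp D E)
    (h1 : J (Function.update ρ y E) w A) (hy : y ∈ w.FV) (h2 : J ρ s D) (h3 : f ∉ s.occ)
    (h4 : f ∉ w.occ) (h5 : ∀ z ∈ w.occ, z ∉ s.occ) : J ρ (splitTerm y w f s) A := by
  have := Term.FV_occ hy
  refine J.app (h1.lam hy) (J.app (by simpa [hf] using J.var ρ f) h2 ?_) ?_ <;>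
    simp only [Term.occ, List.mem_cons, List.mem_append, List.not_mem_nil, or_false] <;> grind

theorem EqE.split {ρ : ℕ → Ty} {y f : ℕ} {w w' s s' : Term} {A D E : Ty} (hf : ρ f = .limp D E)
    (h1 : EqE (Function.update ρ y E) w w' A) (hy : y ∈ w.FV) (h2 : EqE ρ s s' D) (h3 : f ∉ s.occ)
    (h4 : f ∉ w.occ) (h5 : ∀ z ∈ w.occ, z ∉ s.occ) (h3' : f ∉ s'.occ) (h4' : f ∉ w'.occ)
    (h5' : ∀ z ∈ w'.occ, z ∉ s'.occ) : EqE ρ (splitTerm y w f s) (splitTerm y w' f s') A := by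
  have := Term.FV_occ hy
  have := Term.FV_occ (h1.FV_eq ▸ hy)
  refine EqE.app (h1.lam hy) (EqE.app (.refl (by simpa [hf] using J.var ρ f)) h2 ?_ ?_) ?_ ?_ <;>
    simp only [Term.occ, List.mem_cons, List.mem_append, List.not_mem_nil, or_false] <;> grind

/-- Renaming the whole term by `EqE.fresh` need not keep its split form, so the two parts and the
cut variable are renamed separately. -/
theorem EqE.split_fresh {ρ : ℕ → Ty} {y f : ℕ} {t w s : Term} {A D E : Ty} (hf : ρ f = .limp D E)
    (h : EqE ρ t (splitTerm y w f s) A) (S : Finset ℕ) :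
    ∃ y w s, EqE ρ t (splitTerm y w f s) A ∧ ∀ z ∈ (splitTerm y w f s).bv, z ∉ S := by
  obtain ⟨h1, hy, h2, h3, h3', h4, h5, h6, h7⟩ := h.right.split_inv hf
  obtain ⟨s₁, e2, hs⟩ := EqE.fresh h2 (insert f (S ∪ w.occ.toFinset))
  obtain ⟨w₁, e1, hw⟩ := EqE.fresh h1 (insert f (S ∪ s₁.occ.toFinset))
  have hy₁ : y ∈ w₁.FV := e1.FV_eq ▸ hy
  obtain ⟨x, hx⟩ := exists_fresh (S ∪ insert f ((Term.lam y w₁).occ.toFinset ∪ s₁.occ.toFinset))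
  have := w.mem_occ; have := s.mem_occ; have := w₁.mem_occ; have := s₁.mem_occ
  have := e1.FV_eq; have := e2.FV_eq
  simp only [Finset.mem_union, Finset.mem_insert, List.mem_toFinset, not_or] at hs hw hx
  have e3 := h.trans (EqE.split hf e1 hy e2 h3 h4 h5 (by grind) (by grind) (by grind))
  have e4 := (e1.right.lam hy₁).alpha (y := x) (by grind)
  obtain ⟨_, j1, j2, hd⟩ := e3.right.app_inv
  obtain ⟨j1', -⟩ := e3.right.split_inv hf
  obtain ⟨_, -, e, -⟩ := J.lam_inv j1
  have hso := fun z => e1.right.1.subst1_occ hy₁ (.var x) z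
  obtain ⟨_, h8, -⟩ := j2.app_inv
  have e5 := h8.var_inv
  rw [hf] at e5
  cases e5
  refine ⟨x, w₁.subst1 y (.var x), s₁, e3.trans (EqE.app e4 (.refl j2) hd ?_), ?_⟩
  · simp only [Term.occ, List.mem_cons, List.mem_append, List.not_mem_nil, or_false] at hso hd ⊢
    grind
  · simp only [splitTerm, Term.bv, e1.right.1.subst1_var_bv hy₁]
    grind

/-- A term whose head is applied to an argument is equal to a split term. -/
theorem J.headApp_eq {ρ : ℕ → Ty} {C : TermCtx} {f : ℕ} {s : Term} {z : ℕ} {D B A : Ty}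
    (h : J ρ (C.plug (.app (.var f) s)) A) (hC : C.cv = ∅) (hf : ρ f = .limp D B)
    (hz : z ∉ (C.plug (.app (.var f) s)).occ) (hs : J ρ s D)
    (hCz : J (Function.update ρ z B) (C.plug (.var z)) A) :
    EqE ρ (C.plug (.app (.var f) s)) (splitTerm z (C.plug (.var z)) f s) A := by
  obtain ⟨hr, hCl, hb⟩ := (C.plug_lin _).1 h.1
  refine (EqE.of_plug hCz ?_ ?_ ?_ ?_).symm
  · exact J.app (by simpa [hf] using J.var ρ f) hs hr.2.2
  · exact fun h => hz ((C.mem_plug_occ _ _).2 (.inl h))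
  · intro x hx hx'
    rcases (C.mem_plug_occ _ _).1 hx with hx | hx
    · rcases (Term.mem_occ _ _).1 hx' with h' | h'
      · have := hCl.captured h' hx
        simp [hC] at this
      · exact hb x h' hx
    · rw [Term.occ, List.mem_singleton] at hx
      subst hx
      exact hz ((C.mem_plug_occ _ _).2 (.inr hx'))
  · simp [hC]

/-- The colours of the variables of the two parts of a split term. -/
theorem EqE.split_colours {V : Set ℕ} {ρ : ℕ → Ty} {t : Term} {A : Ty} {y : ℕ} {w : Term} {f : ℕ}
    {s : Term} {D E : Ty} (h : EqE ρ t (splitTerm y w f s) A) (hf : ρ f = .limp D E)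
    (hm : ∀ z ∈ t.FV, z ≠ f → (ρ z).Mono V) (hD : D.In Vᶜ) (hE : E.In V) (hA : A.In V) :
    (∀ z ∈ s.FV, (ρ z).In Vᶜ) ∧ ∀ z ∈ w.FV, z ≠ y → (ρ z).In V := by
  obtain ⟨h1, hy, h2, h3, h4, h5, h6, h7, h8⟩ := h.right.split_inv hf
  have hFV := h.FV_eq
  have hs : ∀ z ∈ s.FV, z ∈ t.FV ∧ z ≠ f := fun z hz => by
    rw [hFV]
    have := Term.FV_occ hz
    simp only [splitTerm, Term.FV]
    grind
  have hw : ∀ z ∈ w.FV, z ≠ y → z ∈ t.FV ∧ z ≠ f := fun z hz hzy => by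
    rw [hFV]
    have := Term.FV_occ hz
    simp only [splitTerm, Term.FV]
    grind
  refine ⟨h2.conn (fun z hz => ((hm z (hs z hz).1 (hs z hz).2).compl)) hD, fun z hz hzy => ?_⟩
  have := h1.conn (V := V) (fun z hz => ?_) hA z hz
  · rwa [Function.update_of_ne hzy] at this
  · by_cases e : z = y
    · subst e; simpa [Ty.Mono] using Or.inl hE
    · rw [Function.update_of_ne e]
      exact hm z (hw z hz e).1 (hw z hz e).2

/-- A variable that is a function from one colour to the other, where all other variables are
monochrome, can be brought to the front. -/
theorem J.exists_split {V : Set ℕ} {ρ : ℕ → Ty} {t : Term} {A : Ty} (h : J ρ t A) :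
    ∀ f D E, f ∈ t.FV → ρ f = .limp D E → (∀ z ∈ t.FV, z ≠ f → (ρ z).Mono V) → D.In Vᶜ → E.In V →
      A.In V → ∃ y w s, EqE ρ t (splitTerm y w f s) A := by
  refine J.induction (P := fun ρ t A => ∀ f D E, f ∈ t.FV → ρ f = .limp D E →
    (∀ z ∈ t.FV, z ≠ f → (ρ z).Mono V) → D.In Vᶜ → E.In V → A.In V →
      ∃ y w s, EqE ρ t (splitTerm y w f s) A) ?_ ?_ ?_ ?_ ?_ ?_ h
  · intro ρ x f D E hf hρ hm hD hE hA
    obtain rfl : f = x := by simpa [Term.FV] using hf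
    -- Here t is f itself, but its type has atoms of both colours and A does not.
    rw [hρ] at hA
    exact absurd hD (hA.1.not_compl)
  · intro ρ x t B C h hx ih f D E hf hρ hm hD hE hA
    simp only [Term.FV, Finset.mem_erase] at hf hm
    have hρ' : Function.update ρ x B f = .limp D E := by rwa [Function.update_of_ne hf.1]
    have hm' : ∀ z ∈ t.FV, z ≠ f → (Function.update ρ x B z).Mono V := fun z hz hzf => by
      by_cases e : z = x
      · subst e; simpa [Ty.Mono] using Or.inl hA.1
      · rw [Function.update_of_ne e]; exact hm z ⟨e, hz⟩ hzf
    obtain ⟨y, w, s, e⟩ := ih f D E hf.2 hρ' hm' hD hE hA.2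
    refine ⟨y, .lam x w, s, (e.lam hx).trans (EqE.cut (C := .lam x .hole) (e.lam hx).right ?_)⟩
    -- The bound variable x has the colour of A, and the variables of s have the other one. So x is
    -- not free in the argument, and the redex can leave the abstraction.
    have hs := (e.split_colours hρ' hm' hD hE hA.2).1 x
    simp only [TermCtx.cv, Term.FV, Finset.mem_union, Finset.mem_singleton, Finset.notMem_empty,
      or_false, forall_eq, not_or]
    refine ⟨Ne.symm hf.1, fun hxs => ?_⟩
    have := hs hxs
    rw [Function.update_self] at this
    exact hA.1.not_compl this
  · intro ρ t u B C ht hu hd ih1 ih2 f D E hf hρ hm hD hE hA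
    simp only [Term.FV, Finset.mem_union] at hf hm
    rcases hf with hf | hf
    · obtain ⟨y, w, s, e⟩ := ih1 f D E hf hρ (fun z hz => hm z (.inl hz)) hD hE hA.1
      obtain ⟨y, w, s, e, hb⟩ := e.split_fresh hρ u.occ.toFinset
      have h1 := e.pair (.refl hu) hd (by
        intro z hz hzu
        rcases ((splitTerm y w f s).mem_occ z).1 hz with hz | hz
        · exact hd z (Term.FV_occ (e.FV_eq ▸ hz)) hzu
        · exact hb z hz (by simpa using hzu))
      exact ⟨y, _, s, h1.trans (EqE.cut (C := .pairL .hole u) h1.right (by simp [TermCtx.cv]))⟩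
    · obtain ⟨y, w, s, e⟩ := ih2 f D E hf hρ (fun z hz => hm z (.inr hz)) hD hE hA.2
      obtain ⟨y, w, s, e, hb⟩ := e.split_fresh hρ t.occ.toFinset
      have h1 := (EqE.refl ht).pair e hd (by
        intro z hzt hz
        rcases ((splitTerm y w f s).mem_occ z).1 hz with hz | hz
        · exact hd z hzt (Term.FV_occ (e.FV_eq ▸ hz))
        · exact hb z hz (by simpa using hzt))
      exact ⟨y, _, s, h1.trans (EqE.cut (C := .pairR t .hole) h1.right (by simp [TermCtx.cv]))⟩
  · intro ρ C r r' A h hr ih f D E hf hρ hm hD hE hA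
    have e := EqE.rule C h hr
    have hFV := e.FV_eq
    obtain ⟨y, w, s, e'⟩ := ih f D E (hFV ▸ hf) hρ (hFV ▸ hm) hD hE hA
    exact ⟨y, w, s, e.trans e'⟩
  · intro ρ C g s z D' B' A h hC hg hz hs hCz ihs ihC f D E hf hρ hm hD hE hA
    have hpf := C.mem_plug_FV
    have hpo := C.mem_plug_occ
    have hzC : z ∉ C.occ := fun h => hz ((hpo _ _).2 (.inl h))
    have e0 := h.headApp_eq hC hg hz hs hCz
    obtain ⟨B₁, e1, jr, hd0⟩ := e0.right.app_inv
    have hB : B₁ = B' := by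
      obtain ⟨_, e3, -⟩ := jr.app_inv
      have := e3.var_inv
      rw [hg] at this
      cases this
      rfl
    rw [hB] at jr e1
    have hd : ∀ x ∈ (C.plug (.var z)).occ, x ∉ (Term.app (.var g) s).occ := fun x hx =>
      hd0 x (List.mem_cons_of_mem _ hx)
    have hFV : ∀ x, x ∈ (C.plug (.app (.var g) s)).FV ↔ x ∈ C.FV ∨ x = g ∨ x ∈ s.FV := by
      intro x
      rw [hpf]; simp [hC, Term.FV]
    have hFz : ∀ x, x ∈ (C.plug (.var z)).FV ↔ x ∈ C.FV ∨ x = z := by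
      intro x
      rw [hpf]; simp [hC, Term.FV]
    have hd' := fun x hx => hd x hx
    -- If f is the head, the term is split already. Otherwise f lies in the remaining term or in the
    -- argument of the head g, whose type is monochrome.
    by_cases hfg : f = g
    · subst hfg
      exact ⟨z, _, s, e0⟩
    have hgm := hm g ((hFV g).2 (.inr (.inl rfl))) (Ne.symm hfg)
    rw [hg] at hgm
    have hB' : B'.Mono V := hgm.imp (·.2) (·.2)
    simp only [Term.occ, List.mem_append, List.mem_singleton, hpo, not_or] at hd hz
    rcases (hFV f).1 hf with hfC | hf' | hfs
    · have hzf : f ≠ z := by rintro rfl; exact hzC ((C.mem_occ _).2 (.inl hfC))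
      have hρ' : Function.update ρ z B' f = .limp D E := by rwa [Function.update_of_ne hzf]
      obtain ⟨y, w, s', e⟩ := ihC f D E ((hFz f).2 (.inl hfC)) hρ' (by
        intro x hx hxf
        by_cases e : x = z
        · subst e; simpa using hB'
        · rw [Function.update_of_ne e]
          refine hm x ((hFV x).2 (.inl (((hFz x).1 hx).resolve_right e))) hxf) hD hE hA
      obtain ⟨y, w, s', e, hb⟩ := e.split_fresh hρ' (insert z (Term.app (.var g) s).occ.toFinset)
      have hz' : z ∈ (splitTerm y w f s').FV := e.FV_eq ▸ (hFz z).2 (.inr rfl)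
      have h1 := EqE.app (e.lam ((hFz z).2 (.inr rfl))) (.refl jr) (by
          intro x hx
          rcases List.mem_cons.1 hx with rfl | hx
          · exact hd' _ ((hpo _ _).2 (.inr (by simp [Term.occ])))
          · exact hd' _ hx) (by
          intro x hx hx'
          rcases List.mem_cons.1 hx with rfl | hx
          · exact hd' _ ((hpo _ _).2 (.inr (by simp [Term.occ]))) hx'
          · rcases (Term.mem_occ _ _).1 hx with hx | hx
            · exact hd' x (Term.FV_occ (e.FV_eq ▸ hx)) hx'
            · exact hb x hx (Finset.mem_insert_of_mem (List.mem_toFinset.2 hx')))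
      -- Substituting g s for z keeps the split form at f, whichever part contains z.
      have h2 := EqE.rule .hole h1.right (.beta1 _ _ _)
      have hyz : y ≠ z := fun h => hb y (by simp [splitTerm, Term.bv]) (by simp [h])
      refine ⟨y, w.subst1 z (.app (.var g) s), s'.subst1 z (.app (.var g) s),
        e0.trans (h1.trans ?_)⟩
      simpa only [TermCtx.plug, splitTerm, Term.subst1_app, Term.subst1_lam hyz,
        Term.subst1_var_ne hzf] using h2
    · exact absurd hf' hfg
    · have hm' : ∀ x ∈ s.FV, x ≠ f → (ρ x).Mono V := fun x hx => hm x ((hFV x).2 (.inr (.inr hx)))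
      -- If g has the colour of A, the induction hypothesis splits its argument, and the redex is
      -- moved out of the application. The other colour is impossible.
      rcases hgm with hgV | hgV
      · obtain ⟨y, w, s', e⟩ := ihs f D E hfs hρ hm' hD hE hgV.1
        obtain ⟨y, w, s', e, hb⟩ := e.split_fresh hρ
          ((Term.lam z (C.plug (.var z))).occ.toFinset ∪ {g})
        have hso := s.mem_occ
        have hsp := (splitTerm y w f s').mem_occ
        have hsf := e.FV_eq
        have hgs : g ∉ s.occ := by
          have := ((C.plug_lin _).1 h.1).1.2.2 g (by simp [Term.occ])
          exact this
        have h1 : EqE ρ (.app (.var g) s) (.app (.var g) (splitTerm y w f s')) B' := by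
          refine EqE.app (A := D') (.refl (by simpa [hg] using J.var ρ g)) e ?_ ?_
          · intro x hx
            simp only [Term.occ, List.mem_singleton] at hx
            subst hx; exact hgs
          · intro x hx
            simp only [Term.occ, List.mem_singleton] at hx
            subst hx
            rw [hsp, not_or]
            refine ⟨fun h => hgs (Term.FV_occ (hsf ▸ h)), fun h => hb _ h (by simp)⟩
        have h2 := EqE.app (.refl (hCz.lam ((hFz z).2 (.inr rfl)))) h1 (by
          intro x hx
          rcases List.mem_cons.1 hx with rfl | hx
          · exact hd' _ ((hpo _ _).2 (.inr (by simp [Term.occ])))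
          · exact hd' _ hx) (by
          intro x hx hx'
          rw [Term.occ, List.mem_append, hsp, ← hsf, Term.occ, List.mem_singleton] at hx'
          have hx2 : x = g ∨ x ∈ s.FV → x ∈ (Term.app (.var g) s).occ := by
            simp only [Term.occ, List.mem_append, List.mem_singleton]
            exact Or.imp_right Term.FV_occ
          rcases hx' with h | h | h
          · rcases List.mem_cons.1 hx with rfl | hx
            · exact hd' _ ((hpo _ _).2 (.inr (by simp [Term.occ]))) (hx2 (.inl h))
            · exact hd' _ hx (hx2 (.inl h))
          · rcases List.mem_cons.1 hx with rfl | hx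
            · exact hd' _ ((hpo _ _).2 (.inr (by simp [Term.occ]))) (hx2 (.inr h))
            · exact hd' _ hx (hx2 (.inr h))
          · exact hb x h (Finset.mem_union_left _ (List.mem_toFinset.2 hx)))
        have h3 := EqE.cut (C := .appR (.lam z (C.plug (.var z))) (.appR (.var g) .hole)) h2.right
          (by simp [TermCtx.cv])
        exact ⟨y, _, s', e0.trans (h2.trans h3)⟩
      · exfalso
        -- In the model f has value 1, as its domain has value 0 and its codomain 1. It would force
        -- the argument of g to have value 1, while the type of that argument has value 0.
        have h1 := hs.val (colour V) fun x hx => by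
          by_cases e : x = f
          · subst e
            rw [hρ, Ty.val, hD.val_zero, hE.val_one]; decide
          · exact (hm' x hx e).nonneg
        have h2 := h1.2 ⟨f, hfs, by rw [hρ, Ty.val, hD.val_zero, hE.val_one]; decide⟩
        rw [hgV.1.val_zero] at h2
        exact absurd h2 (by decide)
  · intro ρ C x y g u B' C' A h hC hg hCu ih f D E hf hρ hm hD hE hA
    have hpf := C.mem_plug_FV
    have e0 := EqE.comm h (by simp [hC])
    obtain ⟨B₁, C₁, j1, j2, hx, hy, hxy, hd⟩ := e0.right.letp_inv
    have e1 := j1.var_inv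
    rw [hg] at e1
    cases e1
    simp only [Term.occ, List.mem_singleton, forall_eq] at hd
    have hFV : ∀ z, z ∈ (C.plug (.letp x y (.var g) u)).FV ↔
        z = g ∨ z ∈ (C.plug u).FV ∧ z ≠ x ∧ z ≠ y := by
      intro z; rw [e0.FV_eq]; simp [Term.FV]
    have hfg : f ≠ g := by
      rintro rfl; rw [hg] at hρ; cases hρ
    have hf' := ((hFV f).1 hf).resolve_left hfg
    have hgm := hm g ((hFV g).2 (.inl rfl)) (Ne.symm hfg)
    rw [hg] at hgm
    have hρ' : Function.update (Function.update ρ x B') y C' f = .limp D E := by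
      rwa [Function.update_of_ne hf'.2.2, Function.update_of_ne hf'.2.1]
    have hm' : ∀ z ∈ (C.plug u).FV, z ≠ f →
        (Function.update (Function.update ρ x B') y C' z).Mono V := by
      intro z hz hzf
      by_cases e : z = y
      · subst e; simpa [Ty.Mono] using hgm.imp (·.2) (·.2)
      · by_cases e' : z = x
        · subst e'; simpa [e, Ty.Mono] using hgm.imp (·.1) (·.1)
        · rw [Function.update_of_ne e, Function.update_of_ne e']
          exact hm z ((hFV z).2 (.inr ⟨hz, e', e⟩)) hzf
    obtain ⟨y', w, s, e⟩ := ih f D E hf'.1 hρ' hm' hD hE hA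
    obtain ⟨y', w, s, e, hb⟩ := e.split_fresh hρ' {g, x, y}
    have hsf := e.FV_eq
    have h1 := EqE.letp (.refl j1) e hx hy hxy (by simpa [Term.occ] using hd) (by
      simp only [Term.occ, List.mem_singleton, forall_eq]
      rw [Term.mem_occ, ← hsf, not_or]
      exact ⟨fun h => hd (Term.FV_occ h), fun h => hb g h (by simp)⟩)
    obtain ⟨c1, c2⟩ := e.split_colours hρ' hm' hD hE hA
    obtain ⟨k1, hyw, k2, k3, k4, k5, k6, k7, k8⟩ := e.right.split_inv hρ'
    -- The colour of g decides which part receives the `let`: with the colour of A its variables are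
    -- absent from the argument and the binder joins w; with the other colour they are absent from w
    -- and the binder joins the argument.
    rcases hgm with hgV | hgV
    · have hxs : x ∉ s.FV := fun h => by
        have := c1 x h
        rw [Function.update_of_ne hxy, Function.update_self] at this
        exact hgV.1.not_compl this
      have hys : y ∉ s.FV := fun h => by
        have := c1 y h
        rw [Function.update_self] at this
        exact hgV.2.not_compl this
      have h2 := EqE.cut (C := .letR x y (.var g) .hole) h1.right (by
        simp only [TermCtx.cv, Term.FV]; grind)
      exact ⟨y', _, s, e0.trans (h1.trans h2)⟩
    · have hxw : x ∉ w.FV := fun h => by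
        have := c2 x h (fun h' => hb y' (by simp [splitTerm, Term.bv]) (by simp [h']))
        rw [Function.update_of_ne hxy, Function.update_self] at this
        exact this.not_compl hgV.1
      have hyw : y ∉ w.FV := fun h => by
        have := c2 y h (fun h' => hb y' (by simp [splitTerm, Term.bv]) (by simp [h']))
        rw [Function.update_self] at this
        exact this.not_compl hgV.2
      have hwo := w.mem_occ
      simp only [splitTerm, Term.bv, Finset.mem_union, Finset.mem_insert, Finset.mem_singleton] at hb
      have h2 := EqE.comm' (C := .appR (.lam y' w) (.appR (.var f) .hole)) h1.right
        (by simp [TermCtx.cv]) (by simp only [TermCtx.occ, Term.occ, List.mem_append, List.mem_cons,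
          List.not_mem_nil, or_false]; grind)
        (by simp only [TermCtx.occ, Term.occ, List.mem_append, List.mem_cons,
          List.not_mem_nil, or_false]; grind)
      exact ⟨y', w, _, e0.trans (h1.trans h2)⟩

/-! ### Coherence for balanced sequents -/

/-- The number of occurrences of a type variable. -/
def Ty.count (p : ℕ) : Ty → ℕ
  | .var q => if q = p then 1 else 0
  | .tensor A B => A.count p + B.count p
  | .limp A B => A.count p + B.count p

/-- The size of a type, where tensors count five times. -/
def Ty.wt : Ty → ℕ
  | .var _ => 1
  | .tensor A B => 5 + A.wt + B.wt
  | .limp A B => 1 + A.wt + B.wt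

theorem sum_update_erase {M : Type*} [AddCommMonoid M] (g : Ty → M) {ρ : ℕ → Ty} {F : Finset ℕ}
    {x : ℕ} (B : Ty) (hx : x ∈ F) :
    ∑ z ∈ F, g (Function.update ρ x B z) = g B + ∑ z ∈ F.erase x, g (ρ z) := by
  rw [← Finset.add_sum_erase _ _ hx, Function.update_self]
  congr 1
  refine Finset.sum_congr rfl fun z hz => ?_
  rw [Function.update_of_ne (Finset.ne_of_mem_erase hz)]

theorem sum_update_update {M : Type*} [AddCommMonoid M] (g : Ty → M) {ρ : ℕ → Ty} {F : Finset ℕ}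
    {x y : ℕ} (B C : Ty) (hx : x ∈ F) (hy : y ∈ F) (hxy : x ≠ y) :
    ∑ z ∈ F, g (Function.update (Function.update ρ x B) y C z) =
      g C + (g B + ∑ z ∈ F \ {x, y}, g (ρ z)) := by
  rw [sum_update_erase g C hy, sum_update_erase g B (by grind)]
  congr 3
  grind

theorem FV_disjoint {t s : Term} (hd : ∀ z ∈ t.occ, z ∉ s.occ) : Disjoint t.FV s.FV :=
  Finset.disjoint_left.2 fun z hz hz' => hd z (Term.FV_occ hz) (Term.FV_occ hz')

/-- An axiom contains each of its atoms an even number of times, and a type hidden by application or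
`let` is counted twice, so it drops out modulo 2. -/
theorem J.parity {ρ : ℕ → Ty} {t : Term} {A : Ty} (h : J ρ t A) (p : ℕ) :
    ∑ z ∈ t.FV, ((ρ z).count p : ZMod 2) = A.count p := by
  have two : ∀ a : ZMod 2, a + a = 0 := by decide
  induction t generalizing ρ A with
  | var x =>
      obtain rfl := h.var_inv
      simp [Term.FV]
  | app t s ih1 ih2 =>
      obtain ⟨B, h1, h2, hd⟩ := h.app_inv
      rw [Term.FV, Finset.sum_union (FV_disjoint hd), ih1 h1, ih2 h2]
      simp only [Ty.count, Nat.cast_add]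
      linear_combination two (B.count p)
  | pair s t ih1 ih2 =>
      obtain ⟨B, C, rfl, h1, h2, hd⟩ := h.pair_inv
      rw [Term.FV, Finset.sum_union (FV_disjoint hd), ih1 h1, ih2 h2]
      simp [Ty.count]
  | lam x t ih =>
      obtain ⟨B, C, rfl, h1, hx⟩ := h.lam_inv
      have i := ih h1
      rw [sum_update_erase (fun A => (A.count p : ZMod 2)) B hx] at i
      simp only [Ty.count, Nat.cast_add, Term.FV]
      linear_combination i - two (B.count p)
  | letp x y s t ih1 ih2 =>
      obtain ⟨B, C, h1, h2, hx, hy, hxy, hd⟩ := h.letp_inv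
      have i := ih2 h2
      rw [sum_update_update (fun A => (A.count p : ZMod 2)) B C hx hy hxy] at i
      have i1 := ih1 h1
      simp only [Ty.count, Nat.cast_add] at i1
      rw [Term.FV, Finset.sum_union ((FV_disjoint hd).mono_right Finset.sdiff_subset), i1]
      linear_combination i

theorem J.subst {ρ : ℕ → Ty} {z : ℕ} {t s : Term} {A B : Ty} (h : J (Function.update ρ z B) t A)
    (hz : z ∈ t.FV) (hs : J ρ s B) (hd : ∀ x ∈ t.occ, x ∉ s.occ) :
    EqE ρ (.app (.lam z t) s) (t.subst1 z s) A := by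
  refine EqE.rule .hole ((h.lam hz).app hs fun x hx => ?_) (.beta1 _ _ _)
  rcases List.mem_cons.1 hx with rfl | hx
  · exact hd _ (Term.FV_occ hz)
  · exact hd x hx

/-- A variable of tensor type can be decomposed. -/
theorem J.open_tensor {ρ : ℕ → Ty} {t : Term} {z a b : ℕ} {A B C : Ty} (h : J ρ t A)
    (hz : z ∈ t.FV) (hρ : ρ z = .tensor B C) (hab : a ≠ b) (ha : a ∉ t.occ) (hb : b ∉ t.occ) :
    J (Function.update (Function.update ρ a B) b C) (t.subst1 z (.pair (.var a) (.var b))) A ∧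
    EqE ρ (.letp a b (.var z) (t.subst1 z (.pair (.var a) (.var b)))) t A ∧
    (t.subst1 z (.pair (.var a) (.var b))).FV = insert a (insert b (t.FV.erase z)) := by
  have hz' := Term.FV_occ hz
  have hto := t.mem_occ
  have hJ : J (Function.update (Function.update ρ a B) b C) (.pair (.var a) (.var b))
      (.tensor B C) := by
    refine J.pair ?_ ?_ ?_
    · simpa [Function.update_of_ne hab] using
        J.var (Function.update (Function.update ρ a B) b C) a
    · simpa using J.var (Function.update (Function.update ρ a B) b C) b
    · simpa [Term.occ] using hab
  have h1 : J (Function.update (Function.update (Function.update ρ a B) b C) z (.tensor B C)) t A := by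
    refine h.congr fun x hx => ?_
    simp only [Function.update]
    grind
  have e := h1.subst hz hJ (by simp only [Term.occ, List.mem_append, List.mem_singleton]; grind)
  have hFV : (t.subst1 z (.pair (.var a) (.var b))).FV = insert a (insert b (t.FV.erase z)) := by
    rw [← e.FV_eq]
    ext x
    simp only [Term.FV]
    grind
  have h2 := (J.var ρ z)
  rw [hρ] at h2
  have h3 := h2.letp e.right (by simp [hFV]) (by simp [hFV]) hab (by
    have := h.1.subst1_occ hz (.pair (.var a) (.var b))
    simp only [Term.occ, List.mem_append, List.mem_singleton] at this ⊢
    grind)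
  refine ⟨e.right, ?_, hFV⟩
  obtain ⟨D, rfl, hD⟩ := h.1.exists_plug hz
  rw [TermCtx.plug_var_subst1 hD] at h3 ⊢
  have hpo := D.mem_plug_occ (.var z)
  have hcv := D.cv_sub_occ
  have e1 := EqE.comm' h3 (by simp only [Term.FV, Finset.mem_singleton]; grind) (by grind) (by grind)
  exact e1.trans (EqE.rule D e1.right (.eta2 _ _ _))

/-- A term of tensor type is determined by its components under a generic function. -/
theorem J.tensor_close {ρ : ℕ → Ty} {t : Term} {a b k : ℕ} {B C D : Ty} (h : J ρ t (.tensor B C))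
    (hab : a ≠ b) (hak : a ≠ k) (hbk : b ≠ k) (ha : a ∉ t.occ) (hb : b ∉ t.occ) (hk : k ∉ t.occ) :
    J (Function.update ρ k (.limp B (.limp C D)))
      (.letp a b t (.app (.app (.var k) (.var a)) (.var b))) D := by
  have hto := t.mem_occ
  refine J.letp (A := B) (B := C) (h.congr fun x hx => ?_) (J.app (B := C) (J.app (B := B) ?_ ?_ ?_) ?_ ?_) ?_ ?_ hab ?_
  · rw [Function.update_of_ne]; grind
  · have := J.var (Function.update (Function.update (Function.update ρ k (.limp B (.limp C D))) a B) b C) k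
    simpa [Function.update_of_ne hak.symm, Function.update_of_ne hbk.symm] using this
  · have := J.var (Function.update (Function.update (Function.update ρ k (.limp B (.limp C D))) a B) b C) a
    simpa [Function.update_of_ne hab] using this
  · simp only [Term.occ, List.mem_singleton]; grind
  · have := J.var (Function.update (Function.update (Function.update ρ k (.limp B (.limp C D))) a B) b C) b
    simpa using this
  · simp only [Term.occ, List.mem_append, List.mem_singleton]; grind
  · simp [Term.FV]
  · simp [Term.FV]
  · simp only [Term.occ, List.mem_append, List.mem_singleton]; grind

/-- Substitute the pairing function `fn c => fn d => (c,d)` for k. The two sides contract to `let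
(a,b) = t in (a,b)` and its analogue for t', which eta2 turns into t and t'. -/
theorem EqE.of_tensor_close {ρ : ℕ → Ty} {t t' : Term} {a b k : ℕ} {B C : Ty}
    (h : J ρ t (.tensor B C)) (h' : J ρ t' (.tensor B C))
    (hab : a ≠ b) (hak : a ≠ k) (hbk : b ≠ k) (ha : a ∉ t.occ ++ t'.occ) (hb : b ∉ t.occ ++ t'.occ)
    (hk : k ∉ t.occ ++ t'.occ)
    (e : EqE (Function.update ρ k (.limp B (.limp C (.tensor B C))))
      (.letp a b t (.app (.app (.var k) (.var a)) (.var b)))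
      (.letp a b t' (.app (.app (.var k) (.var a)) (.var b))) (.tensor B C)) :
    EqE ρ t t' (.tensor B C) := by
  simp only [List.mem_append, not_or] at ha hb hk
  obtain ⟨c, d, hcd, hc, hd⟩ := exists_fresh_two (a :: b :: k :: (t.occ ++ t'.occ))
  simp only [List.mem_cons, List.mem_append, not_or] at hc hd
  have hK : J ρ (.lam c (.lam d (.pair (.var c) (.var d)))) (.limp B (.limp C (.tensor B C))) := by
    refine J.lam (J.lam (J.pair ?_ ?_ ?_) ?_) ?_
    · have := J.var (Function.update (Function.update ρ c B) d C) c
      simpa [Function.update_of_ne hcd] using this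
    · have := J.var (Function.update (Function.update ρ c B) d C) d
      simpa using this
    · simpa [Term.occ] using hcd
    · simp [Term.FV]
    · simp [Term.FV]; exact hcd
  have key : ∀ t, J ρ t (.tensor B C) → a ∉ t.occ → b ∉ t.occ → k ∉ t.occ → c ∉ t.occ → d ∉ t.occ →
      EqE ρ (.app (.lam k (.letp a b t (.app (.app (.var k) (.var a)) (.var b))))
        (.lam c (.lam d (.pair (.var c) (.var d))))) t (.tensor B C) := by
    intro t h ha hb hk hc hd
    have hto := t.mem_occ
    have j := h.tensor_close (D := .tensor B C) hab hak hbk ha hb hk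
    have e1 := j.subst (by simp [Term.FV, hak.symm, hbk.symm]) hK (by
      simp only [Term.occ, List.mem_append, List.mem_cons, List.not_mem_nil, or_false]; grind)
    rw [show Term.letp a b t (.app (.app (.var k) (.var a)) (.var b)) =
      (TermCtx.letR a b t (.appL (.appL .hole (.var a)) (.var b))).plug (.var k) from rfl,
      TermCtx.plug_var_subst1 (by
        simp only [TermCtx.occ, List.mem_append, List.mem_cons, Term.occ, List.not_mem_nil,
          or_false]; grind)] at e1
    have e2 := EqE.rule (.letR a b t (.appL .hole (.var b))) e1.right (.beta1 _ _ _)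
    rw [Term.subst1_lam hcd.symm, Term.subst1_pair, Term.subst1_var_self,
      Term.subst1_var_ne hcd.symm] at e2
    have e3 := EqE.rule (.letR a b t .hole) e2.right (.beta1 _ _ _)
    rw [Term.subst1_pair, Term.subst1_var_self, Term.subst1_var_ne (by grind)] at e3
    have e4 := EqE.rule .hole e3.right (.eta2 _ _ _)
    exact e1.trans (e2.trans (e3.trans e4))
  have hto := t.mem_occ
  have hto' := t'.mem_occ
  have e5 := (e.lam (by simp [Term.FV, hak.symm, hbk.symm])).app (.refl hK) (by
    simp only [Term.occ, List.mem_append, List.mem_cons, List.not_mem_nil, or_false]; grind) (by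
    simp only [Term.occ, List.mem_append, List.mem_cons, List.not_mem_nil, or_false]; grind)
  exact (key t h ha.1 hb.1 hk.1 (by grind) (by grind)).symm.trans
    (e5.trans (key t' h' ha.2 hb.2 hk.2 (by grind) (by grind)))

/-- The head normal form of a term of atomic type without variables of tensor type. -/
theorem J.head_cases {ρ : ℕ → Ty} {t : Term} {A : Ty} (h : J ρ t A) :
    ∀ p, A = .var p → (∀ z ∈ t.FV, ∀ B C, ρ z ≠ .tensor B C) →
      (∃ x, EqE ρ t (.var x) A) ∨
        ∃ f D E y w s, f ∈ t.FV ∧ ρ f = .limp D E ∧ EqE ρ t (splitTerm y w f s) A := by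
  refine J.induction (P := fun ρ t A => ∀ p, A = .var p → (∀ z ∈ t.FV, ∀ B C, ρ z ≠ .tensor B C) →
      (∃ x, EqE ρ t (.var x) A) ∨
        ∃ f D E y w s, f ∈ t.FV ∧ ρ f = .limp D E ∧ EqE ρ t (splitTerm y w f s) A) ?_ ?_ ?_ ?_ ?_ ?_ h
  · exact fun ρ x p e hn => .inl ⟨x, .refl (.var ρ x)⟩
  · rintro ρ x t B C - - - p ⟨⟩
  · rintro ρ s t B C - - - - - p ⟨⟩
  · intro ρ E r r' A h hr ih p e hn
    have e1 := EqE.rule E h hr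
    rcases ih p e (e1.FV_eq ▸ hn) with ⟨x, e2⟩ | ⟨f, D, E, y, w, s, hf, hρ, e2⟩
    · exact .inl ⟨x, e1.trans e2⟩
    · exact .inr ⟨f, D, E, y, w, s, e1.FV_eq ▸ hf, hρ, e1.trans e2⟩
  · intro ρ C f s z D B A h hC hρ hz hs hCz _ _ p e hn
    refine .inr ⟨f, D, B, z, _, s, ?_, hρ, h.headApp_eq hC hρ hz hs hCz⟩
    rw [C.mem_plug_FV]; simp [Term.FV, hC]
  · intro ρ C x y f w B D A h hC hρ _ _ p e hn
    refine absurd hρ (hn f ?_ _ _)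
    rw [C.mem_plug_FV]; simp [Term.FV, hC]

theorem J.split_sum {M : Type*} [AddCommMonoid M] (g : Ty → M) {ρ : ℕ → Ty} {y f : ℕ} {w s : Term}
    {A D E : Ty} (h : J ρ (splitTerm y w f s) A) (hf : ρ f = .limp D E) :
    ∑ z ∈ (splitTerm y w f s).FV, g (ρ z) =
      g (.limp D E) + (∑ z ∈ w.FV.erase y, g (ρ z) + ∑ z ∈ s.FV, g (ρ z)) := by
  obtain ⟨h1, hy, h2, h3, h4, h5, h6, h7, h8⟩ := h.split_inv hf
  have hw := w.mem_occ; have hs := s.mem_occ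
  have e : (splitTerm y w f s).FV = insert f (w.FV.erase y ∪ s.FV) := by
    ext z; simp only [splitTerm, Term.FV]; grind
  rw [e, Finset.sum_insert (by grind), hf, Finset.sum_union]
  rw [Finset.disjoint_left]; grind

theorem Ty.In_of_count {V : Set ℕ} {A : Ty} (h : ∀ p, A.count p ≠ 0 → p ∈ V) : A.In V := by
  induction A with
  | var q => exact h q (by simp [Ty.count])
  | tensor A B i1 i2 =>
      exact ⟨i1 fun p hp => h p (by simp only [Ty.count]; omega),
        i2 fun p hp => h p (by simp only [Ty.count]; omega)⟩
  | limp A B i1 i2 =>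
      exact ⟨i1 fun p hp => h p (by simp only [Ty.count]; omega),
        i2 fun p hp => h p (by simp only [Ty.count]; omega)⟩

theorem Ty.exists_fresh (A : Ty) : ∃ n, ∀ p, n ≤ p → A.count p = 0 := by
  induction A with
  | var q => exact ⟨q + 1, fun p hp => by simp only [Ty.count]; grind⟩
  | tensor A B i1 i2 =>
      obtain ⟨n, hn⟩ := i1; obtain ⟨m, hm⟩ := i2
      exact ⟨n + m, fun p hp => by simp [Ty.count, hn p (by omega), hm p (by omega)]⟩
  | limp A B i1 i2 =>
      obtain ⟨n, hn⟩ := i1; obtain ⟨m, hm⟩ := i2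
      exact ⟨n + m, fun p hp => by simp [Ty.count, hn p (by omega), hm p (by omega)]⟩

theorem exists_fresh_tyvar (ρ : ℕ → Ty) (F : Finset ℕ) (A : Ty) :
    ∃ r, A.count r = 0 ∧ ∀ z ∈ F, (ρ z).count r = 0 := by
  choose n hn using fun A : Ty => A.exists_fresh
  refine ⟨n A + ∑ z ∈ F, n (ρ z), hn _ _ (by omega), fun z hz => hn _ _ ?_⟩
  have := Finset.single_le_sum (f := fun z => n (ρ z)) (fun _ _ => Nat.zero_le _) hz
  omega

theorem Ty.bind_of_count {f : ℕ → Ty} {A : Ty} (h : ∀ p, A.count p ≠ 0 → f p = .var p) :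
    A.bind f = A := by
  induction A with
  | var q => exact h q (by simp [Ty.count])
  | tensor A B i1 i2 =>
      rw [Ty.bind, i1 fun p hp => h p (by simp only [Ty.count]; omega),
        i2 fun p hp => h p (by simp only [Ty.count]; omega)]
  | limp A B i1 i2 =>
      rw [Ty.bind, i1 fun p hp => h p (by simp only [Ty.count]; omega),
        i2 fun p hp => h p (by simp only [Ty.count]; omega)]

theorem EqE.of_app_var {ρ : ℕ → Ty} {t t' : Term} {x : ℕ} {B C : Ty} (h : J ρ t (.limp B C))
    (h' : J ρ t' (.limp B C))
    (e : EqE (Function.update ρ x B) (.app t (.var x)) (.app t' (.var x)) C) :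
    EqE ρ t t' (.limp B C) := by
  have key : ∀ t, J ρ t (.limp B C) → J (Function.update ρ x B) (.app t (.var x)) C →
      EqE ρ (.lam x (.app t (.var x))) t (.limp B C) := fun t _ j =>
    EqE.rule .hole (j.lam (by simp [Term.FV])) (.eta1 _ _)
  exact (key t h e.left).symm.trans ((e.lam (by simp [Term.FV])).trans (key t' h' e.right))

theorem J.app_var {ρ : ℕ → Ty} {t : Term} {x : ℕ} {B C : Ty} (h : J ρ t (.limp B C))
    (hx : x ∉ t.occ) : J (Function.update ρ x B) (.app t (.var x)) C := by
  refine J.app (B := B) (h.congr fun z hz => ?_) ?_ ?_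
  · rw [Function.update_of_ne (by rintro rfl; exact hx (Term.FV_occ hz))]
  · simpa using J.var (Function.update ρ x B) x
  · simp only [Term.occ, List.mem_singleton]; grind

/-- The separation of the type variables in a balanced split sequent. -/
theorem J.split_balanced {ρ : ℕ → Ty} {y f : ℕ} {w s : Term} {A D E : Ty}
    (h : J ρ (splitTerm y w f s) A) (hf : ρ f = .limp D E)
    (hb : ∀ p, ∑ z ∈ (splitTerm y w f s).FV, (ρ z).count p + A.count p ≤ 2) :
    ∃ V : Set ℕ, D.In Vᶜ ∧ E.In V ∧ A.In V ∧
      ∀ z ∈ (splitTerm y w f s).FV, z ≠ f → (ρ z).Mono V := by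
  -- V consists of the atoms of the sequent of w, from which f and its argument have been cut off.
  let V : Set ℕ := {p | ∑ z ∈ w.FV.erase y, (ρ z).count p + E.count p + A.count p ≠ 0}
  obtain ⟨h1, hy, h2, -⟩ := h.split_inv hf
  -- By parity an atom of that sequent occurs in it at least twice. Balance leaves no further
  -- occurrence for D or for the variables of s.
  have key : ∀ p ∈ V, D.count p = 0 ∧ ∑ z ∈ s.FV, (ρ z).count p = 0 := by
    intro p hp
    have h3 := h1.parity p
    rw [sum_update_erase (fun A => (A.count p : ZMod 2)) E hy] at h3
    have h4 : ((∑ z ∈ w.FV.erase y, (ρ z).count p + E.count p + A.count p : ℕ) : ZMod 2) = 0 := by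
      have two : ∀ a : ZMod 2, a + a = 0 := by decide
      push_cast
      linear_combination h3 + two (A.count p)
    rw [ZMod.natCast_eq_zero_iff] at h4
    have h5 := hb p
    rw [h.split_sum (fun A => A.count p) hf] at h5
    simp only [Ty.count] at h5
    simp only [V, Set.mem_ofPred_eq] at hp
    omega
  have le : ∀ {F : Finset ℕ} {z p : ℕ}, z ∈ F → (ρ z).count p ≤ ∑ z ∈ F, (ρ z).count p :=
    fun {F z p} hz => Finset.single_le_sum (f := fun z => (ρ z).count p) (fun _ _ => Nat.zero_le _) hz
  refine ⟨V, Ty.In_of_count fun p hp hV => hp (key p hV).1, Ty.In_of_count fun p hp => ?_,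
    Ty.In_of_count fun p hp => ?_, fun z hz hzf => ?_⟩
  · simp only [V, Set.mem_ofPred_eq]; omega
  · simp only [V, Set.mem_ofPred_eq]; omega
  · have hz' : z ∈ w.FV.erase y ∨ z ∈ s.FV := by
      simp only [splitTerm, Term.FV] at hz; grind
    rcases hz' with hz' | hz'
    · refine .inl (Ty.In_of_count fun p hp => ?_)
      have := le (p := p) hz'
      simp only [V, Set.mem_ofPred_eq]; omega
    · refine .inr (Ty.In_of_count fun p hp hV => ?_)
      have := le (p := p) hz'
      have := (key p hV).2
      omega

/-- Coherence: terms of the same balanced sequent are equal. -/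
theorem EqE.of_balanced {ρ : ℕ → Ty} {t t' : Term} {A : Ty} (h : J ρ t A) (h' : J ρ t' A)
    (hFV : t.FV = t'.FV) (hb : ∀ p, ∑ z ∈ t.FV, (ρ z).count p + A.count p ≤ 2) :
    EqE ρ t t' A := by
  -- The weight of the sequent decreases in every case, whatever the terms are.
  obtain ⟨n, hn⟩ : ∃ n, ∑ z ∈ t.FV, (ρ z).wt + A.wt = n := ⟨_, rfl⟩
  induction n using Nat.strong_induction_on generalizing ρ t t' A with
  | _ n ih =>
  have hto := t.mem_occ; have hto' := t'.mem_occ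
  by_cases ht : ∃ z ∈ t.FV, ∃ B C, ρ z = .tensor B C
  -- A tensor hypothesis is replaced by its two components, without changing the counts of atoms; a
  -- `let` recovers the original terms.
  · obtain ⟨z, hz, B, C, hρ⟩ := ht
    obtain ⟨a, b, hab, ha, hb'⟩ := exists_fresh_two (t.occ ++ t'.occ)
    simp only [List.mem_append, not_or] at ha hb'
    obtain ⟨j1, e1, f1⟩ := h.open_tensor hz hρ hab ha.1 hb'.1
    obtain ⟨j2, e2, f2⟩ := h'.open_tensor (hFV ▸ hz) hρ hab ha.2 hb'.2
    have hsum : ∀ g : Ty → ℕ, ∑ x ∈ (t.subst1 z (.pair (.var a) (.var b))).FV,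
        g (Function.update (Function.update ρ a B) b C x) =
          g B + g C + ∑ x ∈ t.FV.erase z, g (ρ x) := by
      intro g
      rw [sum_update_update g B C (by simp [f1]) (by simp [f1]) hab, f1]
      rw [show insert a (insert b (t.FV.erase z)) \ {a, b} = t.FV.erase z by grind]
      ring
    have hsum' : ∀ g : Ty → ℕ, ∑ x ∈ t.FV, g (ρ x) =
        g (.tensor B C) + ∑ x ∈ t.FV.erase z, g (ρ x) := by
      intro g
      rw [← Finset.add_sum_erase _ _ hz, hρ]
    have e3 := ih (B.wt + C.wt + ∑ x ∈ t.FV.erase z, (ρ x).wt + A.wt) (by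
      rw [hsum' Ty.wt, Ty.wt] at hn
      omega) j1 j2 (by rw [f1, f2, hFV]) (fun p => by
      have := hb p
      rw [hsum' (fun A => A.count p), Ty.count] at this
      rw [hsum (fun A => A.count p)]
      exact this) (by rw [hsum Ty.wt])
    refine e1.symm.trans (EqE.trans (EqE.letp (A := B) (B := C) ?_ e3 ?_ ?_ hab ?_ ?_) e2)
    · have := J.var ρ z
      rw [hρ] at this
      exact .refl this
    · simp [f1]
    · simp [f1]
    · have := h.1.subst1_occ hz (.pair (.var a) (.var b))
      simp only [Term.occ, List.mem_append, List.mem_singleton] at this ⊢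
      grind
    · have := h'.1.subst1_occ (hFV ▸ hz) (.pair (.var a) (.var b))
      simp only [Term.occ, List.mem_append, List.mem_singleton] at this ⊢
      grind
  push Not at ht
  match A, h, h', hb, hn with
  | .limp B C, h, h', hb, hn =>
      -- A functional conclusion is tested on a fresh variable; eta recovers the equality of the
      -- functions.
      obtain ⟨x, hx⟩ := exists_fresh (t.occ.toFinset ∪ t'.occ.toFinset)
      simp only [Finset.mem_union, List.mem_toFinset, not_or] at hx
      have hsum : ∀ g : Ty → ℕ, ∑ z ∈ (Term.app t (.var x)).FV, g (Function.update ρ x B z) =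
          g B + ∑ z ∈ t.FV, g (ρ z) := by
        intro g
        rw [sum_update_erase g B (by simp [Term.FV])]
        rw [show (Term.app t (.var x)).FV.erase x = t.FV by simp only [Term.FV]; grind]
      refine EqE.of_app_var h h' (ih _ ?_ (h.app_var hx.1) (h'.app_var hx.2)
        (by simp only [Term.FV, hFV]) ?_ rfl)
      · rw [hsum, ← hn, Ty.wt]; omega
      · intro p
        have := hb p
        rw [hsum (fun A => A.count p)]
        simp only [Ty.count] at this
        omega
  | .tensor B C, h, h', hb, hn =>
      obtain ⟨a, b, hab, ha, hb'⟩ := exists_fresh_two (t.occ ++ t'.occ)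
      obtain ⟨k, hk⟩ := exists_fresh (insert a (insert b (t.occ ++ t'.occ).toFinset))
      simp only [Finset.mem_insert, List.mem_toFinset, not_or] at hk
      -- A tensor conclusion is turned into a hypothesis: the components are passed to a variable k
      -- : B ⊸ (C ⊸ r). The fresh atom r occurs exactly twice, in the type of k and in the new
      -- conclusion, so balance is kept.
      obtain ⟨r, hrA, hr⟩ := exists_fresh_tyvar ρ t.FV (.tensor B C)
      simp only [List.mem_append, not_or] at ha hb' hk
      have hsum : ∀ g : Ty → ℕ, ∑ z ∈ (Term.letp a b t (.app (.app (.var k) (.var a)) (.var b))).FV,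
          g (Function.update ρ k (.limp B (.limp C (.var r))) z) =
          g (.limp B (.limp C (.var r))) + ∑ z ∈ t.FV, g (ρ z) := by
        intro g
        rw [sum_update_erase g _ (by simp only [Term.FV]; grind)]
        rw [show (Term.letp a b t (.app (.app (.var k) (.var a)) (.var b))).FV.erase k = t.FV by
          simp only [Term.FV]; grind]
      have hak := Ne.symm hk.1
      have hbk := Ne.symm hk.2.1
      have e1 := ih
        (Ty.wt (.limp B (.limp C (.var r))) + ∑ z ∈ t.FV, (ρ z).wt + Ty.wt (.var r))
        -- The type of k and the conclusion r together add 4 to the weights of B and C; this is why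
        -- a tensor has weight 5 beyond its components.
        (by rw [← hn]; simp only [Ty.wt]; omega)
        (h.tensor_close (D := .var r) hab hak hbk ha.1 hb'.1 hk.2.2.1)
        (h'.tensor_close (D := .var r) hab hak hbk ha.2 hb'.2 hk.2.2.2)
        (by simp only [Term.FV, hFV]) (fun p => by
          rw [hsum (fun A => A.count p)]
          have h1 := hb p
          by_cases e : r = p
          · subst e
            have h2 : ∑ z ∈ t.FV, (ρ z).count r = 0 := Finset.sum_eq_zero hr
            simp only [Ty.count] at hrA ⊢
            rw [h2]; simp; omega
          · simp only [Ty.count, e, if_false] at h1 ⊢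
            omega) (by rw [hsum])
      -- Instantiating r by B ⊗ C affects neither B and C nor the types of the context, and makes
      -- the pairing function an admissible value of k.
      have e2 := e1.bind (Function.update Ty.var r (.tensor B C))
      have hbd : ∀ A : Ty, A.count r = 0 → A.bind (Function.update Ty.var r (.tensor B C)) = A := by
        intro A hA
        refine Ty.bind_of_count fun p hp => ?_
        rw [Function.update_of_ne (by rintro rfl; exact hp hA)]
      have hB : B.count r = 0 := by simp only [Ty.count] at hrA; omega
      have hC : C.count r = 0 := by simp only [Ty.count] at hrA; omega
      simp only [Ty.bind, Function.update_self] at e2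
      refine EqE.of_tensor_close h h' hab hak hbk (by simp [ha]) (by simp [hb']) (by simp [hk])
        (e2.congr_env ?_)
      intro z hz
      by_cases e : z = k
      · subst e; simp [Ty.bind, hbd B hB, hbd C hC]
      · simp only [Function.update_of_ne e]
        refine hbd _ (hr z ?_)
        simp only [Term.FV] at hz
        grind
  | .var p, h, h', hb, hn =>
      rcases h.head_cases p rfl ht with ⟨x, e⟩ | ⟨f, D, E, y, w, s, hf, hρ, e⟩
      · have hx : t.FV = {x} := e.FV_eq
        have hρx := e.right.var_inv
        refine e.trans (EqE.symm ?_)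
        -- The only free variable has atomic type, so t' cannot have a function as head and equals
        -- the same variable.
        rcases h'.head_cases p rfl (hFV ▸ ht) with ⟨x', e'⟩ | ⟨f, D, E, y, w, s, hf, hρ, -⟩
        · have hx' : t'.FV = {x'} := e'.FV_eq
          rw [← hFV, hx, Finset.singleton_inj] at hx'
          exact hx' ▸ e'
        · rw [← hFV, hx, Finset.mem_singleton] at hf
          rw [← hf, hρ] at hρx
          cases hρx
      · obtain ⟨V, hD, hE, hA, hm⟩ := e.right.split_balanced hρ (e.FV_eq ▸ hb)
        rw [← e.FV_eq] at hm
        -- The colouring found from t depends only on the common sequent for its use here, so the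
        -- same f can be brought to the front of t'.
        obtain ⟨y', w', s', e'⟩ := h'.exists_split f D E (hFV ▸ hf) hρ (hFV ▸ hm) hD hE hA
        obtain ⟨c1, c2⟩ := e.split_colours hρ hm hD hE hA
        obtain ⟨c1', c2'⟩ := e'.split_colours hρ (hFV ▸ hm) hD hE hA
        obtain ⟨h1, h2, h3, h4, h5, h6, h7, h8, h9⟩ := e.right.split_inv hρ
        obtain ⟨h1', h2', h3', h4', h5', h6', h7', h8', h9'⟩ := e'.right.split_inv hρ
        have fv : ∀ z, z ∈ (splitTerm y w f s).FV ↔ z ∈ (splitTerm y' w' f s').FV := by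
          rw [← e.FV_eq, ← e'.FV_eq, hFV]; simp
        have hwo := w.mem_occ; have hwo' := w'.mem_occ; have hso := s.mem_occ
        have hso' := s'.mem_occ
        -- A variable other than f belongs to the argument or to the rest according to its colour;
        -- the two splittings therefore use the same contexts, and the induction hypothesis applies
        -- to both parts.
        simp only [splitTerm, Term.FV, Finset.mem_union, Finset.mem_erase,
          Finset.mem_singleton] at fv
        have nc : ∀ z, (ρ z).In V → ¬ (ρ z).In Vᶜ := fun z h => h.not_compl
        have fs : s.FV = s'.FV := by ext z; grind
        have fw : w.FV.erase y = w'.FV.erase y' := by ext z; grind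
        -- The cut variables y and y' receive a common name before the two remaining terms are
        -- compared.
        obtain ⟨x, hx⟩ := exists_fresh (((Term.lam y w).occ ++ (Term.lam y' w').occ).toFinset)
        simp only [List.mem_append, List.mem_toFinset, not_or] at hx
        have a1 := (h1.lam h2).alpha hx.1
        have a2 := (h1'.lam h2').alpha hx.2
        have hsum : ∀ g : Ty → ℕ, ∑ z ∈ t.FV, g (ρ z) =
            g (.limp D E) + (∑ z ∈ w.FV.erase y, g (ρ z) + ∑ z ∈ s.FV, g (ρ z)) := by
          intro g
          rw [e.FV_eq]; exact e.right.split_sum g hρ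
        have es := ih _ (by
          rw [← hn, hsum Ty.wt]
          simp only [Ty.wt]
          show ∑ z ∈ s.FV, (ρ z).wt + D.wt < _
          omega) h3 h3' fs (fun q => by
          have := hb q
          rw [hsum (fun A => A.count q)] at this
          simp only [Ty.count] at this ⊢
          omega) rfl
        obtain ⟨_, _, r1, k1, k2⟩ := a1.right.lam_inv
        cases r1
        obtain ⟨_, _, r1, k1', k2'⟩ := a2.right.lam_inv
        cases r1
        have g1 : (w.subst1 y (.var x)).FV.erase x = w.FV.erase y := a1.FV_eq.symm
        have g2 : (w'.subst1 y' (.var x)).FV.erase x = w'.FV.erase y' := a2.FV_eq.symm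
        have hsum2 : ∀ g : Ty → ℕ, ∑ z ∈ (w.subst1 y (.var x)).FV, g (Function.update ρ x E z) =
            g E + ∑ z ∈ w.FV.erase y, g (ρ z) := by
          intro g
          rw [sum_update_erase g E k2, g1]
        have ew := ih _ (by
          rw [← hn, hsum Ty.wt]
          show E.wt + ∑ z ∈ w.FV.erase y, (ρ z).wt + Ty.wt (.var p) < _
          simp only [Ty.wt]
          omega) k1 k1' (by
            rw [← Finset.insert_erase k2, ← Finset.insert_erase k2', g1, g2, fw]) (fun q => by
          have := hb q
          rw [hsum (fun A => A.count q)] at this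
          rw [hsum2 (fun A => A.count q)]
          simp only [Ty.count] at this ⊢
          omega) (by rw [hsum2])
        have hJf : J ρ (.var f) (.limp D E) := by
          have := J.var ρ f
          rwa [hρ] at this
        refine e.trans (EqE.trans ?_ e'.symm)
        refine EqE.app (A := E) (a1.trans ((ew.lam k2).trans a2.symm)) (EqE.app (.refl hJf) es ?_ ?_) ?_ ?_ <;>
          simp only [Term.occ, List.mem_append, List.mem_cons, List.not_mem_nil, or_false] <;> grind

/-! ### Links and labellings -/

/-- The formula of a signed formula. -/
def SFormula.ty : SFormula → Ty
  | .pos A => A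
  | .neg A => A

namespace Link
variable {V W : Type}

/-- The premises of a link. -/
def prems : Link V → List V
  | .ax _ _ => []
  | .cut p n => [p, n]
  | .tensorPos a b _ => [a, b]
  | .tensorNeg a b _ => [a, b]
  | .limpPos a b _ => [a, b]
  | .limpNeg a b _ => [a, b]

/-- The conclusions of a link. -/
def concls : Link V → List V
  | .ax p n => [p, n]
  | .cut _ _ => []
  | .tensorPos _ _ c => [c]
  | .tensorNeg _ _ c => [c]
  | .limpPos _ _ c => [c]
  | .limpNeg _ _ c => [c]

/-- A labelling of the occurrences by types is consistent with a link. -/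
def Ok (f : V → Ty) : Link V → Prop
  | .ax p n => f p = f n
  | .cut p n => f p = f n
  | .tensorPos a b c => f c = .tensor (f a) (f b)
  | .tensorNeg a b c => f c = .tensor (f a) (f b)
  | .limpPos a b c => f c = .limp (f a) (f b)
  | .limpNeg a b c => f c = .limp (f a) (f b)

/-- The occurrences in a link carry the right signed formulas. -/
def Typed (f : V → SFormula) : Link V → Prop
  | .ax p n => ∃ A, f p = .pos A ∧ f n = .neg A
  | .cut p n => ∃ A, f p = .pos A ∧ f n = .neg A
  | .tensorPos a b c => ∃ A B, f a = .pos A ∧ f b = .pos B ∧ f c = .pos (.tensor A B)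
  | .tensorNeg a b c => ∃ A B, f a = .neg A ∧ f b = .neg B ∧ f c = .neg (.tensor A B)
  | .limpPos a b c => ∃ A B, f a = .neg A ∧ f b = .pos B ∧ f c = .pos (.limp A B)
  | .limpNeg a b c => ∃ A B, f a = .pos A ∧ f b = .neg B ∧ f c = .neg (.limp A B)

theorem prems_map (g : V → W) (l : Link V) : (l.map g).prems = l.prems.map g := by
  cases l <;> rfl

theorem concls_map (g : V → W) (l : Link V) : (l.map g).concls = l.concls.map g := by
  cases l <;> rfl

theorem ok_map (g : V → W) (f : W → Ty) (l : Link V) : (l.map g).Ok f ↔ l.Ok (f ∘ g) := by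
  cases l <;> rfl

theorem typed_map (g : V → W) (f : W → SFormula) (l : Link V) :
    (l.map g).Typed f ↔ l.Typed (f ∘ g) := by
  cases l <;> rfl

theorem Ok.congr {f f' : V → Ty} {l : Link V} (h : l.Ok f) (h1 : ∀ v ∈ l.prems, f' v = f v)
    (h2 : ∀ v ∈ l.concls, f' v = f v) : l.Ok f' := by
  cases l <;> simp only [prems, concls, List.mem_cons, List.not_mem_nil, or_false,
    forall_eq_or_imp, forall_eq, Ok] at * <;> grind

theorem Typed.congr {f f' : V → SFormula} {l : Link V} (h : l.Typed f)
    (h1 : ∀ v ∈ l.prems, f' v = f v) (h2 : ∀ v ∈ l.concls, f' v = f v) : l.Typed f' := by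
  cases l <;> simp only [prems, concls, List.mem_cons, List.not_mem_nil, or_false,
    forall_eq_or_imp, forall_eq, Typed] at * <;> grind

theorem Typed.ok {f : V → SFormula} {l : Link V} (h : l.Typed f) : l.Ok fun v => (f v).ty := by
  cases l with
  | ax => obtain ⟨A, h1, h2⟩ := h; simp [Ok, h1, h2, SFormula.ty]
  | cut => obtain ⟨A, h1, h2⟩ := h; simp [Ok, h1, h2, SFormula.ty]
  | _ => obtain ⟨A, B, h1, h2, h3⟩ := h; simp [Ok, h1, h2, h3, SFormula.ty]

theorem map_map {X : Type} (g : V → W) (g' : W → X) (l : Link V) :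
    (l.map g).map g' = l.map (g' ∘ g) := by
  cases l <;> rfl

theorem map_id (l : Link V) : l.map id = l := by cases l <;> rfl

theorem map_injective {g : V → W} (hg : Function.Injective g) :
    Function.Injective (Link.map g) := by
  intro l l' h
  cases l <;> cases l' <;> simp only [Link.map, reduceCtorEq, Link.ax.injEq, Link.cut.injEq,
    Link.tensorPos.injEq, Link.tensorNeg.injEq, Link.limpPos.injEq, Link.limpNeg.injEq] at h ⊢ <;>
    simpa [hg.eq_iff] using h

end Link

/-- The lists `f l`, for `l` in `L`, are without repetitions and partition `S`. -/
structure Cov {ι V : Type} (f : ι → List V) (L : Set ι) (S : Set V) : Prop where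
  nodup : ∀ l ∈ L, (f l).Nodup
  unique : ∀ l ∈ L, ∀ l' ∈ L, ∀ v ∈ f l, v ∈ f l' → l = l'
  mem : ∀ v, v ∈ S ↔ ∃ l ∈ L, v ∈ f l

namespace Cov
variable {ι V W : Type} {f : ι → List V} {L K : Set ι} {S T : Set V}

theorem union (h : Cov f L S) (h' : Cov f K T) (hd : ∀ v ∈ S, v ∉ T) : Cov f (L ∪ K) (S ∪ T) := by
  have m := h.mem; have m' := h'.mem; have u := h.unique; have u' := h'.unique
  refine ⟨fun l hl => hl.elim (h.nodup l) (h'.nodup l), ?_, ?_⟩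
  · rintro l (hl | hl) l' (hl' | hl') v hv hv'
    · exact u l hl l' hl' v hv hv'
    · exact absurd ((m' v).2 ⟨l', hl', hv'⟩) (hd v ((m v).2 ⟨l, hl, hv⟩))
    · exact absurd ((m' v).2 ⟨l, hl, hv⟩) (hd v ((m v).2 ⟨l', hl', hv'⟩))
    · exact u' l hl l' hl' v hv hv'
  · intro v
    simp only [Set.mem_union]
    grind

theorem single {l : ι} (h : (f l).Nodup) : Cov f {l} {v | v ∈ f l} :=
  ⟨by simpa using h, by simp, by simp⟩

theorem diff (h : Cov f L S) (hK : K ⊆ L) : Cov f (L \ K) (S \ {v | ∃ l ∈ K, v ∈ f l}) := by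
  refine ⟨fun l hl => h.nodup l hl.1, fun l hl l' hl' => h.unique l hl.1 l' hl'.1, fun v => ?_⟩
  simp only [Set.mem_sdiff, h.mem, Set.mem_ofPred_eq, not_exists, not_and]
  constructor
  · rintro ⟨⟨l, hl, hv⟩, h'⟩
    exact ⟨l, ⟨hl, fun hK => h' l hK hv⟩, hv⟩
  · rintro ⟨l, ⟨hl, hlK⟩, hv⟩
    refine ⟨⟨l, hl, hv⟩, fun l' hl' hv' => hlK ?_⟩
    rwa [h.unique l hl l' (hK hl') v hv hv']

theorem map {f : Link V → List V} {f' : Link W → List W} {g : V → W} {L : Set (Link V)}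
    (hf : ∀ l, f' (l.map g) = (f l).map g) (h : Cov f L S) (hg : Set.InjOn g S) :
    Cov f' (Link.map g '' L) (g '' S) := by
  have hS : ∀ l ∈ L, ∀ v ∈ f l, v ∈ S := fun l hl v hv => (h.mem v).2 ⟨l, hl, hv⟩
  refine ⟨?_, ?_, fun v => ?_⟩
  · rintro _ ⟨l, hl, rfl⟩
    rw [hf]
    exact (h.nodup l hl).map_on fun x hx y hy e => hg (hS l hl x hx) (hS l hl y hy) e
  · rintro _ ⟨l, hl, rfl⟩ _ ⟨l', hl', rfl⟩ v hv hv'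
    simp only [hf, List.mem_map] at hv hv'
    obtain ⟨u, hu, rfl⟩ := hv
    obtain ⟨u', hu', e⟩ := hv'
    obtain rfl := hg (hS l' hl' u' hu') (hS l hl u hu) e
    rw [h.unique l hl l' hl' u' hu hu']
  · constructor
    · rintro ⟨u, hu, rfl⟩
      obtain ⟨l, hl, hv⟩ := (h.mem u).1 hu
      exact ⟨_, ⟨l, hl, rfl⟩, by rw [hf]; exact List.mem_map_of_mem hv⟩
    · rintro ⟨_, ⟨l, hl, rfl⟩, hv⟩
      rw [hf, List.mem_map] at hv
      obtain ⟨u, hu, rfl⟩ := hv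
      exact ⟨u, hS l hl u hu, rfl⟩

theorem comap {f : Link V → List V} {f' : Link W → List W} {g : V → W} {L : Set (Link V)}
    {T : Set W} (hf : ∀ l, f' (l.map g) = (f l).map g) (hg : Function.Injective g)
    (h : Cov f' (Link.map g '' L) T) : Cov f L (g ⁻¹' T) := by
  refine ⟨fun l hl => ?_, fun l hl l' hl' v hv hv' => ?_, fun v => ?_⟩
  · have := h.nodup _ ⟨l, hl, rfl⟩
    rw [hf] at this
    exact this.of_map _
  · refine Link.map_injective hg (h.unique _ ⟨l, hl, rfl⟩ _ ⟨l', hl', rfl⟩ (g v) ?_ ?_) <;> rw [hf]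
    · exact List.mem_map_of_mem hv
    · exact List.mem_map_of_mem hv'
  · rw [Set.mem_preimage, h.mem]
    simp only [Set.mem_image, exists_exists_and_eq_and, hf, List.mem_map, hg.eq_iff,
      exists_eq_right]

theorem congr (h : Cov f L S) (hL : L = K) (hS : ∀ v, v ∈ S ↔ v ∈ T) : Cov f K T := by
  obtain rfl : S = T := Set.ext hS
  exact hL ▸ h

end Cov

/-! ### Well-formed structures and their closure under the net constructions -/

/-- The invariants of proof nets that hold along reductions. -/
structure Good (Θ : PStruct) : Prop where
  finite : Θ.links.Finite
  typed : ∀ l ∈ Θ.links, l.Typed Θ.form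
  concls : Cov Link.concls Θ.links Set.univ
  prems : Cov Link.prems Θ.links {v | v ≠ Θ.concl ∧ v ∉ Θ.hyps}
  nodup : (Θ.concl :: Θ.hyps).Nodup

/-- The conclusions of a structure. -/
def Bdry (Γ : List Ty) (A : Ty) (Θ : PStruct) : Prop :=
  Θ.hyps.map Θ.form = Γ.map .neg ∧ Θ.form Θ.concl = .pos A

namespace PStruct

theorem swapAt_map {α β : Type} (f : α → β) (n : ℕ) (l : List α) :
    swapAt n (l.map f) = (swapAt n l).map f := by
  induction n generalizing l with
  | zero => rcases l with _ | ⟨a, _ | ⟨b, l⟩⟩ <;> rfl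
  | succ n ih => rcases l with _ | ⟨a, l⟩ <;> simp [swapAt, ih]

theorem swapAt_swapAt {α : Type} (n : ℕ) (l : List α) : swapAt n (swapAt n l) = l := by
  induction n generalizing l with
  | zero => rcases l with _ | ⟨a, _ | ⟨b, l⟩⟩ <;> rfl
  | succ n ih => rcases l with _ | ⟨a, l⟩ <;> simp [swapAt, ih]

theorem swapAt_append {α : Type} (l m : List α) (a b : α) :
    swapAt l.length (l ++ a :: b :: m) = l ++ b :: a :: m := by
  induction l with
  | nil => rfl
  | cons c l ih => simp [swapAt, ih]

theorem swapAt_perm {α : Type} (n : ℕ) (l : List α) : (swapAt n l).Perm l := by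
  induction n generalizing l with
  | zero =>
      rcases l with _ | ⟨a, _ | ⟨b, l⟩⟩
      · rfl
      · rfl
      · exact .swap _ _ _
  | succ n ih =>
      rcases l with _ | ⟨a, l⟩
      · rfl
      · exact (ih l).cons a

/-- Link sets given by the first two negative conclusions. -/
theorem setOf_cons_cons {α β : Type} {l : List α} {a b : α} {r : List α} (h : l = a :: b :: r)
    (f : α → α → β) : {x | ∃ a b r, l = a :: b :: r ∧ x = f a b} = {f a b} := by
  subst h
  ext x
  simp

theorem setOf_cons {α β : Type} {l : List α} {a : α} {r : List α} (h : l = a :: r)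
    (f : α → β) : {x | ∃ a r, l = a :: r ∧ x = f a} = {f a} := by
  subst h
  ext x
  simp

end PStruct

open PStruct

theorem Good.exch {Θ : PStruct} (h : Good Θ) (n : ℕ) : Good (Θ.exch n) where
  finite := h.finite
  typed := h.typed
  concls := h.concls
  prems := h.prems.congr rfl fun v => by
    simp [(swapAt_perm n Θ.hyps).mem_iff]
  nodup := ((swapAt_perm n Θ.hyps).cons _).nodup_iff.2 h.nodup

theorem Good.idLink (A : Ty) : Good (.idLink A) where
  finite := Set.finite_singleton _
  typed := by
    rintro l rfl
    exact ⟨A, rfl, rfl⟩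
  concls := (Cov.single (by simp [Link.concls])).congr rfl fun v => by
    cases v <;> simp [Link.concls]
  prems := (Cov.single (by simp [Link.prems])).congr rfl fun v => by
    cases v <;> simp [Link.prems]
  nodup := by simp

theorem some_inl_injective {V W : Type} :
    Function.Injective (fun v : V => (some (.inl v) : Option (V ⊕ W))) :=
  fun _ _ h => by simpa using h

theorem some_inr_injective {V W : Type} :
    Function.Injective (fun v : W => (some (.inr v) : Option (V ⊕ W))) :=
  fun _ _ h => by simpa using h

theorem Good.tensorPos {A B : Ty} {Θ Ξ : PStruct} (h1 : Good Θ) (h2 : Good Ξ)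
    (f1 : Θ.form Θ.concl = .pos A) (f2 : Ξ.form Ξ.concl = .pos B) : Good (.tensorPos A B Θ Ξ) where
  finite := ((h1.finite.image _).union (h2.finite.image _)).union (Set.finite_singleton _)
  typed := by
    rintro l ((⟨l, hl, rfl⟩ | ⟨l, hl, rfl⟩) | rfl)
    · exact (Link.typed_map _ _ _).2 (h1.typed l hl)
    · exact (Link.typed_map _ _ _).2 (h2.typed l hl)
    · exact ⟨A, B, f1, f2, rfl⟩
  concls := (((h1.concls.map (Link.concls_map _) some_inl_injective.injOn).union
    (h2.concls.map (Link.concls_map _) some_inr_injective.injOn) (by simp)).union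
    (Cov.single (l := .tensorPos (some (.inl Θ.concl)) (some (.inr Ξ.concl)) none)
      (by simp [Link.concls])) (by simp [Link.concls]; grind)).congr rfl fun v => by
    rcases v with _ | v | v <;> simp [Link.concls]
  prems := (((h1.prems.map (Link.prems_map _) some_inl_injective.injOn).union
    (h2.prems.map (Link.prems_map _) some_inr_injective.injOn) (by simp; grind)).union
    (Cov.single (l := .tensorPos (some (.inl Θ.concl)) (some (.inr Ξ.concl)) none)
      (by simp [Link.prems])) (by simp [Link.prems]; grind)).congr rfl fun v => by
    have := h1.nodup; have := h2.nodup
    rcases v with _ | v | v <;> simp [Link.prems] <;> grind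
  nodup := by
    have := h1.nodup; have := h2.nodup
    simp only [List.nodup_cons, List.nodup_append, List.mem_append, List.mem_map,
      List.nodup_map_iff some_inl_injective, List.nodup_map_iff some_inr_injective] at *
    grind

theorem Good.tensorNeg {A B : Ty} {Θ : PStruct} {a b : Θ.Occ} {r : List Θ.Occ} (h : Good Θ)
    (e : Θ.hyps = a :: b :: r) (fa : Θ.form a = .neg A) (fb : Θ.form b = .neg B) :
    Good (.tensorNeg A B Θ) := by
  have hn := h.nodup
  have hs := setOf_cons_cons e fun a b => (.tensorNeg (some a) (some b) none : Link (Option Θ.Occ))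
  rw [e] at hn
  have inj := Option.some_injective Θ.Occ
  refine ⟨?_, ?_, ?_, ?_, ?_⟩
  · rw [PStruct.tensorNeg, hs]
    exact (h.finite.image _).union (Set.finite_singleton _)
  · rw [PStruct.tensorNeg, hs]
    rintro l (⟨l, hl, rfl⟩ | rfl)
    · exact (Link.typed_map _ _ _).2 (h.typed l hl)
    · exact ⟨A, B, fa, fb, rfl⟩
  · rw [PStruct.tensorNeg, hs]
    refine ((h.concls.map (Link.concls_map _) inj.injOn).union (Cov.single ?_) ?_).congr rfl
      fun v => ?_
    · simp [Link.concls]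
    · simp [Link.concls]
    · rcases v with _ | v <;> simp [Link.concls]
  · rw [PStruct.tensorNeg, hs]
    refine ((h.prems.map (Link.prems_map _) inj.injOn).union (Cov.single ?_) ?_).congr rfl
      fun v => ?_
    · simp only [Link.prems]; grind
    · simp [Link.prems, e]; grind
    · rcases v with _ | v <;> simp [Link.prems, e] <;> grind
  · simp only [e, List.drop_succ_cons, List.drop_zero, List.nodup_cons, List.mem_cons, List.mem_map,
      List.nodup_map_iff inj] at *
    grind

theorem Good.limpPos {A B : Ty} {Θ : PStruct} {a : Θ.Occ} {r : List Θ.Occ} (h : Good Θ)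
    (e : Θ.hyps = a :: r) (fa : Θ.form a = .neg A) (fb : Θ.form Θ.concl = .pos B) :
    Good (.limpPos A B Θ) := by
  have hn := h.nodup
  have hs := setOf_cons e fun a => (.limpPos (some a) (some Θ.concl) none : Link (Option Θ.Occ))
  rw [e] at hn
  have inj := Option.some_injective Θ.Occ
  refine ⟨?_, ?_, ?_, ?_, ?_⟩
  · rw [PStruct.limpPos, hs]
    exact (h.finite.image _).union (Set.finite_singleton _)
  · rw [PStruct.limpPos, hs]
    rintro l (⟨l, hl, rfl⟩ | rfl)
    · exact (Link.typed_map _ _ _).2 (h.typed l hl)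
    · exact ⟨A, B, fa, fb, rfl⟩
  · rw [PStruct.limpPos, hs]
    refine ((h.concls.map (Link.concls_map _) inj.injOn).union (Cov.single ?_) ?_).congr rfl
      fun v => ?_
    · simp [Link.concls]
    · simp [Link.concls]
    · rcases v with _ | v <;> simp [Link.concls]
  · rw [PStruct.limpPos, hs]
    refine ((h.prems.map (Link.prems_map _) inj.injOn).union (Cov.single ?_) ?_).congr rfl
      fun v => ?_
    · simp only [Link.prems]; grind
    · simp [Link.prems, e]; grind
    · rcases v with _ | v <;> simp [Link.prems, e] <;> grind
  · simp only [e, List.drop_succ_cons, List.drop_zero, List.nodup_cons, List.mem_cons, List.mem_map,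
      List.nodup_map_iff inj] at *
    grind

theorem Good.limpNeg {A B : Ty} {Θ Ξ : PStruct} {b : Ξ.Occ} {r : List Ξ.Occ} (h1 : Good Θ)
    (h2 : Good Ξ) (e : Ξ.hyps = b :: r) (fa : Θ.form Θ.concl = .pos A) (fb : Ξ.form b = .neg B) :
    Good (.limpNeg A B Θ Ξ) := by
  have hn1 := h1.nodup
  have hn := h2.nodup
  have hs := setOf_cons e fun b =>
    (.limpNeg (some (.inl Θ.concl)) (some (.inr b)) none : Link (Option (Θ.Occ ⊕ Ξ.Occ)))
  rw [e] at hn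
  refine ⟨?_, ?_, ?_, ?_, ?_⟩
  · rw [PStruct.limpNeg, hs]
    exact ((h1.finite.image _).union (h2.finite.image _)).union (Set.finite_singleton _)
  · rw [PStruct.limpNeg, hs]
    rintro l ((⟨l, hl, rfl⟩ | ⟨l, hl, rfl⟩) | rfl)
    · exact (Link.typed_map _ _ _).2 (h1.typed l hl)
    · exact (Link.typed_map _ _ _).2 (h2.typed l hl)
    · exact ⟨A, B, fa, fb, rfl⟩
  · rw [PStruct.limpNeg, hs]
    refine (((h1.concls.map (Link.concls_map _) some_inl_injective.injOn).union
      (h2.concls.map (Link.concls_map _) some_inr_injective.injOn) (by simp)).union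
      (Cov.single ?_) ?_).congr rfl fun v => ?_
    · simp [Link.concls]
    · simp [Link.concls]; grind
    · rcases v with _ | v | v <;> simp [Link.concls]
  · rw [PStruct.limpNeg, hs]
    refine (((h1.prems.map (Link.prems_map _) some_inl_injective.injOn).union
      (h2.prems.map (Link.prems_map _) some_inr_injective.injOn) (by simp; grind)).union
      (Cov.single ?_) ?_).congr rfl fun v => ?_
    · simp [Link.prems]
    · simp [Link.prems, e]; grind
    · rcases v with _ | v | v <;> simp [Link.prems, e] <;> grind
  · simp only [e, List.drop_succ_cons, List.drop_zero, List.nodup_cons, List.nodup_append,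
      List.mem_append, List.mem_cons, List.mem_map,
      List.nodup_map_iff some_inl_injective, List.nodup_map_iff some_inr_injective] at *
    grind

theorem Good.cut {A : Ty} {Θ Ξ : PStruct} {b : Ξ.Occ} {r : List Ξ.Occ} (h1 : Good Θ)
    (h2 : Good Ξ) (e : Ξ.hyps = b :: r) (fa : Θ.form Θ.concl = .pos A) (fb : Ξ.form b = .neg A) :
    Good (.cut Θ Ξ) := by
  have hn1 := h1.nodup
  have hn := h2.nodup
  have hs := setOf_cons e fun b => (.cut (.inl Θ.concl) (.inr b) : Link (Θ.Occ ⊕ Ξ.Occ))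
  rw [e] at hn
  have i1 := Sum.inl_injective (α := Θ.Occ) (β := Ξ.Occ)
  have i2 := Sum.inr_injective (α := Θ.Occ) (β := Ξ.Occ)
  refine ⟨?_, ?_, ?_, ?_, ?_⟩
  · rw [PStruct.cut, hs]
    exact ((h1.finite.image _).union (h2.finite.image _)).union (Set.finite_singleton _)
  · rw [PStruct.cut, hs]
    rintro l ((⟨l, hl, rfl⟩ | ⟨l, hl, rfl⟩) | rfl)
    · exact (Link.typed_map _ _ _).2 (h1.typed l hl)
    · exact (Link.typed_map _ _ _).2 (h2.typed l hl)
    · exact ⟨A, fa, fb⟩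
  · rw [PStruct.cut, hs]
    refine (((h1.concls.map (Link.concls_map _) i1.injOn).union
      (h2.concls.map (Link.concls_map _) i2.injOn) (by simp)).union
      (Cov.single ?_) ?_).congr rfl fun v => ?_
    · simp [Link.concls]
    · simp [Link.concls]
    · rcases v with v | v <;> simp [Link.concls]
  · rw [PStruct.cut, hs]
    refine (((h1.prems.map (Link.prems_map _) i1.injOn).union
      (h2.prems.map (Link.prems_map _) i2.injOn) (by simp)).union
      (Cov.single ?_) ?_).congr rfl fun v => ?_
    · simp [Link.prems]
    · simp [Link.prems, e]; grind
    · rcases v with v | v <;> simp [Link.prems, e] <;> grind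
  · simp only [e, List.drop_succ_cons, List.drop_zero, List.nodup_cons, List.nodup_append,
      List.mem_append, List.mem_cons, List.mem_map, List.nodup_map_iff i1,
      List.nodup_map_iff i2] at *
    grind

theorem Good.iso {Θ Ξ : PStruct} (h : Good Θ) (i : Θ.Iso Ξ) : Good Ξ := by
  obtain ⟨e, h1, h2, h3, h4⟩ := i
  refine ⟨h2 ▸ h.finite.image _, ?_, ?_, ?_, ?_⟩
  · rw [← h2]
    rintro _ ⟨l, hl, rfl⟩
    rw [Link.typed_map]
    exact (h.typed l hl).congr (fun v _ => h1 v) fun v _ => h1 v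
  · refine (h.concls.map (Link.concls_map e) e.injective.injOn).congr h2 fun v => ?_
    simp
  · refine (h.prems.map (Link.prems_map e) e.injective.injOn).congr h2 fun v => ?_
    rw [← h3, ← h4]
    obtain ⟨u, rfl⟩ := e.surjective v
    simp
    grind
  · rw [← h3, ← h4, ← List.map_cons]
    exact (List.nodup_map_iff e.injective).2 h.nodup

/-! ### Labellings as an invariant of structures -/

/-- Consistent labellings of the occurrences of a structure by types of the right shapes. -/
def PStruct.Lab (Θ : PStruct) (f : Θ.Occ → Ty) : Prop :=
  -- Without the condition on shapes an ID-link of a compound formula could be labelled by an atom,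
  -- and eta expansion would lose this labelling.
  (∀ l ∈ Θ.links, l.Ok f) ∧ ∀ v, (f v).sh = (Θ.form v).ty.sh

/-- The labels of the conclusions in consistent labellings. -/
def Typ (Θ : PStruct) (G : List Ty) (Z : Ty) : Prop :=
  ∃ f, Θ.Lab f ∧ Θ.hyps.map f = G ∧ f Θ.concl = Z

/-- A consistent labelling is determined by the labels of the conclusions. -/
def Uniq (Θ : PStruct) : Prop :=
  ∀ f f', Θ.Lab f → Θ.Lab f' → Θ.hyps.map f = Θ.hyps.map f' → f Θ.concl = f' Θ.concl → f = f'

theorem Good.lab {Θ : PStruct} (h : Good Θ) : Θ.Lab fun v => (Θ.form v).ty :=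
  ⟨fun l hl => (h.typed l hl).ok, fun _ => rfl⟩

theorem Bdry.types {Γ : List Ty} {A : Ty} {Θ : PStruct} (h : Bdry Γ A Θ) :
    Θ.hyps.map (fun v => (Θ.form v).ty) = Γ := by
  have := congrArg (List.map SFormula.ty) h.1
  simpa [Function.comp_def, SFormula.ty] using this

theorem Good.typ {Γ : List Ty} {A : Ty} {Θ : PStruct} (h : Good Θ) (hb : Bdry Γ A Θ) :
    Typ Θ Γ A :=
  ⟨_, h.lab, hb.types, by simp [hb.2, SFormula.ty]⟩

theorem Typ.length {Θ : PStruct} {G : List Ty} {Z : Ty} (h : Typ Θ G Z) :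
    G.length = Θ.hyps.length := by
  obtain ⟨f, -, rfl, -⟩ := h
  simp

theorem Bdry.length {Γ : List Ty} {A : Ty} {Θ : PStruct} (h : Bdry Γ A Θ) :
    Θ.hyps.length = Γ.length := by simpa using congrArg List.length h.1

/-! #### Labellings of composed structures -/

section
variable {A B : Ty} {Θ Ξ : PStruct}

theorem lab_tensorPos {f : Option (Θ.Occ ⊕ Ξ.Occ) → Ty} (hA : Θ.form Θ.concl = .pos A)
    (hB : Ξ.form Ξ.concl = .pos B) :
    (PStruct.tensorPos A B Θ Ξ).Lab f ↔ Θ.Lab (fun v => f (some (.inl v))) ∧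
      Ξ.Lab (fun v => f (some (.inr v))) ∧
      f none = .tensor (f (some (.inl Θ.concl))) (f (some (.inr Ξ.concl))) := by
  constructor
  · rintro ⟨h1, h2⟩
    exact ⟨⟨fun l hl => (Link.ok_map _ _ _).1 (h1 _ (.inl (.inl ⟨l, hl, rfl⟩))), fun v => h2 _⟩,
      ⟨fun l hl => (Link.ok_map _ _ _).1 (h1 _ (.inl (.inr ⟨l, hl, rfl⟩))), fun v => h2 _⟩,
      h1 _ (.inr rfl)⟩
  · rintro ⟨h1, h2, h3⟩
    refine ⟨?_, ?_⟩
    · rintro l ((⟨l, hl, rfl⟩ | ⟨l, hl, rfl⟩) | rfl)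
      · exact (Link.ok_map _ _ _).2 (h1.1 l hl)
      · exact (Link.ok_map _ _ _).2 (h2.1 l hl)
      · exact h3
    · rintro (_ | v | v)
      · rw [h3, Ty.sh_tensor, h1.2, h2.2, hA, hB]; rfl
      · exact h1.2 v
      · exact h2.2 v

theorem typ_tensorPos {G₁ G₂ : List Ty} {Z : Ty} (hA : Θ.form Θ.concl = .pos A)
    (hB : Ξ.form Ξ.concl = .pos B) (hl : G₁.length = Θ.hyps.length) :
    Typ (.tensorPos A B Θ Ξ) (G₁ ++ G₂) Z ↔
      ∃ X Y, Z = .tensor X Y ∧ Typ Θ G₁ X ∧ Typ Ξ G₂ Y := by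
  constructor
  · rintro ⟨f, hf, e1, rfl⟩
    obtain ⟨h1, h2, h3⟩ := (lab_tensorPos hA hB).1 hf
    rw [List.map_append, List.map_map, List.map_map] at e1
    obtain ⟨e1, e2⟩ := List.append_inj e1 (by simp [hl])
    exact ⟨_, _, h3, ⟨_, h1, e1, rfl⟩, ⟨_, h2, e2, rfl⟩⟩
  · rintro ⟨_, _, rfl, ⟨f, hf, rfl, rfl⟩, ⟨g, hg, rfl, rfl⟩⟩
    let k : Option (Θ.Occ ⊕ Ξ.Occ) → Ty
      | some (.inl v) => f v
      | some (.inr v) => g v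
      | none => .tensor (f Θ.concl) (g Ξ.concl)
    refine ⟨k, (lab_tensorPos hA hB).2 ⟨hf, hg, rfl⟩, ?_, rfl⟩
    rw [List.map_append, List.map_map, List.map_map]
    rfl

theorem Uniq.tensorPos (h1 : Uniq Θ) (h2 : Uniq Ξ) (hA : Θ.form Θ.concl = .pos A)
    (hB : Ξ.form Ξ.concl = .pos B) : Uniq (.tensorPos A B Θ Ξ) := by
  intro f f' hf hf' e1 e2
  obtain ⟨a1, a2, a3⟩ := (lab_tensorPos hA hB).1 hf
  obtain ⟨b1, b2, b3⟩ := (lab_tensorPos hA hB).1 hf'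
  rw [List.map_append, List.map_append, List.map_map, List.map_map, List.map_map,
    List.map_map] at e1
  obtain ⟨e3, e4⟩ := List.append_inj e1 (by simp)
  have e2' : f none = f' none := e2
  rw [a3, b3, Ty.tensor.injEq] at e2'
  have r1 := h1 _ _ a1 b1 e3 e2'.1
  have r2 := h2 _ _ a2 b2 e4 e2'.2
  funext v
  rcases v with _ | v | v
  · exact e2
  · exact congrFun r1 v
  · exact congrFun r2 v

theorem lab_tensorNeg {f : Option Θ.Occ → Ty} {a b : Θ.Occ} {r : List Θ.Occ}
    (e : Θ.hyps = a :: b :: r) (hA : Θ.form a = .neg A) (hB : Θ.form b = .neg B) :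
    (PStruct.tensorNeg A B Θ).Lab f ↔ Θ.Lab (fun v => f (some v)) ∧
      f none = .tensor (f (some a)) (f (some b)) := by
  constructor
  · rintro ⟨h1, h2⟩
    exact ⟨⟨fun l hl => (Link.ok_map _ _ _).1 (h1 _ (.inl ⟨l, hl, rfl⟩)), fun v => h2 _⟩,
      h1 _ (.inr ⟨a, b, r, e, rfl⟩)⟩
  · rintro ⟨h1, h3⟩
    refine ⟨?_, ?_⟩
    · rintro l (⟨l, hl, rfl⟩ | ⟨a', b', r', e', rfl⟩)
      · exact (Link.ok_map _ _ _).2 (h1.1 l hl)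
      · rw [e] at e'
        cases e'
        exact h3
    · rintro (_ | v)
      · rw [h3, Ty.sh_tensor, h1.2, h1.2, hA, hB]; rfl
      · exact h1.2 v

theorem typ_tensorNeg {G : List Ty} {T Z : Ty} {a b : Θ.Occ} {r : List Θ.Occ}
    (e : Θ.hyps = a :: b :: r) (hA : Θ.form a = .neg A) (hB : Θ.form b = .neg B) :
    Typ (.tensorNeg A B Θ) (T :: G) Z ↔ ∃ X Y, T = .tensor X Y ∧ Typ Θ (X :: Y :: G) Z := by
  constructor
  · rintro ⟨f, hf, e1, rfl⟩
    obtain ⟨h1, h3⟩ := (lab_tensorNeg e hA hB).1 hf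
    simp only [e, List.drop_succ_cons, List.drop_zero, List.map_cons, List.map_map,
      List.cons.injEq] at e1
    refine ⟨_, _, e1.1.symm.trans h3, _, h1, ?_, rfl⟩
    rw [e, List.map_cons, List.map_cons, ← e1.2]
    rfl
  · rintro ⟨X, Y, rfl, f, hf, e1, rfl⟩
    rw [e, List.map_cons, List.map_cons, List.cons.injEq, List.cons.injEq] at e1
    obtain ⟨rfl, rfl, rfl⟩ := e1
    refine ⟨fun v => v.elim (.tensor (f a) (f b)) f, (lab_tensorNeg e hA hB).2 ⟨hf, rfl⟩, ?_, rfl⟩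
    simp [e]

theorem Uniq.tensorNeg (h : Uniq Θ) {a b : Θ.Occ} {r : List Θ.Occ}
    (e : Θ.hyps = a :: b :: r) (hA : Θ.form a = .neg A) (hB : Θ.form b = .neg B) :
    Uniq (.tensorNeg A B Θ) := by
  intro f f' hf hf' e1 e2
  obtain ⟨a1, a3⟩ := (lab_tensorNeg e hA hB).1 hf
  obtain ⟨b1, b3⟩ := (lab_tensorNeg e hA hB).1 hf'
  simp only [e, List.drop_succ_cons, List.drop_zero, List.map_cons, List.map_map,
    List.cons.injEq] at e1
  have e3 := e1.1
  rw [a3, b3, Ty.tensor.injEq] at e3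
  have r1 := h _ _ a1 b1 (by
    rw [e, List.map_cons, List.map_cons, List.map_cons, List.map_cons, e3.1, e3.2]
    exact congrArg _ (congrArg _ e1.2)) e2
  funext v
  rcases v with _ | v
  · exact e1.1
  · exact congrFun r1 v

theorem lab_limpPos {f : Option Θ.Occ → Ty} {a : Θ.Occ} {r : List Θ.Occ}
    (e : Θ.hyps = a :: r) (hA : Θ.form a = .neg A) (hB : Θ.form Θ.concl = .pos B) :
    (PStruct.limpPos A B Θ).Lab f ↔ Θ.Lab (fun v => f (some v)) ∧
      f none = .limp (f (some a)) (f (some Θ.concl)) := by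
  constructor
  · rintro ⟨h1, h2⟩
    exact ⟨⟨fun l hl => (Link.ok_map _ _ _).1 (h1 _ (.inl ⟨l, hl, rfl⟩)), fun v => h2 _⟩,
      h1 _ (.inr ⟨a, r, e, rfl⟩)⟩
  · rintro ⟨h1, h3⟩
    refine ⟨?_, ?_⟩
    · rintro l (⟨l, hl, rfl⟩ | ⟨a', r', e', rfl⟩)
      · exact (Link.ok_map _ _ _).2 (h1.1 l hl)
      · rw [e] at e'
        cases e'
        exact h3
    · rintro (_ | v)
      · rw [h3, Ty.sh_limp, h1.2, h1.2, hA, hB]; rfl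
      · exact h1.2 v

theorem typ_limpPos {G : List Ty} {Z : Ty} {a : Θ.Occ} {r : List Θ.Occ}
    (e : Θ.hyps = a :: r) (hA : Θ.form a = .neg A) (hB : Θ.form Θ.concl = .pos B) :
    Typ (.limpPos A B Θ) G Z ↔ ∃ X Y, Z = .limp X Y ∧ Typ Θ (X :: G) Y := by
  constructor
  · rintro ⟨f, hf, e1, rfl⟩
    obtain ⟨h1, h3⟩ := (lab_limpPos e hA hB).1 hf
    simp only [e, List.drop_succ_cons, List.drop_zero, List.map_map] at e1
    refine ⟨_, _, h3, _, h1, ?_, rfl⟩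
    rw [e, List.map_cons, ← e1]
    rfl
  · rintro ⟨X, Y, rfl, f, hf, e1, rfl⟩
    rw [e, List.map_cons, List.cons.injEq] at e1
    obtain ⟨rfl, rfl⟩ := e1
    refine ⟨fun v => v.elim (.limp (f a) (f Θ.concl)) f, (lab_limpPos e hA hB).2 ⟨hf, rfl⟩, ?_, rfl⟩
    simp [e]

theorem Uniq.limpPos (h : Uniq Θ) {a : Θ.Occ} {r : List Θ.Occ}
    (e : Θ.hyps = a :: r) (hA : Θ.form a = .neg A) (hB : Θ.form Θ.concl = .pos B) :
    Uniq (.limpPos A B Θ) := by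
  intro f f' hf hf' e1 e2
  obtain ⟨a1, a3⟩ := (lab_limpPos e hA hB).1 hf
  obtain ⟨b1, b3⟩ := (lab_limpPos e hA hB).1 hf'
  simp only [e, List.drop_succ_cons, List.drop_zero, List.map_map] at e1
  have e3 : f none = f' none := e2
  rw [a3, b3, Ty.limp.injEq] at e3
  have r1 := h _ _ a1 b1 (by
    rw [e, List.map_cons, List.map_cons, e3.1]
    exact congrArg _ e1) e3.2
  funext v
  rcases v with _ | v
  · exact e2
  · exact congrFun r1 v

theorem lab_limpNeg {f : Option (Θ.Occ ⊕ Ξ.Occ) → Ty} {b : Ξ.Occ} {r : List Ξ.Occ}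
    (e : Ξ.hyps = b :: r) (hA : Θ.form Θ.concl = .pos A) (hB : Ξ.form b = .neg B) :
    (PStruct.limpNeg A B Θ Ξ).Lab f ↔ Θ.Lab (fun v => f (some (.inl v))) ∧
      Ξ.Lab (fun v => f (some (.inr v))) ∧
      f none = .limp (f (some (.inl Θ.concl))) (f (some (.inr b))) := by
  constructor
  · rintro ⟨h1, h2⟩
    exact ⟨⟨fun l hl => (Link.ok_map _ _ _).1 (h1 _ (.inl (.inl ⟨l, hl, rfl⟩))), fun v => h2 _⟩,
      ⟨fun l hl => (Link.ok_map _ _ _).1 (h1 _ (.inl (.inr ⟨l, hl, rfl⟩))), fun v => h2 _⟩,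
      h1 _ (.inr ⟨b, r, e, rfl⟩)⟩
  · rintro ⟨h1, h2, h3⟩
    refine ⟨?_, ?_⟩
    · rintro l ((⟨l, hl, rfl⟩ | ⟨l, hl, rfl⟩) | ⟨b', r', e', rfl⟩)
      · exact (Link.ok_map _ _ _).2 (h1.1 l hl)
      · exact (Link.ok_map _ _ _).2 (h2.1 l hl)
      · rw [e] at e'
        cases e'
        exact h3
    · rintro (_ | v | v)
      · rw [h3, Ty.sh_limp, h1.2, h2.2, hA, hB]; rfl
      · exact h1.2 v
      · exact h2.2 v

theorem typ_limpNeg {G₁ G₂ : List Ty} {T Z : Ty} {b : Ξ.Occ} {r : List Ξ.Occ}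
    (e : Ξ.hyps = b :: r) (hA : Θ.form Θ.concl = .pos A) (hB : Ξ.form b = .neg B)
    (hl : G₁.length = Θ.hyps.length) :
    Typ (.limpNeg A B Θ Ξ) (T :: (G₁ ++ G₂)) Z ↔
      ∃ X Y, T = .limp X Y ∧ Typ Θ G₁ X ∧ Typ Ξ (Y :: G₂) Z := by
  constructor
  · rintro ⟨f, hf, e1, rfl⟩
    obtain ⟨h1, h2, h3⟩ := (lab_limpNeg e hA hB).1 hf
    simp only [e, List.drop_succ_cons, List.drop_zero, List.map_cons, List.map_append, List.map_map,
      List.cons.injEq] at e1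
    obtain ⟨e2, e1⟩ := e1
    obtain ⟨e1, e3⟩ := List.append_inj e1 (by simp [hl])
    refine ⟨_, _, e2.symm.trans h3, ⟨_, h1, e1, rfl⟩, ⟨_, h2, ?_, rfl⟩⟩
    rw [e, List.map_cons, ← e3]
    rfl
  · rintro ⟨X, Y, rfl, ⟨f, hf, rfl, rfl⟩, ⟨g, hg, e1, rfl⟩⟩
    rw [e, List.map_cons, List.cons.injEq] at e1
    obtain ⟨rfl, rfl⟩ := e1
    let k : Option (Θ.Occ ⊕ Ξ.Occ) → Ty
      | some (.inl v) => f v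
      | some (.inr v) => g v
      | none => .limp (f Θ.concl) (g b)
    refine ⟨k, (lab_limpNeg e hA hB).2 ⟨hf, hg, rfl⟩, ?_, rfl⟩
    simp only [e, List.drop_succ_cons, List.drop_zero, List.map_cons, List.map_append, List.map_map]
    rfl

theorem Uniq.limpNeg (h1 : Uniq Θ) (h2 : Uniq Ξ) {b : Ξ.Occ} {r : List Ξ.Occ}
    (e : Ξ.hyps = b :: r) (hA : Θ.form Θ.concl = .pos A) (hB : Ξ.form b = .neg B) :
    Uniq (.limpNeg A B Θ Ξ) := by
  intro f f' hf hf' e1 e2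
  obtain ⟨a1, a2, a3⟩ := (lab_limpNeg e hA hB).1 hf
  obtain ⟨b1, b2, b3⟩ := (lab_limpNeg e hA hB).1 hf'
  simp only [e, List.drop_succ_cons, List.drop_zero, List.map_cons, List.map_append, List.map_map,
    List.cons.injEq] at e1
  obtain ⟨e0, e1⟩ := e1
  obtain ⟨e3, e4⟩ := List.append_inj e1 (by simp)
  have e5 := e0
  rw [a3, b3, Ty.limp.injEq] at e5
  have r1 := h1 _ _ a1 b1 e3 e5.1
  have r2 := h2 _ _ a2 b2 (by
    rw [e, List.map_cons, List.map_cons, e5.2]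
    exact congrArg _ e4) e2
  funext v
  rcases v with _ | v | v
  · exact e0
  · exact congrFun r1 v
  · exact congrFun r2 v

theorem lab_cut {f : Θ.Occ ⊕ Ξ.Occ → Ty} {b : Ξ.Occ} {r : List Ξ.Occ} (e : Ξ.hyps = b :: r) :
    (PStruct.cut Θ Ξ).Lab f ↔ Θ.Lab (fun v => f (.inl v)) ∧
      Ξ.Lab (fun v => f (.inr v)) ∧ f (.inl Θ.concl) = f (.inr b) := by
  constructor
  · rintro ⟨h1, h2⟩
    exact ⟨⟨fun l hl => (Link.ok_map _ _ _).1 (h1 _ (.inl (.inl ⟨l, hl, rfl⟩))), fun v => h2 _⟩,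
      ⟨fun l hl => (Link.ok_map _ _ _).1 (h1 _ (.inl (.inr ⟨l, hl, rfl⟩))), fun v => h2 _⟩,
      h1 _ (.inr ⟨b, r, e, rfl⟩)⟩
  · rintro ⟨h1, h2, h3⟩
    refine ⟨?_, ?_⟩
    · rintro l ((⟨l, hl, rfl⟩ | ⟨l, hl, rfl⟩) | ⟨b', r', e', rfl⟩)
      · exact (Link.ok_map _ _ _).2 (h1.1 l hl)
      · exact (Link.ok_map _ _ _).2 (h2.1 l hl)
      · rw [e] at e'
        cases e'
        exact h3
    · rintro (v | v)
      · exact h1.2 v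
      · exact h2.2 v

theorem typ_cut {G₁ G₂ : List Ty} {Z : Ty} {b : Ξ.Occ} {r : List Ξ.Occ} (e : Ξ.hyps = b :: r)
    (hl : G₁.length = Θ.hyps.length) :
    Typ (.cut Θ Ξ) (G₁ ++ G₂) Z ↔ ∃ X, Typ Θ G₁ X ∧ Typ Ξ (X :: G₂) Z := by
  constructor
  · rintro ⟨f, hf, e1, rfl⟩
    obtain ⟨h1, h2, h3⟩ := (lab_cut e).1 hf
    simp only [e, List.drop_succ_cons, List.drop_zero, List.map_append, List.map_map] at e1
    obtain ⟨e1, e3⟩ := List.append_inj e1 (by simp [hl])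
    refine ⟨_, ⟨_, h1, e1, rfl⟩, ⟨_, h2, ?_, rfl⟩⟩
    rw [e, List.map_cons, ← e3, h3]
    rfl
  · rintro ⟨X, ⟨f, hf, rfl, rfl⟩, ⟨g, hg, e1, rfl⟩⟩
    rw [e, List.map_cons, List.cons.injEq] at e1
    obtain ⟨e1, rfl⟩ := e1
    refine ⟨Sum.elim f g, (lab_cut e).2 ⟨hf, hg, e1.symm⟩, ?_, rfl⟩
    simp [e]

/-- The label of the cut is not visible in the conclusions; that it is nevertheless determined has
to be assumed here. For represented structures it follows from rigidity of typings. -/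
theorem Uniq.cut (h1 : Uniq Θ) (h2 : Uniq Ξ) {b : Ξ.Occ} {r : List Ξ.Occ}
    (e : Ξ.hyps = b :: r)
    (h : ∀ G₁ G₂ X X' Z, Typ Θ G₁ X → Typ Ξ (X :: G₂) Z → Typ Θ G₁ X' → Typ Ξ (X' :: G₂) Z →
      X = X') : Uniq (.cut Θ Ξ) := by
  intro f f' hf hf' e1 e2
  obtain ⟨a1, a2, a3⟩ := (lab_cut e).1 hf
  obtain ⟨b1, b2, b3⟩ := (lab_cut e).1 hf'
  simp only [e, List.drop_succ_cons, List.drop_zero, List.map_append, List.map_map] at e1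
  obtain ⟨e3, e4⟩ := List.append_inj e1 (by simp)
  have e5 : f (.inl Θ.concl) = f' (.inl Θ.concl) := by
    refine h (Θ.hyps.map (f ∘ Sum.inl)) (r.map (f ∘ Sum.inr)) _ _ (f (.inr Ξ.concl))
      ⟨_, a1, rfl, rfl⟩ ⟨_, a2, ?_, rfl⟩ ⟨_, b1, e3.symm, rfl⟩ ⟨_, b2, ?_, e2.symm⟩
    · rw [e, a3]; rfl
    · rw [e, b3, e4]; rfl
  have r1 := h1 _ _ a1 b1 e3 e5
  have r2 := h2 _ _ a2 b2 (by
    rw [e, List.map_cons, List.map_cons, ← a3, ← b3, e5]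
    exact congrArg _ e4) e2
  funext v
  rcases v with v | v
  · exact congrFun r1 v
  · exact congrFun r2 v

theorem typ_exch {n : ℕ} {G : List Ty} {Z : Ty} :
    Typ (Θ.exch n) G Z ↔ Typ Θ (PStruct.swapAt n G) Z := by
  constructor
  · rintro ⟨f, hf, rfl, rfl⟩
    refine ⟨f, hf, ?_, rfl⟩
    rw [PStruct.swapAt_map, PStruct.swapAt_swapAt]
  · rintro ⟨f, hf, e, rfl⟩
    refine ⟨f, hf, ?_, rfl⟩
    rw [← PStruct.swapAt_map, e, PStruct.swapAt_swapAt]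

theorem Uniq.exch (h : Uniq Θ) (n : ℕ) : Uniq (Θ.exch n) := by
  intro f f' hf hf' e1 e2
  refine h f f' hf hf' ?_ e2
  have := congrArg (PStruct.swapAt n) e1
  rwa [PStruct.swapAt_map, PStruct.swapAt_map, PStruct.swapAt_swapAt] at this

theorem lab_idLink {f : Bool → Ty} :
    (PStruct.idLink A).Lab f ↔ f true = f false ∧ (f true).sh = A.sh := by
  constructor
  · rintro ⟨h1, h2⟩
    exact ⟨h1 _ rfl, h2 true⟩
  · rintro ⟨h1, h2⟩
    refine ⟨?_, ?_⟩
    · rintro l rfl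
      exact h1
    · rintro (_ | _)
      · rw [← h1]; exact h2
      · exact h2

theorem typ_idLink {T Z : Ty} : Typ (.idLink A) [T] Z ↔ T = Z ∧ Z.sh = A.sh := by
  constructor
  · rintro ⟨f, hf, e, rfl⟩
    obtain ⟨h1, h2⟩ := lab_idLink.1 hf
    refine ⟨?_, h2⟩
    simp only [List.map_cons, List.map_nil, List.cons.injEq, and_true] at e
    rw [← e, h1]
  · rintro ⟨rfl, h⟩
    exact ⟨fun _ => T, lab_idLink.2 ⟨rfl, h⟩, rfl, rfl⟩

theorem Uniq.idLink (A : Ty) : Uniq (.idLink A) := by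
  intro f f' hf hf' e1 e2
  funext v
  cases v
  · simpa using e1
  · exact e2

theorem PStruct.Iso.symm (h : Θ.Iso Ξ) : Ξ.Iso Θ := by
  obtain ⟨e, h1, h2, h3, h4⟩ := h
  refine ⟨e.symm, fun v => ?_, ?_, ?_, ?_⟩
  · rw [← h1]; simp
  · rw [← h2, Set.image_image]
    simp only [Link.map_map]
    convert Set.image_id _ using 2
    funext l
    simp [Link.map_id]
  · rw [← h3]; simp
  · rw [← h4]; simp

theorem PStruct.Iso.trans {Ψ : PStruct} (h : Θ.Iso Ξ) (h' : Ξ.Iso Ψ) : Θ.Iso Ψ := by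
  obtain ⟨e, h1, h2, h3, h4⟩ := h
  obtain ⟨e', h1', h2', h3', h4'⟩ := h'
  refine ⟨e.trans e', fun v => ?_, ?_, ?_, ?_⟩
  · rw [Equiv.trans_apply, h1', h1]
  · rw [← h2', ← h2, Set.image_image]
    simp only [Link.map_map]
    rfl
  · rw [← h3', ← h3, List.map_map]; rfl
  · rw [Equiv.trans_apply, h4, h4']

theorem PStruct.Lab.iso {e : Θ.Occ → Ξ.Occ} {f : Ξ.Occ → Ty} (hf : Ξ.Lab f)
    (h1 : ∀ v, Ξ.form (e v) = Θ.form v) (h2 : ∀ l ∈ Θ.links, l.map e ∈ Ξ.links) :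
    Θ.Lab (f ∘ e) :=
  ⟨fun l hl => (Link.ok_map _ _ _).1 (hf.1 _ (h2 l hl)), fun v => by
    rw [Function.comp_apply, hf.2, h1]⟩

theorem Typ.iso (i : Θ.Iso Ξ) {G : List Ty} {Z : Ty} (h : Typ Ξ G Z) : Typ Θ G Z := by
  obtain ⟨e, h1, h2, h3, h4⟩ := i
  obtain ⟨f, hf, rfl, rfl⟩ := h
  refine ⟨f ∘ e, hf.iso h1 fun l hl => h2 ▸ ⟨l, hl, rfl⟩, ?_, ?_⟩
  · rw [← h3, List.map_map]
  · rw [← h4]; rfl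

theorem Uniq.iso (h : Uniq Θ) (i : Θ.Iso Ξ) : Uniq Ξ := by
  obtain ⟨e, h1, h2, h3, h4⟩ := i
  intro f f' hf hf' e1 e2
  have h2' : ∀ l ∈ Θ.links, l.map e ∈ Ξ.links := fun l hl => h2 ▸ ⟨l, hl, rfl⟩
  have := h _ _ (hf.iso h1 h2') (hf'.iso h1 h2')
    (by rw [← List.map_map, ← List.map_map, h3, e1])
    (by simp only [Function.comp_apply, h4, e2])
  funext v
  obtain ⟨u, rfl⟩ := e.surjective v
  exact congrFun this u

theorem Bdry.iso {Γ : List Ty} {C : Ty} (h : Bdry Γ C Θ) (i : Θ.Iso Ξ) : Bdry Γ C Ξ := by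
  obtain ⟨e, h1, h2, h3, h4⟩ := i
  refine ⟨?_, by rw [← h4, h1, h.2]⟩
  rw [← h3, List.map_map, ← h.1]
  exact List.map_congr_left fun v _ => h1 v

end

/-! ### Representation of structures by terms -/

/-- The structure `Θ` has the labellings that the typings of the term `t`, whose free variables
are listed in `l`, prescribe. -/
structure Rep (l : List ℕ) (t : Term) (Γ : List Ty) (A : Ty) (Θ : PStruct) : Prop where
  nodup : l.Nodup
  fv : ∀ z, z ∈ l ↔ z ∈ t.FV
  good : Good Θ
  bdry : Bdry Γ A Θ
  uniq : Uniq Θ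
  typ : ∀ ρ Z, Typ Θ (l.map ρ) Z ↔
    (l.map ρ).map Ty.sh = Γ.map Ty.sh ∧ Z.sh = A.sh ∧ J ρ t Z
  length : l.length = Γ.length

theorem exists_map_eq {α β : Type} [Nonempty β] {l : List α} (h : l.Nodup) {G : List β}
    (e : l.length = G.length) : ∃ ρ : α → β, l.map ρ = G := by
  classical
  induction l generalizing G with
  | nil => exact ⟨fun _ => Classical.arbitrary β, by simpa using (List.length_eq_zero_iff.1 e.symm).symm⟩
  | cons a l ih =>
      rcases G with _ | ⟨b, G⟩
      · simp at e
      · obtain ⟨ha, hl⟩ := List.nodup_cons.1 h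
        obtain ⟨ρ, hρ⟩ := ih hl (by simpa using e)
        refine ⟨Function.update ρ a b, ?_⟩
        rw [List.map_cons, Function.update_self, List.map_congr_left (g := ρ), hρ]
        intro x hx
        rw [Function.update_of_ne (by rintro rfl; exact ha hx)]

theorem map_update {l : List ℕ} {x : ℕ} (hx : x ∉ l) (ρ : ℕ → Ty) (B : Ty) :
    l.map (Function.update ρ x B) = l.map ρ :=
  List.map_congr_left fun z hz => by rw [Function.update_of_ne (by rintro rfl; exact hx hz)]

instance : Nonempty Ty := ⟨.var 0⟩

section
variable {l m : List ℕ} {t s u : Term} {Γ Δ : List Ty} {A B C : Ty} {Θ Ξ : PStruct}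

theorem Rep.exists_J (h : Rep l t Γ A Θ) : ∃ ρ, l.map ρ = Γ ∧ J ρ t A := by
  obtain ⟨ρ, hρ⟩ := exists_map_eq h.nodup h.length
  exact ⟨ρ, hρ, ((h.typ ρ A).1 (hρ ▸ h.good.typ h.bdry)).2.2⟩

theorem Rep.hyps_length (h : Rep l t Γ A Θ) : Θ.hyps.length = l.length := by
  rw [h.bdry.length, h.length]

theorem Rep.occ (h : Rep l t Γ A Θ) {z : ℕ} (hz : z ∈ l) : z ∈ t.occ :=
  Term.FV_occ ((h.fv z).1 hz)

theorem EqE.sound {ρ ρ₀ : ℕ → Ty} {t t' : Term} {A Z : Ty} (h : EqE ρ₀ t t' A)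
    (hρ : ∀ z ∈ t.FV, (ρ z).sh = (ρ₀ z).sh) (hZ : Z.sh = A.sh) : J ρ t Z ↔ J ρ t' Z := by
  obtain ⟨Γ, f, e⟩ := h
  exact e.sound hZ fun p hp => by
    rw [f.2.2 p hp]
    exact hρ _ ((f.2.1 _).1 (List.mem_map_of_mem hp))

/-- Soundness of equality for typings makes representation a property of equality classes, so
representing terms may be normalised and renamed at will. -/
theorem Rep.congr (h : Rep l t Γ A Θ) {ρ₀ : ℕ → Ty} (hρ : l.map ρ₀ = Γ) (e : EqE ρ₀ t s A) :
    Rep l s Γ A Θ where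
  nodup := h.nodup
  fv := by rw [← e.FV_eq]; exact h.fv
  good := h.good
  bdry := h.bdry
  uniq := h.uniq
  length := h.length
  typ ρ Z := by
    rw [h.typ]
    refine and_congr_right fun h1 => and_congr_right fun h2 => e.sound (fun z hz => ?_) h2
    rw [← hρ, List.map_map, List.map_map, List.map_inj_left] at h1
    exact h1 z ((h.fv z).2 hz)

theorem Rep.iso (h : Rep l t Γ A Θ) (i : Θ.Iso Ξ) : Rep l t Γ A Ξ where
  nodup := h.nodup
  fv := h.fv
  good := h.good.iso i
  bdry := h.bdry.iso i
  uniq := h.uniq.iso i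
  length := h.length
  typ ρ Z := by
    rw [← h.typ]
    exact ⟨Typ.iso i, Typ.iso i.symm⟩

theorem Rep.idLink (x : ℕ) (A : Ty) : Rep [x] (.var x) [A] A (.idLink A) where
  nodup := by simp
  fv := by simp [Term.FV]
  good := .idLink A
  bdry := ⟨rfl, rfl⟩
  uniq := .idLink A
  length := rfl
  typ ρ Z := by
    rw [List.map_singleton, typ_idLink]
    constructor
    · rintro ⟨rfl, h⟩
      exact ⟨by simpa using h, h, .var ρ x⟩
    · rintro ⟨-, h, hJ⟩
      exact ⟨hJ.var_inv.symm, h⟩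

theorem Bdry.exch (h : Bdry Γ A Θ) (n : ℕ) : Bdry (PStruct.swapAt n Γ) A (Θ.exch n) :=
  ⟨by rw [← PStruct.swapAt_map, h.1, PStruct.swapAt_map], h.2⟩

theorem Rep.exch (h : Rep l t Γ A Θ) (n : ℕ) :
    Rep (PStruct.swapAt n l) t (PStruct.swapAt n Γ) A (Θ.exch n) where
  nodup := (PStruct.swapAt_perm n l).nodup_iff.2 h.nodup
  fv z := by rw [(PStruct.swapAt_perm n l).mem_iff, h.fv]
  good := h.good.exch n
  bdry := h.bdry.exch n
  uniq := h.uniq.exch n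
  length := by
    rw [(PStruct.swapAt_perm n l).length_eq, (PStruct.swapAt_perm n Γ).length_eq, h.length]
  typ ρ Z := by
    have e : ∀ a b : List Ty, PStruct.swapAt n a = PStruct.swapAt n b ↔ a = b := fun a b =>
      ⟨fun h => by rw [← PStruct.swapAt_swapAt n a, h, PStruct.swapAt_swapAt], fun h => h ▸ rfl⟩
    rw [typ_exch, PStruct.swapAt_map, PStruct.swapAt_swapAt, h.typ, ← PStruct.swapAt_map,
      ← PStruct.swapAt_map, ← PStruct.swapAt_map, e]

theorem Rep.tensorPos (h1 : Rep l t Γ A Θ) (h2 : Rep m s Δ B Ξ) (hd : ∀ z ∈ t.occ, z ∉ s.occ) :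
    Rep (l ++ m) (.pair t s) (Γ ++ Δ) (.tensor A B) (.tensorPos A B Θ Ξ) where
  nodup := List.nodup_append.2 ⟨h1.nodup, h2.nodup, fun z hz z' hz' e =>
    hd z (h1.occ hz) (e ▸ h2.occ hz')⟩
  fv z := by rw [List.mem_append, h1.fv, h2.fv, Term.FV, Finset.mem_union]
  good := h1.good.tensorPos h2.good h1.bdry.2 h2.bdry.2
  bdry := by
    refine ⟨?_, rfl⟩
    rw [List.map_append, List.map_append, ← h1.bdry.1, ← h2.bdry.1, List.map_map, List.map_map]
    rfl
  uniq := h1.uniq.tensorPos h2.uniq h1.bdry.2 h2.bdry.2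
  length := by rw [List.length_append, List.length_append, h1.length, h2.length]
  typ ρ Z := by
    rw [List.map_append, typ_tensorPos h1.bdry.2 h2.bdry.2 (by simp [h1.hyps_length])]
    constructor
    · rintro ⟨X, Y, rfl, e1, e2⟩
      obtain ⟨a1, b1, c1⟩ := (h1.typ _ _).1 e1
      obtain ⟨a2, b2, c2⟩ := (h2.typ _ _).1 e2
      rw [List.map_append, List.map_append, a1, a2, Ty.sh_tensor, Ty.sh_tensor, b1, b2]
      exact ⟨rfl, rfl, c1.pair c2 hd⟩
    · rintro ⟨a, b, c⟩
      obtain ⟨X, Y, rfl, c1, c2, -⟩ := c.pair_inv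
      rw [List.map_append, List.map_append] at a
      obtain ⟨a1, a2⟩ := List.append_inj a (by simp [h1.length])
      rw [Ty.sh_tensor, Ty.sh_tensor, Ty.tensor.injEq] at b
      exact ⟨X, Y, rfl, (h1.typ _ _).2 ⟨a1, b.1, c1⟩, (h2.typ _ _).2 ⟨a2, b.2, c2⟩⟩

theorem Rep.cons_cons {x y : ℕ} (h : Rep (x :: y :: l) t (A :: B :: Γ) C Θ) :
    ∃ a b r, Θ.hyps = a :: b :: r ∧ Θ.form a = .neg A ∧ Θ.form b = .neg B ∧
      r.map Θ.form = Γ.map .neg := by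
  have := h.bdry.1
  rcases e : Θ.hyps with _ | ⟨a, _ | ⟨b, r⟩⟩
  · simp [e] at this
  · simp [e] at this
  · rw [e] at this
    simp only [List.map_cons, List.cons.injEq] at this
    exact ⟨a, b, r, rfl, this⟩

theorem Rep.cons {x : ℕ} (h : Rep (x :: l) t (A :: Γ) C Θ) :
    ∃ a r, Θ.hyps = a :: r ∧ Θ.form a = .neg A ∧ r.map Θ.form = Γ.map .neg := by
  have := h.bdry.1
  rcases e : Θ.hyps with _ | ⟨a, r⟩
  · simp [e] at this
  · rw [e] at this
    simp only [List.map_cons, List.cons.injEq] at this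
    exact ⟨a, r, rfl, this⟩

theorem Rep.typ_cons {x : ℕ} (h : Rep (x :: l) t (A :: Γ) C Θ) (ρ : ℕ → Ty) (X Z : Ty) :
    Typ Θ (X :: l.map ρ) Z ↔ (X.sh = A.sh ∧ (l.map ρ).map Ty.sh = Γ.map Ty.sh) ∧ Z.sh = C.sh ∧
      J (Function.update ρ x X) t Z := by
  have := h.typ (Function.update ρ x X) Z
  rwa [List.map_cons, map_update (List.nodup_cons.1 h.nodup).1, Function.update_self,
    List.map_cons, List.map_cons, List.cons.injEq] at this

theorem Rep.typ_cons_cons {x y : ℕ} (h : Rep (x :: y :: l) t (A :: B :: Γ) C Θ) (ρ : ℕ → Ty)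
    (X Y Z : Ty) : Typ Θ (X :: Y :: l.map ρ) Z ↔
      (X.sh = A.sh ∧ Y.sh = B.sh ∧ (l.map ρ).map Ty.sh = Γ.map Ty.sh) ∧ Z.sh = C.sh ∧
      J (Function.update (Function.update ρ x X) y Y) t Z := by
  have hn := h.nodup
  simp only [List.nodup_cons, List.mem_cons, not_or] at hn
  have := h.typ (Function.update (Function.update ρ x X) y Y) Z
  rwa [List.map_cons, List.map_cons, map_update hn.2.1, map_update hn.1.2,
    Function.update_self, Function.update_of_ne hn.1.1, Function.update_self,
    List.map_cons, List.map_cons, List.map_cons, List.map_cons,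
    List.cons.injEq, List.cons.injEq] at this

theorem Rep.limpPos {x : ℕ} (h : Rep (x :: l) t (A :: Γ) B Θ) :
    Rep l (.lam x t) Γ (.limp A B) (.limpPos A B Θ) := by
  obtain ⟨a, r, e, fa, fr⟩ := h.cons
  obtain ⟨hx, hl⟩ := List.nodup_cons.1 h.nodup
  have hfv := h.fv
  refine ⟨hl, fun z => ?_, h.good.limpPos e fa h.bdry.2, ⟨?_, rfl⟩, h.uniq.limpPos e fa h.bdry.2,
    fun ρ Z => ?_, by simpa using h.length⟩
  · simp only [Term.FV, Finset.mem_erase, ← hfv, List.mem_cons]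
    grind
  · rw [← fr]; simp [e, Function.comp_def]
  · rw [typ_limpPos e fa h.bdry.2]
    have key := h.typ_cons ρ
    constructor
    · rintro ⟨X, Y, rfl, e1⟩
      obtain ⟨⟨a1, a2⟩, a3, a4⟩ := (key X Y).1 e1
      rw [Ty.sh_limp, Ty.sh_limp, a1, a3]
      exact ⟨a2, rfl, a4.lam ((hfv x).1 (by simp))⟩
    · rintro ⟨a1, a2, a3⟩
      obtain ⟨X, Y, rfl, c1, c2⟩ := a3.lam_inv
      rw [Ty.sh_limp, Ty.sh_limp, Ty.limp.injEq] at a2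
      exact ⟨X, Y, rfl, (key X Y).2 ⟨⟨a2.1, a1⟩, a2.2, c1⟩⟩

/-- The link is read as a `let` that decomposes a fresh variable z, which stands for its conclusion.
-/
theorem Rep.tensorNeg {x y z : ℕ} (h : Rep (x :: y :: l) t (A :: B :: Γ) C Θ) (hz : z ∉ t.occ) :
    Rep (z :: l) (.letp x y (.var z) t) (.tensor A B :: Γ) C (.tensorNeg A B Θ) := by
  obtain ⟨a, b, r, e, fa, fb, fr⟩ := h.cons_cons
  have hfv := h.fv
  have hn := h.nodup
  simp only [List.nodup_cons, List.mem_cons, not_or] at hn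
  have hzl : z ∉ l := fun h' => hz (h.occ (by simp [h']))
  have hxt : x ∈ t.FV := (hfv x).1 (by simp)
  have hyt : y ∈ t.FV := (hfv y).1 (by simp)
  refine ⟨List.nodup_cons.2 ⟨hzl, hn.2.2⟩, fun z => ?_, h.good.tensorNeg e fa fb,
    ⟨?_, h.bdry.2⟩, h.uniq.tensorNeg e fa fb, fun ρ Z => ?_, by simpa using h.length⟩
  · simp only [Term.FV, Finset.mem_union, Finset.mem_sdiff, ← hfv, List.mem_cons,
      Finset.mem_singleton, Finset.mem_insert]
    grind
  · rw [List.map_cons (f := SFormula.neg), ← fr]; simp [e, Function.comp_def]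
  · rw [List.map_cons, typ_tensorNeg e fa fb]
    have key := fun X Y => h.typ_cons_cons ρ X Y Z
    constructor
    · rintro ⟨X, Y, e0, e1⟩
      obtain ⟨⟨a1, a2, a3⟩, a4, a5⟩ := (key X Y).1 e1
      rw [List.map_cons, List.map_cons, e0, Ty.sh_tensor, Ty.sh_tensor, a1, a2, a3]
      refine ⟨rfl, a4, J.letp (A := X) (B := Y) ?_ a5 hxt hyt hn.1.1 (by simpa [Term.occ] using hz)⟩
      rw [← e0]
      exact .var ρ z
    · rintro ⟨a1, a2, a3⟩
      obtain ⟨X, Y, c1, c2, -⟩ := a3.letp_inv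
      have c3 := c1.var_inv.symm
      rw [List.map_cons, List.map_cons, List.cons.injEq, c3, Ty.sh_tensor, Ty.sh_tensor,
        Ty.tensor.injEq] at a1
      exact ⟨X, Y, c3, (key X Y).2 ⟨⟨a1.1.1, a1.1.2, a1.2⟩, a2, c2⟩⟩

/-- The link is read as a split term: the variable f of its conclusion is applied to s, and the
result takes the place of y in t. -/
theorem Rep.limpNeg {f y : ℕ} (h1 : Rep l s Γ A Θ) (h2 : Rep (y :: m) t (B :: Δ) C Ξ)
    (hfs : f ∉ s.occ) (hft : f ∉ t.occ) (hd : ∀ z ∈ t.occ, z ∉ s.occ) :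
    Rep (f :: (l ++ m)) (splitTerm y t f s) (.limp A B :: (Γ ++ Δ)) C (.limpNeg A B Θ Ξ) := by
  obtain ⟨b, r, e, fb, fr⟩ := h2.cons
  obtain ⟨hy, hm⟩ := List.nodup_cons.1 h2.nodup
  have hfv1 := h1.fv
  have hfv2 := h2.fv
  have ho1 := fun z => h1.occ (z := z)
  have ho2 := fun z => h2.occ (z := z)
  have hyt : y ∈ t.FV := (hfv2 y).1 (by simp)
  refine ⟨?_, fun z => ?_, h1.good.limpNeg h2.good e h1.bdry.2 fb, ⟨?_, h2.bdry.2⟩,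
    h1.uniq.limpNeg h2.uniq e h1.bdry.2 fb, fun ρ Z => ?_, ?_⟩
  · have := h1.nodup
    simp only [List.nodup_cons, List.nodup_append, List.mem_append, not_or]
    grind
  · simp only [splitTerm, Term.FV, Finset.mem_union, Finset.mem_erase, ← hfv1, ← hfv2,
      List.mem_cons, List.mem_append, Finset.mem_singleton]
    grind
  · rw [List.map_cons (f := SFormula.neg), List.map_append (f := SFormula.neg), ← fr, ← h1.bdry.1]; simp [e, Function.comp_def]
  · rw [List.map_cons, List.map_append, typ_limpNeg e h1.bdry.2 fb (by simp [h1.hyps_length])]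
    have key := fun Y => h2.typ_cons ρ Y Z
    constructor
    · rintro ⟨X, Y, e0, e1, e2⟩
      obtain ⟨a1, a2, a3⟩ := (h1.typ _ _).1 e1
      obtain ⟨⟨b1, b2⟩, b3, b4⟩ := (key Y).1 e2
      rw [List.map_cons, List.map_cons, List.map_append, List.map_append, e0, Ty.sh_limp,
        Ty.sh_limp, a1, a2, b1, b2]
      exact ⟨rfl, b3, J.split e0 b4 hyt a3 hfs hft hd⟩
    · rintro ⟨a1, a2, a3⟩
      obtain ⟨D, E, hρ⟩ : ∃ D E, ρ f = .limp D E := by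
        obtain ⟨E, -, c, -⟩ := a3.app_inv
        obtain ⟨D, c, -⟩ := c.app_inv
        exact ⟨D, E, c.var_inv.symm⟩
      obtain ⟨c1, -, c2, -⟩ := a3.split_inv hρ
      rw [List.map_cons, List.map_cons, List.map_append, List.map_append, hρ, Ty.sh_limp,
        Ty.sh_limp, List.cons.injEq, Ty.limp.injEq] at a1
      obtain ⟨⟨r1, r2⟩, r3⟩ := a1
      obtain ⟨r3, r4⟩ := List.append_inj r3 (by simp [h1.length])
      exact ⟨D, E, hρ, (h1.typ _ _).2 ⟨r3, r1, c2⟩, (key E).2 ⟨⟨r2, r4⟩, a2, c1⟩⟩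
  · have := h1.length; have := h2.length
    simp only [List.length_cons, List.length_append] at *
    omega

/-- A cut is read as a beta-redex. Its label is the hidden argument type, so rigidity of the
application yields uniqueness of labellings. -/
theorem Rep.cut {x : ℕ} (h1 : Rep l t Γ A Θ) (h2 : Rep (x :: m) u (A :: Δ) C Ξ)
    (hd : ∀ z ∈ u.occ, z ∉ t.occ) : Rep (l ++ m) (.app (.lam x u) t) (Γ ++ Δ) C (.cut Θ Ξ) := by
  obtain ⟨b, r, e, fb, fr⟩ := h2.cons
  obtain ⟨hx, hm⟩ := List.nodup_cons.1 h2.nodup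
  have hfv1 := h1.fv
  have hfv2 := h2.fv
  have ho1 := fun z => h1.occ (z := z)
  have ho2 := fun z => h2.occ (z := z)
  have hxu : x ∈ u.FV := (hfv2 x).1 (by simp)
  have hd' : ∀ z ∈ (Term.lam x u).occ, z ∉ t.occ := by
    intro z hz
    rcases List.mem_cons.1 hz with rfl | hz
    · exact hd _ (Term.FV_occ hxu)
    · exact hd z hz
  have hn : (l ++ m).Nodup := by
    have := h1.nodup
    simp only [List.nodup_append]
    grind
  have key := h2.typ_cons
  have hlen : (l ++ m).length = (Γ ++ Δ).length := by
    have := h1.length; have := h2.length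
    simp only [List.length_cons, List.length_append] at *
    omega
  refine ⟨hn, fun z => ?_, h1.good.cut h2.good e h1.bdry.2 fb, ⟨?_, h2.bdry.2⟩,
    h1.uniq.cut h2.uniq e ?_, fun ρ Z => ?_, hlen⟩
  · simp only [Term.FV, Finset.mem_union, Finset.mem_erase, ← hfv1, ← hfv2,
      List.mem_cons, List.mem_append]
    grind
  · rw [List.map_append (f := SFormula.neg), ← fr, ← h1.bdry.1]; simp [e, Function.comp_def]
  · intro G₁ G₂ X X' Z r1 r2 r3 r4
    obtain ⟨ρ, hρ⟩ := exists_map_eq hn (G := G₁ ++ G₂) (by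
      have := r1.length; have := r2.length; have := h1.hyps_length; have := h2.hyps_length
      simp only [List.length_cons, List.length_append] at *
      omega)
    rw [List.map_append] at hρ
    obtain ⟨rfl, rfl⟩ := List.append_inj hρ (by
      have := r1.length; have := h1.hyps_length
      simp only [List.length_map] at *
      omega)
    have j1 := ((h1.typ _ _).1 r1).2.2
    have j1' := ((h1.typ _ _).1 r3).2.2
    have j2 := ((key _ _ _).1 r2).2.2
    have j2' := ((key _ _ _).1 r4).2.2
    exact J.app_rigid hd' (j2.lam hxu) j1 (j2'.lam hxu) j1'
  · rw [List.map_append, typ_cut e (by simp [h1.hyps_length])]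
    constructor
    · rintro ⟨X, e1, e2⟩
      obtain ⟨a1, a2, a3⟩ := (h1.typ _ _).1 e1
      obtain ⟨⟨b1, b2⟩, b3, b4⟩ := (key _ _ _).1 e2
      rw [List.map_append, List.map_append, a1, b2]
      exact ⟨rfl, b3, (b4.lam hxu).app a3 hd'⟩
    · rintro ⟨a1, a2, a3⟩
      obtain ⟨X, c1, c2, -⟩ := a3.app_inv
      obtain ⟨_, _, r, c3, -⟩ := c1.lam_inv
      cases r
      obtain ⟨ρ₀, hρ₀⟩ := exists_map_eq hn hlen
      have sh : ∀ z ∈ l ++ m, (ρ z).sh = (ρ₀ z).sh := by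
        rw [← List.map_append, ← hρ₀, List.map_map, List.map_map, List.map_inj_left] at a1
        exact a1
      rw [List.map_append] at hρ₀
      obtain ⟨rfl, rfl⟩ := List.append_inj hρ₀ (by simp [h1.length])
      have j1 := ((h1.typ _ _).1 (h1.good.typ h1.bdry)).2.2
      have j2 := ((key _ _ _).1 (h2.good.typ h2.bdry)).2.2
      -- A typing of the redex hides the argument type; its shape is forced by comparison with the
      -- typing given by the formulas of the structures.
      have hX : X.sh = A.sh := by
        refine J.app_shape hd' (j2.lam hxu) j1 c1 c2 a2 fun z hz => sh z ?_
        simp only [Term.FV, Finset.mem_union, Finset.mem_erase, ← hfv1, ← hfv2,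
          List.mem_cons, List.mem_append] at hz ⊢
        grind
      rw [List.map_append, List.map_append] at a1
      obtain ⟨r3, r4⟩ := List.append_inj a1 (by simp)
      exact ⟨X, (h1.typ _ _).2 ⟨r3, hX, c2⟩, (key _ _ _).2 ⟨⟨hX, r4⟩, a2, c3⟩⟩

end

section
variable {l m : List ℕ} {t s u : Term} {Γ Δ : List Ty} {A B C : Ty} {Θ Ξ : PStruct}

theorem Rep.rule {D : TermCtx} (h : Rep l (D.plug t) Γ A Θ) (hr : BetaEtaRule t s) :
    Rep l (D.plug s) Γ A Θ := by
  obtain ⟨ρ, hρ, hJ⟩ := h.exists_J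
  exact h.congr hρ (EqE.rule D hJ hr)

theorem Rep.fresh (h : Rep l t Γ A Θ) (S : Finset ℕ) :
    ∃ t', Rep l t' Γ A Θ ∧ ∀ z ∈ t'.bv, z ∉ S := by
  obtain ⟨ρ, hρ, hJ⟩ := h.exists_J
  obtain ⟨t', e, hb⟩ := EqE.fresh hJ S
  exact ⟨t', h.congr hρ e, hb⟩

theorem Rep.mem_occ (h : Rep l t Γ A Θ) (z : ℕ) : z ∈ t.occ ↔ z ∈ l ∨ z ∈ t.bv := by
  rw [Term.mem_occ, h.fv]

/-- The translation of an application. -/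
theorem Rep.app (h1 : Rep l t Γ (.limp A B) Θ) (h2 : Rep m s Δ A Ξ) (hd : ∀ z ∈ t.occ, z ∉ s.occ) :
    Rep (l ++ m) (.app t s) (Γ ++ Δ) B (.cut Θ (.limpNeg A B Ξ (.idLink B))) := by
  obtain ⟨f, y, hfy, hf, hy⟩ := exists_fresh_two (t.occ ++ s.occ)
  simp only [List.mem_append, not_or] at hf hy
  have h3 := h2.limpNeg (Rep.idLink y B) hf.2 (by simpa [Term.occ] using hfy)
    (by simpa [Term.occ] using hy.2)
  have h4 := h1.cut h3 (by
    simp only [splitTerm, Term.occ, List.mem_append, List.mem_cons, List.not_mem_nil, or_false]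
    grind)
  rw [List.append_nil, List.append_nil] at h4
  -- Link by link the structure reads as `(fn f => (fn y => y) (f s)) t`, and two contractions lead
  -- to t s.
  have h5 := h4.rule (D := .appL (.lam f .hole) t) (.beta1 _ _ _)
  rw [Term.subst1_var_self] at h5
  simp only [TermCtx.plug] at h5
  have h6 := h5.rule (D := .hole) (.beta1 _ _ _)
  rwa [Term.subst1_app, Term.subst1_var_self,
    Term.subst1_of_notMem fun h => hf.2 (Term.FV_occ h)] at h6

/-- The translation of a let term. -/
theorem Rep.letp {x y : ℕ} (h1 : Rep l s Γ (.tensor A B) Θ) (h2 : Rep (x :: y :: m) t (A :: B :: Δ) C Ξ)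
    (hd : ∀ z ∈ s.occ, z ∉ t.occ) :
    Rep (l ++ m) (.letp x y s t) (Γ ++ Δ) C (.cut Θ (.tensorNeg A B Ξ)) := by
  obtain ⟨z, hz⟩ := exists_fresh (s.occ ++ t.occ).toFinset
  simp only [List.mem_toFinset, List.mem_append, not_or] at hz
  have hx : x ∈ t.occ := h2.occ (by simp)
  have hy : y ∈ t.occ := h2.occ (by simp)
  have h4 := h1.cut (h2.tensorNeg hz.2) (by
    simp only [Term.occ, List.mem_append, List.mem_cons, List.not_mem_nil, or_false]
    grind)
  -- The cut reads as the function z ↦ `let (x,y) = z in t` applied to s.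
  have h5 := h4.rule (D := .hole) (.beta1 _ _ _)
  rwa [Term.subst1_letp (by grind) (by grind), Term.subst1_var_self,
    Term.subst1_of_notMem fun h => hz.2 (Term.FV_occ h)] at h5

end

/-- The labellings of the translation of a derivation are the typings of the term. -/
theorem Deriv.rep {Γ : Ctx} {t : Term} {A : Ty} (d : Deriv Γ t A) :
    Rep Γ.names t Γ.types A d.toStruct := by
  induction d with
  | var x A => exact .idLink x A
  | exch Γ Δ x y A B C t d ih =>
      have := ih.exch Γ.length
      simp only [Ctx.names, Ctx.types, List.map_append, List.map_cons] at this ⊢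
      have e1 := PStruct.swapAt_append (Γ.map Prod.fst) (Δ.map Prod.fst) x y
      have e2 := PStruct.swapAt_append (Γ.map Prod.snd) (Δ.map Prod.snd) A B
      rw [List.length_map] at e1 e2
      rw [e1, e2] at this
      exact this
  | lam Γ x A B t d ih => exact ih.limpPos
  | app Γ Δ A B t s lin d e ih1 ih2 =>
      obtain ⟨ρ, -, j⟩ := deriv_iff.1 ⟨Deriv.app Γ Δ A B t s lin d e⟩
      obtain ⟨_, -, -, hd⟩ := j.app_inv
      simpa only [Ctx.names, Ctx.types, List.map_append, Deriv.toStruct] using ih1.app ih2 hd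
  | pair Γ Δ A B s t lin d e ih1 ih2 =>
      obtain ⟨ρ, -, j⟩ := deriv_iff.1 ⟨Deriv.pair Γ Δ A B s t lin d e⟩
      obtain ⟨_, _, -, -, -, hd⟩ := j.pair_inv
      simpa only [Ctx.names, Ctx.types, List.map_append, Deriv.toStruct] using ih1.tensorPos ih2 hd
  | letp Γ Δ x y A B C s t lin d e ih1 ih2 =>
      obtain ⟨ρ, -, j⟩ := deriv_iff.1 ⟨Deriv.letp Γ Δ x y A B C s t lin d e⟩
      obtain ⟨_, _, -, -, -, -, -, hd⟩ := j.letp_inv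
      simpa only [Ctx.names, Ctx.types, List.map_append, Deriv.toStruct] using ih1.letp ih2 hd

theorem exists_append_of_length {α β γ : Type} {l : List α} {Γ : List β} {Δ : List γ}
    (h : l.length = Γ.length + Δ.length) :
    ∃ l₁ l₂, l = l₁ ++ l₂ ∧ l₁.length = Γ.length ∧ l₂.length = Δ.length := by
  refine ⟨l.take Γ.length, l.drop Γ.length, (List.take_append_drop _ _).symm, ?_, ?_⟩ <;> simp <;>
    omega

/-- Every proof net has the labellings of a term. -/
theorem IsProofNet.exists_rep {Γ : List Ty} {A : Ty} {Θ : PStruct} (h : IsProofNet Γ A Θ)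
    {l : List ℕ} (hl : l.Nodup) (e : l.length = Γ.length) : ∃ t, Rep l t Γ A Θ := by
  induction h generalizing l with
  | idLink A =>
      obtain ⟨x, rfl⟩ := List.length_eq_one_iff.1 e
      exact ⟨_, .idLink x A⟩
  | exch Γ Δ A B C Θ _ ih =>
      have p := PStruct.swapAt_perm Γ.length l
      obtain ⟨t, ht⟩ := ih (p.nodup_iff.2 hl) (by rw [p.length_eq, e]; simp)
      refine ⟨t, ?_⟩
      have := ht.exch Γ.length
      rwa [PStruct.swapAt_swapAt, PStruct.swapAt_append] at this
  | tensorPos Γ Δ A B Θ Ξ _ _ ih1 ih2 =>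
      obtain ⟨l₁, l₂, rfl, e1, e2⟩ := exists_append_of_length (Γ := Γ) (Δ := Δ) (by simpa using e)
      rw [List.nodup_append] at hl
      obtain ⟨t, ht⟩ := ih1 hl.1 e1
      -- The representing terms come with arbitrary bound names; these are chosen apart before the
      -- terms are combined.
      obtain ⟨t, ht, hb⟩ := ht.fresh (l₁ ++ l₂).toFinset
      obtain ⟨s, hs⟩ := ih2 hl.2.1 e2
      obtain ⟨s, hs, hb'⟩ := hs.fresh (t.occ).toFinset
      have ho := ht.mem_occ; have ho' := hs.mem_occ
      simp only [List.mem_toFinset, List.mem_append] at hb hb'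
      exact ⟨_, ht.tensorPos hs (by grind)⟩
  | tensorNeg Γ A B C Θ _ ih =>
      rcases l with _ | ⟨z, l⟩
      · simp at e
      obtain ⟨x, y, hxy, hx, hy⟩ := exists_fresh_two (z :: l)
      obtain ⟨hz, hl⟩ := List.nodup_cons.1 hl
      simp only [List.mem_cons, not_or] at hx hy
      obtain ⟨t, ht⟩ := ih (l := x :: y :: l)
        (by simp only [List.nodup_cons, List.mem_cons, not_or]; grind) (by simpa using e)
      obtain ⟨t, ht, hb⟩ := ht.fresh {z}
      have ho := ht.mem_occ
      simp only [List.mem_cons, Finset.mem_singleton] at ho hb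
      exact ⟨_, ht.tensorNeg (by grind)⟩
  | limpPos Γ A B Θ _ ih =>
      obtain ⟨x, hx⟩ := exists_fresh l.toFinset
      obtain ⟨t, ht⟩ := ih (l := x :: l) (List.nodup_cons.2 ⟨by simpa using hx, hl⟩) (by simpa using e)
      exact ⟨_, ht.limpPos⟩
  | limpNeg Γ Δ A B C Θ Ξ _ _ ih1 ih2 =>
      rcases l with _ | ⟨f, l⟩
      · simp at e
      obtain ⟨l₁, l₂, rfl, e1, e2⟩ := exists_append_of_length (Γ := Γ) (Δ := Δ) (by simpa using e)
      obtain ⟨hf, hl⟩ := List.nodup_cons.1 hl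
      rw [List.nodup_append] at hl
      obtain ⟨y, hy⟩ := exists_fresh (f :: (l₁ ++ l₂)).toFinset
      simp only [List.mem_toFinset, List.mem_append, List.mem_cons, not_or] at hf hy
      obtain ⟨s, hs⟩ := ih1 hl.1 e1
      obtain ⟨s, hs, hb⟩ := hs.fresh (f :: y :: (l₁ ++ l₂)).toFinset
      obtain ⟨t, ht⟩ := ih2 (l := y :: l₂) (List.nodup_cons.2 ⟨hy.2.2, hl.2.1⟩) (by simpa using e2)
      obtain ⟨t, ht, hb'⟩ := ht.fresh (f :: s.occ).toFinset
      have ho := ht.mem_occ; have ho' := hs.mem_occ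
      simp only [List.mem_toFinset, List.mem_append, List.mem_cons] at hb hb' ho
      exact ⟨_, hs.limpNeg ht (by grind) (by grind) (by grind)⟩
  | cut Γ Δ A C Θ Ξ _ _ ih1 ih2 =>
      obtain ⟨l₁, l₂, rfl, e1, e2⟩ := exists_append_of_length (Γ := Γ) (Δ := Δ) (by simpa using e)
      rw [List.nodup_append] at hl
      obtain ⟨x, hx⟩ := exists_fresh (l₁ ++ l₂).toFinset
      simp only [List.mem_toFinset, List.mem_append, not_or] at hx
      obtain ⟨t, ht⟩ := ih1 hl.1 e1
      obtain ⟨t, ht, hb⟩ := ht.fresh (x :: (l₁ ++ l₂)).toFinset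
      obtain ⟨u, hu⟩ := ih2 (l := x :: l₂) (List.nodup_cons.2 ⟨hx.2, hl.2.1⟩) (by simpa using e2)
      obtain ⟨u, hu, hb'⟩ := hu.fresh t.occ.toFinset
      have ho := ht.mem_occ; have ho' := hu.mem_occ
      simp only [List.mem_toFinset, List.mem_append, List.mem_cons] at hb hb' ho'
      exact ⟨_, ht.cut hu (by grind)⟩
  | iso Γ A Θ Ξ i _ ih =>
      obtain ⟨t, ht⟩ := ih hl e
      exact ⟨t, ht.iso i⟩

/-! ### Cut-free nets with generic labellings -/

/-- The link is no cut, and an ID-link only if its formula is a variable. -/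
def Link.Atomic {V : Type} (f : V → SFormula) : Link V → Prop
  | .ax p _ => ∃ q, f p = .pos (.var q)
  | .cut _ _ => False
  | _ => True

theorem Link.atomic_map {V W : Type} (g : V → W) (f : W → SFormula) (l : Link V) :
    (l.map g).Atomic f ↔ l.Atomic (f ∘ g) := by cases l <;> rfl

/-- A labelling in which different ID-links have different labels, and from which the formulas
arise by substitution. -/
structure GenLab (Θ : PStruct) (f : Θ.Occ → Ty) (θ : ℕ → Ty) : Prop where
  lab : Θ.Lab f
  inj : ∀ p n p' n', .ax p n ∈ Θ.links → .ax p' n' ∈ Θ.links → f p = f p' → p = p' ∧ n = n'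
  bind : ∀ v, (f v).bind θ = (Θ.form v).ty
  bal : ∀ q, ((Θ.hyps.map f).map (Ty.count q)).sum + (f Θ.concl).count q ≤ 2

/-- Cut-free structures with atomic ID-links that have a generic labelling. -/
structure Generic (Θ : PStruct) : Prop where
  atomic : ∀ l ∈ Θ.links, l.Atomic Θ.form
  lab : ∃ f θ, GenLab Θ f θ

theorem Ty.bind_bind (A : Ty) (f g : ℕ → Ty) : (A.bind f).bind g = A.bind fun p => (f p).bind g := by
  induction A <;> simp_all [Ty.bind]

theorem Ty.bind_var (A : Ty) : A.bind .var = A := by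
  induction A <;> simp_all [Ty.bind]

theorem Ty.sh_bind {A : Ty} {d : ℕ → ℕ} : (A.bind fun p => .var (d p)).sh = A.sh := by
  rw [Ty.sh, Ty.bind_bind]; rfl

theorem Link.Ok.bind {V : Type} {f : V → Ty} {l : Link V} (h : l.Ok f) (g : ℕ → Ty) :
    l.Ok fun v => (f v).bind g := by
  cases l <;> simp only [Link.Ok] at h ⊢ <;> rw [h] <;> rfl

theorem PStruct.Lab.bind {Θ : PStruct} {f : Θ.Occ → Ty} (h : Θ.Lab f) (d : ℕ → ℕ) :
    Θ.Lab fun v => (f v).bind fun p => .var (d p) :=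
  ⟨fun l hl => (h.1 l hl).bind _, fun v => by rw [Ty.sh_bind, h.2]⟩

/-- The type variables are given even numbers. -/
def Ty.even (A : Ty) : Ty := A.bind fun p => .var (2 * p)

/-- The type variables are given odd numbers. -/
def Ty.odd (A : Ty) : Ty := A.bind fun p => .var (2 * p + 1)

theorem Ty.even_bind (A : Ty) (θ : ℕ → Ty) : A.even.bind θ = A.bind fun p => θ (2 * p) := by
  rw [Ty.even, Ty.bind_bind]; rfl

theorem Ty.odd_bind (A : Ty) (θ : ℕ → Ty) : A.odd.bind θ = A.bind fun p => θ (2 * p + 1) := by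
  rw [Ty.odd, Ty.bind_bind]; rfl

theorem Ty.even_injective : Function.Injective Ty.even := fun A B h => by
  have := congrArg (Ty.bind fun p => .var (p / 2)) h
  simpa [Ty.even_bind, Ty.bind_var] using this

theorem Ty.odd_injective : Function.Injective Ty.odd := fun A B h => by
  have := congrArg (Ty.bind fun p => .var (p / 2)) h
  simp only [Ty.odd_bind, show ∀ p, (2 * p + 1) / 2 = p from fun p => by omega] at this
  rwa [Ty.bind_var, Ty.bind_var] at this

/-- Modulo 2 all atoms of one side become 0 and all atoms of the other side become 1; the leftmost
atoms then differ, if the shapes agree at all. -/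
theorem Ty.even_ne_odd (A B : Ty) : A.even ≠ B.odd := by
  intro h
  have := congrArg (Ty.bind fun p => .var (p % 2)) h
  simp only [Ty.even_bind, Ty.odd_bind, show ∀ p, (2 * p) % 2 = 0 from fun p => by omega,
    show ∀ p, (2 * p + 1) % 2 = 1 from fun p => by omega] at this
  clear h
  induction A generalizing B with
  | var p => cases B <;> simp [Ty.bind] at this
  | tensor A A' ih _ => cases B with
    | tensor B B' => exact ih B (Ty.tensor.inj this).1
    | _ => simp [Ty.bind] at this
  | limp A A' ih _ => cases B with
    | limp B B' => exact ih B (Ty.limp.inj this).1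
    | _ => simp [Ty.bind] at this

theorem Ty.count_even (A : Ty) (q : ℕ) : A.even.count (2 * q) = A.count q ∧
    A.even.count (2 * q + 1) = 0 := by
  induction A <;> simp_all [Ty.even, Ty.bind, Ty.count]
  omega

theorem Ty.count_odd (A : Ty) (q : ℕ) : A.odd.count (2 * q) = 0 ∧
    A.odd.count (2 * q + 1) = A.count q := by
  induction A <;> simp_all [Ty.odd, Ty.bind, Ty.count]
  omega

theorem sum_count_even {V : Type} (l : List V) (f : V → Ty) (q : ℕ) :
    (l.map fun v => (f v).even.count (2 * q)).sum = ((l.map f).map (Ty.count q)).sum ∧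
    (l.map fun v => (f v).even.count (2 * q + 1)).sum = 0 := by
  simp [Ty.count_even, Function.comp_def]

theorem sum_count_odd {V : Type} (l : List V) (f : V → Ty) (q : ℕ) :
    (l.map fun v => (f v).odd.count (2 * q)).sum = 0 ∧
    (l.map fun v => (f v).odd.count (2 * q + 1)).sum = ((l.map f).map (Ty.count q)).sum := by
  simp [Ty.count_odd, Function.comp_def]

/-- The union of two substitutions. -/
def joinSubst (θ θ' : ℕ → Ty) (p : ℕ) : Ty := if p % 2 = 0 then θ (p / 2) else θ' (p / 2)

theorem Ty.even_join (A : Ty) (θ θ' : ℕ → Ty) : A.even.bind (joinSubst θ θ') = A.bind θ := by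
  rw [Ty.even_bind]; simp [joinSubst]

theorem Ty.odd_join (A : Ty) (θ θ' : ℕ → Ty) : A.odd.bind (joinSubst θ θ') = A.bind θ' := by
  rw [Ty.odd_bind]
  congr 1
  funext p
  rw [joinSubst, if_neg (by omega), show (2 * p + 1) / 2 = p by omega]

theorem Link.map_eq_ax {V W : Type} {g : V → W} {l : Link V} {p n : W} (h : l.map g = .ax p n) :
    ∃ p' n', l = .ax p' n' ∧ g p' = p ∧ g n' = n := by
  cases l <;> simp_all [Link.map]

section
variable {A B : Ty} {Θ Ξ : PStruct}

theorem Generic.idLink (q : ℕ) : Generic (.idLink (.var q)) where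
  atomic := by
    rintro l rfl
    exact ⟨q, rfl⟩
  lab := by
    refine ⟨fun _ => .var q, Ty.var, lab_idLink.2 ⟨rfl, rfl⟩, ?_, ?_, ?_⟩
    · intro p n p' n' h h' _
      cases h; cases h'
      exact ⟨rfl, rfl⟩
    · rintro (_ | _) <;> rfl
    · intro q'
      simp only [List.map_cons, List.map_nil, List.sum_cons, List.sum_nil, Ty.count]
      split <;> omega

theorem Generic.exch (h : Generic Θ) (n : ℕ) : Generic (Θ.exch n) where
  atomic := h.atomic
  lab := by
    obtain ⟨f, θ, h⟩ := h.lab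
    refine ⟨f, θ, h.lab, h.inj, h.bind, fun q => ?_⟩
    have := (((PStruct.swapAt_perm n Θ.hyps).map f).map (Ty.count q)).sum_eq
    rw [this]
    exact h.bal q

theorem Generic.tensorNeg (h : Generic Θ) {a b : Θ.Occ} {r : List Θ.Occ}
    (e : Θ.hyps = a :: b :: r) (hA : Θ.form a = .neg A) (hB : Θ.form b = .neg B) :
    Generic (.tensorNeg A B Θ) where
  atomic := by
    rintro l (⟨l, hl, rfl⟩ | ⟨a', b', r', -, rfl⟩)
    · exact (Link.atomic_map _ _ _).2 (h.atomic l hl)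
    · trivial
  lab := by
    obtain ⟨f, θ, h⟩ := h.lab
    refine ⟨fun v => v.elim (.tensor (f a) (f b)) f, θ, (lab_tensorNeg e hA hB).2 ⟨h.lab, rfl⟩,
      ?_, ?_, fun q => ?_⟩
    · rintro p n p' n' (⟨l, hl, e⟩ | ⟨a', b', r', -, e⟩) (⟨l', hl', e'⟩ | ⟨a', b', r', -, e'⟩) hp
      · obtain ⟨p, n, rfl, rfl, rfl⟩ := Link.map_eq_ax e
        obtain ⟨p', n', rfl, rfl, rfl⟩ := Link.map_eq_ax e'
        simpa using h.inj p n p' n' hl hl' hp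
      all_goals simp at e e'
    · rintro (_ | v)
      · simp only [Option.elim, Ty.bind, h.bind, hA, hB]; rfl
      · exact h.bind v
    · have := h.bal q
      simp only [e, List.drop_succ_cons, List.drop_zero, List.map_cons, List.map_map,
        List.sum_cons, Option.elim, Ty.count] at this ⊢
      simp only [Function.comp_def] at this ⊢
      omega

theorem Generic.limpPos (h : Generic Θ) {a : Θ.Occ} {r : List Θ.Occ}
    (e : Θ.hyps = a :: r) (hA : Θ.form a = .neg A) (hB : Θ.form Θ.concl = .pos B) :
    Generic (.limpPos A B Θ) where
  atomic := by
    rintro l (⟨l, hl, rfl⟩ | ⟨a', r', -, rfl⟩)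
    · exact (Link.atomic_map _ _ _).2 (h.atomic l hl)
    · trivial
  lab := by
    obtain ⟨f, θ, h⟩ := h.lab
    refine ⟨fun v => v.elim (.limp (f a) (f Θ.concl)) f, θ, (lab_limpPos e hA hB).2 ⟨h.lab, rfl⟩,
      ?_, ?_, fun q => ?_⟩
    · rintro p n p' n' (⟨l, hl, e⟩ | ⟨a', r', -, e⟩) (⟨l', hl', e'⟩ | ⟨a', r', -, e'⟩) hp
      · obtain ⟨p, n, rfl, rfl, rfl⟩ := Link.map_eq_ax e
        obtain ⟨p', n', rfl, rfl, rfl⟩ := Link.map_eq_ax e'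
        simpa using h.inj p n p' n' hl hl' hp
      all_goals simp at e e'
    · rintro (_ | v)
      · simp only [Option.elim, Ty.bind, h.bind, hA, hB]; rfl
      · exact h.bind v
    · have := h.bal q
      simp only [e, List.drop_succ_cons, List.drop_zero, List.map_cons, List.map_map,
        List.sum_cons, Option.elim, Ty.count] at this ⊢
      simp only [Function.comp_def] at this ⊢
      omega

/-- The atoms of the two generic labellings are separated, even numbers for one part and odd numbers
for the other. Labels of ID-links in different parts then differ, and an atom of the conclusions
comes from one part only, so balance is inherited. -/
theorem Generic.tensorPos (h : Generic Θ) (h' : Generic Ξ) (hA : Θ.form Θ.concl = .pos A)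
    (hB : Ξ.form Ξ.concl = .pos B) : Generic (.tensorPos A B Θ Ξ) where
  atomic := by
    rintro l ((⟨l, hl, rfl⟩ | ⟨l, hl, rfl⟩) | rfl)
    · exact (Link.atomic_map _ _ _).2 (h.atomic l hl)
    · exact (Link.atomic_map _ _ _).2 (h'.atomic l hl)
    · trivial
  lab := by
    obtain ⟨f, θ, h⟩ := h.lab
    obtain ⟨g, θ', h'⟩ := h'.lab
    refine ⟨fun v => v.elim (.tensor (f Θ.concl).even (g Ξ.concl).odd)
      (Sum.elim (fun v => (f v).even) fun v => (g v).odd), joinSubst θ θ',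
      (lab_tensorPos hA hB).2 ⟨h.lab.bind _, h'.lab.bind _, rfl⟩, ?_, ?_, fun q => ?_⟩
    · rintro p n p' n' ((⟨l, hl, e⟩ | ⟨l, hl, e⟩) | e) ((⟨l', hl', e'⟩ | ⟨l', hl', e'⟩) | e') hp
      any_goals simp at e e'
      all_goals
        obtain ⟨p, n, rfl, rfl, rfl⟩ := Link.map_eq_ax e
        obtain ⟨p', n', rfl, rfl, rfl⟩ := Link.map_eq_ax e'
      · simpa using h.inj p n p' n' hl hl' (Ty.even_injective hp)
      · exact absurd hp (Ty.even_ne_odd _ _)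
      · exact absurd hp.symm (Ty.even_ne_odd _ _)
      · simpa using h'.inj p n p' n' hl hl' (Ty.odd_injective hp)
    · rintro (_ | v | v)
      · simp only [Option.elim, Ty.bind, Ty.even_join, Ty.odd_join, h.bind, h'.bind, hA, hB]; rfl
      · exact (Ty.even_join _ _ _).trans (h.bind v)
      · exact (Ty.odd_join _ _ _).trans (h'.bind v)
    · simp only [List.map_append, List.map_map, List.sum_append, Option.elim, Ty.count,
        Function.comp_def, Sum.elim_inl, Sum.elim_inr]
      obtain ⟨k, rfl | rfl⟩ : ∃ k, q = 2 * k ∨ q = 2 * k + 1 := ⟨q / 2, by omega⟩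
      · have := h.bal k
        rw [(sum_count_even _ _ _).1, (sum_count_odd _ _ _).1, (Ty.count_even _ _).1,
          (Ty.count_odd _ _).1]
        omega
      · have := h'.bal k
        rw [(sum_count_even _ _ _).2, (sum_count_odd _ _ _).2, (Ty.count_even _ _).2,
          (Ty.count_odd _ _).2]
        omega

theorem Generic.limpNeg (h : Generic Θ) (h' : Generic Ξ) {b : Ξ.Occ} {r : List Ξ.Occ}
    (e : Ξ.hyps = b :: r) (hA : Θ.form Θ.concl = .pos A) (hB : Ξ.form b = .neg B) :
    Generic (.limpNeg A B Θ Ξ) where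
  atomic := by
    rintro l ((⟨l, hl, rfl⟩ | ⟨l, hl, rfl⟩) | ⟨_, _, -, rfl⟩)
    · exact (Link.atomic_map _ _ _).2 (h.atomic l hl)
    · exact (Link.atomic_map _ _ _).2 (h'.atomic l hl)
    · trivial
  lab := by
    obtain ⟨f, θ, h⟩ := h.lab
    obtain ⟨g, θ', h'⟩ := h'.lab
    refine ⟨fun v => v.elim (.limp (f Θ.concl).even (g b).odd)
      (Sum.elim (fun v => (f v).even) fun v => (g v).odd), joinSubst θ θ',
      (lab_limpNeg e hA hB).2 ⟨h.lab.bind _, h'.lab.bind _, rfl⟩, ?_, ?_, fun q => ?_⟩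
    · rintro p n p' n' ((⟨l, hl, e⟩ | ⟨l, hl, e⟩) | ⟨_, _, -, e⟩)
        ((⟨l', hl', e'⟩ | ⟨l', hl', e'⟩) | ⟨_, _, -, e'⟩) hp
      any_goals simp at e e'
      all_goals
        obtain ⟨p, n, rfl, rfl, rfl⟩ := Link.map_eq_ax e
        obtain ⟨p', n', rfl, rfl, rfl⟩ := Link.map_eq_ax e'
      · simpa using h.inj p n p' n' hl hl' (Ty.even_injective hp)
      · exact absurd hp (Ty.even_ne_odd _ _)
      · exact absurd hp.symm (Ty.even_ne_odd _ _)
      · simpa using h'.inj p n p' n' hl hl' (Ty.odd_injective hp)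
    · rintro (_ | v | v)
      · simp only [Option.elim, Ty.bind, Ty.even_join, Ty.odd_join, h.bind, h'.bind, hA, hB]; rfl
      · exact (Ty.even_join _ _ _).trans (h.bind v)
      · exact (Ty.odd_join _ _ _).trans (h'.bind v)
    · simp only [e, List.drop_succ_cons, List.drop_zero, List.map_cons, List.sum_cons,
        List.map_append, List.map_map, List.sum_append, Option.elim, Ty.count,
        Function.comp_def, Sum.elim_inl, Sum.elim_inr]
      obtain ⟨k, rfl | rfl⟩ : ∃ k, q = 2 * k ∨ q = 2 * k + 1 := ⟨q / 2, by omega⟩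
      · have := h.bal k
        rw [(sum_count_even _ _ _).1, (sum_count_odd _ _ _).1, (Ty.count_even _ _).1,
          (Ty.count_odd _ _).1, (Ty.count_odd _ _).1]
        omega
      · have := h'.bal k
        rw [(sum_count_even _ _ _).2, (sum_count_odd _ _ _).2, (Ty.count_even _ _).2,
          (Ty.count_odd _ _).2, (Ty.count_odd _ _).2]
        simp only [e, List.map_cons, List.sum_cons] at this
        omega

end

/-- A term is represented by a generic proof net. -/
def Norm (l : List ℕ) (t : Term) (Γ : List Ty) (A : Ty) : Prop :=
  ∃ N, IsProofNet Γ A N ∧ Generic N ∧ Rep l t Γ A N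

section
variable {l m : List ℕ} {t s u : Term} {Γ Δ : List Ty} {A B C : Ty}

theorem Norm.congr (h : Norm l t Γ A) {ρ₀ : ℕ → Ty} (hρ : l.map ρ₀ = Γ) (e : EqE ρ₀ t s A) :
    Norm l s Γ A := by
  obtain ⟨N, h1, h2, h3⟩ := h
  exact ⟨N, h1, h2, h3.congr hρ e⟩

theorem Norm.rule {D : TermCtx} (h : Norm l (D.plug t) Γ A) (hr : BetaEtaRule t s) :
    Norm l (D.plug s) Γ A := by
  obtain ⟨N, h1, h2, h3⟩ := h
  exact ⟨N, h1, h2, h3.rule hr⟩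

theorem Norm.tensorPos (h1 : Norm l t Γ A) (h2 : Norm m s Δ B) (hd : ∀ z ∈ t.occ, z ∉ s.occ) :
    Norm (l ++ m) (.pair t s) (Γ ++ Δ) (.tensor A B) := by
  obtain ⟨N, a1, a2, a3⟩ := h1
  obtain ⟨M, b1, b2, b3⟩ := h2
  exact ⟨_, .tensorPos _ _ _ _ _ _ a1 b1, a2.tensorPos b2 a3.bdry.2 b3.bdry.2, a3.tensorPos b3 hd⟩

theorem Norm.tensorNeg {x y z : ℕ} (h : Norm (x :: y :: l) t (A :: B :: Γ) C) (hz : z ∉ t.occ) :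
    Norm (z :: l) (.letp x y (.var z) t) (.tensor A B :: Γ) C := by
  obtain ⟨N, a1, a2, a3⟩ := h
  obtain ⟨a, b, r, e, fa, fb, -⟩ := a3.cons_cons
  exact ⟨_, .tensorNeg _ _ _ _ _ a1, a2.tensorNeg e fa fb, a3.tensorNeg hz⟩

theorem Norm.limpPos {x : ℕ} (h : Norm (x :: l) t (A :: Γ) B) :
    Norm l (.lam x t) Γ (.limp A B) := by
  obtain ⟨N, a1, a2, a3⟩ := h
  obtain ⟨a, r, e, fa, -⟩ := a3.cons
  exact ⟨_, .limpPos _ _ _ _ a1, a2.limpPos e fa a3.bdry.2, a3.limpPos⟩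

theorem Norm.limpNeg {f y : ℕ} (h1 : Norm l s Γ A) (h2 : Norm (y :: m) t (B :: Δ) C)
    (hfs : f ∉ s.occ) (hft : f ∉ t.occ) (hd : ∀ z ∈ t.occ, z ∉ s.occ) :
    Norm (f :: (l ++ m)) (splitTerm y t f s) (.limp A B :: (Γ ++ Δ)) C := by
  obtain ⟨N, a1, a2, a3⟩ := h1
  obtain ⟨M, b1, b2, b3⟩ := h2
  obtain ⟨b, r, e, fb, -⟩ := b3.cons
  exact ⟨_, .limpNeg _ _ _ _ _ _ _ a1 b1, a2.limpNeg b2 e a3.bdry.2 fb,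
    a3.limpNeg b3 hfs hft hd⟩

theorem Norm.swap {x y : ℕ} (h : Norm (l ++ x :: y :: m) t (Γ ++ A :: B :: Δ) C)
    (hl : l.length = Γ.length) : Norm (l ++ y :: x :: m) t (Γ ++ B :: A :: Δ) C := by
  obtain ⟨N, a1, a2, a3⟩ := h
  refine ⟨_, .exch _ _ _ _ _ _ a1, a2.exch _, ?_⟩
  have := a3.exch Γ.length
  rw [PStruct.swapAt_append, ← hl, PStruct.swapAt_append] at this
  rw [← hl]
  exact this

theorem Norm.perm {ρ : ℕ → Ty} (h : Norm l t (l.map ρ) A) (hp : l.Perm m) :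
    Norm m t (m.map ρ) A := by
  refine perm_induction (P := fun l => Norm l t (l.map ρ) A) ?_ hp h
  intro l m x y h
  simp only [List.map_append, List.map_cons] at h ⊢
  exact h.swap (by simp)

/-- Only atomic ID-links are generic. A compound identity is represented by its eta expansion, built
from the identities of the components, and the term it reads as is equal to x. -/
theorem Norm.var (x : ℕ) (A : Ty) : Norm [x] (.var x) [A] A := by
  induction A generalizing x with
  | var q => exact ⟨_, .idLink _, .idLink q, .idLink x _⟩
  | tensor B C ih1 ih2 =>
      obtain ⟨b, c, hbc, hb, hc⟩ := exists_fresh_two [x]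
      simp only [List.mem_singleton] at hb hc
      have h1 := ((ih1 b).tensorPos (ih2 c) (by simpa [Term.occ] using hbc))
      have h2 := h1.tensorNeg (z := x) (by
        simp only [Term.occ, List.mem_append, List.mem_singleton]; grind)
      exact h2.rule (D := .hole) (.eta2 _ _ _)
  | limp B C ih1 ih2 =>
      obtain ⟨y, z, hyz, hy, hz⟩ := exists_fresh_two [x]
      simp only [List.mem_singleton] at hy hz
      have h1 := (ih1 y).limpNeg (ih2 z) (f := x) (by simpa [Term.occ] using Ne.symm hy)
        (by simpa [Term.occ] using Ne.symm hz) (by simpa [Term.occ] using hyz.symm)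
      have h2 := h1.rule (D := .hole) (.beta1 _ _ _)
      rw [Term.subst1_var_self] at h2
      have h3 := Norm.limpPos (h2.swap (l := []) (Γ := []) rfl)
      exact h3.rule (D := .hole) (.eta1 _ _)

end

/-- Every typed term is represented by a generic proof net. -/
theorem J.norm {ρ : ℕ → Ty} {t : Term} {A : Ty} (h : J ρ t A) :
    ∀ l : List ℕ, l.Nodup → (∀ z, z ∈ l ↔ z ∈ t.FV) → Norm l t (l.map ρ) A := by
  have perm : ∀ {ρ : ℕ → Ty} {t : Term} {A : Ty} {l : List ℕ}, Norm l t (l.map ρ) A →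
      ∀ l' : List ℕ, l'.Nodup → (∀ z, z ∈ l' ↔ z ∈ t.FV) → Norm l' t (l'.map ρ) A := by
    intro ρ t A l h l' hl' hf'
    obtain ⟨N, a1, a2, a3⟩ := id h
    exact h.perm ((List.perm_ext_iff_of_nodup a3.nodup hl').2 fun z => by rw [a3.fv, hf'])
  -- In the induction along normalisation, introductions and heads add a link without a cut, a
  -- variable adds an expanded identity, and a beta-eta step only replaces the term by an equal one.
  -- So the net found is cut-free although the term is not.
  refine J.induction (P := fun ρ t A => ∀ l : List ℕ, l.Nodup → (∀ z, z ∈ l ↔ z ∈ t.FV) →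
    Norm l t (l.map ρ) A) ?_ ?_ ?_ ?_ ?_ ?_ h
  · intro ρ x
    exact perm (l := [x]) (.var x _)
  · intro ρ x t B C h hx ih l hl hf
    simp only [Term.FV, Finset.mem_erase] at hf
    have hxl : x ∉ l := by rw [hf]; simp
    have := ih (x :: l) (List.nodup_cons.2 ⟨hxl, hl⟩) (by
      intro z; rw [List.mem_cons, hf]; grind)
    rw [List.map_cons, map_update hxl, Function.update_self] at this
    exact this.limpPos
  · intro ρ s t B C h1 h2 hd ih1 ih2
    refine perm (l := s.FV.toList ++ t.FV.toList) ?_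
    rw [List.map_append]
    exact (ih1 _ (Finset.nodup_toList _) (by simp)).tensorPos
      (ih2 _ (Finset.nodup_toList _) (by simp)) hd
  · intro ρ E r r' A h hr ih l hl hf
    have e := EqE.rule E h hr
    exact (ih l hl (by rw [← e.FV_eq]; exact hf)).congr rfl e.symm
  · intro ρ E f s z D B A h hE hf hz hs hEz ih1 ih2
    have e := h.headApp_eq hE hf hz hs hEz
    obtain ⟨j1, j2, j3, j4, j5, j6, j7, j8, j9⟩ := e.right.split_inv hf
    have hzl : z ∉ ((E.plug (.var z)).FV.erase z).toList := by simp
    refine fun l hl hl' => Norm.congr (ρ₀ := ρ) (perm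
      (l := f :: (s.FV.toList ++ ((E.plug (.var z)).FV.erase z).toList)) ?_ l hl
      (by rw [← e.FV_eq]; exact hl')) rfl e.symm
    have h2 := ih2 (z :: ((E.plug (.var z)).FV.erase z).toList)
      (List.nodup_cons.2 ⟨hzl, Finset.nodup_toList _⟩) (by
        intro x; simp only [List.mem_cons, Finset.mem_toList, Finset.mem_erase]; grind)
    rw [List.map_cons, map_update hzl, Function.update_self] at h2
    rw [List.map_cons, List.map_append, hf]
    exact (ih1 _ (Finset.nodup_toList _) (by simp)).limpNeg h2 j4 j6 j7
  · intro ρ E x y f w B C A h hE hf hEw ih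
    have e := EqE.comm h (by simp [hE])
    obtain ⟨_, _, -, -, hx, hy, hxy, hd⟩ := e.right.letp_inv
    refine fun l hl hl' => Norm.congr (ρ₀ := ρ) (perm
      (l := f :: ((E.plug w).FV \ {x, y}).toList) ?_ l hl (by rw [← e.FV_eq]; exact hl')) rfl e.symm
    have hn : x ∉ ((E.plug w).FV \ {x, y}).toList := by simp
    have hn' : y ∉ ((E.plug w).FV \ {x, y}).toList := by simp
    have h2 := ih (x :: y :: ((E.plug w).FV \ {x, y}).toList)
      (by simp only [List.nodup_cons, List.mem_cons, not_or]; exact ⟨⟨hxy, hn⟩, hn', Finset.nodup_toList _⟩) (by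
        intro x; simp only [List.mem_cons, Finset.mem_toList, Finset.mem_sdiff, Finset.mem_insert,
          Finset.mem_singleton]; grind)
    rw [List.map_cons, List.map_cons, map_update hn', map_update hn, Function.update_self,
      Function.update_of_ne hxy, Function.update_self] at h2
    rw [List.map_cons, hf]
    exact h2.tensorNeg (hd f (by simp [Term.occ]))

/-! ### Reduction steps and the invariants of structures -/

/-- What a reduction step preserves. -/
structure Sound (Θ Θ' : PStruct) : Prop where
  good : Good Θ'
  bdry : ∀ Γ A, Bdry Γ A Θ → Bdry Γ A Θ'
  typ : ∀ G Z, Typ Θ' G Z ↔ Typ Θ G Z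
  uniq : Uniq Θ → Uniq Θ'

/-- The links of `L` are a correct replacement for those of `Θ` after the deletion of the
occurrences in `gone`. -/
structure Sim (Θ : PStruct) (gone : Set Θ.Occ) (L : Set (Link Θ.Occ)) : Prop where
  bdry : Θ.concl ∉ gone ∧ ∀ v ∈ Θ.hyps, v ∉ gone
  finite : L.Finite
  typed : ∀ l ∈ L, l.Typed Θ.form
  concls : Cov Link.concls L goneᶜ
  prems : Cov Link.prems L {v | (v ≠ Θ.concl ∧ v ∉ Θ.hyps) ∧ v ∉ gone}
  restrict : ∀ f, Θ.Lab f → ∀ l ∈ L, l.Ok f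
  extend : ∀ f, (∀ l ∈ L, l.Ok f) → (∀ v ∉ gone, (f v).sh = (Θ.form v).ty.sh) →
    ∃ f', Θ.Lab f' ∧ ∀ v ∉ gone, f' v = f v

/-- The remaining structure embeds into the old occurrences. Labellings restrict along the
embedding, and `extend` supplies labels for the deleted occurrences; since the conclusions survive,
`Typ` and `Uniq` are unaffected. -/
theorem Sim.sound {Θ Θ' : PStruct} {gone : Set Θ.Occ} {L : Set (Link Θ.Occ)} (h : Sim Θ gone L)
    (hg : Good Θ) (r : Θ.Remains Θ' gone L) : Sound Θ Θ' := by
  obtain ⟨ι, hr, hform, hlinks, hhyps, hconcl⟩ := r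
  have inj := ι.injective
  have hgone : ∀ v, ι v ∉ gone := fun v => by
    rw [← Set.mem_compl_iff, ← hr]; exact ⟨v, rfl⟩
  have lab_restrict : ∀ f, Θ.Lab f → Θ'.Lab (f ∘ ι) := fun f hf =>
    ⟨fun l hl => (Link.ok_map _ _ _).1 (h.restrict f hf _ (hlinks ▸ ⟨l, hl, rfl⟩)), fun v => by
      rw [hform]; exact hf.2 _⟩
  have lab_extend : ∀ f, Θ'.Lab f → ∃ f', Θ.Lab f' ∧ f' ∘ ι = f := by
    intro f hf
    have hext : ∀ v, Function.extend ι f (fun _ => .var 0) (ι v) = f v :=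
      fun v => inj.extend_apply _ _ _
    obtain ⟨f', h1, h2⟩ := h.extend (Function.extend ι f fun _ => .var 0) (by
      rw [← hlinks]
      rintro _ ⟨l, hl, rfl⟩
      rw [Link.ok_map]
      exact (hf.1 l hl).congr (fun v _ => hext v) fun v _ => hext v) (by
      intro v hv
      rw [← Set.mem_compl_iff, ← hr] at hv
      obtain ⟨v, rfl⟩ := hv
      rw [hext, hf.2, hform])
    exact ⟨f', h1, funext fun v => (h2 _ (hgone v)).trans (hext v)⟩
  refine ⟨⟨?_, ?_, ?_, ?_, ?_⟩, ?_, ?_, ?_⟩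
  · refine Set.Finite.of_finite_image (f := Link.map ι) ?_ (Link.map_injective inj).injOn
    rw [hlinks]; exact h.finite
  · intro l hl
    have hL : l.map ι ∈ L := hlinks ▸ ⟨l, hl, rfl⟩
    have := (Link.typed_map _ _ _).1 (h.typed _ hL)
    exact this.congr (fun v _ => hform v) fun v _ => hform v
  · refine (Cov.comap (Link.concls_map ι) inj (hlinks ▸ h.concls)).congr rfl fun v => ?_
    simpa using hgone v
  · refine (Cov.comap (Link.prems_map ι) inj (hlinks ▸ h.prems)).congr rfl fun v => ?_
    simp only [← hhyps, ← hconcl, Set.mem_preimage, Set.mem_ofPred_eq, inj.ne_iff,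
      List.mem_map_of_injective inj]
    simp [hgone v]
  · have := hg.nodup
    rw [← hhyps, ← hconcl, ← List.map_cons] at this
    exact this.of_map _
  · rintro Γ A ⟨h1, h2⟩
    refine ⟨?_, by rw [hform, hconcl, h2]⟩
    rw [← h1, ← hhyps, List.map_map]
    exact List.map_congr_left fun v _ => hform v
  · intro G Z
    constructor
    · rintro ⟨f, hf, rfl, rfl⟩
      obtain ⟨f', h1, rfl⟩ := lab_extend f hf
      exact ⟨f', h1, by rw [← hhyps, List.map_map], by rw [← hconcl]; rfl⟩
    · rintro ⟨f, hf, rfl, rfl⟩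
      exact ⟨_, lab_restrict f hf, by rw [← hhyps, List.map_map], by rw [← hconcl]; rfl⟩
  · intro hu f g hf hg e1 e2
    obtain ⟨f, h1, rfl⟩ := lab_extend f hf
    obtain ⟨g, h2, rfl⟩ := lab_extend g hg
    rw [hu f g h1 h2 (by simpa [← hhyps] using e1) (by simpa [← hconcl] using e2)]

theorem Link.exists_map {V : Type} {P : V → Prop} {l : Link V} (h1 : ∀ v ∈ l.prems, P v)
    (h2 : ∀ v ∈ l.concls, P v) : ∃ l' : Link {v // P v}, l'.map Subtype.val = l := by
  cases l with
  | ax a b => exact ⟨.ax ⟨a, h2 a (by simp [concls])⟩ ⟨b, h2 b (by simp [concls])⟩, rfl⟩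
  | cut a b => exact ⟨.cut ⟨a, h1 a (by simp [prems])⟩ ⟨b, h1 b (by simp [prems])⟩, rfl⟩
  | tensorPos a b c => exact ⟨.tensorPos ⟨a, h1 a (by simp [prems])⟩ ⟨b, h1 b (by simp [prems])⟩
      ⟨c, h2 c (by simp [concls])⟩, rfl⟩
  | tensorNeg a b c => exact ⟨.tensorNeg ⟨a, h1 a (by simp [prems])⟩ ⟨b, h1 b (by simp [prems])⟩
      ⟨c, h2 c (by simp [concls])⟩, rfl⟩
  | limpPos a b c => exact ⟨.limpPos ⟨a, h1 a (by simp [prems])⟩ ⟨b, h1 b (by simp [prems])⟩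
      ⟨c, h2 c (by simp [concls])⟩, rfl⟩
  | limpNeg a b c => exact ⟨.limpNeg ⟨a, h1 a (by simp [prems])⟩ ⟨b, h1 b (by simp [prems])⟩
      ⟨c, h2 c (by simp [concls])⟩, rfl⟩

/-- Reduction is a relation between structures, so a reduct has to be constructed before one can say
that a normal structure contains no redex. -/
theorem Sim.exists_remains {Θ : PStruct} {gone : Set Θ.Occ} {L : Set (Link Θ.Occ)}
    (h : Sim Θ gone L) : ∃ Θ', Θ.Remains Θ' gone L := by
  have hh : ∃ hy : List {v // v ∉ gone}, hy.map Subtype.val = Θ.hyps := by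
    have := h.bdry.2
    generalize Θ.hyps = l at this
    lift l to List {v // v ∉ gone} using this
    exact ⟨l, rfl⟩
  obtain ⟨hy, hh⟩ := hh
  refine ⟨⟨{v // v ∉ gone}, fun v => Θ.form v, {l | l.map Subtype.val ∈ L}, hy, ⟨_, h.bdry.1⟩⟩,
    .subtype _, ?_, fun _ => rfl, ?_, hh, rfl⟩
  · ext v; simp
  · ext l
    constructor
    · rintro ⟨l, hl, rfl⟩; exact hl
    · intro hl
      obtain ⟨l', rfl⟩ := Link.exists_map (P := fun v => v ∉ gone) (l := l)
        (fun v hv => ((h.prems.mem v).2 ⟨l, hl, hv⟩).2) fun v hv => (h.concls.mem v).2 ⟨l, hl, hv⟩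
      exact ⟨l', hl, rfl⟩

theorem Cov.replace {ι V : Type} {f : ι → List V} {L D K : Set ι} {S T U : Set V} (h : Cov f L S)
    (hD : D ⊆ L) (hK : Cov f K T) (hT : ∀ v ∈ T, v ∈ S)
    (hU : ∀ v, (∃ l ∈ D, v ∈ f l) ↔ v ∈ T ∨ v ∈ U) (hd : ∀ v ∈ T, v ∉ U) :
    Cov f (L \ D ∪ K) {v | v ∈ S ∧ v ∉ U} := by
  refine ((h.diff hD).union hK fun v hv hv' => ?_).congr rfl fun v => ?_
  · exact hv.2 ((hU v).2 (.inl hv'))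
  · have := hT v
    have := hd v
    simp only [Set.mem_union, Set.mem_sdiff, Set.mem_ofPred_eq, hU]
    tauto

theorem Cov.pair {ι V : Type} {f : ι → List V} {k₁ k₂ : ι} (h₁ : (f k₁).Nodup) (h₂ : (f k₂).Nodup)
    (hd : ∀ v ∈ f k₁, v ∉ f k₂) : Cov f {k₁, k₂} {v | v ∈ f k₁ ∨ v ∈ f k₂} := by
  refine ((Cov.single h₁).union (Cov.single h₂) hd).congr ?_ fun v => .rfl
  ext; simp [or_comm]

/-- The elimination of a cut between dual links. -/
theorem Good.sim_cut {Θ : PStruct} (h : Good Θ) {l₁ l₂ k₁ k₂ : Link Θ.Occ} {a b c a' b' c' : Θ.Occ}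
    {op : Ty → Ty → Ty} (hl₁ : l₁ ∈ Θ.links) (hl₂ : l₂ ∈ Θ.links) (hl₃ : .cut c c' ∈ Θ.links)
    (p₁ : l₁.prems = [a, b]) (p₂ : l₂.prems = [a', b']) (c₁ : l₁.concls = [c])
    (c₂ : l₂.concls = [c']) (q₁ : k₁.prems.Perm [a, a']) (q₂ : k₂.prems.Perm [b, b'])
    (d₁ : k₁.concls = []) (d₂ : k₂.concls = []) (t₁ : k₁.Typed Θ.form) (t₂ : k₂.Typed Θ.form)
    (hne : l₁ ≠ l₂) (o₁ : ∀ f, l₁.Ok f ↔ f c = op (f a) (f b))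
    (o₂ : ∀ f, l₂.Ok f ↔ f c' = op (f a') (f b')) (r₁ : ∀ f, k₁.Ok f ↔ f a = f a')
    (r₂ : ∀ f, k₂.Ok f ↔ f b = f b')
    (op_inj : ∀ X Y X' Y', op X Y = op X' Y' → X = X' ∧ Y = Y') 
    (op_sh : ∀ X Y X' Y', X.sh = X'.sh → Y.sh = Y'.sh → (op X Y).sh = (op X' Y').sh) :
    Sim Θ {c, c'} ((Θ.links \ {l₁, l₂, .cut c c'}) ∪ {k₁, k₂}) := by
  have hsub : ({l₁, l₂, .cut c c'} : Set (Link Θ.Occ)) ⊆ Θ.links := by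
    rintro l (rfl | rfl | rfl) <;> assumption
  have u := h.prems.unique
  have uc := h.concls.unique
  have n₁ : l₁ ≠ .cut c c' := by rintro rfl; simp [Link.concls] at c₁
  have n₂ : l₂ ≠ .cut c c' := by rintro rfl; simp [Link.concls] at c₂
  have pc : (Link.cut c c').prems = [c, c'] := rfl
  have cc : (Link.cut c c').concls = [] := rfl
  have u12 := u _ hl₁ _ hl₂
  have u13 := u _ hl₁ _ hl₃
  have u23 := u _ hl₂ _ hl₃
  have nd1 := h.prems.nodup _ hl₁
  have nd2 := h.prems.nodup _ hl₂
  have mem := h.prems.mem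
  have S1 := fun v hv => (mem v).2 ⟨_, hl₁, hv⟩
  have S2 := fun v hv => (mem v).2 ⟨_, hl₂, hv⟩
  have S3 := fun v hv => (mem v).2 ⟨_, hl₃, hv⟩
  have mk₁ := fun v => q₁.mem_iff (a := v)
  have mk₂ := fun v => q₂.mem_iff (a := v)
  simp only [p₁, p₂, pc, List.mem_cons, List.not_mem_nil, or_false, forall_eq_or_imp, forall_eq,
    List.nodup_cons, List.nodup_nil, and_true, not_false_eq_true, Set.mem_ofPred_eq]
    at u12 u13 u23 nd1 nd2 S1 S2 S3 mk₁ mk₂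
  have hab : ∀ v, v = a ∨ v = b ∨ v = a' ∨ v = b' → v ≠ c ∧ v ≠ c' := by
    rintro v (e | e | e | e) <;> rw [e]
    · exact ⟨fun e => n₁ (u13.1 (.inl e)), fun e => n₁ (u13.1 (.inr e))⟩
    · exact ⟨fun e => n₁ (u13.2 (.inl e)), fun e => n₁ (u13.2 (.inr e))⟩
    · exact ⟨fun e => n₂ (u23.1 (.inl e)), fun e => n₂ (u23.1 (.inr e))⟩
    · exact ⟨fun e => n₂ (u23.2 (.inl e)), fun e => n₂ (u23.2 (.inr e))⟩
  have a_ne : a ≠ a' := fun e => hne (u12.1 (.inl e))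
  have b_ne : b ≠ b' := fun e => hne (u12.2 (.inr e))
  have u12' : (a ≠ b ∧ a ≠ b') ∧ a' ≠ b ∧ a' ≠ b' := by
    exact ⟨⟨nd1, fun e => hne (u12.1 (.inr e))⟩, fun e => hne (u12.2 (.inl e.symm)), nd2⟩
  have hgone : ∀ l ∈ Θ.links, l ≠ l₁ → l ≠ l₂ → l ≠ .cut c c' →
      (∀ v ∈ l.prems, v ≠ c ∧ v ≠ c') ∧ ∀ v ∈ l.concls, v ≠ c ∧ v ≠ c' := by
    intro l hl m1 m2 m3
    refine ⟨fun v hv => ⟨?_, ?_⟩, fun v hv => ⟨?_, ?_⟩⟩ <;> rintro rfl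
    · exact m3 (u _ hl _ hl₃ v hv (by simp [pc]))
    · exact m3 (u _ hl _ hl₃ v hv (by simp [pc]))
    · exact m1 (uc _ hl _ hl₁ v hv (by simp [c₁]))
    · exact m2 (uc _ hl _ hl₂ v hv (by simp [c₂]))
  refine ⟨?_, ?_, ?_, ?_, ?_, ?_, ?_⟩
  · simp only [Set.mem_insert_iff, Set.mem_singleton_iff]
    grind
  · exact h.finite.sdiff.union (by simp)
  · rintro l (hl | rfl | rfl)
    · exact h.typed l hl.1
    · exact t₁
    · exact t₂
  · refine ((h.concls.diff hsub).union (K := {k₁, k₂}) (T := ∅) ⟨?_, ?_, ?_⟩ (by simp)).congr rfl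
      fun v => ?_
    · simp [d₁, d₂]
    · simp [d₁, d₂]
    · simp [d₁, d₂]
    · simp [c₁, c₂, cc]
  · refine h.prems.replace hsub (Cov.pair (q₁.nodup_iff.2 ?_) (q₂.nodup_iff.2 ?_) ?_) ?_ ?_ ?_
    · simp [a_ne]
    · simp [b_ne]
    · simp only [mk₁, mk₂]
      rintro v (rfl | rfl) <;> rw [not_or]
      exacts [u12'.1, u12'.2]
    · simp only [mk₁, mk₂, Set.mem_ofPred_eq]
      rintro v ((rfl | rfl) | rfl | rfl)
      exacts [S1.1, S2.1, S1.2, S2.2]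
    · simp only [Set.mem_ofPred_eq, Set.mem_insert_iff, Set.mem_singleton_iff,
        exists_eq_or_imp, exists_eq_left, p₁, p₂, pc, mk₁, mk₂, List.mem_cons, List.not_mem_nil,
        or_false]
      intro v
      clear * -
      tauto
    · simp only [mk₁, mk₂, Set.mem_ofPred_eq, Set.mem_insert_iff, Set.mem_singleton_iff, not_or]
      rintro v ((rfl | rfl) | rfl | rfl)
      exacts [hab _ (.inl rfl), hab _ (.inr (.inr (.inl rfl))), hab _ (.inr (.inl rfl)),
        hab _ (.inr (.inr (.inr rfl)))]
  · rintro f hf l (hl | rfl | rfl)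
    · exact hf.1 l hl.1
    · have e1 := (o₁ f).1 (hf.1 _ hl₁)
      have e2 := (o₂ f).1 (hf.1 _ hl₂)
      have e3 : f c = f c' := hf.1 _ hl₃
      exact (r₁ f).2 (op_inj _ _ _ _ (e1.symm.trans (e3.trans e2))).1
    · have e1 := (o₁ f).1 (hf.1 _ hl₁)
      have e2 := (o₂ f).1 (hf.1 _ hl₂)
      have e3 : f c = f c' := hf.1 _ hl₃
      exact (r₂ f).2 (op_inj _ _ _ _ (e1.symm.trans (e3.trans e2))).2
  · intro f hf hs
    classical
    have e1 := (r₁ f).1 (hf _ (.inr (.inl rfl)))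
    have e2 := (r₂ f).1 (hf _ (.inr (.inr rfl)))
    -- The labels of the deleted cut formulas are forced by those of their components, which the two
    -- new cuts make equal on both sides.
    let f' : Θ.Occ → Ty := fun v => if v = c ∨ v = c' then op (f a) (f b) else f v
    have hf' : ∀ v, v ≠ c ∧ v ≠ c' → f' v = f v := fun v hv => if_neg (by tauto)
    have hc : f' c = op (f a) (f b) := if_pos (.inl rfl)
    have hc' : f' c' = op (f a) (f b) := if_pos (.inr rfl)
    have hfa := hf' a (hab a (by simp))
    have hfb := hf' b (hab b (by simp))
    have hfa' := hf' a' (hab a' (by simp))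
    have hfb' := hf' b' (hab b' (by simp))
    have sa := hs a (by simpa using hab a (by simp))
    have sb := hs b (by simpa using hab b (by simp))
    have sh : (op (f a) (f b)).sh = (op (Θ.form a).ty (Θ.form b).ty).sh := op_sh _ _ _ _ sa sb
    have h1 := (o₁ _).1 (h.lab.1 _ hl₁)
    have h3 : (Θ.form c).ty = (Θ.form c').ty := h.lab.1 _ hl₃
    refine ⟨f', ⟨fun l hl => ?_, fun v => ?_⟩, fun v hv => hf' v (by simpa using hv)⟩
    · by_cases m1 : l = l₁
      · subst m1; rw [o₁, hc, hfa, hfb]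
      by_cases m2 : l = l₂
      · subst m2; rw [o₂, hc', hfa', hfb', e1, e2]
      by_cases m3 : l = .cut c c'
      · subst m3; exact hc.trans hc'.symm
      obtain ⟨g1, g2⟩ := hgone l hl m1 m2 m3
      exact (hf l (.inl ⟨hl, by simp [m1, m2, m3]⟩)).congr (fun v hv => hf' v (g1 v hv))
        fun v hv => hf' v (g2 v hv)
    · by_cases m1 : v = c
      · subst m1; rw [hc, sh, ← h1]
      by_cases m2 : v = c'
      · subst m2; rw [hc', sh, ← h1, h3]
      rw [hf' v ⟨m1, m2⟩]
      exact hs v (by simp [m1, m2])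

theorem redirect_self {V : Type} (a b : V) : PStruct.redirect a b a = b := by
  simp [PStruct.redirect]

theorem redirect_ne {V : Type} {a b v : V} (h : v ≠ a) : PStruct.redirect a b v = v := by
  simp [PStruct.redirect, h]

theorem comp_redirect {V W : Type} {a b : V} {f : V → W} (h : f a = f b) (v : V) :
    f (PStruct.redirect a b v) = f v := by
  by_cases e : v = a
  · rw [e, redirect_self, h]
  · rw [redirect_ne e]

/-- The elimination of a cut against an ID-link. -/
theorem Good.sim_ax {Θ : PStruct} (h : Good Θ) {l₁ l₂ : Link Θ.Occ} {a b c : Θ.Occ}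
    (hl₁ : l₁ ∈ Θ.links) (hl₂ : l₂ ∈ Θ.links) (p₁ : l₁.prems = []) (c₁ : l₁.concls.Perm [a, b])
    (p₂ : l₂.prems.Perm [a, c]) (c₂ : l₂.concls = []) (o₁ : ∀ f, l₁.Ok f ↔ f a = f b)
    (o₂ : ∀ f, l₂.Ok f ↔ f a = f c) (hf : Θ.form c = Θ.form b) (hca : c ≠ a) (hcb : c ≠ b) :
    Sim Θ {a, c} (Link.map (PStruct.redirect c b) '' (Θ.links \ {l₁, l₂})) := by
  classical
  have hsub : ({l₁, l₂} : Set (Link Θ.Occ)) ⊆ Θ.links := by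
    rintro l (rfl | rfl) <;> assumption
  have u := h.prems.unique
  have uc := h.concls.unique
  have mem := h.prems.mem
  have mc := fun v => c₁.mem_iff (a := v)
  have mp := fun v => p₂.mem_iff (a := v)
  simp only [List.mem_cons, List.not_mem_nil, or_false] at mc mp
  have S2 := fun v hv => (mem v).2 ⟨_, hl₂, hv⟩
  have nd := h.concls.nodup _ hl₁
  rw [c₁.nodup_iff] at nd
  have hab : a ≠ b := by simpa using nd
  have hr : ∀ v, PStruct.redirect c b v = if v = c then b else v := fun v => by
    split
    · subst_vars; exact redirect_self _ _
    · exact redirect_ne ‹_›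
  -- Identifying c with b merges nothing: as a conclusion b has disappeared with the ID-link, and as
  -- a premise c has disappeared with the cut.
  have ginj : Set.InjOn (PStruct.redirect c b) {v | v ≠ a ∧ v ≠ b} := by
    intro v hv w hw e
    simp only [hr, Set.mem_ofPred_eq] at e hv hw
    grind
  have ginj' : Set.InjOn (PStruct.redirect c b) {v | v ≠ c} := by
    intro v hv w hw e
    simp only [hr, Set.mem_ofPred_eq] at e hv hw
    grind
  refine ⟨?_, ?_, ?_, ?_, ?_, ?_, ?_⟩
  · simp only [Set.mem_insert_iff, Set.mem_singleton_iff]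
    have := S2 a ((mp a).2 (.inl rfl))
    have := S2 c ((mp c).2 (.inr rfl))
    simp only [Set.mem_ofPred_eq] at *
    grind
  · exact h.finite.sdiff.image _
  · rintro _ ⟨l, hl, rfl⟩
    rw [Link.typed_map]
    exact (h.typed l hl.1).congr (fun v _ => comp_redirect hf v) fun v _ => comp_redirect hf v
  · refine (((h.concls.diff hsub).congr (T := {v | v ≠ a ∧ v ≠ b}) rfl fun v => ?_).map
      (Link.concls_map _) ginj).congr rfl fun v => ?_
    · simp [c₂, mc]
    · simp only [Set.mem_image, Set.mem_ofPred_eq, Set.mem_compl_iff, Set.mem_insert_iff,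
        Set.mem_singleton_iff, hr]
      constructor
      · grind
      · intro hv
        by_cases e : v = b
        · exact ⟨c, by grind⟩
        · exact ⟨v, by grind⟩
  · refine (((h.prems.diff hsub).congr (T := {v | (v ≠ Θ.concl ∧ v ∉ Θ.hyps) ∧ v ≠ a ∧ v ≠ c}) rfl
      fun v => ?_).map (Link.prems_map _) (ginj'.mono fun v hv => hv.2.2)).congr rfl fun v => ?_
    · simp [p₁, mp]
    · simp only [Set.mem_image, Set.mem_ofPred_eq, Set.mem_insert_iff, Set.mem_singleton_iff, hr]
      constructor
      · grind
      · intro hv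
        exact ⟨v, by grind⟩
  · rintro f hf _ ⟨l, hl, rfl⟩
    rw [Link.ok_map]
    have e : f c = f b := ((o₂ f).1 (hf.1 _ hl₂)).symm.trans ((o₁ f).1 (hf.1 _ hl₁))
    exact (hf.1 l hl.1).congr (fun v _ => comp_redirect e v) fun v _ => comp_redirect e v
  · intro f hok hs
    -- The ID-link and the cut force the deleted a and c to carry the label of b.
    let f' : Θ.Occ → Ty := fun v => if v = a ∨ v = c then f b else f v
    have ha : f' a = f b := if_pos (.inl rfl)
    have hc : f' c = f b := if_pos (.inr rfl)
    have hf' : ∀ v, v ≠ a → v ≠ c → f' v = f v := fun v h1 h2 => if_neg (by tauto)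
    have hg : ∀ v, v ≠ a → f' v = f (PStruct.redirect c b v) := fun v h1 => by
      rw [hr]; split
      · subst_vars; exact hc
      · exact hf' v h1 ‹_›
    have hb := hf' b hab.symm hcb.symm
    have sb := hs b (by simp [hab.symm, hcb.symm])
    refine ⟨f', ⟨fun l hl => ?_, fun v => ?_⟩, fun v hv => by
      simp only [Set.mem_insert_iff, Set.mem_singleton_iff, not_or] at hv
      exact hf' v hv.1 hv.2⟩
    · by_cases m1 : l = l₁
      · subst m1; rw [o₁, ha, hb]
      by_cases m2 : l = l₂
      · subst m2; rw [o₂, ha, hc]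
      refine ((Link.ok_map _ _ _).1 (hok _ ⟨l, ⟨hl, by simp [m1, m2]⟩, rfl⟩)).congr
        (fun v hv => hg v ?_) fun v hv => hg v ?_ <;> rintro rfl
      · exact m2 (u _ hl _ hl₂ v hv ((mp v).2 (.inl rfl)))
      · exact m1 (uc _ hl _ hl₁ v hv ((mc v).2 (.inl rfl)))
    · by_cases m1 : v = a
      · subst m1; rw [ha, sb, (o₁ _).1 (h.lab.1 _ hl₁)]
      by_cases m2 : v = c
      · subst m2; rw [hc, sb, hf]
      rw [hf' v m1 m2]
      exact hs v (by simp [m1, m2])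

theorem Link.concls_ax {V : Type} (p n : V) : (Link.ax p n).concls = [p, n] := rfl

theorem Link.prems_ax {V : Type} (p n : V) : (Link.ax p n).prems = [] := rfl

/-- The replacement of an ID-link of a compound formula by ID-links of the components. -/
theorem Good.sound_expand {Θ : PStruct} (h : Good Θ) {A B : Ty} {p n : Θ.Occ} {i j : Fin 4}
    {l₁ l₂ : Link (Θ.Occ ⊕ Fin 4)} {op : Ty → Ty → Ty} (hl : .ax p n ∈ Θ.links)
    -- The index i is the occurrence of A attached to p. It is 0 for a tensor and 1 for an
    -- implication, since there the first component has the opposite sign.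
    (hij : i = 0 ∧ j = 1 ∨ i = 1 ∧ j = 0)
    (p₁ : l₁.prems = [.inr i, .inr 2]) (p₂ : l₂.prems = [.inr j, .inr 3])
    (c₁ : l₁.concls = [.inl p]) (c₂ : l₂.concls = [.inl n])
    (o₁ : ∀ f, l₁.Ok f ↔ f (.inl p) = op (f (.inr i)) (f (.inr 2)))
    (o₂ : ∀ f, l₂.Ok f ↔ f (.inl n) = op (f (.inr j)) (f (.inr 3)))
    (hp : (Θ.form p).ty = op A B)
    (op_inj : ∀ X Y X' Y', op X Y = op X' Y' → X = X' ∧ Y = Y')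
    (op_sh : ∀ Z, Z.sh = (op A B).sh → ∃ X Y, Z = op X Y ∧ X.sh = A.sh ∧ Y.sh = B.sh)
    (t : ∀ l ∈ ({.ax (.inr 0) (.inr 1), .ax (.inr 2) (.inr 3), l₁, l₂} : Set _), l.Typed
      (Θ.expand A B {.ax p n} {.ax (.inr 0) (.inr 1), .ax (.inr 2) (.inr 3), l₁, l₂}).form) :
    Sound Θ (Θ.expand A B {.ax p n} {.ax (.inr 0) (.inr 1), .ax (.inr 2) (.inr 3), l₁, l₂}) := by
  set Θ' := Θ.expand A B {.ax p n} {.ax (.inr 0) (.inr 1), .ax (.inr 2) (.inr 3), l₁, l₂} with hΘ'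
  have hsub : ({.ax p n} : Set (Link Θ.Occ)) ⊆ Θ.links := by simpa using hl
  have inl := Sum.inl_injective (α := Θ.Occ) (β := Fin 4)
  have inr := Sum.inr_injective (α := Θ.Occ) (β := Fin 4)
  have pn : p ≠ n := by simpa [Link.concls] using h.concls.nodup _ hl
  have ax₁ : (Link.ax (.inr 0) (.inr 1) : Link (Θ.Occ ⊕ Fin 4)) ∈ Θ'.links :=
    .inr (.inl rfl)
  have ax₂ : (Link.ax (.inr 2) (.inr 3) : Link (Θ.Occ ⊕ Fin 4)) ∈ Θ'.links :=
    .inr (.inr (.inl rfl))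
  have m₁ : l₁ ∈ Θ'.links := .inr (.inr (.inr (.inl rfl)))
  have m₂ : l₂ ∈ Θ'.links := .inr (.inr (.inr (.inr rfl)))
  have hmap : ∀ f : Θ'.Occ → Ty, Θ'.hyps.map f = Θ.hyps.map fun v => f (.inl v) :=
    fun f => List.map_map
  have lab_old : ∀ f : Θ'.Occ → Ty, Θ'.Lab f → Θ.Lab fun v => f (.inl v) := by
    intro f hf
    refine ⟨fun l hl' => ?_, fun v => hf.2 (.inl v)⟩
    by_cases e : l = .ax p n
    · have e1 := (o₁ _).1 (hf.1 _ m₁)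
      have e2 := (o₂ _).1 (hf.1 _ m₂)
      have e3 : f (.inr 0) = f (.inr 1) := hf.1 _ ax₁
      have e4 : f (.inr 2) = f (.inr 3) := hf.1 _ ax₂
      rw [e]
      change f _ = f _
      rw [e1, e2, e4]
      rcases hij with ⟨rfl, rfl⟩ | ⟨rfl, rfl⟩ <;> rw [e3]
    · exact (Link.ok_map _ _ _).1 (hf.1 _ (.inl ⟨l, ⟨hl', e⟩, rfl⟩))
  have lab_new : ∀ f, Θ.Lab f → ∃ f', Θ'.Lab f' ∧ ∀ v, f' (.inl v) = f v := by
    intro f hf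
    have h1 : f p = f n := hf.1 _ hl
    -- The condition on shapes makes the label of p compound, so that its components can label the
    -- new occurrences.
    obtain ⟨X, Y, e, hX, hY⟩ := op_sh (f p) (by rw [hf.2, hp])
    refine ⟨Sum.elim f ![X, X, Y, Y], ⟨?_, ?_⟩, fun v => rfl⟩
    · rintro l (⟨l, hl, rfl⟩ | e' | e' | e' | e')
      · exact (Link.ok_map _ _ _).2 (hf.1 l hl.1)
      · rw [e']; rfl
      · rw [e']; rfl
      · rw [e', o₁]
        rcases hij with ⟨rfl, rfl⟩ | ⟨rfl, rfl⟩ <;> exact e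
      · rw [e', o₂]
        rcases hij with ⟨rfl, rfl⟩ | ⟨rfl, rfl⟩ <;> exact h1.symm.trans e
    · rintro (v | k)
      · exact hf.2 v
      · fin_cases k
        exacts [hX, hX, hY, hY]
  refine ⟨⟨?_, ?_, ?_, ?_, ?_⟩, ?_, ?_, ?_⟩
  · exact (h.finite.sdiff.image _).union (by simp)
  · rintro l (⟨l, hl, rfl⟩ | hl)
    · exact (Link.typed_map _ _ _).2 (h.typed l hl.1)
    · exact t l hl
  · have hK := (Cov.pair (f := Link.concls) (k₁ := .ax (.inr 0) (.inr 1))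
      (k₂ := (.ax (.inr 2) (.inr 3) : Link (Θ.Occ ⊕ Fin 4))) (by simp [Link.concls_ax])
      (by simp [Link.concls_ax]) (by simp [Link.concls_ax])).union
      (Cov.pair (f := Link.concls) (k₁ := l₁) (k₂ := l₂) (by simp [c₁]) (by simp [c₂])
        (by simp [c₁, c₂, pn])) (by simp [Link.concls_ax, c₁, c₂])
    refine (((h.concls.diff hsub).map (Link.concls_map _) inl.injOn).union hK ?_).congr ?_
      fun v => ?_
    · simp [Link.concls_ax, c₁, c₂]; grind
    · rw [Set.insert_union, Set.singleton_union]
    · rcases v with v | k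
      · simp [Link.concls_ax, c₁, c₂]; grind
      · simp [Link.concls_ax, c₁, c₂]; fin_cases k <;> simp
  · have hK := (Cov.pair (f := Link.prems) (k₁ := .ax (.inr 0) (.inr 1))
      (k₂ := (.ax (.inr 2) (.inr 3) : Link (Θ.Occ ⊕ Fin 4))) (by simp [Link.prems_ax])
      (by simp [Link.prems_ax]) (by simp [Link.prems_ax])).union
      (Cov.pair (f := Link.prems) (k₁ := l₁) (k₂ := l₂) (by rw [p₁]; simp; grind)
        (by rw [p₂]; simp; grind) (by rw [p₁, p₂]; simp; grind)) (by simp [Link.prems_ax])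
    refine (((h.prems.diff hsub).map (Link.prems_map _) inl.injOn).union hK ?_).congr ?_
      fun v => ?_
    · simp [Link.prems_ax, p₁, p₂]
    · rw [Set.insert_union, Set.singleton_union]
    · change _ ↔ v ≠ .inl Θ.concl ∧ v ∉ Θ.hyps.map .inl
      rcases v with v | k
      · simp [Link.prems_ax, p₁, p₂]
      · rcases hij with ⟨rfl, rfl⟩ | ⟨rfl, rfl⟩ <;> simp [Link.prems_ax, p₁, p₂] <;>
          fin_cases k <;> simp
  · have := h.nodup
    rw [hΘ']
    change (List.map Sum.inl (Θ.concl :: Θ.hyps)).Nodup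
    exact (List.nodup_map_iff inl).2 this
  · rintro Γ C ⟨h1, h2⟩
    exact ⟨by rw [← h1, hΘ', List.map_map]; rfl, h2⟩
  · intro G Z
    constructor
    · rintro ⟨f, hf, rfl, rfl⟩
      exact ⟨_, lab_old f hf, (hmap f).symm, rfl⟩
    · rintro ⟨f, hf, rfl, rfl⟩
      obtain ⟨f', h1, h2⟩ := lab_new f hf
      refine ⟨f', h1, ?_, h2 _⟩
      rw [hmap]
      exact List.map_congr_left fun v _ => h2 v
  · intro hu f g hf hg e1 e2
    rw [hmap, hmap] at e1
    have e := congrFun (hu _ _ (lab_old f hf) (lab_old g hg) e1 e2)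
    have a1 := (o₁ _).1 (hf.1 _ m₁)
    have a2 := (o₂ _).1 (hf.1 _ m₂)
    have b1 := (o₁ _).1 (hg.1 _ m₁)
    have b2 := (o₂ _).1 (hg.1 _ m₂)
    have d1 := op_inj _ _ _ _ (a1.symm.trans ((e p).trans b1))
    have d2 := op_inj _ _ _ _ (a2.symm.trans ((e n).trans b2))
    funext v
    rcases v with v | k
    · exact e v
    · rcases hij with ⟨rfl, rfl⟩ | ⟨rfl, rfl⟩ <;> fin_cases k
      exacts [d1.1, d2.1, d1.2, d2.2, d2.1, d1.1, d1.2, d2.2]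

theorem Ty.sh_eq_tensor {A B Z : Ty} (h : Z.sh = (Ty.tensor A B).sh) :
    ∃ X Y, Z = .tensor X Y ∧ X.sh = A.sh ∧ Y.sh = B.sh := by
  cases Z with
  | tensor X Y => exact ⟨X, Y, rfl, (Ty.tensor.inj h).1, (Ty.tensor.inj h).2⟩
  | _ => cases h

theorem Ty.sh_eq_limp {A B Z : Ty} (h : Z.sh = (Ty.limp A B).sh) :
    ∃ X Y, Z = .limp X Y ∧ X.sh = A.sh ∧ Y.sh = B.sh := by
  cases Z with
  | limp X Y => exact ⟨X, Y, rfl, (Ty.limp.inj h).1, (Ty.limp.inj h).2⟩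
  | _ => cases h

section
variable {Θ : PStruct}

theorem Good.sim_tensor (h : Good Θ) {a b c a' b' c' : Θ.Occ}
    (h1 : .tensorPos a b c ∈ Θ.links) (h2 : .tensorNeg a' b' c' ∈ Θ.links)
    (h3 : .cut c c' ∈ Θ.links) :
    Sim Θ {c, c'} ((Θ.links \ {.tensorPos a b c, .tensorNeg a' b' c', .cut c c'}) ∪
      {.cut a a', .cut b b'}) := by
  obtain ⟨A, B, t1, t2, t3⟩ := h.typed _ h1
  obtain ⟨A', B', t4, t5, t6⟩ := h.typed _ h2
  obtain ⟨C, t7, t8⟩ := h.typed _ h3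
  obtain rfl := SFormula.pos.inj (t7.symm.trans t3)
  obtain ⟨rfl, rfl⟩ := Ty.tensor.inj (SFormula.neg.inj (t8.symm.trans t6))
  exact h.sim_cut (op := .tensor) h1 h2 h3 rfl rfl rfl rfl .rfl .rfl rfl rfl ⟨_, t1, t4⟩ ⟨_, t2, t5⟩
    (by simp) (fun _ => .rfl) (fun _ => .rfl) (fun _ => .rfl) (fun _ => .rfl)
    (fun _ _ _ _ => Ty.tensor.inj) fun _ _ _ _ e e' => by rw [Ty.sh_tensor, Ty.sh_tensor, e, e']

theorem Good.sim_limp (h : Good Θ) {a b c a' b' c' : Θ.Occ}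
    (h1 : .limpPos a b c ∈ Θ.links) (h2 : .limpNeg a' b' c' ∈ Θ.links)
    (h3 : .cut c c' ∈ Θ.links) :
    Sim Θ {c, c'} ((Θ.links \ {.limpPos a b c, .limpNeg a' b' c', .cut c c'}) ∪
      {.cut a' a, .cut b b'}) := by
  obtain ⟨A, B, t1, t2, t3⟩ := h.typed _ h1
  obtain ⟨A', B', t4, t5, t6⟩ := h.typed _ h2
  obtain ⟨C, t7, t8⟩ := h.typed _ h3
  obtain rfl := SFormula.pos.inj (t7.symm.trans t3)
  obtain ⟨rfl, rfl⟩ := Ty.limp.inj (SFormula.neg.inj (t8.symm.trans t6))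
  exact h.sim_cut (op := .limp) h1 h2 h3 rfl rfl rfl rfl (.swap _ _ _) .rfl rfl rfl ⟨_, t4, t1⟩
    ⟨_, t2, t5⟩ (by simp) (fun _ => .rfl) (fun _ => .rfl) (fun _ => eq_comm) (fun _ => .rfl)
    (fun _ _ _ _ => Ty.limp.inj) fun _ _ _ _ e e' => by rw [Ty.sh_limp, Ty.sh_limp, e, e']

theorem Good.sim_axPos (h : Good Θ) {p n n' : Θ.Occ} (hn : n' ≠ n) (h1 : .ax p n ∈ Θ.links)
    (h2 : .cut p n' ∈ Θ.links) : Sim Θ {p, n'}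
      (Link.map (PStruct.redirect n' n) '' (Θ.links \ {.ax p n, .cut p n'})) := by
  obtain ⟨A, t1, t2⟩ := h.typed _ h1
  obtain ⟨A', t3, t4⟩ := h.typed _ h2
  obtain rfl := SFormula.pos.inj (t1.symm.trans t3)
  exact h.sim_ax h1 h2 rfl .rfl .rfl rfl (fun _ => .rfl) (fun _ => .rfl) (t4.trans t2.symm)
    (by rintro rfl; simp_all) hn

theorem Good.sim_axNeg (h : Good Θ) {p n p' : Θ.Occ} (hp : p' ≠ p) (h1 : .ax p n ∈ Θ.links)
    (h2 : .cut p' n ∈ Θ.links) : Sim Θ {n, p'}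
      (Link.map (PStruct.redirect p' p) '' (Θ.links \ {.ax p n, .cut p' n})) := by
  obtain ⟨A, t1, t2⟩ := h.typed _ h1
  obtain ⟨A', t3, t4⟩ := h.typed _ h2
  obtain rfl := SFormula.neg.inj (t2.symm.trans t4)
  exact h.sim_ax h1 h2 rfl (.swap _ _ _) (.swap _ _ _) rfl (fun _ => eq_comm) (fun _ => eq_comm)
    (t3.trans t1.symm) (by rintro rfl; simp_all) hp

theorem Good.step (h : Good Θ) {Θ' : PStruct} (s : Θ.Step Θ') : Sound Θ Θ' := by
  cases s with
  | tensor _ a b c a' b' c' h1 h2 h3 r => exact (h.sim_tensor h1 h2 h3).sound h r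
  | limp _ a b c a' b' c' h1 h2 h3 r => exact (h.sim_limp h1 h2 h3).sound h r
  | axPos _ p n n' hn h1 h2 r => exact (h.sim_axPos hn h1 h2).sound h r
  | axNeg _ p n p' hp h1 h2 r => exact (h.sim_axNeg hp h1 h2).sound h r
  | etaTensor A B p n h1 hp hn =>
      refine h.sound_expand (op := .tensor) h1 (.inl ⟨rfl, rfl⟩) rfl rfl rfl rfl (fun _ => .rfl)
        (fun _ => .rfl) (by rw [hp]; rfl) (fun _ _ _ _ => Ty.tensor.inj)
        (fun _ => Ty.sh_eq_tensor) ?_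
      rintro l (rfl | rfl | rfl | rfl)
      exacts [⟨A, rfl, rfl⟩, ⟨B, rfl, rfl⟩, ⟨A, B, rfl, rfl, hp⟩, ⟨A, B, rfl, rfl, hn⟩]
  | etaLimp A B p n h1 hp hn =>
      refine h.sound_expand (op := .limp) h1 (.inr ⟨rfl, rfl⟩) rfl rfl rfl rfl (fun _ => .rfl)
        (fun _ => .rfl) (by rw [hp]; rfl) (fun _ _ _ _ => Ty.limp.inj)
        (fun _ => Ty.sh_eq_limp) ?_
      rintro l (rfl | rfl | rfl | rfl)
      exacts [⟨A, rfl, rfl⟩, ⟨B, rfl, rfl⟩, ⟨A, B, rfl, rfl, hp⟩, ⟨A, B, rfl, rfl, hn⟩]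

theorem Sound.refl (h : Good Θ) : Sound Θ Θ := ⟨h, fun _ _ h => h, fun _ _ => .rfl, fun h => h⟩

theorem Sound.trans {Ξ Ψ : PStruct} (h : Sound Θ Ξ) (h' : Sound Ξ Ψ) : Sound Θ Ψ :=
  ⟨h'.good, fun _ _ hb => h'.bdry _ _ (h.bdry _ _ hb), fun G Z => (h'.typ G Z).trans (h.typ G Z),
    fun hu => h'.uniq (h.uniq hu)⟩

theorem Good.steps (h : Good Θ) {Θ' : PStruct} (s : Relation.ReflTransGen PStruct.Step Θ Θ') :
    Sound Θ Θ' := by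
  induction s with
  | refl => exact .refl h
  | tail _ s ih => exact ih.trans (ih.good.step s)

end

/-! ### Termination -/

/-- The number of type variables and connectives. -/
def Ty.size : Ty → ℕ
  | .var _ => 1
  | .tensor A B => A.size + B.size + 1
  | .limp A B => A.size + B.size + 1

theorem Ty.size_pos (A : Ty) : 0 < A.size := by cases A <;> simp [Ty.size]

/-- The weight of a link: the size of the formula of an ID-link or of a cut. -/
def Link.weight {V : Type} (f : V → SFormula) : Link V → ℕ
  | .ax p _ => (f p).ty.size
  | .cut p _ => (f p).ty.size
  | _ => 0

/-- The total weight of the links is at most `n`. -/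
def Bounded {V : Type} (f : V → SFormula) (L : Set (Link V)) (n : ℕ) : Prop :=
  ∃ s : List (Link V), (∀ l ∈ L, l ∈ s) ∧ (s.map (Link.weight f)).sum ≤ n

namespace Bounded
variable {V W : Type} {f : V → SFormula} {L K : Set (Link V)} {n : ℕ}

theorem exists_of_finite (h : L.Finite) : ∃ n, Bounded f L n :=
  ⟨_, h.toFinset.toList, by simp, le_rfl⟩

theorem diff (h : Bounded f L n) {D : List (Link V)} (hD : D.Nodup) (hL : ∀ l ∈ D, l ∈ L)
    (hK : ∀ l ∈ D, l ∈ K) : ∃ m, Bounded f (L \ K) m ∧ m + (D.map (Link.weight f)).sum ≤ n := by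
  classical
  obtain ⟨s, h1, h2⟩ := h
  obtain ⟨D', hp, hs⟩ := List.subperm_of_subset hD fun l hl => h1 l (hL l hl)
  obtain ⟨r, hr⟩ := hs.exists_perm_append
  replace hr := hr.trans (hp.append_right r)
  refine ⟨_, ⟨r, fun l hl => ?_, le_rfl⟩, ?_⟩
  · have := hr.mem_iff.1 (h1 l hl.1)
    exact (List.mem_append.1 this).resolve_left fun h => hl.2 (hK l h)
  · have := (hr.map (Link.weight f)).sum_eq
    rw [List.map_append, List.sum_append] at this
    omega

theorem union (h : Bounded f L n) (D : List (Link V)) (hK : ∀ l ∈ K, l ∈ D) :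
    Bounded f (L ∪ K) (n + (D.map (Link.weight f)).sum) := by
  obtain ⟨s, h1, h2⟩ := h
  refine ⟨s ++ D, fun l hl => List.mem_append.2 (hl.imp (h1 l) (hK l)), ?_⟩
  rw [List.map_append, List.sum_append]
  omega

theorem image {f' : W → SFormula} {g : V → W} (h : Bounded f L n) (hg : ∀ v, f' (g v) = f v) :
    Bounded f' (Link.map g '' L) n := by
  obtain ⟨s, h1, h2⟩ := h
  refine ⟨s.map (Link.map g), ?_, ?_⟩
  · rintro _ ⟨l, hl, rfl⟩
    exact List.mem_map_of_mem (h1 l hl)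
  · rw [List.map_map]
    convert h2 using 3
    funext l
    cases l <;> simp [Link.weight, Link.map, hg]

theorem preimage {f' : W → SFormula} {g : W → V} {L' : Set (Link W)}
    (h : Bounded f (Link.map g '' L') n) (hi : Function.Injective g) (hg : ∀ v, f' v = f (g v)) :
    Bounded f' L' n := by
  classical
  obtain ⟨s, h1, h2⟩ := h
  have inj := Link.map_injective hi
  have hw : ∀ l, Link.weight f (l.map g) = Link.weight f' l := fun l => by
    cases l <;> simp [Link.weight, Link.map, hg]
  refine ⟨s.filterMap fun l => if h : ∃ l', Link.map g l' = l then some h.choose else none, ?_, ?_⟩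
  · intro l hl
    refine List.mem_filterMap.2 ⟨_, h1 _ ⟨l, hl, rfl⟩, ?_⟩
    have hx : ∃ l', Link.map g l' = Link.map g l := ⟨l, rfl⟩
    rw [dif_pos hx]
    exact congrArg some (inj hx.choose_spec)
  · refine le_trans ?_ h2
    clear h1 h2
    induction s with
    | nil => simp
    | cons l s ih =>
        rw [List.filterMap_cons]
        by_cases e : ∃ l', Link.map g l' = l
        · rw [dif_pos e]
          simp only [List.map_cons, List.sum_cons]
          have := hw e.choose
          rw [e.choose_spec] at this
          omega
        · rw [dif_neg e]
          simp only [List.map_cons, List.sum_cons]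
          omega

end Bounded

theorem PStruct.Remains.bounded {Θ Θ' : PStruct} {gone : Set Θ.Occ} {L : Set (Link Θ.Occ)}
    (r : Θ.Remains Θ' gone L) {n : ℕ} (h : Bounded Θ.form L n) : Bounded Θ'.form Θ'.links n := by
  obtain ⟨ι, -, h1, h2, -⟩ := r
  exact Bounded.preimage (h2 ▸ h) ι.injective h1

/-- The weight adds the sizes of the formulas of all ID-links and cuts. A compound formula is
replaced by its components, which saves the connective; a cut against an ID-link removes two
positive weights. Hence every reduction sequence terminates. -/
theorem Good.bounded {Θ Θ' : PStruct} (h : Good Θ) (s : Θ.Step Θ') {n : ℕ}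
    (hb : Bounded Θ.form Θ.links n) : ∃ m < n, Bounded Θ'.form Θ'.links m := by
  cases s with
  | tensor _ a b c a' b' c' h1 h2 h3 r =>
      obtain ⟨A, B, t1, t2, t3⟩ := h.typed _ h1
      obtain ⟨m, h4, h5⟩ := hb.diff (D := [.tensorPos a b c, .tensorNeg a' b' c', .cut c c']) (K := {.tensorPos a b c, .tensorNeg a' b' c', .cut c c'})
        (by simp) (by simp [h1, h2, h3]) (by simp)
      have h6 := h4.union (K := {.cut a a', .cut b b'})
        [.cut a a', .cut b b'] (by simp)
      refine ⟨_, ?_, r.bounded h6⟩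
      simp [Link.weight, t1, t2, t3, SFormula.ty, Ty.size] at h5 ⊢
      omega
  | limp _ a b c a' b' c' h1 h2 h3 r =>
      obtain ⟨A, B, t1, t2, t3⟩ := h.typed _ h1
      obtain ⟨A', B', t4, t5, t6⟩ := h.typed _ h2
      obtain ⟨C, t7, t8⟩ := h.typed _ h3
      obtain rfl := SFormula.pos.inj (t7.symm.trans t3)
      obtain ⟨rfl, rfl⟩ := Ty.limp.inj (SFormula.neg.inj (t8.symm.trans t6))
      obtain ⟨m, h4, h5⟩ := hb.diff (D := [.limpPos a b c, .limpNeg a' b' c', .cut c c']) (K := {.limpPos a b c, .limpNeg a' b' c', .cut c c'})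
        (by simp) (by simp [h1, h2, h3]) (by simp)
      have h6 := h4.union (K := {.cut a' a, .cut b b'})
        [.cut a' a, .cut b b'] (by simp)
      refine ⟨_, ?_, r.bounded h6⟩
      simp [Link.weight, t4, t2, t3, SFormula.ty, Ty.size] at h5 ⊢
      omega
  | axPos _ p n n' hn h1 h2 r =>
      obtain ⟨A, t1, t2⟩ := h.typed _ h1
      obtain ⟨A', t3, t4⟩ := h.typed _ h2
      obtain rfl := SFormula.pos.inj (t1.symm.trans t3)
      obtain ⟨m, h4, h5⟩ := hb.diff (D := [.ax p n, .cut p n']) (K := {.ax p n, .cut p n'})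
        (by simp) (by simp [h1, h2]) (by simp)
      have h6 := h4.image (f' := Θ.form) (g := PStruct.redirect n' n)
        fun v => comp_redirect (t4.trans t2.symm) v
      refine ⟨_, ?_, r.bounded h6⟩
      have := A.size_pos
      simp [Link.weight, t1, SFormula.ty] at h5 ⊢
      omega
  | axNeg _ p n p' hp h1 h2 r =>
      obtain ⟨A, t1, t2⟩ := h.typed _ h1
      obtain ⟨A', t3, t4⟩ := h.typed _ h2
      obtain rfl := SFormula.neg.inj (t2.symm.trans t4)
      obtain ⟨m, h4, h5⟩ := hb.diff (D := [.ax p n, .cut p' n]) (K := {.ax p n, .cut p' n})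
        (by simp) (by simp [h1, h2]) (by simp)
      have h6 := h4.image (f' := Θ.form) (g := PStruct.redirect p' p)
        fun v => comp_redirect (t3.trans t1.symm) v
      refine ⟨_, ?_, r.bounded h6⟩
      have := A.size_pos
      simp [Link.weight, t1, SFormula.ty] at h5 ⊢
      omega
  | etaTensor A B p n h1 hp hn =>
      obtain ⟨m, h4, h5⟩ := hb.diff (D := [.ax p n]) (K := {.ax p n})
        (by simp) (by simp [h1]) (by simp)
      have h6 := (h4.image (f' := (Θ.expand A B ∅ ∅).form) (g := .inl) fun v => rfl).union
        (K := {.ax (.inr 0) (.inr 1), .ax (.inr 2) (.inr 3),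
          .tensorPos (.inr 0) (.inr 2) (.inl p), .tensorNeg (.inr 1) (.inr 3) (.inl n)})
        [.ax (.inr 0) (.inr 1), .ax (.inr 2) (.inr 3),
          .tensorPos (.inr 0) (.inr 2) (.inl p), .tensorNeg (.inr 1) (.inr 3) (.inl n)] (by simp)
      refine ⟨_, ?_, h6⟩
      simp [Link.weight, hp, SFormula.ty, Ty.size] at h5 ⊢
      omega
  | etaLimp A B p n h1 hp hn =>
      obtain ⟨m, h4, h5⟩ := hb.diff (D := [.ax p n]) (K := {.ax p n})
        (by simp) (by simp [h1]) (by simp)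
      have h6 := (h4.image (f' := (Θ.expand A B ∅ ∅).form) (g := .inl) fun v => rfl).union
        (K := {.ax (.inr 0) (.inr 1), .ax (.inr 2) (.inr 3),
          .limpPos (.inr 1) (.inr 2) (.inl p), .limpNeg (.inr 0) (.inr 3) (.inl n)})
        [.ax (.inr 0) (.inr 1), .ax (.inr 2) (.inr 3),
          .limpPos (.inr 1) (.inr 2) (.inl p), .limpNeg (.inr 0) (.inr 3) (.inl n)] (by simp)
      refine ⟨_, ?_, h6⟩
      simp [Link.weight, hp, SFormula.ty, Ty.size] at h5 ⊢
      omega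

theorem Good.exists_normalForm {Θ : PStruct} (h : Good Θ) : ∃ N : PStruct, N.NormalFormOf Θ := by
  obtain ⟨n, hn⟩ := Bounded.exists_of_finite (f := Θ.form) h.finite
  induction n using Nat.strong_induction_on generalizing Θ with
  | _ n ih =>
    by_cases e : Θ.Normal
    · exact ⟨Θ, .refl, e⟩
    · simp only [PStruct.Normal, not_forall, not_not] at e
      obtain ⟨Θ', s⟩ := e
      obtain ⟨m, hm, hb⟩ := h.bounded s hn
      obtain ⟨N, h1, h2⟩ := ih m hm (h.step s).good hb
      exact ⟨N, .head s h1, h2⟩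

/-- A relabelling of the two ends of an ID-link that is cut against itself is consistent. -/
theorem Uniq.no_loop {Θ : PStruct} (hu : Uniq Θ) (h : Good Θ) {p n : Θ.Occ}
    (h1 : .ax p n ∈ Θ.links) (h2 : .cut p n ∈ Θ.links) : False := by
  classical
  -- Shifting the atoms changes every type and keeps its shape. Applied to p and n alone it respects
  -- all links, because the loop contains the only links at these occurrences; and they are not
  -- conclusions.
  let up : Ty → Ty := fun A => A.bind fun q => .var (q + 1)
  have hup : ∀ A, up A ≠ A := by
    intro A
    induction A with
    | var q => simp [up, Ty.bind]
    | tensor A B ih _ => exact fun e => ih (Ty.tensor.inj e).1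
    | limp A B ih _ => exact fun e => ih (Ty.limp.inj e).1
  let f : Θ.Occ → Ty := fun v => (Θ.form v).ty
  let g : Θ.Occ → Ty := fun v => if v = p ∨ v = n then up (f v) else f v
  have hg : ∀ v, v ≠ p ∧ v ≠ n → g v = f v := fun v hv => if_neg (by tauto)
  have hp : g p = up (f p) := if_pos (.inl rfl)
  have hn : g n = up (f n) := if_pos (.inr rfl)
  have e : f p = f n := h.lab.1 _ h1
  have hlab : Θ.Lab g := by
    constructor
    · intro l hl
      by_cases m1 : l = .ax p n
      · rw [m1]; change g p = g n; rw [hp, hn, e]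
      by_cases m2 : l = .cut p n
      · rw [m2]; change g p = g n; rw [hp, hn, e]
      refine (h.lab.1 l hl).congr (fun v hv => hg v ⟨?_, ?_⟩) fun v hv => hg v ⟨?_, ?_⟩ <;>
        rintro rfl
      · exact m2 (h.prems.unique _ hl _ h2 v hv (by simp [Link.prems]))
      · exact m2 (h.prems.unique _ hl _ h2 v hv (by simp [Link.prems]))
      · exact m1 (h.concls.unique _ hl _ h1 v hv (by simp [Link.concls]))
      · exact m1 (h.concls.unique _ hl _ h1 v hv (by simp [Link.concls]))
    · intro v
      by_cases e : v = p ∨ v = n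
      · rw [show g v = up (f v) from if_pos e]; exact Ty.sh_bind
      · rw [show g v = f v from if_neg e]
  have S : ∀ v, v = p ∨ v = n → v ≠ Θ.concl ∧ v ∉ Θ.hyps := fun v hv =>
    (h.prems.mem v).2 ⟨_, h2, by simpa [Link.prems] using hv⟩
  have := hu _ _ hlab h.lab (List.map_congr_left fun v hv => hg v ?_) (hg _ ?_)
  · exact hup _ (hp.symm.trans (congrFun this p))
  · exact ⟨fun e => (S v (.inl e)).2 hv, fun e => (S v (.inr e)).2 hv⟩
  · exact ⟨fun e => (S _ (.inl e)).1 rfl, fun e => (S _ (.inr e)).1 rfl⟩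

/-- In a normal structure there are no cuts, and ID-links have variables as formulas. -/
theorem Good.atomic {Θ : PStruct} (h : Good Θ) (hu : Uniq Θ) (hN : Θ.Normal) :
    ∀ l ∈ Θ.links, l.Atomic Θ.form := by
  have step : ∀ {gone L}, Sim Θ gone L → (∀ Θ', Θ.Remains Θ' gone L → Θ.Step Θ') → False :=
    fun hs hr => by
      obtain ⟨Θ', r⟩ := hs.exists_remains
      exact hN _ (hr Θ' r)
  intro l hl
  cases l with
  | ax p n =>
      obtain ⟨A, t1, t2⟩ := h.typed _ hl
      cases A with
      | var q => exact ⟨q, t1⟩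
      | tensor A B => exact absurd (.etaTensor A B p n hl t1 t2) (hN _)
      | limp A B => exact absurd (.etaLimp A B p n hl t1 t2) (hN _)
  | cut p n =>
      exfalso
      obtain ⟨A, t1, t2⟩ := h.typed _ hl
      obtain ⟨k, hk, hp⟩ := (h.concls.mem p).1 trivial
      obtain ⟨k', hk', hn⟩ := (h.concls.mem n).1 trivial
      -- A cut that meets an ID-link at one end reduces unless it meets the same link at both ends;
      -- this loop is excluded by uniqueness of labellings.
      have ax : ∀ p' n', Link.ax p' n' ∈ Θ.links → p = p' ∨ n = n' → False := by
        rintro p' n' h1 (rfl | rfl)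
        · by_cases e : n = n'
          · subst e; exact hu.no_loop h h1 hl
          · exact step (h.sim_axPos e h1 hl) fun Θ' r => .axPos Θ' _ _ _ e h1 hl r
        · by_cases e : p = p'
          · subst e; exact hu.no_loop h h1 hl
          · exact step (h.sim_axNeg e h1 hl) fun Θ' r => .axNeg Θ' _ _ _ e h1 hl r
      have tk := h.typed _ hk
      have tk' := h.typed _ hk'
      cases k <;> simp only [Link.concls, List.mem_cons, List.not_mem_nil, or_false] at hp <;>
        simp only [Link.Typed] at tk
      · rcases hp with hp | hp
        · exact ax _ _ hk (.inl hp)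
        · subst hp; simp [t1] at tk
      · subst hp
        obtain ⟨B, C, -, -, e⟩ := tk
        obtain rfl := SFormula.pos.inj (t1.symm.trans e)
        cases k' <;> simp only [Link.concls, List.mem_cons, List.not_mem_nil, or_false] at hn <;>
          simp only [Link.Typed] at tk'
        · rcases hn with hn | hn
          · subst hn; simp [t2] at tk'
          · exact ax _ _ hk' (.inr hn)
        · subst hn; simp [t2] at tk'
        · subst hn
          exact step (h.sim_tensor hk hk' hl) fun Θ' r => .tensor Θ' _ _ _ _ _ _ hk hk' hl r
        · subst hn; simp [t2] at tk'
        · subst hn; simp [t2] at tk'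
      · subst hp; simp [t1] at tk
      · subst hp
        obtain ⟨B, C, -, -, e⟩ := tk
        obtain rfl := SFormula.pos.inj (t1.symm.trans e)
        cases k' <;> simp only [Link.concls, List.mem_cons, List.not_mem_nil, or_false] at hn <;>
          simp only [Link.Typed] at tk'
        · rcases hn with hn | hn
          · subst hn; simp [t2] at tk'
          · exact ax _ _ hk' (.inr hn)
        · subst hn; simp [t2] at tk'
        · subst hn; simp [t2] at tk'
        · subst hn; simp [t2] at tk'
        · subst hn
          exact step (h.sim_limp hk hk' hl) fun Θ' r => .limp Θ' _ _ _ _ _ _ hk hk' hl r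
      · subst hp; simp [t1] at tk
  | _ => trivial

/-! ### Isomorphism of normal structures -/

/-- Occurrences at corresponding places below corresponding conclusions. -/
inductive Rel (N M : PStruct) : N.Occ → M.Occ → Prop
  | concl : Rel N M N.concl M.concl
  | hyp {v : N.Occ} {w : M.Occ} (i : ℕ) : N.hyps[i]? = some v → M.hyps[i]? = some w → Rel N M v w
  | prem {v c : N.Occ} {w c' : M.Occ} {l : Link N.Occ} {l' : Link M.Occ} (i : ℕ) :
      l ∈ N.links → l' ∈ M.links → l.concls = [c] → l'.concls = [c'] → Rel N M c c' →
      l.prems[i]? = some v → l'.prems[i]? = some w → Rel N M v w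

/-- The links with a given conclusion in a structure with atomic ID-links. -/
theorem Link.concls_cases {V : Type} {F : V → SFormula} {l : Link V} {c : V} (ht : l.Typed F)
    (ha : l.Atomic F) (hc : c ∈ l.concls) :
    (∃ p n q, l = .ax p n ∧ F p = .pos (.var q) ∧ F n = .neg (.var q) ∧
      (c = p ∧ F c = .pos (.var q) ∨ c = n ∧ F c = .neg (.var q))) ∨
    (∃ a b A B, l = .tensorPos a b c ∧ F a = .pos A ∧ F b = .pos B ∧ F c = .pos (.tensor A B)) ∨
    (∃ a b A B, l = .tensorNeg a b c ∧ F a = .neg A ∧ F b = .neg B ∧ F c = .neg (.tensor A B)) ∨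
    (∃ a b A B, l = .limpPos a b c ∧ F a = .neg A ∧ F b = .pos B ∧ F c = .pos (.limp A B)) ∨
    (∃ a b A B, l = .limpNeg a b c ∧ F a = .pos A ∧ F b = .neg B ∧ F c = .neg (.limp A B)) := by
  cases l with
  | ax p n =>
      obtain ⟨q, hq⟩ := ha
      obtain ⟨A, h1, h2⟩ := ht
      obtain rfl := SFormula.pos.inj (h1.symm.trans hq)
      refine .inl ⟨p, n, q, rfl, h1, h2, ?_⟩
      simp only [concls, List.mem_cons, List.not_mem_nil, or_false] at hc
      exact hc.imp (fun e => ⟨e, e ▸ h1⟩) fun e => ⟨e, e ▸ h2⟩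
  | cut p n => exact absurd hc (by simp [concls])
  | tensorPos a b d =>
      obtain rfl : c = d := by simpa [concls] using hc
      obtain ⟨A, B, h⟩ := ht
      exact .inr (.inl ⟨a, b, A, B, rfl, h⟩)
  | tensorNeg a b d =>
      obtain rfl : c = d := by simpa [concls] using hc
      obtain ⟨A, B, h⟩ := ht
      exact .inr (.inr (.inl ⟨a, b, A, B, rfl, h⟩))
  | limpPos a b d =>
      obtain rfl : c = d := by simpa [concls] using hc
      obtain ⟨A, B, h⟩ := ht
      exact .inr (.inr (.inr (.inl ⟨a, b, A, B, rfl, h⟩)))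
  | limpNeg a b d =>
      obtain rfl : c = d := by simpa [concls] using hc
      obtain ⟨A, B, h⟩ := ht
      exact .inr (.inr (.inr (.inr ⟨a, b, A, B, rfl, h⟩)))

/-- Links whose conclusions have the same formula are of the same kind. -/
theorem Link.same_kind {V W : Type} {F : V → SFormula} {G : W → SFormula} {l : Link V}
    {l' : Link W} {c : V} {c' : W} (ht : l.Typed F) (ha : l.Atomic F) (hc : c ∈ l.concls)
    (ht' : l'.Typed G) (ha' : l'.Atomic G) (hc' : c' ∈ l'.concls) (h : F c = G c') :
    (∃ p n p' n', l = .ax p n ∧ l' = .ax p' n' ∧ (c = p ∧ c' = p' ∨ c = n ∧ c' = n')) ∨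
    ∃ a b a' b', F a = G a' ∧ F b = G b' ∧
      (l = .tensorPos a b c ∧ l' = .tensorPos a' b' c' ∨
      l = .tensorNeg a b c ∧ l' = .tensorNeg a' b' c' ∨
      l = .limpPos a b c ∧ l' = .limpPos a' b' c' ∨
      l = .limpNeg a b c ∧ l' = .limpNeg a' b' c') := by
  rcases concls_cases ht ha hc with ⟨p, n, q, rfl, f1, f2, ⟨rfl, f3⟩ | ⟨rfl, f3⟩⟩ |
    ⟨a, b, A, B, rfl, f1, f2, f3⟩ |
    ⟨a, b, A, B, rfl, f1, f2, f3⟩ | ⟨a, b, A, B, rfl, f1, f2, f3⟩ | ⟨a, b, A, B, rfl, f1, f2, f3⟩ <;>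
  rcases concls_cases ht' ha' hc' with ⟨p', n', q', rfl, g1, g2, ⟨rfl, g3⟩ | ⟨rfl, g3⟩⟩ |
    ⟨a', b', A', B', rfl, g1, g2, g3⟩ | ⟨a', b', A', B', rfl, g1, g2, g3⟩ |
    ⟨a', b', A', B', rfl, g1, g2, g3⟩ | ⟨a', b', A', B', rfl, g1, g2, g3⟩ <;>
  simp only [f1, f2, f3, g1, g2, g3, reduceCtorEq, SFormula.pos.injEq, SFormula.neg.injEq,
    Ty.tensor.injEq, Ty.limp.injEq] at h
  · exact .inl ⟨_, _, _, _, rfl, rfl, .inl ⟨rfl, rfl⟩⟩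
  · exact .inl ⟨_, _, _, _, rfl, rfl, .inr ⟨rfl, rfl⟩⟩
  all_goals
    obtain ⟨rfl, rfl⟩ := h
    exact .inr ⟨a, b, a', b', f1.trans g1.symm, f2.trans g2.symm, by simp⟩

namespace Rel
variable {N M : PStruct}

theorem symm {v : N.Occ} {w : M.Occ} (h : Rel N M v w) : Rel M N w v := by
  induction h with
  | concl => exact .concl
  | hyp i h1 h2 => exact .hyp i h2 h1
  | prem i h1 h2 h3 h4 _ h6 h7 ih => exact .prem i h2 h1 h4 h3 ih h7 h6

theorem unique (hN : Good N) (hM : Good M) {v : N.Occ} {w w' : M.Occ} (h : Rel N M v w)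
    (h' : Rel N M v w') : w = w' := by
  have nd := hN.nodup
  rw [List.nodup_cons] at nd
  have np : ∀ {l v i}, l ∈ N.links → l.prems[i]? = some v → v ≠ N.concl ∧ v ∉ N.hyps :=
    fun hl hi => (hN.prems.mem _).2 ⟨_, hl, List.mem_of_getElem? hi⟩
  induction h generalizing w' with
  | concl =>
      cases h' with
      | concl => rfl
      | hyp i h1 h2 => exact absurd (List.mem_of_getElem? h1) nd.1
      | prem i h1 h2 h3 h4 h5 h6 h7 => exact absurd rfl (np h1 h6).1
  | hyp i h1 h2 =>
      cases h' with
      | concl => exact absurd (List.mem_of_getElem? h1) nd.1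
      | hyp j h3 h4 =>
          have : i = j := (List.getElem?_inj (List.getElem?_eq_some_iff.1 h1).1 nd.2).1 (h1.trans h3.symm)
          subst this
          exact Option.some.inj (h2.symm.trans h4)
      | prem j h3 h4 h5 h6 h7 h8 h9 => exact absurd (List.mem_of_getElem? h1) (np h3 h8).2
  | prem i h1 h2 h3 h4 _ h6 h7 ih =>
      cases h' with
      | concl => exact absurd rfl (np h1 h6).1
      | hyp j a1 a2 => exact absurd (List.mem_of_getElem? a1) (np h1 h6).2
      | prem j a1 a2 a3 a4 a5 a6 a7 =>
          have e := hN.prems.unique _ h1 _ a1 _ (List.mem_of_getElem? h6) (List.mem_of_getElem? a6)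
          subst e
          rw [h3] at a3
          cases a3
          have e := ih a5
          subst e
          have e := hM.concls.unique _ h2 _ a2 _ (h4 ▸ List.mem_singleton_self _)
            (a4 ▸ List.mem_singleton_self _)
          subst e
          have : i = j := (List.getElem?_inj (List.getElem?_eq_some_iff.1 h6).1
            (hN.prems.nodup _ h1)).1 (h6.trans a6.symm)
          subst this
          exact Option.some.inj (h7.symm.trans a7)

end Rel

/-- Two structures with atomic links and labellings that agree on the conclusions. -/
structure Twin (N M : PStruct) (f : N.Occ → Ty) (g : M.Occ → Ty) : Prop where
  goodN : Good N
  goodM : Good M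
  atomicN : ∀ l ∈ N.links, l.Atomic N.form
  atomicM : ∀ l ∈ M.links, l.Atomic M.form
  labN : N.Lab f
  labM : M.Lab g
  hyps_form : N.hyps.map N.form = M.hyps.map M.form
  concl_form : N.form N.concl = M.form M.concl
  hyps_lab : N.hyps.map f = M.hyps.map g
  concl_lab : f N.concl = g M.concl

namespace Twin
variable {N M : PStruct} {f : N.Occ → Ty} {g : M.Occ → Ty}

theorem symm (h : Twin N M f g) : Twin M N g f :=
  ⟨h.2, h.1, h.4, h.3, h.6, h.5, h.7.symm, h.8.symm, h.9.symm, h.10.symm⟩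

theorem hyps_length (h : Twin N M f g) : N.hyps.length = M.hyps.length := by
  simpa using congrArg List.length h.hyps_form

/-- By induction along the path: links whose conclusions carry equal formulas are of the same kind,
and equality of the labels of their conclusions passes to the premises. -/
theorem rel (h : Twin N M f g) {v : N.Occ} {w : M.Occ} (r : Rel N M v w) :
    N.form v = M.form w ∧ f v = g w := by
  induction r with
  | concl => exact ⟨h.concl_form, h.concl_lab⟩
  | hyp i h1 h2 =>
      constructor
      · have := congrArg (·[i]?) h.hyps_form
        simpa [h1, h2] using this
      · have := congrArg (·[i]?) h.hyps_lab
        simpa [h1, h2] using this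
  | @prem v c w c' l l' i hl hl' hc hc' _ hv hw ih =>
      have o := h.labN.1 l hl
      have o' := h.labM.1 l' hl'
      rcases Link.same_kind (h.goodN.typed l hl) (h.atomicN l hl) (by rw [hc]; simp)
        (h.goodM.typed l' hl') (h.atomicM l' hl') (by rw [hc']; simp) ih.1 with
        ⟨p, n, p', n', rfl, rfl, -⟩ | ⟨a, b, a', b', e1, e2, ⟨rfl, rfl⟩ | ⟨rfl, rfl⟩ | ⟨rfl, rfl⟩ |
          ⟨rfl, rfl⟩⟩
      · simp [Link.prems] at hv
      all_goals
        simp only [Link.Ok] at o o'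
        have e := ih.2
        rw [o, o'] at e
        simp only [Ty.tensor.injEq, Ty.limp.injEq] at e
        simp only [Link.prems] at hv hw
        rcases i with _ | _ | i
        · cases hv; cases hw; exact ⟨e1, e.1⟩
        · cases hv; cases hw; exact ⟨e2, e.2⟩
        · simp at hv

theorem exists_size_le (h : Good N) : ∃ k, ∀ v, (N.form v).ty.size ≤ k := by
  have : (Set.univ : Set N.Occ).Finite := by
    refine (h.finite.biUnion fun l _ => l.concls.finite_toSet).subset fun v _ => ?_
    obtain ⟨l, hl, hv⟩ := (h.concls.mem v).1 trivial
    exact Set.mem_biUnion hl hv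
  obtain ⟨k, hk⟩ := (this.image fun v => (N.form v).ty.size).bddAbove
  exact ⟨k, fun v => hk ⟨v, trivial, rfl⟩⟩

/-- Going down from an occurrence, the formulas grow; their sizes are bounded, so a conclusion is
reached. No separate acyclicity condition is needed. The path can be copied because a formula
determines the kind of the link above it. -/
theorem total (h : Twin N M f g) (v : N.Occ) : ∃ w, Rel N M v w := by
  obtain ⟨k, hk⟩ := exists_size_le h.goodN
  obtain ⟨d, hd⟩ : ∃ d, d + (N.form v).ty.size = k := ⟨k - (N.form v).ty.size, by have := hk v; omega⟩
  induction d using Nat.strong_induction_on generalizing v with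
  | _ d ih =>
    by_cases h1 : v = N.concl
    · subst h1; exact ⟨_, .concl⟩
    by_cases h2 : v ∈ N.hyps
    · obtain ⟨i, hi⟩ := List.mem_iff_getElem?.1 h2
      have := (List.getElem?_eq_some_iff.1 hi).1
      exact ⟨_, .hyp i hi (List.getElem?_eq_getElem (h.hyps_length ▸ this))⟩
    obtain ⟨l, hl, hv⟩ := (h.goodN.prems.mem v).1 ⟨h1, h2⟩
    have key : ∀ c, c ∈ l.concls → (N.form v).ty.size < (N.form c).ty.size → ∃ w, Rel N M v w := by
      intro c hc hlt
      obtain ⟨w, r⟩ := ih (k - (N.form c).ty.size) (by have := hk c; omega) c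
        (by have := hk c; omega)
      obtain ⟨l', hl', hw⟩ := (h.goodM.concls.mem w).1 trivial
      have same := Link.same_kind (h.goodN.typed l hl) (h.atomicN l hl) hc
        (h.goodM.typed l' hl') (h.atomicM l' hl') hw (h.rel r).1
      obtain ⟨i, hi⟩ := List.mem_iff_getElem?.1 hv
      rcases same with ⟨p, n, p', n', rfl, rfl, -⟩ | ⟨a, b, a', b', -, -, ⟨rfl, rfl⟩ | ⟨rfl, rfl⟩ |
        ⟨rfl, rfl⟩ | ⟨rfl, rfl⟩⟩
      · simp [Link.prems] at hv
      all_goals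
        rcases i with _ | _ | i
        · exact ⟨a', .prem 0 hl hl' rfl rfl r hi rfl⟩
        · exact ⟨b', .prem 1 hl hl' rfl rfl r hi rfl⟩
        · simp [Link.prems] at hi
    have ht := h.goodN.typed l hl
    have ha := h.atomicN l hl
    cases l with
    | ax p n => simp [Link.prems] at hv
    | cut p n => exact ha.elim
    | _ a b c =>
        obtain ⟨A, B, f1, f2, f3⟩ := ht
        refine key c (by simp [Link.concls]) ?_
        simp only [Link.prems, List.mem_cons, List.not_mem_nil, or_false] at hv
        rcases hv with rfl | rfl
        · rw [f1, f3]; simp only [SFormula.ty, Ty.size]; omega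
        · rw [f2, f3]; simp only [SFormula.ty, Ty.size]; omega

/-- Logical links correspond because paths do. For an ID-link of N, consider the ID-link of M at the
image of one end: pulled back to N, its ends carry the same label, and genericity of f leaves only
the two ends of the original link. -/
theorem links_subset (h : Twin N M f g)
    (inj : ∀ p n p' n', .ax p n ∈ N.links → .ax p' n' ∈ N.links → f p = f p' → p = p' ∧ n = n')
    {e : N.Occ → M.Occ} (he : ∀ v, Rel N M v (e v)) {l : Link N.Occ} (hl : l ∈ N.links) :
    l.map e ∈ M.links := by
  have uniq : ∀ {v w}, Rel N M v w → w = e v := fun r => r.unique h.goodN h.goodM (he _)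
  have key : ∀ c ∈ l.concls, l.map e ∈ M.links := by
    intro c hc
    obtain ⟨l', hl', hw⟩ := (h.goodM.concls.mem (e c)).1 trivial
    rcases Link.same_kind (h.goodN.typed l hl) (h.atomicN l hl) hc (h.goodM.typed l' hl')
      (h.atomicM l' hl') hw (h.rel (he c)).1 with ⟨p, n, p', n', rfl, rfl, hcc⟩ |
        ⟨a, b, a', b', -, -, ⟨rfl, rfl⟩ | ⟨rfl, rfl⟩ | ⟨rfl, rfl⟩ | ⟨rfl, rfl⟩⟩
    · have e1 : f p = f n := h.labN.1 _ hl
      have e2 : g p' = g n' := h.labM.1 _ hl'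
      have hlab : f p = g p' := by
        rcases hcc with ⟨rfl, e3⟩ | ⟨rfl, e3⟩
        · rw [← e3]; exact (h.rel (he _)).2
        · rw [e1, e2, ← e3]; exact (h.rel (he _)).2
      obtain ⟨p₀, rp⟩ := h.symm.total p'
      obtain ⟨n₀, rn⟩ := h.symm.total n'
      have ep := h.symm.rel rp
      have en := h.symm.rel rn
      have up := uniq rp.symm
      have un := uniq rn.symm
      have hp : p₀ = p := by
        obtain ⟨l₁, hl₁, hm⟩ := (h.goodN.concls.mem p₀).1 trivial
        rcases Link.same_kind (h.goodM.typed _ hl') (h.atomicM _ hl') (c := p')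
          (by simp [Link.concls]) (h.goodN.typed l₁ hl₁) (h.atomicN l₁ hl₁) hm ep.1 with
          ⟨p1, n1, p2, n2, e3, rfl, ⟨-, rfl⟩ | ⟨rfl, -⟩⟩ | ⟨_, _, _, _, -, -, h⟩
        · exact (inj _ _ _ _ hl₁ hl (by rw [hlab, ep.2])).1
        · cases e3
          exact absurd (h.goodM.concls.nodup _ hl') (by simp [Link.concls])
        · simp at h
      have hn : n₀ = n := by
        obtain ⟨l₁, hl₁, hm⟩ := (h.goodN.concls.mem n₀).1 trivial
        rcases Link.same_kind (h.goodM.typed _ hl') (h.atomicM _ hl') (c := n')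
          (by simp [Link.concls]) (h.goodN.typed l₁ hl₁) (h.atomicN l₁ hl₁) hm en.1 with
          ⟨p1, n1, p2, n2, e3, rfl, ⟨rfl, -⟩ | ⟨-, rfl⟩⟩ | ⟨_, _, _, _, -, -, h⟩
        · cases e3
          exact absurd (h.goodM.concls.nodup _ hl') (by simp [Link.concls])
        · refine (inj _ _ _ _ hl₁ hl ?_).2
          have : f p2 = f n₀ := h.labN.1 _ hl₁
          rw [this, hlab, e2, en.2]
        · simp at h
      rw [Link.map, ← hp, ← hn, ← up, ← un]
      exact hl'
    all_goals
      have ra := uniq (.prem 0 hl hl' rfl rfl (he c) rfl rfl)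
      have rb := uniq (.prem 1 hl hl' rfl rfl (he c) rfl rfl)
      rw [Link.map, ← ra, ← rb]
      exact hl'
  have ha := h.atomicN l hl
  cases l with
  | cut p n => exact ha.elim
  | ax p n => exact key p (by simp [Link.concls])
  | _ a b c => exact key c (by simp [Link.concls])

/-- Genericity is needed on one side only. The bijection is copying of paths, and it reaches every
link of M because a link is determined by any of its conclusions. -/
theorem iso (h : Twin N M f g)
    (inj : ∀ p n p' n', .ax p n ∈ N.links → .ax p' n' ∈ N.links → f p = f p' → p = p' ∧ n = n') :
    N.Iso M := by
  choose e he using h.total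
  choose d hd using h.symm.total
  have uniq : ∀ {v w}, Rel N M v w → w = e v := fun r => r.unique h.goodN h.goodM (he _)
  have uniq' : ∀ {v w}, Rel N M v w → v = d w :=
    fun r => r.symm.unique h.goodM h.goodN (hd _)
  refine ⟨⟨e, d, fun v => (uniq' (he v)).symm, fun w => (uniq (hd w).symm).symm⟩,
    fun v => (h.rel (he v)).1.symm, ?_, ?_, (uniq .concl).symm⟩
  · apply Set.Subset.antisymm
    · rintro _ ⟨l, hl, rfl⟩
      exact h.links_subset inj he hl
    · intro l' hl'
      have key : ∀ c ∈ l'.concls, l' ∈ Link.map e '' N.links := by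
        intro c hc
        obtain ⟨l, hl, hv⟩ := (h.goodN.concls.mem (d c)).1 trivial
        refine ⟨l, hl, h.goodM.concls.unique _ (h.links_subset inj he hl) _ hl' c ?_ hc⟩
        rw [Link.concls_map, uniq (hd c).symm]
        exact List.mem_map_of_mem hv
      have ha := h.atomicM l' hl'
      cases l' with
      | cut p n => exact ha.elim
      | ax p n => exact key p (by simp [Link.concls])
      | _ a b c => exact key c (by simp [Link.concls])
  · refine List.ext_getElem? fun i => ?_
    rw [List.getElem?_map]
    by_cases hi : i < N.hyps.length
    · have h1 := List.getElem?_eq_getElem hi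
      have h2 := List.getElem?_eq_getElem (h.hyps_length ▸ hi)
      rw [h1, h2]
      exact congrArg some (uniq (.hyp i h1 h2)).symm
    · rw [List.getElem?_eq_none (not_lt.1 hi), List.getElem?_eq_none (h.hyps_length ▸ not_lt.1 hi)]
      rfl

end Twin

/-! ### Normal forms and equality -/

section
variable {l : List ℕ} {t t' : Term} {Γ : List Ty} {A : Ty} {Θ Ξ : PStruct}

theorem Rep.typ_of_typ (h : Rep l t Γ A Θ) (h' : Rep l t Γ A Ξ) {G : List Ty} {Z : Ty}
    (hT : Typ Θ G Z) : Typ Ξ G Z := by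
  obtain ⟨ρ, rfl⟩ := exists_map_eq h.nodup (h.hyps_length.symm.trans hT.length.symm)
  exact (h'.typ ρ Z).2 ((h.typ ρ Z).1 hT)

/-- A generic net is the normal form of all structures with the same labellings. -/
theorem Rep.iso_normalForm {N M : PStruct} (h : Rep l t Γ A Θ) (hN : Rep l t Γ A N)
    (g : Generic N) (hM : M.NormalFormOf Θ) : N.Iso M := by
  have s := h.good.steps hM.1
  have b := s.bdry _ _ h.bdry
  obtain ⟨f, θ, gf⟩ := g.lab
  -- The generic labels of the conclusions of N form a typing of the term, hence of Θ, and by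
  -- invariance also of its normal form M.
  obtain ⟨f', h1, h2, h3⟩ := (s.typ _ _).2 (hN.typ_of_typ h ⟨f, gf.lab, rfl, rfl⟩)
  exact Twin.iso ⟨hN.good, s.good, g.atomic, s.good.atomic (s.uniq h.uniq) hM.2, gf.lab, h1,
    hN.bdry.1.trans b.1.symm, hN.bdry.2.trans b.2.symm, h2.symm, h3.symm⟩ gf.inj

theorem Rep.norm (h : Rep l t Γ A Θ) : Norm l t Γ A := by
  obtain ⟨ρ, rfl, hJ⟩ := h.exists_J
  exact hJ.norm l h.nodup h.fv

theorem Rep.equal {Θ Ξ : ProofNet Γ A} (h : Rep l t Γ A Θ.1) (h' : Rep l t Γ A Ξ.1) :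
    Θ.Equal Ξ := by
  obtain ⟨N, -, g, r⟩ := h.norm
  obtain ⟨M, hM⟩ := h.good.exists_normalForm
  obtain ⟨M', hM'⟩ := h'.good.exists_normalForm
  exact ⟨M, M', hM, hM', (h.iso_normalForm r g hM).symm.trans (h'.iso_normalForm r g hM')⟩

theorem ProofNet.Equal.typ {Θ Ξ : ProofNet Γ A} (h : Θ.Equal Ξ) (g : Good Θ.1) (g' : Good Ξ.1)
    {G : List Ty} {Z : Ty} (hT : Typ Θ.1 G Z) : Typ Ξ.1 G Z := by
  obtain ⟨N, M, h1, h2, i⟩ := h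
  exact ((g'.steps h2.1).typ G Z).1 (Typ.iso i.symm (((g.steps h1.1).typ G Z).2 hT))

/-- Terms with the same labellings are equal. -/
theorem Rep.eqE (h : Rep l t Γ A Θ) (h' : Rep l t' Γ A Ξ)
    (hT : ∀ G Z, Typ Θ G Z → Typ Ξ G Z) : ∃ ρ, l.map ρ = Γ ∧ EqE ρ t t' A := by
  obtain ⟨N, -, g, r⟩ := h.norm
  obtain ⟨f, θ, gf⟩ := g.lab
  have hN : Typ N (N.hyps.map f) (f N.concl) := ⟨f, gf.lab, rfl, rfl⟩
  obtain ⟨ρ, hρ⟩ := exists_map_eq h.nodup (r.hyps_length.symm.trans hN.length.symm)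
  have hbal := gf.bal
  rw [← hρ] at hN hbal
  have j := ((r.typ ρ _).1 hN).2.2
  have j' := ((h'.typ ρ _).1 (hT _ _ (r.typ_of_typ h hN))).2.2
  have hl : l.toFinset = t.FV := by ext z; rw [List.mem_toFinset, h.fv]
  -- Both terms inhabit the generic sequent of the normal net, and this sequent is balanced.
  have e := EqE.of_balanced j j' (by ext z; rw [← h.fv, h'.fv]) fun p => by
    rw [← hl, List.sum_toFinset _ h.nodup]
    simpa [Function.comp_def] using hbal p
  have hA : (f N.concl).bind θ = A := by rw [gf.bind, r.bdry.2]; rfl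
  -- The substitution θ sends the generic labels to the formulas of the net, so it takes the
  -- equality back to the original sequent.
  refine ⟨_, ?_, hA ▸ e.bind θ⟩
  rw [← r.bdry.types, ← List.map_congr_left fun v _ => gf.bind v]
  have := congrArg (List.map (fun X : Ty => X.bind θ)) hρ
  simpa [Function.comp_def] using this

end

theorem Fits.of_map {Γ : Ctx} {ρ : ℕ → Ty} {F : Finset ℕ} (hn : Γ.names.Nodup)
    (hF : ∀ x, x ∈ Γ.names ↔ x ∈ F) (h : Γ.names.map ρ = Γ.types) : Fits Γ ρ F :=
  ⟨hn, hF, fun p hp => by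
    rw [Ctx.names, Ctx.types, List.map_map] at h
    exact (List.map_inj_left.1 h p hp).symm⟩

/-- Equal terms represent the same structures, so both nets have the normal form of one generic net.
-/
theorem EqJ.equal {Γ : Ctx} {t t' : Term} {A : Ty} (d : Deriv Γ t A) (d' : Deriv Γ t' A)
    (h : EqJ Γ t t' A) : d.net.Equal d'.net := by
  obtain ⟨ρ, f, -⟩ := d.fits
  have hρ : Γ.names.map ρ = Γ.types := by
    rw [Ctx.names, Ctx.types, List.map_map]
    exact List.map_congr_left fun p hp => (f.2.2 p hp).symm
  exact Rep.equal (d.rep.congr hρ ⟨Γ, f, h⟩) d'.rep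

/-- Equality of nets passes to their sets of typings, and these determine the terms up to equality
by genericity and coherence. -/
theorem EqJ.of_equal {Γ : Ctx} {t t' : Term} {A : Ty} {d : Deriv Γ t A} {d' : Deriv Γ t' A}
    (h : d.net.Equal d'.net) : EqJ Γ t t' A := by
  have r := d.rep
  obtain ⟨ρ, hρ, e⟩ := r.eqE d'.rep fun _ _ => h.typ r.good d'.rep.good
  exact e.toEqJ (.of_map r.nodup r.fv hρ)

end LinLam

/-! ### The proposition -/

theorem mainTheorem7 :
    -- normal forms of proof nets exist, are proof nets and are unique up to isomorphism
    (∀ (Γ : List LinLam.Ty) (A : LinLam.Ty) (Θ : LinLam.ProofNet Γ A),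
      ∃ N : LinLam.ProofNet Γ A, N.1.NormalFormOf Θ.1 ∧
        ∀ M : LinLam.PStruct, M.NormalFormOf Θ.1 → M.Iso N.1) ∧
    -- the translation respects reduction
    (∀ (Γ : LinLam.Ctx) (t t' : LinLam.Term) (A : LinLam.Ty) (d : LinLam.Deriv Γ t A),
      LinLam.BetaEtaC t t' →
        Nonempty (LinLam.Deriv Γ t' A) ∧
        ∀ d' : LinLam.Deriv Γ t' A, d.net.Equal d'.net) ∧
    -- it is well defined and injective on equality classes
    (∀ (Γ : LinLam.Ctx) (t t' : LinLam.Term) (A : LinLam.Ty)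
      (d : LinLam.Deriv Γ t A) (d' : LinLam.Deriv Γ t' A),
      d.net.Equal d'.net ↔ LinLam.EqJ Γ t t' A) ∧
    -- it is onto
    (∀ (Γ : LinLam.Ctx) (A : LinLam.Ty), (LinLam.Ctx.names Γ).Nodup →
      ∀ Θ : LinLam.ProofNet (LinLam.Ctx.types Γ) A,
        ∃ (t : LinLam.Term) (d : LinLam.Deriv Γ t A), d.net.Equal Θ) := by
  open LinLam in
  refine ⟨?_, ?_, fun Γ t t' A d d' => ⟨EqJ.of_equal, EqJ.equal d d'⟩, ?_⟩
  · rintro Γ A ⟨Θ, hΘ⟩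
    -- A net has no variable names, so the numbers of its negative conclusions serve as names.
    obtain ⟨t, r⟩ := hΘ.exists_rep (List.nodup_range (n := Γ.length)) List.length_range
    obtain ⟨N, hN, g, r'⟩ := r.norm
    obtain ⟨M, hM⟩ := r.good.exists_normalForm
    have i := r.iso_normalForm r' g hM
    -- The normal form is a proof net because it is isomorphic to one; the intermediate structures
    -- need not be known to be proof nets.
    exact ⟨⟨M, .iso _ _ _ _ i hN⟩, hM, fun M' hM' => (r.iso_normalForm r' g hM').symm.trans i⟩
  · intro Γ t t' A d h
    exact ⟨(EqJ.red d h).typed.2, fun d' => EqJ.equal d d' (.red d h)⟩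
  · rintro Γ A hn ⟨Θ, hΘ⟩
    -- Here the names are prescribed by the context, and the representing term is itself the
    -- required preimage.
    obtain ⟨t, r⟩ := hΘ.exists_rep hn (by simp [Ctx.names, Ctx.types])
    obtain ⟨ρ, hρ, hJ⟩ := r.exists_J
    obtain ⟨d⟩ := Deriv.exists_of_J hJ (.of_map hn r.fv hρ)
    exact ⟨t, d, Rep.equal d.rep r⟩
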